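/- **Theorem 1.1.** Let $\alpha>0$, $\nu>0$ and let $u_0\in L^2(\mathbb R^3)^3$ with $\operatorname{div}u_0=0$ in the sense of distributions. For a function $\psi$ on $\mathbb R^3$ let $\overline\psi=H_\alpha\star\psi$, with $H_\alpha(x)=\dfrac{e^{-|x|/\alpha}}{4\pi\alpha^2|x|}$, be its Helmholtz filter, i.e. $\overline\psi=(I-\alpha^2\Delta)^{-1}\psi$. Consider the Bardina model $$\partial_t u+\operatorname{div}(\overline{u\otimes u})-\nu\Delta u+\nabla p=0,\qquad \operatorname{div}u=0,\qquad u(0)=\overline{u_0}.$$ For $0<T\le\infty$, call $(u,p)$ a *regular solution over $[0,T[$* if 1. $u,p,\nabla p$ are well defined and continuous on $[0,T[\times\mathbb R^3$; $\partial_tu,\nabla u,D^2u$ are well defined and continuous on $]0,T[\times\mathbb R^3$; and the two equations hold pointwise on $]0,T[\times\mathbb R^3$; 2. $u(0,x)=\overline{u_0}(x)$ for all $x\in\mathbb R^3$; 3. $u\in C([0,\tau];H^2(\mathbb R^3)^3)$ for all $0\le \tau<T$. Then there is a regular solution $(u,p)$ over $[0,\infty[$ with the following properties. * (Energy balance) For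 all $t>0$, $$\tfrac12\Big(\alpha^2\!\int|\nabla u(t)|^2+\int|u(t)|^2\Big)+\nu\alpha^2\!\int_0^t\!\!\int|\Delta u|^2\,dx\,dt'+\nu\!\int_0^t\!\!\int|\nabla u|^2\,dx\,dt'=\tfrac12\Big(\alpha^2\!\int|\nabla\overline{u_0}|^2+\int|\overline{u_0}|^2\Big).$$ * (Regularity) $\partial_tu\in C([0,\infty[;L^2(\mathbb R^3)^3)$ and $p\in C([0,\infty[;H^4(\mathbb R^3))$; and for every $\tau>0$ and every integer $m\ge0$, $(u,p)\in C([\tau,\infty[;H^m(\mathbb R^3)^3\times H^m(\mathbb R^3))$. * (Uniqueness) If $0<T\le\infty$ and $(v,q)$ is a regular solution over $[0,T[$ with the same $\alpha,\nu,u_0$, then $v=u$ on $[0,T[\times\mathbb R^3$, and for each $t\in[0,T[$ the function $q(t,\cdot)-p(t,\cdot)$ is constant in $x$. If moreover $q(t,\cdot)\in L^2(\mathbb R^3)$ for all $t\in[0,T[$, then $q=p$ on $[0,T[\times\mathbb R^3$. In particular, for $0<T<\infty$, no regular solution $(v,q)$ over $[0,T[$ becomes singular at $T$: it is not the case that $\|v(t,\cdot)\|_{H^2}\to\infty$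 as $t\to T$, $t<T$. -/

import Mathlib

open MeasureTheory Set Filter Topology
open scoped ContDiff

noncomputable section

namespace Bardina

/-- The physical space `ℝ³` with its Euclidean norm. -/
abbrev E3 : Type := EuclideanSpace ℝ (Fin 3)

/-- The `k`-th vector of the canonical basis of `ℝ³`. -/
def e (k : Fin 3) : E3 := EuclideanSpace.single k 1

/-- The classical partial derivative `∂ₖ f`. -/
def pd {F : Type*} [NormedAddCommGroup F] [NormedSpace ℝ F] (k : Fin 3) (f : E3 → F) : E3 → F :=
  fun x => fderiv ℝ f x (e k)

/-! ### The Helmholtz filter -/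

/-- The Helmholtz kernel `H_α(x) = exp(-|x|/α) / (4 π α² |x|)`, the fundamental solution of
`I - α² Δ` on `ℝ³`. -/
def helmholtzKernel (α : ℝ) (x : E3) : ℝ :=
  Real.exp (-‖x‖ / α) / (4 * Real.pi * α ^ 2 * ‖x‖)

/-- The Helmholtz filter (the bar operator) `ψ ↦ H_α ⋆ ψ`.  The integral converges at every point
when `ψ ∈ L²`. -/
def bar {F : Type*} [NormedAddCommGroup F] [NormedSpace ℝ F] (α : ℝ) (ψ : E3 → F) : E3 → F :=
  fun x => ∫ y, helmholtzKernel α (x - y) • ψ y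

/-- The filtered convection term: `(div (bar (v ⊗ v)))ᵢ = ∑ⱼ ∂ⱼ (bar (vⱼ vᵢ))`. -/
def divBar (α : ℝ) (v : E3 → E3) : E3 → E3 :=
  fun x => WithLp.toLp 2 (fun i => ∑ j, pd j (bar α (fun y => v y j * v y i)) x)

/-! ### Sobolev spaces `H^m(ℝ³)` through weak derivatives -/

section Sobolev

variable {F : Type*} [NormedAddCommGroup F] [NormedSpace ℝ F]

/-- `g` is the weak derivative of order `j` of `f` along the directions `a 0, …, a (j-1)`:
`∫ (∂ᵃ φ) f = (-1)^j ∫ φ g` for all test functions `φ`.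
It is only used for `f` and `g` in `L²`. -/
def IsWeakDeriv {j : ℕ} (a : Fin j → Fin 3) (f g : E3 → F) : Prop :=
  ∀ φ : E3 → ℝ, ContDiff ℝ ∞ φ → HasCompactSupport φ →
    ∫ x, (iteratedFDeriv ℝ j φ x (fun k => e (a k))) • f x = (-1 : ℝ) ^ j • ∫ x, φ x • g x

/-- The partial derivatives of order at most `m`: an order `j ≤ m` and `j` directions. -/
abbrev DerivIndex (m : ℕ) : Type := (j : Fin (m + 1)) × (Fin j → Fin 3)

/-- The index of the function itself (order zero). -/
def DerivIndex.zero (m : ℕ) : DerivIndex m := ⟨⟨0, m.succ_pos⟩, Fin.elim0⟩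

theorem integrable_smul_of_test {g : E3 → F} (hg : MemLp g 2 volume) {φ : E3 → ℝ}
    (hφ : Continuous φ) (hc : HasCompactSupport φ) : Integrable (fun x => φ x • g x) volume := by
  have h : MemLp φ 2 volume := hφ.memLp_of_hasCompactSupport hc
  exact memLp_one_iff_integrable.1 (hg.smul h)

theorem continuous_iteratedFDeriv_apply {φ : E3 → ℝ} (hφ : ContDiff ℝ ∞ φ) {j : ℕ}
    (v : Fin j → E3) : Continuous (fun x => iteratedFDeriv ℝ j φ x v) :=
  (ContinuousMultilinearMap.apply ℝ (fun _ : Fin j => E3) ℝ v).continuous.comp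
    (hφ.continuous_iteratedFDeriv (by exact_mod_cast le_top))

theorem hasCompactSupport_iteratedFDeriv_apply {φ : E3 → ℝ} (hc : HasCompactSupport φ) {j : ℕ}
    (v : Fin j → E3) : HasCompactSupport (fun x => iteratedFDeriv ℝ j φ x v) :=
  (hc.iteratedFDeriv (𝕜 := ℝ) j).comp_left
    (g := fun L : ContinuousMultilinearMap ℝ (fun _ : Fin j => E3) ℝ => L v) rfl

variable (F) in
/-- The Sobolev space `H^m(ℝ³; F)`: an element is a function of `L²` (the component of order zero)
together with its weak derivatives up to order `m`, all of them in `L²` (they are determined by the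
function).  The norm is the `ℓ²` combination of the `L²` norms of these derivatives, one of the
usual equivalent norms of `H^m`. -/
def SobolevH (m : ℕ) : Submodule ℝ (PiLp 2 (fun _ : DerivIndex m => Lp F 2 (volume : Measure E3)))
    where
  carrier := {U | ∀ i : DerivIndex m, IsWeakDeriv i.2 (U (DerivIndex.zero m)) (U i)}
  zero_mem' := by
    intro i φ _ _
    have h : ((0 : Lp F 2 (volume : Measure E3)) : E3 → F) =ᵐ[volume] 0 := Lp.coeFn_zero F 2 volume
    have h1 : ∀ ψ : E3 → ℝ, ∫ x, ψ x • (0 : Lp F 2 (volume : Measure E3)) x = 0 := by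
      intro ψ
      rw [← integral_zero E3 F (μ := volume)]
      refine integral_congr_ae ?_
      filter_upwards [h] with x hx
      rw [hx]
      simp
    simp only [PiLp.zero_apply]
    rw [h1, h1, smul_zero]
  add_mem' := by
    intro U V hU hV i φ hφ hc
    have h1 : ∀ (ψ : E3 → ℝ) (f g : Lp F 2 (volume : Measure E3)), Continuous ψ →
        HasCompactSupport ψ →
        ∫ x, ψ x • (f + g : Lp F 2 (volume : Measure E3)) x
          = (∫ x, ψ x • f x) + ∫ x, ψ x • g x := by
      intro ψ f g hψ hψc
      rw [← integral_add (integrable_smul_of_test (Lp.memLp f) hψ hψc)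
        (integrable_smul_of_test (Lp.memLp g) hψ hψc)]
      refine integral_congr_ae ?_
      filter_upwards [Lp.coeFn_add f g] with x hx
      rw [hx, Pi.add_apply, smul_add]
    simp only [PiLp.add_apply]
    rw [h1 _ _ _ (continuous_iteratedFDeriv_apply hφ _)
      (hasCompactSupport_iteratedFDeriv_apply hc _), h1 _ _ _ hφ.continuous hc, smul_add,
      hU i φ hφ hc, hV i φ hφ hc]
  smul_mem' := by
    intro c U hU i φ hφ hc
    have h1 : ∀ (ψ : E3 → ℝ) (f : Lp F 2 (volume : Measure E3)),
        ∫ x, ψ x • (c • f : Lp F 2 (volume : Measure E3)) x = c • ∫ x, ψ x • f x := by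
      intro ψ f
      rw [← integral_smul]
      refine integral_congr_ae ?_
      filter_upwards [Lp.coeFn_smul c f] with x hx
      rw [hx, Pi.smul_apply, smul_comm]
    simp only [PiLp.smul_apply]
    rw [h1, h1, hU i φ hφ hc, smul_comm]

/-- The weak derivative, as an element of `L²`, of an element of `H^m`. -/
def wd {m : ℕ} (U : SobolevH F m) (i : DerivIndex m) : Lp F 2 (volume : Measure E3) :=
  (U : PiLp 2 (fun _ : DerivIndex m => Lp F 2 (volume : Measure E3))) i

/-- The function `f` belongs to the class `U ∈ H^m`. -/
def Represents {m : ℕ} (U : SobolevH F m) (f : E3 → F) : Prop :=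
  wd U (DerivIndex.zero m) =ᵐ[volume] f

/-- `f ∈ C(I; H^m(ℝ³))`: the map `t ↦ f(t, ·)` takes its values in `H^m` for `t ∈ I`, and is
continuous on `I` for the norm of `H^m`. -/
def ContInSobolev (m : ℕ) (I : Set ℝ) (f : ℝ → E3 → F) : Prop :=
  ∃ U : ℝ → SobolevH F m, ContinuousOn U I ∧ ∀ t ∈ I, Represents (U t) (f t)

end Sobolev

/-- `div v = 0` in the sense of distributions, for a vector field `v ∈ L²`:
`∫ v · ∇φ = 0` for all test functions `φ`. -/
def WeaklyDivFree (v : E3 → E3) : Prop :=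
  ∀ φ : E3 → ℝ, ContDiff ℝ ∞ φ → HasCompactSupport φ → ∫ x, inner ℝ (v x) (gradient φ x) = 0

/-! ### Regular solutions -/

/-- The half-open time interval `[0, T[`, where `T = +∞` is allowed. -/
def timeIco (T : EReal) : Set ℝ := {t | 0 ≤ t ∧ (t : EReal) < T}

/-- The open time interval `]0, T[`, where `T = +∞` is allowed. -/
def timeIoo (T : EReal) : Set ℝ := {t | 0 < t ∧ (t : EReal) < T}

/-- `(u, p)` is a regular solution of the Bardina model over `[0, T[` with data `u₀`:
`u, p, ∇p` exist and are continuous on `[0, T[ × ℝ³`; `∂ₜu, ∇u, D²u` exist and are continuous on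
`]0, T[ × ℝ³`; both equations hold pointwise on `]0, T[ × ℝ³`; `u(0, x)` is the filtered datum at
every `x`; and `u ∈ C([0, τ]; H²)` for every `τ < T`. -/
structure IsRegularSolution (α ν : ℝ) (u₀ : E3 → E3) (T : EReal) (u : ℝ → E3 → E3)
    (p : ℝ → E3 → ℝ) : Prop where
  cont_u : ContinuousOn (fun z : ℝ × E3 => u z.1 z.2) (timeIco T ×ˢ univ)
  cont_p : ContinuousOn (fun z : ℝ × E3 => p z.1 z.2) (timeIco T ×ˢ univ)
  diff_p : ∀ t ∈ timeIco T, Differentiable ℝ (p t)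
  cont_grad_p : ContinuousOn (fun z : ℝ × E3 => gradient (p z.1) z.2) (timeIco T ×ˢ univ)
  diff_t_u : ∀ t ∈ timeIoo T, ∀ x, DifferentiableAt ℝ (fun s => u s x) t
  cont_dt_u : ContinuousOn (fun z : ℝ × E3 => deriv (fun s => u s z.2) z.1) (timeIoo T ×ˢ univ)
  diff_u : ∀ t ∈ timeIoo T, ContDiff ℝ 2 (u t)
  cont_grad_u : ContinuousOn (fun z : ℝ × E3 => fderiv ℝ (u z.1) z.2) (timeIoo T ×ˢ univ)
  cont_hess_u : ContinuousOn (fun z : ℝ × E3 => fderiv ℝ (fderiv ℝ (u z.1)) z.2)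
    (timeIoo T ×ˢ univ)
  momentum : ∀ t ∈ timeIoo T, ∀ x,
    deriv (fun s => u s x) t + divBar α (u t) x - ν • ∑ k, pd k (pd k (u t)) x
      + gradient (p t) x = 0
  incompressible : ∀ t ∈ timeIoo T, ∀ x, ∑ k, pd k (u t) x k = 0
  initial : ∀ x, u 0 x = bar α u₀ x
  cont_H2 : ∀ τ : ℝ, 0 ≤ τ → (τ : EReal) < T → ContInSobolev 2 (Icc 0 τ) u

/-- A regular solution `u` over `[0, T[`, with `T` finite, becomes singular when `t → T`:
`‖u(t, ·)‖_{H²} → ∞` as `t → T`, `t < T`. -/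
def BecomesSingular (T : ℝ) (u : ℝ → E3 → E3) : Prop :=
  ∃ U : ℝ → SobolevH E3 2, (∀ t ∈ Ico 0 T, Represents (U t) (u t)) ∧
    Tendsto (fun t => ‖U t‖) (𝓝[<] T) atTop

/-! ### Energy balance -/

/-- `∫ |v|²` for the function `v` of class `U`. -/
def normSq (U : SobolevH E3 2) : ℝ := ‖wd U (DerivIndex.zero 2)‖ ^ 2

/-- `∫ |∇v|² = ∑ₖ ∫ |∂ₖ v|²` for the function `v` of class `U`. -/
def gradNormSq (U : SobolevH E3 2) : ℝ := ∑ k : Fin 3, ‖wd U ⟨⟨1, by decide⟩, ![k]⟩‖ ^ 2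

/-- `∫ |Δv|²`, with `Δv = ∑ₖ ∂ₖ∂ₖ v`, for the function `v` of class `U`. -/
def laplNormSq (U : SobolevH E3 2) : ℝ := ‖∑ k : Fin 3, wd U ⟨⟨2, by decide⟩, ![k, k]⟩‖ ^ 2

/-- The energy balance, for all `t > 0`, of a velocity field `u ∈ C([0, ∞[; H²)` with initial value
`bar u₀ ∈ H²`.  The time integrals are integrals of continuous functions. -/
def EnergyBalance (α ν : ℝ) (u₀ : E3 → E3) (u : ℝ → E3 → E3) : Prop :=
  ∃ (U : ℝ → SobolevH E3 2) (U₀ : SobolevH E3 2),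
    ContinuousOn U (Ici 0) ∧ (∀ t ∈ Ici (0 : ℝ), Represents (U t) (u t)) ∧
    Represents U₀ (bar α u₀) ∧
    ∀ t : ℝ, 0 < t →
      1 / 2 * (α ^ 2 * gradNormSq (U t) + normSq (U t))
          + ν * α ^ 2 * (∫ s in (0 : ℝ)..t, laplNormSq (U s))
          + ν * (∫ s in (0 : ℝ)..t, gradNormSq (U s))
        = 1 / 2 * (α ^ 2 * gradNormSq U₀ + normSq U₀)

/-- `∂ₜu ∈ C([0, ∞[; L²)`: as a map with values in `L²`, `u` is differentiable at every `t ≥ 0`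
(from the right at `t = 0`), with a derivative that is continuous on `[0, ∞[`, and which is the
pointwise time derivative when `t > 0`. -/
def TimeDerivContInL2 (u : ℝ → E3 → E3) : Prop :=
  ∃ V W : ℝ → Lp E3 2 (volume : Measure E3),
    (∀ t ∈ Ici (0 : ℝ), V t =ᵐ[volume] u t) ∧
    (∀ t ∈ Ici (0 : ℝ), HasDerivWithinAt V (W t) (Ici 0) t) ∧
    ContinuousOn W (Ici 0) ∧
    ∀ t : ℝ, 0 < t → W t =ᵐ[volume] fun x => deriv (fun s => u s x) t

end Bardina

end

/-!
# Global well-posedness of the Bardina model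

The whole proof lives on the Fourier side.  A velocity `u` in `H²` is replaced by the function
`w = (1 + |ξ|)² û` of `L²`, so that `C(I; H²)` becomes `C(I; L²)`; the operator `ev` recovers `u` at
every point (`H²` embeds in the bounded continuous functions), and real-valuedness and the
divergence condition become the two linear constraints `herm w = w` and `leray.op w = w`.  Products
become convolutions, bounded in every `Hⁿ⁺²` by Young's inequality, because
`(1 + |ξ + η|)ⁿ ≤ 2ⁿ ((1 + |ξ|)ⁿ + (1 + |η|)ⁿ)`; these are the bilinear operators `K n`.
The symbol of the filter is computed by writing the Helmholtz kernel as a mean of heat kernels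
(`fourier_helmholtzKernel`, `bar_L2`).

After the Leray projection the model is a heat equation `∂ₜw = ν Δ w + NL w`.  The filter gains two
derivatives and the divergence loses one, so that `NL` is a quadratic map of `L²`, which moreover
gains one derivative.

* Existence (`exists_global`).  With the nonlinear term truncated outside a ball whose radius grows
  exponentially, Duhamel's equation is solved for all times by a fixed point in a weighted space.
  The energy `∫ |u|² + α² ∫ |∇u|²` does not increase, because the operator `I - α² Δ` in the energy
  cancels the filter and `∫ u · div (u ⊗ u) = 0` (`inner_nonlin`).  Hence the `H¹` norm stays
  bounded, and as `‖NL w‖ ≤ C ‖u‖_{H¹} ‖w‖`, Gronwall's inequality keeps the solution inside the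
  ball where nothing is truncated.
* Regularity (`exists_lift`).  For positive times each application of Duhamel's formula gains one
  derivative.  The equations then hold pointwise, with the pressure given by Riesz transforms of the
  filtered stress (`isRegularSolution_vel`), and the energy identity follows by integration in time
  (`energyBalance_vel`).
* Uniqueness.  A regular solution `v` is only a classical solution that is continuous in `H²`, with
  no control at infinity of `∂ₜv` or of the pressure.  Tested against the curl of a test function,
  the momentum equation loses its pressure; as `v` is divergence free, this is enough to see that
  `v` solves the projected equation in `L²` (`hasDerivAt_of_curlL`, `IsRegularSolution.hasDerivAt`).
  The nonlinear term is Lipschitz in `L²` on bounded sets of `H²`, so that the energy method in `L²`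
  gives `v = u` (`eqOn_of_hasDerivAt`).  The pressures then have the same gradient.
* Absence of blow-up is a consequence: `v = u` is continuous in `H²` up to the time `T`
  (`IsRegularSolution.not_becomesSingular`).
-/

set_option linter.unusedSectionVars false

open scoped FourierTransform ENNReal SchwartzMap LineDeriv

noncomputable section

namespace Bardina

/-- Complex vectors are given the real structure of the complex inner product space. -/
instance instNormedSpaceEuclidean {ι : Type*} [Fintype ι] :
    NormedSpace ℂ (EuclideanSpace ℂ ι) := InnerProductSpace.toNormedSpace

instance instRealNormedSpaceEuclidean {ι : Type*} [Fintype ι] :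
    NormedSpace ℝ (EuclideanSpace ℂ ι) := NormedSpace.complexToReal

instance instModuleEuclidean {ι : Type*} [Fintype ι] :
    Module ℂ (EuclideanSpace ℂ ι) := NormedSpace.toModule

instance instRealModuleEuclidean {ι : Type*} [Fintype ι] :
    Module ℝ (EuclideanSpace ℂ ι) := NormedSpace.toModule

/-! ### Bounded Fourier multipliers on `L²` -/

/-- The space `L²(ℝ³; V)`. -/
abbrev L2 (V : Type*) [NormedAddCommGroup V] := Lp V 2 (volume : Measure E3)

/-- A bounded measurable family of operators, acting on `L²` by pointwise application. -/
structure Mult (V W : Type*) [NormedAddCommGroup V] [NormedSpace ℂ V] [NormedAddCommGroup W]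
    [NormedSpace ℂ W] where
  /-- the symbol of the multiplier -/
  sym : E3 → V →L[ℂ] W
  meas : StronglyMeasurable sym
  bdd : ∃ C, ∀ ξ, ‖sym ξ‖ ≤ C

section Mult

variable {V W Z : Type*} [NormedAddCommGroup V] [NormedSpace ℂ V]
  [NormedAddCommGroup W] [NormedSpace ℂ W]
  [NormedAddCommGroup Z] [NormedSpace ℂ Z]

theorem aestronglyMeasurable_symbol_apply {m : E3 → V →L[ℂ] W} (hm : StronglyMeasurable m)
    {f : E3 → V} (hf : AEStronglyMeasurable f volume) :
    AEStronglyMeasurable (fun ξ => m ξ (f ξ)) volume :=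
  (ContinuousLinearMap.id ℂ (V →L[ℂ] W)).aestronglyMeasurable_comp₂ hm.aestronglyMeasurable hf

namespace Mult

theorem memLp (M : Mult V W) (f : L2 V) : MemLp (fun ξ => M.sym ξ (f ξ)) 2 volume := by
  obtain ⟨C, hC⟩ := M.bdd
  refine MemLp.of_le_mul (c := C) (Lp.memLp f)
    (aestronglyMeasurable_symbol_apply M.meas (Lp.aestronglyMeasurable f)) ?_
  filter_upwards with ξ
  exact (M.sym ξ).le_of_opNorm_le (hC ξ) _

theorem norm_toLp_le (M : Mult V W) {C : ℝ} (hC : ∀ ξ, ‖M.sym ξ‖ ≤ C) (f : L2 V) :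
    ‖(M.memLp f).toLp‖ ≤ C * ‖f‖ := by
  refine Lp.norm_le_mul_norm_of_ae_le_mul ?_
  filter_upwards [(M.memLp f).coeFn_toLp] with ξ h
  rw [h]
  exact (M.sym ξ).le_of_opNorm_le (hC ξ) _

theorem toLp_add (M : Mult V W) (f g : L2 V) :
    (M.memLp (f + g)).toLp = (M.memLp f).toLp + (M.memLp g).toLp := by
  refine Lp.ext ?_
  filter_upwards [(M.memLp (f + g)).coeFn_toLp, (M.memLp f).coeFn_toLp,
    (M.memLp g).coeFn_toLp, Lp.coeFn_add f g,
    Lp.coeFn_add (M.memLp f).toLp (M.memLp g).toLp] with ξ h1 h2 h3 h4 h5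
  rw [h1, h5, Pi.add_apply, h2, h3, h4, Pi.add_apply, map_add]

theorem toLp_smul (M : Mult V W) (c : ℝ) (f : L2 V) :
    (M.memLp (c • f)).toLp = c • (M.memLp f).toLp := by
  refine Lp.ext ?_
  filter_upwards [(M.memLp (c • f)).coeFn_toLp, (M.memLp f).coeFn_toLp, Lp.coeFn_smul c f,
    Lp.coeFn_smul c (M.memLp f).toLp] with ξ h1 h2 h3 h4
  rw [h1, h4, Pi.smul_apply, h2, h3, Pi.smul_apply]
  exact (M.sym ξ).map_smul_of_tower c (f ξ)

/-- The operator on `L²` defined by a multiplier. -/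
def op (M : Mult V W) : L2 V →L[ℝ] L2 W :=
  LinearMap.mkContinuousOfExistsBound
    { toFun := fun f => (M.memLp f).toLp
      map_add' := M.toLp_add
      map_smul' := M.toLp_smul }
    (M.bdd.imp fun _ hC f => M.norm_toLp_le hC f)

theorem op_coe (M : Mult V W) (f : L2 V) : M.op f =ᵐ[volume] fun ξ => M.sym ξ (f ξ) :=
  (M.memLp f).coeFn_toLp

theorem norm_op_le (M : Mult V W) {C : ℝ} (hC : ∀ ξ, ‖M.sym ξ‖ ≤ C) (f : L2 V) :
    ‖M.op f‖ ≤ C * ‖f‖ := M.norm_toLp_le hC f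

theorem exists_norm_op_le (M : Mult V W) : ∃ C, 0 ≤ C ∧ ∀ f, ‖M.op f‖ ≤ C * ‖f‖ := by
  obtain ⟨C, hC⟩ := M.bdd
  exact ⟨C, (norm_nonneg _).trans (hC 0), M.norm_op_le hC⟩

theorem op_congr (M : Mult V W) {f : L2 V} {g : E3 → V} (h : f =ᵐ[volume] g) :
    M.op f =ᵐ[volume] fun ξ => M.sym ξ (g ξ) := by
  filter_upwards [M.op_coe f, h] with ξ h1 h2
  rw [h1, h2]

theorem op_eq_of_sym (M N : Mult V W) (h : ∀ ξ v, M.sym ξ v = N.sym ξ v) (f : L2 V) :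
    M.op f = N.op f := by
  refine Lp.ext ?_
  filter_upwards [M.op_coe f, N.op_coe f] with ξ h1 h2
  rw [h1, h2, h]

theorem op_op_of_sym (M : Mult W Z) (N : Mult V W) (K : Mult V Z)
    (h : ∀ ξ v, M.sym ξ (N.sym ξ v) = K.sym ξ v) (f : L2 V) : M.op (N.op f) = K.op f := by
  refine Lp.ext ?_
  filter_upwards [M.op_coe (N.op f), N.op_coe f, K.op_coe f] with ξ h1 h2 h3
  rw [h1, h2, h3, h]

theorem op_op_eq_of_sym {W' : Type*} [NormedAddCommGroup W'] [NormedSpace ℂ W']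
    (M : Mult W Z) (N : Mult V W) (M' : Mult W' Z) (N' : Mult V W')
    (h : ∀ ξ v, M.sym ξ (N.sym ξ v) = M'.sym ξ (N'.sym ξ v)) (f : L2 V) :
    M.op (N.op f) = M'.op (N'.op f) := by
  refine Lp.ext ?_
  filter_upwards [M.op_coe (N.op f), N.op_coe f, M'.op_coe (N'.op f), N'.op_coe f]
    with ξ h1 h2 h3 h4
  rw [h1, h2, h3, h4, h]

theorem op_injective (M : Mult V W) (h : ∀ ξ, Function.Injective (M.sym ξ)) :
    Function.Injective M.op := by
  intro f g hfg
  refine Lp.ext ?_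
  filter_upwards [M.op_coe f, M.op_coe g] with ξ h1 h2
  refine h ξ ?_
  rw [← h1, ← h2, hfg]

/-- A scalar multiplier. -/
def scal (c : E3 → ℂ) (hc : Measurable c) (hb : ∃ C, ∀ ξ, ‖c ξ‖ ≤ C) : Mult V V where
  sym ξ := c ξ • ContinuousLinearMap.id ℂ V
  meas := hc.stronglyMeasurable.smul_const _
  bdd := by
    obtain ⟨C, hC⟩ := hb
    refine ⟨C, fun ξ => ContinuousLinearMap.opNorm_le_bound _ ((norm_nonneg _).trans (hC 0))
      fun v => ?_⟩
    change ‖c ξ • v‖ ≤ _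
    rw [norm_smul]
    exact mul_le_mul_of_nonneg_right (hC ξ) (norm_nonneg _)

@[simp] theorem scal_sym (c : E3 → ℂ) (hc : Measurable c) (hb : ∃ C, ∀ ξ, ‖c ξ‖ ≤ C) (ξ : E3)
    (v : V) : (scal c hc hb : Mult V V).sym ξ v = c ξ • v := rfl

theorem norm_scal_le {c : E3 → ℂ} (hc : Measurable c) {C : ℝ} (hC : ∀ ξ, ‖c ξ‖ ≤ C) (ξ : E3) :
    ‖(scal c hc ⟨C, hC⟩ : Mult V V).sym ξ‖ ≤ C := by
  refine ContinuousLinearMap.opNorm_le_bound _ ((norm_nonneg _).trans (hC 0)) fun v => ?_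
  rw [scal_sym, norm_smul]
  exact mul_le_mul_of_nonneg_right (hC ξ) (norm_nonneg _)

end Mult

attribute [irreducible] Mult.op

/-- Dominated convergence for multipliers: a bounded family of symbols that depends continuously
on a parameter, at each frequency, gives a strongly continuous family of operators. -/
theorem continuousOn_op {T : Type*} [TopologicalSpace T] [FirstCountableTopology T]
    (M : T → Mult V W) {S : Set T} {C : ℝ} (hC : ∀ t ∈ S, ∀ ξ, ‖(M t).sym ξ‖ ≤ C)
    (hM : ∀ ξ v, ContinuousOn (fun t => (M t).sym ξ v) S) (f : L2 V) :
    ContinuousOn (fun t => (M t).op f) S := by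
  intro t ht
  have key : Tendsto (fun s => ∫⁻ ξ, ‖(M s).sym ξ (f ξ) - (M t).sym ξ (f ξ)‖ₑ ^ (2 : ℝ))
      (𝓝[S] t) (𝓝 (∫⁻ _ : E3, 0)) := by
    refine tendsto_of_seq_tendsto fun u hu => ?_
    obtain ⟨hu1, hu2⟩ := tendsto_nhdsWithin_iff.1 hu
    obtain ⟨N, hN⟩ := eventually_atTop.1 hu2
    rw [← tendsto_add_atTop_iff_nat N]
    refine tendsto_lintegral_of_dominated_convergence'
      (fun ξ => (‖(2 * C) • f ξ‖ₑ) ^ (2 : ℝ)) ?_ ?_ ?_ ?_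
    · intro n
      have h1 : AEStronglyMeasurable
          (fun ξ => (M (u (n + N))).sym ξ (f ξ) - (M t).sym ξ (f ξ)) volume :=
        ((M (u (n + N))).memLp f).1.sub ((M t).memLp f).1
      exact h1.enorm.pow_const _
    · intro n
      filter_upwards with ξ
      have hs : u (n + N) ∈ S := hN _ (Nat.le_add_left _ _)
      refine ENNReal.rpow_le_rpow ?_ (by norm_num)
      rw [← ofReal_norm, ← ofReal_norm]
      refine ENNReal.ofReal_le_ofReal ?_
      have hC0 : 0 ≤ C := (norm_nonneg _).trans (hC t ht ξ)
      rw [norm_smul, Real.norm_of_nonneg (by positivity)]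
      calc _ ≤ ‖(M (u (n + N))).sym ξ (f ξ)‖ + ‖(M t).sym ξ (f ξ)‖ := norm_sub_le _ _
        _ ≤ C * ‖f ξ‖ + C * ‖f ξ‖ := add_le_add
            ((M (u (n + N))).sym ξ |>.le_of_opNorm_le (hC _ hs ξ) _)
            ((M t).sym ξ |>.le_of_opNorm_le (hC t ht ξ) _)
        _ = 2 * C * ‖f ξ‖ := by ring
    · have h2 := ((Lp.memLp f).const_smul (2 * C))
      have h3 := lintegral_rpow_enorm_lt_top_of_eLpNorm_lt_top (by norm_num) (by norm_num) h2.2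
      simpa using h3.ne
    · filter_upwards with ξ
      have h3 : Tendsto (fun s => (M s).sym ξ (f ξ) - (M t).sym ξ (f ξ)) (𝓝[S] t)
          (𝓝 ((M t).sym ξ (f ξ) - (M t).sym ξ (f ξ))) := (hM ξ (f ξ) t ht).sub tendsto_const_nhds
      rw [sub_self] at h3
      have h4 := (ENNReal.continuous_rpow_const (y := 2)).continuousAt.tendsto.comp
        (h3.comp (hu.comp (tendsto_add_atTop_nat N))).enorm
      simpa [Function.comp_def] using h4
  rw [lintegral_zero] at key
  refine tendsto_iff_edist_tendsto_0.2 ?_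
  have key2 := (ENNReal.continuous_rpow_const (y := 1 / 2)).continuousAt.tendsto.comp key
  have e0 : (0 : ℝ≥0∞) ^ (1 / 2 : ℝ) = 0 := by simp
  rw [e0] at key2
  refine key2.congr fun s => ?_
  rw [Lp.edist_def, eLpNorm_eq_lintegral_rpow_enorm_toReal (by norm_num) (by norm_num)]
  simp only [Function.comp, ENNReal.toReal_ofNat]
  congr 1
  refine lintegral_congr_ae ?_
  filter_upwards [(M s).op_coe f, (M t).op_coe f] with ξ h1 h2
  rw [Pi.sub_apply, h1, h2]

end Mult

/-! ### Weights, and evaluation of inverse Fourier transforms -/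

/-- The weight `1 + |ξ|`. -/
def rho (ξ : E3) : ℝ := 1 + ‖ξ‖

theorem one_le_rho (ξ : E3) : 1 ≤ rho ξ := by simp [rho]

theorem rho_pos (ξ : E3) : 0 < rho ξ := zero_lt_one.trans_le (one_le_rho ξ)

theorem continuous_rho : Continuous rho := by unfold rho; fun_prop

theorem norm_le_rho (ξ : E3) : ‖ξ‖ ≤ rho ξ := by simp [rho]

theorem rho_ne_zero (ξ : E3) : (rho ξ : ℂ) ≠ 0 := by exact_mod_cast (rho_pos ξ).ne'

theorem norm_rho (ξ : E3) : ‖(rho ξ : ℂ)‖ = rho ξ := by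
  rw [Complex.norm_real, Real.norm_of_nonneg (rho_pos ξ).le]

section

variable {V : Type*} [NormedAddCommGroup V] [InnerProductSpace ℂ V] [CompleteSpace V]

theorem norm_inv_rho_pow_le (n : ℕ) (ξ : E3) : ‖((rho ξ : ℂ) ^ n)⁻¹‖ ≤ 1 := by
  rw [norm_inv, norm_pow, norm_rho]
  exact inv_le_one_of_one_le₀ (one_le_pow₀ (one_le_rho ξ))

theorem measurable_inv_rho_pow (n : ℕ) : Measurable fun ξ : E3 => ((rho ξ : ℂ) ^ n)⁻¹ :=
  ((Complex.measurable_ofReal.comp continuous_rho.measurable).pow_const n).inv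

/-- The multiplier `(1 + |ξ|)⁻ⁿ`. -/
def wt (n : ℕ) : Mult V V :=
  Mult.scal (fun ξ => ((rho ξ : ℂ) ^ n)⁻¹) (measurable_inv_rho_pow n) ⟨1, norm_inv_rho_pow_le n⟩

@[simp] theorem wt_sym (n : ℕ) (ξ : E3) (v : V) :
    (wt n : Mult V V).sym ξ v = ((rho ξ : ℂ) ^ n)⁻¹ • v := rfl

theorem wt_injective (n : ℕ) : Function.Injective (wt n : Mult V V).op := by
  refine Mult.op_injective _ fun ξ v w h => ?_
  simp only [wt_sym] at h
  exact smul_right_injective V (inv_ne_zero (pow_ne_zero n (rho_ne_zero ξ))) h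

theorem wt_wt (m n : ℕ) (f : L2 V) : (wt m).op ((wt n).op f) = (wt (m + n)).op f :=
  Mult.op_op_of_sym _ _ _ (fun ξ v => by simp [smul_smul, pow_add, mul_comm]) f

theorem norm_wt_le (n : ℕ) (f : L2 V) : ‖(wt n).op f‖ ≤ ‖f‖ := by
  simpa using (wt n : Mult V V).norm_op_le
    (Mult.norm_scal_le (measurable_inv_rho_pow n) (norm_inv_rho_pow_le n)) f

theorem wt_zero_op (f : L2 V) : (wt 0).op f = f := by
  refine Lp.ext ?_
  filter_upwards [(wt 0 : Mult V V).op_coe f] with ξ h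
  rw [h]; simp

theorem memLp_inv_rho_sq : MemLp (fun ξ : E3 => ((rho ξ : ℂ) ^ 2)⁻¹) 2 volume := by
  refine (memLp_two_iff_integrable_sq_norm (measurable_inv_rho_pow 2).aestronglyMeasurable).2 ?_
  have h := integrable_one_add_norm (E := E3) (μ := volume) (r := 4) (by simp; norm_num)
  refine h.congr (Eventually.of_forall fun ξ => ?_)
  simp only [norm_inv, norm_pow, norm_rho]
  rw [Real.rpow_neg (by positivity), inv_pow, ← pow_mul]
  norm_cast

theorem integrable_wt_two (f : L2 V) : Integrable ((wt 2).op f) volume := by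
  have h : MemLp (fun ξ => ((rho ξ : ℂ) ^ 2)⁻¹ • f ξ) 1 volume :=
    (Lp.memLp f).smul memLp_inv_rho_sq
  exact (memLp_one_iff_integrable.1 h).congr ((wt 2 : Mult V V).op_coe f).symm

/-- The norm of the embedding of weighted `L²` functions into `L¹`. -/
def embC : ℝ := (eLpNorm (fun ξ : E3 => ((rho ξ : ℂ) ^ 2)⁻¹) 2 volume).toReal

theorem embC_nonneg : 0 ≤ embC := ENNReal.toReal_nonneg

theorem eLpNorm_wt_two_le (f : L2 V) :
    eLpNorm ((wt 2).op f) 1 volume ≤ ENNReal.ofReal (embC * ‖f‖) := by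
  rw [eLpNorm_congr_ae ((wt 2 : Mult V V).op_coe f)]
  have h := eLpNorm_smul_le_mul_eLpNorm (p := 2) (q := 2) (r := 1) (Lp.memLp f).1
    memLp_inv_rho_sq.1
  refine h.trans (le_of_eq ?_)
  rw [ENNReal.ofReal_mul embC_nonneg, embC, ENNReal.ofReal_toReal memLp_inv_rho_sq.2.ne,
    Lp.norm_def, ENNReal.ofReal_toReal (Lp.memLp f).2.ne]

theorem integral_norm_wt_two_le (f : L2 V) : ∫ ξ, ‖(wt 2).op f ξ‖ ≤ embC * ‖f‖ := by
  rw [integral_norm_eq_lintegral_enorm (integrable_wt_two f).1, ← eLpNorm_one_eq_lintegral_enorm]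
  refine ENNReal.toReal_le_of_le_ofReal (mul_nonneg embC_nonneg (norm_nonneg _)) ?_
  exact eLpNorm_wt_two_le f

theorem norm_fourierInv_le {f : E3 → V} (x : E3) : ‖𝓕⁻ f x‖ ≤ ∫ ξ, ‖f ξ‖ := by
  rw [Real.fourierInv_eq]
  refine (norm_integral_le_integral_norm _).trans (le_of_eq ?_)
  simp

theorem continuous_fourierInv' {f : E3 → V} (hf : Integrable f volume) : Continuous (𝓕⁻ f) := by
  have h : Continuous (𝓕 f) := VectorFourier.fourierIntegral_continuous Real.continuous_fourierChar
    (by exact continuous_inner) hf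
  have h2 : 𝓕⁻ f = fun x => 𝓕 f (-x) := funext fun x => Real.fourierInv_eq_fourier_neg f x
  rw [h2]
  exact h.comp continuous_neg

theorem fourierInv_add' {f g : E3 → V} (hf : Integrable f volume) (hg : Integrable g volume)
    (x : E3) : 𝓕⁻ (f + g) x = 𝓕⁻ f x + 𝓕⁻ g x := by
  simp only [Real.fourierInv_eq_fourier_neg]
  exact congrFun (VectorFourier.fourierIntegral_add Real.continuous_fourierChar
    (by exact continuous_inner) hf hg) (-x)

/-- Evaluation of the inverse Fourier transform of `(1 + |ξ|)⁻² f`, as a bounded continuous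
function.  It is the Sobolev embedding of `H²` in the bounded continuous functions. -/
def ev : L2 V →L[ℝ] BoundedContinuousFunction E3 V :=
  LinearMap.mkContinuous
    { toFun := fun f => BoundedContinuousFunction.ofNormedAddCommGroup
        (𝓕⁻ ((wt 2).op f : E3 → V)) (continuous_fourierInv' (integrable_wt_two f)) (embC * ‖f‖)
        (fun x => (norm_fourierInv_le x).trans (integral_norm_wt_two_le f))
      map_add' := by
        intro f g
        ext x
        simp only [BoundedContinuousFunction.coe_ofNormedAddCommGroup,
          BoundedContinuousFunction.coe_add, Pi.add_apply]
        rw [← fourierInv_add' (integrable_wt_two f) (integrable_wt_two g)]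
        refine Real.fourierInv_congr_ae ?_ x
        rw [map_add]
        exact Lp.coeFn_add _ _
      map_smul' := by
        intro c f
        ext x
        simp only [BoundedContinuousFunction.coe_ofNormedAddCommGroup,
          BoundedContinuousFunction.coe_smul, RingHom.id_apply]
        have h : 𝓕⁻ ((wt 2).op (c • f) : E3 → V) x
            = 𝓕⁻ (fun ξ => c • ((wt 2).op f : E3 → V) ξ) x := by
          refine Real.fourierInv_congr_ae ?_ x
          rw [map_smul]
          exact Lp.coeFn_smul _ _
        rw [h, Real.fourierInv_eq, Real.fourierInv_eq, ← integral_smul]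
        refine integral_congr_ae (Eventually.of_forall fun ξ => ?_)
        simp only
        rw [smul_comm] }
    embC (fun f => by
      refine BoundedContinuousFunction.norm_ofNormedAddCommGroup_le _ ?_
        (fun x => (norm_fourierInv_le x).trans (integral_norm_wt_two_le f))
      exact mul_nonneg embC_nonneg (norm_nonneg _))

theorem ev_apply (f : L2 V) (x : E3) : ev f x = 𝓕⁻ ((wt 2).op f : E3 → V) x := rfl

theorem ev_eq_of_ae (f : L2 V) {g : E3 → V} (h : (wt 2).op f =ᵐ[volume] g) (x : E3) :
    ev f x = 𝓕⁻ g x := by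
  rw [ev_apply]
  exact Real.fourierInv_congr_ae h x

theorem norm_ev_le (f : L2 V) (x : E3) : ‖ev f x‖ ≤ embC * ‖f‖ :=
  (norm_fourierInv_le x).trans (integral_norm_wt_two_le f)

/-- Joint continuity of `(t, x) ↦ ev (F t) x`. -/
theorem continuousOn_ev {F : ℝ → L2 V} {I : Set ℝ} (hF : ContinuousOn F I) :
    ContinuousOn (fun z : ℝ × E3 => ev (F z.1) z.2) (I ×ˢ univ) := by
  have h1 : ContinuousOn (fun z : ℝ × E3 => ev (F z.1)) (I ×ˢ univ) :=
    ev.continuous.comp_continuousOn (hF.comp continuousOn_fst fun z hz => hz.1)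
  exact continuous_eval.comp_continuousOn (h1.prodMk continuousOn_snd)

/-- Evaluation at a point, as a continuous linear functional. -/
def evAt (x : E3) : L2 V →L[ℝ] V :=
  (BoundedContinuousFunction.evalCLM ℝ x).comp ev

attribute [irreducible] ev

/-! ### The Fourier transform of `L²` and integrals against test functions -/

theorem integral_smul_fourierInv (ψ : 𝓢(E3, ℂ)) (f : L2 V) :
    ∫ x, ψ x • (𝓕⁻ f : L2 V) x = ∫ ξ, (𝓕⁻ ψ) ξ • f ξ := by
  have h := congrArg (fun T : 𝓢'(E3, V) => T ψ) (Lp.fourierInv_toTemperedDistribution_eq f)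
  simp only [TemperedDistribution.fourierInv_apply, Lp.toTemperedDistribution_apply] at h
  exact h.symm

theorem integral_fourier_smul_flip (ψ : 𝓢(E3, ℂ)) {f : E3 → V} (hf : Integrable f volume) :
    ∫ x, (𝓕 ψ) x • f x = ∫ ξ, ψ ξ • 𝓕 f ξ := by
  have h := VectorFourier.integral_fourierIntegral_smul_eq_flip (e := Real.fourierChar)
    (L := innerₗ E3) (μ := volume) (ν := volume)
    Real.continuous_fourierChar (by exact continuous_inner) ψ.integrable hf
  rw [flip_innerₗ] at h
  exact h

theorem integral_fourierInv_smul_flip (ψ : 𝓢(E3, ℂ)) {f : E3 → V} (hf : Integrable f volume) :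
    ∫ x, (𝓕⁻ ψ) x • f x = ∫ ξ, ψ ξ • 𝓕⁻ f ξ := by
  have h := integral_fourier_smul_flip ψ hf.comp_neg
  rw [← integral_neg_eq_self] at h
  simp only [neg_neg] at h
  rw [Real.fourierInv_eq_fourier_comp_neg, ← h]
  refine integral_congr_ae (Eventually.of_forall fun x => ?_)
  simp only [SchwartzMap.fourierInv_coe, Real.fourierInv_eq_fourier_neg, SchwartzMap.fourier_coe]

/-- A test function, as a complex Schwartz function. -/
def testC {φ : E3 → ℝ} (hφ : ContDiff ℝ ∞ φ) (hc : HasCompactSupport φ) : 𝓢(E3, ℂ) :=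
  HasCompactSupport.toSchwartzMap (f := fun x => (φ x : ℂ))
    (hc.comp_left (g := fun r : ℝ => (r : ℂ)) Complex.ofReal_zero)
    (Complex.ofRealCLM.contDiff.comp hφ)

theorem testC_apply {φ : E3 → ℝ} (hφ : ContDiff ℝ ∞ φ) (hc : HasCompactSupport φ) (x : E3) :
    testC hφ hc x = (φ x : ℂ) := rfl

theorem ae_eq_of_forall_schwartz {f g : E3 → V} (hf : LocallyIntegrable f volume)
    (hg : LocallyIntegrable g volume)
    (h : ∀ ψ : 𝓢(E3, ℂ), ∫ x, ψ x • f x = ∫ x, ψ x • g x) : f =ᵐ[volume] g := by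
  refine ae_eq_of_integral_contDiff_smul_eq hf hg fun φ hφ hc => ?_
  have := h (testC hφ hc)
  simpa [testC_apply] using this

theorem locallyIntegrable_L2 (f : L2 V) : LocallyIntegrable f volume :=
  (Lp.memLp f).locallyIntegrable (by norm_num)

/-- The inverse Fourier transform in `L²` is given by the integral, when it converges. -/
theorem fourierInv_L2_ae (f : L2 V) (hf : Integrable f volume) :
    (𝓕⁻ f : L2 V) =ᵐ[volume] 𝓕⁻ (f : E3 → V) := by
  refine ae_eq_of_forall_schwartz (locallyIntegrable_L2 _)
    (continuous_fourierInv' hf).locallyIntegrable fun ψ => ?_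
  rw [integral_smul_fourierInv, integral_fourierInv_smul_flip ψ hf]

theorem fourierInv_wt_two_ae (f : L2 V) : (𝓕⁻ ((wt 2).op f) : L2 V) =ᵐ[volume] ev f := by
  filter_upwards [fourierInv_L2_ae _ (integrable_wt_two f)] with x hx
  rw [hx, ev_apply]

/-- A function of `H²` determines its Fourier transform. -/
theorem ev_injective {f g : L2 V} (h : ∀ᵐ x ∂volume, ev f x = ev g x) : f = g := by
  refine wt_injective 2 ?_
  have h1 : (𝓕⁻ ((wt 2).op f) : L2 V) = 𝓕⁻ ((wt 2).op g) := by
    refine Lp.ext ?_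
    filter_upwards [fourierInv_wt_two_ae f, fourierInv_wt_two_ae g, h] with x h1 h2 h3
    rw [h1, h2, h3]
  exact (Lp.fourierTransformₗᵢ E3 V).symm.injective h1

/-- An integrable function whose Fourier transform vanishes is zero. -/
theorem ae_eq_zero_of_fourier {f : E3 → V} (hf : Integrable f volume) (h : ∀ x, 𝓕 f x = 0) :
    f =ᵐ[volume] 0 := by
  refine ae_eq_of_forall_schwartz hf.locallyIntegrable
    (locallyIntegrable_zero (μ := volume)) fun ψ => ?_
  have h1 : 𝓕 (𝓕⁻ ψ) = ψ := FourierTransform.fourier_fourierInv_eq ψ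
  have h2 := integral_fourier_smul_flip (𝓕⁻ ψ) hf
  rw [h1] at h2
  rw [h2]
  simp [h]

end

/-! ### Derivatives on the Fourier side -/

section

variable {V : Type*} [NormedAddCommGroup V] [InnerProductSpace ℂ V] [CompleteSpace V]

/-- The symbol `2πi ξₖ` of the derivative `∂ₖ`. -/
def dsym (k : Fin 3) (ξ : E3) : ℂ := 2 * Real.pi * Complex.I * (ξ k : ℂ)

theorem inner_e (ξ : E3) (k : Fin 3) : inner ℝ ξ (e k) = ξ k := by
  rw [e, EuclideanSpace.inner_single_right]
  simp

theorem inner_e' (ξ : E3) (k : Fin 3) : inner ℝ (e k) ξ = ξ k := by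
  rw [real_inner_comm, inner_e]

theorem abs_coord_le (ξ : E3) (k : Fin 3) : |ξ k| ≤ ‖ξ‖ := by
  simpa using PiLp.norm_apply_le ξ k

theorem norm_dsym_le (k : Fin 3) (ξ : E3) : ‖dsym k ξ‖ ≤ 2 * Real.pi * rho ξ := by
  unfold dsym
  simp only [norm_mul, Complex.norm_ofNat, Complex.norm_real, Complex.norm_I, mul_one,
    Real.norm_eq_abs, abs_of_pos Real.pi_pos]
  have := (abs_coord_le ξ k).trans (norm_le_rho ξ)
  gcongr

theorem continuous_dsym (k : Fin 3) : Continuous (dsym k) := by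
  unfold dsym; fun_prop

/-- The symbol of the iterated derivative along the directions `a`. -/
def dsyms {j : ℕ} (a : Fin j → Fin 3) (ξ : E3) : ℂ := ∏ k, dsym (a k) ξ

theorem continuous_dsyms {j : ℕ} (a : Fin j → Fin 3) : Continuous (dsyms a) :=
  continuous_finsetProd _ fun k _ => continuous_dsym (a k)

theorem norm_dsyms_le {j : ℕ} (a : Fin j → Fin 3) (ξ : E3) :
    ‖dsyms a ξ‖ ≤ (2 * Real.pi) ^ j * rho ξ ^ j := by
  unfold dsyms
  rw [norm_prod]
  calc ∏ k, ‖dsym (a k) ξ‖ ≤ ∏ _k : Fin j, (2 * Real.pi * rho ξ) :=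
        Finset.prod_le_prod (fun _ _ => norm_nonneg _) fun k _ => norm_dsym_le (a k) ξ
    _ = _ := by simp [mul_pow]

theorem fourierInv_iteratedLineDeriv {j : ℕ} (a : Fin j → Fin 3) (ψ : 𝓢(E3, ℂ)) (ξ : E3) :
    (𝓕⁻ (∂^{fun k => e (a k)} ψ)) ξ = (-1) ^ j * dsyms a ξ * (𝓕⁻ ψ) ξ := by
  induction j generalizing ψ with
  | zero => simp [dsyms]
  | succ n ih =>
    rw [LineDeriv.iteratedLineDerivOp_succ_right]
    have h1 := ih (Fin.init a) (∂_{e (a (Fin.last n))} ψ)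
    have h2 : (Fin.init fun k => e (a k)) = fun k : Fin n => e (Fin.init a k) := rfl
    rw [h2, h1, SchwartzMap.fourierInv_lineDerivOp_eq]
    have htg : (fun x : E3 => inner ℝ x (e (a (Fin.last n)))).HasTemperateGrowth := by fun_prop
    rw [smul_apply, SchwartzMap.smulLeftCLM_apply_apply htg, inner_e]
    unfold dsyms
    rw [Fin.prod_univ_castSucc]
    simp only [Fin.init, dsym, smul_eq_mul, Complex.real_smul]
    ring

theorem iteratedLineDeriv_testC {φ : E3 → ℝ} (hφ : ContDiff ℝ ∞ φ) (hc : HasCompactSupport φ)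
    {j : ℕ} (a : Fin j → Fin 3) (x : E3) :
    (∂^{fun k => e (a k)} (testC hφ hc)) x
      = ((iteratedFDeriv ℝ j φ x fun k => e (a k) : ℝ) : ℂ) := by
  rw [SchwartzMap.iteratedLineDerivOp_eq_iteratedFDeriv]
  have h : (testC hφ hc : E3 → ℂ) = Complex.ofRealCLM ∘ φ := rfl
  rw [h, ContinuousLinearMap.iteratedFDeriv_comp_left (n := ∞) _ hφ.contDiffAt
    (by exact_mod_cast le_top)]
  rfl

variable {F : Type*} [NormedAddCommGroup F] [NormedSpace ℝ F] [CompleteSpace F]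

/-- A real-linear map applied to the inverse Fourier transform, in `L²`. -/
def reInv (T : V →L[ℝ] F) : L2 V →L[ℝ] Lp F 2 (volume : Measure E3) :=
  (T.compLpL 2 volume).comp
    ((Lp.fourierTransformₗᵢ E3 V).symm.toContinuousLinearEquiv.toContinuousLinearMap.restrictScalars
      ℝ)

theorem reInv_coe (T : V →L[ℝ] F) (f : L2 V) :
    reInv T f =ᵐ[volume] fun x => T ((𝓕⁻ f : L2 V) x) :=
  T.coeFn_compLpL _

theorem reInv_wt_two (T : V →L[ℝ] F) (f : L2 V) :
    reInv T ((wt 2).op f) =ᵐ[volume] fun x => T (ev f x) := by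
  filter_upwards [reInv_coe T ((wt 2).op f), fourierInv_wt_two_ae f] with x h1 h2
  rw [h1, h2]

theorem integral_smul_reInv (T : V →L[ℝ] F) (f : L2 V) {φ : E3 → ℝ} (hφ : Continuous φ)
    (hc : HasCompactSupport φ) :
    ∫ x, φ x • reInv T f x = T (∫ x, (φ x : ℂ) • (𝓕⁻ f : L2 V) x) := by
  have hi : Integrable (fun x => φ x • (𝓕⁻ f : L2 V) x) volume :=
    integrable_smul_of_test (Lp.memLp _) hφ hc
  have h2 : ∀ x, (φ x : ℂ) • (𝓕⁻ f : L2 V) x = φ x • (𝓕⁻ f : L2 V) x := fun x => by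
    rw [Complex.coe_smul]
  simp only [h2]
  rw [← T.integral_comp_comm hi]
  refine integral_congr_ae ?_
  filter_upwards [reInv_coe T f] with x hx
  rw [hx, map_smul]

/-- Multiplication by the symbol of a derivative gives a weak derivative. -/
theorem isWeakDeriv_reInv (T : V →L[ℝ] F) {j : ℕ} (a : Fin j → Fin 3) {f g : L2 V}
    (h : g =ᵐ[volume] fun ξ => dsyms a ξ • f ξ) : IsWeakDeriv a (reInv T f) (reInv T g) := by
  intro φ hφ hc
  have h1 : ∫ x, (iteratedFDeriv ℝ j φ x fun k => e (a k)) • reInv T f x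
      = T (∫ x, (∂^{fun k => e (a k)} (testC hφ hc)) x • (𝓕⁻ f : L2 V) x) := by
    rw [integral_smul_reInv T f (continuous_iteratedFDeriv_apply hφ _)
      (hasCompactSupport_iteratedFDeriv_apply hc _)]
    simp only [iteratedLineDeriv_testC]
  have h2 : ∫ x, φ x • reInv T g x = T (∫ x, testC hφ hc x • (𝓕⁻ g : L2 V) x) := by
    rw [integral_smul_reInv T g hφ.continuous hc]
    simp only [testC_apply]
  rw [h1, h2, integral_smul_fourierInv, integral_smul_fourierInv, ← map_smul]
  congr 1
  rw [← integral_smul]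
  refine integral_congr_ae ?_
  filter_upwards [h] with ξ hξ
  rw [hξ, fourierInv_iteratedLineDeriv, smul_smul, ← Complex.coe_smul, smul_smul]
  congr 1
  push_cast
  ring

/-- The multiplier `∂ᵃ (1 + |ξ|)⁻ᵐ` for `|a| ≤ m`. -/
def dwt (m : ℕ) {j : ℕ} (hj : j ≤ m) (a : Fin j → Fin 3) : Mult V V :=
  Mult.scal (fun ξ => dsyms a ξ * ((rho ξ : ℂ) ^ m)⁻¹)
    ((continuous_dsyms a).measurable.mul (measurable_inv_rho_pow m))
    ⟨(2 * Real.pi) ^ j, fun ξ => by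
      rw [norm_mul, norm_inv, norm_pow, norm_rho, ← div_eq_mul_inv,
        div_le_iff₀ (pow_pos (rho_pos ξ) m)]
      exact (norm_dsyms_le a ξ).trans
        (mul_le_mul_of_nonneg_left (pow_le_pow_right₀ (one_le_rho ξ) hj) (by positivity))⟩

@[simp] theorem dwt_sym (m : ℕ) {j : ℕ} (hj : j ≤ m) (a : Fin j → Fin 3) (ξ : E3) (v : V) :
    (dwt m hj a : Mult V V).sym ξ v = (dsyms a ξ * ((rho ξ : ℂ) ^ m)⁻¹) • v := rfl

theorem dwt_zero (m : ℕ) (a : Fin 0 → Fin 3) (f : L2 V) :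
    (dwt m (Nat.zero_le m) a).op f = (wt m).op f :=
  Mult.op_eq_of_sym _ _ (fun ξ v => by simp [dsyms]) f

/-- The element of `H^m` given by a function whose Fourier transform is `(1 + |ξ|)⁻ᵐ f`. -/
def toSobolev (T : V →L[ℝ] F) (m : ℕ) (f : L2 V) : SobolevH F m :=
  ⟨WithLp.toLp 2 fun i : DerivIndex m =>
      reInv T ((dwt m (Nat.lt_succ_iff.1 i.1.2) i.2).op f), by
    intro i
    have h0 : (dwt m (Nat.zero_le m) (Fin.elim0 : Fin 0 → Fin 3)).op f = (wt m).op f :=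
      dwt_zero m _ f
    refine isWeakDeriv_reInv T i.2 ?_
    simp only [DerivIndex.zero]
    have h1 := (dwt m (Nat.zero_le m) (Fin.elim0 : Fin 0 → Fin 3) : Mult V V).op_coe f
    have h2 := (dwt m (Nat.lt_succ_iff.1 i.1.2) i.2 : Mult V V).op_coe f
    filter_upwards [h1, h2] with ξ h1 h2
    rw [h2]
    refine Eq.trans ?_ (congrArg (dsyms i.2 ξ • ·) h1.symm)
    simp [dsyms, smul_smul]⟩

theorem wd_toSobolev (T : V →L[ℝ] F) (m : ℕ) (f : L2 V) (i : DerivIndex m) :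
    wd (toSobolev T m f) i = reInv T ((dwt m (Nat.lt_succ_iff.1 i.1.2) i.2).op f) := rfl

theorem wd_toSobolev_zero (T : V →L[ℝ] F) (m : ℕ) (f : L2 V) :
    wd (toSobolev T m f) (DerivIndex.zero m) = reInv T ((wt m).op f) := by
  rw [wd_toSobolev]
  exact congrArg (reInv T) (dwt_zero m _ f)

theorem continuous_toSobolev (T : V →L[ℝ] F) (m : ℕ) : Continuous (toSobolev T m) := by
  refine Continuous.subtype_mk ?_ _
  refine (PiLp.continuous_toLp 2 _).comp (continuous_pi fun i => ?_)
  exact (reInv T).continuous.comp (Mult.op _).continuous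

theorem contInSobolev_of_fourier (T : V →L[ℝ] F) (m : ℕ) {I : Set ℝ} {f : ℝ → L2 V}
    (hf : ContinuousOn f I) {u : ℝ → E3 → F}
    (hu : ∀ t ∈ I, reInv T ((wt m).op (f t)) =ᵐ[volume] u t) : ContInSobolev m I u :=
  ⟨fun t => toSobolev T m (f t), (continuous_toSobolev T m).comp_continuousOn hf, fun t ht => by
    rw [Represents, wd_toSobolev_zero]
    exact hu t ht⟩

end

/-! ### Fourier transforms of test functions separate functions of moderate growth -/

section

variable {V : Type*} [NormedAddCommGroup V] [InnerProductSpace ℂ V] [CompleteSpace V]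

theorem memLp_rho_pow_mul_schwartz (ψ : 𝓢(E3, ℂ)) (n : ℕ) :
    MemLp (fun ξ => (rho ξ : ℂ) ^ n * ψ ξ) 2 volume := by
  obtain ⟨C, hC⟩ : ∃ C : ℝ, ∀ ξ, rho ξ ^ (n + 2) * ‖ψ ξ‖ ≤ C :=
    ⟨_, fun ξ => by
      simpa [rho] using SchwartzMap.one_add_le_sup_seminorm_apply (𝕜 := ℝ) (m := (n + 2, 0)) le_rfl
        le_rfl ψ ξ⟩
  refine memLp_inv_rho_sq.of_le_mul (c := C) ?_ (Eventually.of_forall fun ξ => ?_)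
  · exact (((Complex.continuous_ofReal.comp continuous_rho).pow n).mul
      ψ.continuous).aestronglyMeasurable
  · have h := rho_pos ξ
    rw [norm_mul, norm_inv, norm_pow, norm_pow, norm_rho, ← div_eq_mul_inv,
      le_div_iff₀ (by positivity)]
    calc _ = rho ξ ^ (n + 2) * ‖ψ ξ‖ := by ring
      _ ≤ C := hC ξ

theorem integrable_schwartz_smul (ψ : 𝓢(E3, ℂ)) {n : ℕ} {h : E3 → V}
    (hh : MemLp (fun ξ => ((rho ξ : ℂ) ^ n)⁻¹ • h ξ) 2 volume) :
    Integrable (fun ξ => ψ ξ • h ξ) volume := by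
  have h1 : MemLp _ 1 volume := hh.smul (memLp_rho_pow_mul_schwartz ψ n)
  refine (memLp_one_iff_integrable.1 h1).congr (Eventually.of_forall fun ξ => ?_)
  simp only [Pi.smul_apply', smul_smul]
  congr 1
  field_simp [rho_ne_zero ξ]

theorem contDiff_comp_add {φ : E3 → ℝ} (hφ : ContDiff ℝ ∞ φ) (y : E3) :
    ContDiff ℝ ∞ fun x => φ (x + y) := hφ.comp (contDiff_id.add contDiff_const)

theorem hasCompactSupport_comp_add {φ : E3 → ℝ} (hc : HasCompactSupport φ) (y : E3) :
    HasCompactSupport fun x => φ (x + y) := hc.comp_homeomorph (Homeomorph.addRight y)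

theorem fourierInv_testC_translate {φ : E3 → ℝ} (hφ : ContDiff ℝ ∞ φ) (hc : HasCompactSupport φ)
    (y ξ : E3) :
    (𝓕⁻ (testC (contDiff_comp_add hφ y) (hasCompactSupport_comp_add hc y))) ξ
      = Real.fourierChar (-inner ℝ ξ y) • (𝓕⁻ (testC hφ hc)) ξ := by
  rw [SchwartzMap.fourierInv_coe, SchwartzMap.fourierInv_coe, Real.fourierInv_eq,
    Real.fourierInv_eq, Circle.smul_def, ← integral_smul,
    ← integral_add_right_eq_self _ (-y)]
  refine integral_congr_ae (Eventually.of_forall fun x => ?_)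
  simp only [testC_apply]
  rw [neg_add_cancel_right, ← Circle.smul_def, smul_smul, ← AddChar.map_add_eq_mul, inner_add_left,
    inner_neg_left, real_inner_comm y ξ, add_comm]

/-- At each frequency some test function has a nonzero Fourier transform: a bump function supported
in a ball whose radius is small compared with the wavelength. -/
theorem fourierInv_bump_ne_zero (φ : ContDiffBump (0 : E3)) {ξ : E3}
    (hξ : φ.rOut * ‖ξ‖ < 1 / 4) :
    (𝓕⁻ (testC φ.contDiff φ.hasCompactSupport)) ξ ≠ 0 := by
  have hre : 0 < ((𝓕⁻ (testC φ.contDiff φ.hasCompactSupport)) ξ).re := by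
    rw [SchwartzMap.fourierInv_coe, Real.fourierInv_eq']
    have hint : Integrable (fun v : E3 => Complex.exp (↑(2 * Real.pi * inner ℝ v ξ) * Complex.I) •
        (testC φ.contDiff φ.hasCompactSupport) v) volume := by
      have := (Real.fourierIntegral_convergent_iff (μ := volume)
        (f := testC φ.contDiff φ.hasCompactSupport) (-ξ)).2 (SchwartzMap.integrable _)
      refine this.congr (Eventually.of_forall fun v => ?_)
      simp [Circle.smul_def, Real.fourierChar_apply]
    rw [← RCLike.re_eq_complex_re, ← integral_re hint]
    have hcos : ∀ v : E3, RCLike.re (Complex.exp (↑(2 * Real.pi * inner ℝ v ξ) * Complex.I) •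
        (testC φ.contDiff φ.hasCompactSupport) v)
          = Real.cos (2 * Real.pi * inner ℝ v ξ) * φ v := by
      intro v
      rw [testC_apply, smul_eq_mul, RCLike.re_eq_complex_re, Complex.re_mul_ofReal,
        Complex.exp_ofReal_mul_I_re]
    simp only [hcos]
    have hc0 : ∀ v : E3, φ v ≠ 0 → 0 < Real.cos (2 * Real.pi * inner ℝ v ξ) := by
      intro v hv
      have hv1 : v ∈ Metric.ball (0 : E3) φ.rOut := by
        rw [← φ.support_eq]; exact hv
      have hv2 : ‖v‖ < φ.rOut := by simpa using hv1
      have h3 : |inner ℝ v ξ| ≤ φ.rOut * ‖ξ‖ :=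
        (abs_real_inner_le_norm v ξ).trans (by gcongr)
      have h4 : |inner ℝ v ξ| < 1 / 4 := h3.trans_lt hξ
      rw [abs_lt] at h4
      have := Real.pi_pos
      apply Real.cos_pos_of_mem_Ioo
      constructor <;> nlinarith
    have hcont : Continuous fun v : E3 => Real.cos (2 * Real.pi * inner ℝ v ξ) * φ v := by
      have := φ.contDiff (n := 0) |>.continuous
      fun_prop
    refine hcont.integral_pos_of_hasCompactSupport_nonneg_nonzero (x := 0)
      φ.hasCompactSupport.mul_left ?_ ?_
    · intro v
      by_cases hv : φ v = 0
      · simp [hv]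
      · exact mul_nonneg (hc0 v hv).le φ.nonneg
    · have : φ (0 : E3) = 1 := φ.one_of_mem_closedBall (by simp [φ.rIn_pos.le])
      simp [this]
  intro h0
  rw [h0] at hre
  simp at hre

/-- A function of at most polynomial growth (in the `L²` sense) that is orthogonal to the Fourier
transforms of all test functions vanishes.  Translating the test function shows that the Fourier
transform of the product with the transform of a fixed test function is zero. -/
theorem ae_eq_zero_of_forall_test {n : ℕ} {h : E3 → V}
    (hh : MemLp (fun ξ => ((rho ξ : ℂ) ^ n)⁻¹ • h ξ) 2 volume)
    (horth : ∀ (φ : E3 → ℝ) (hφ : ContDiff ℝ ∞ φ) (hc : HasCompactSupport φ),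
      ∫ ξ, (𝓕⁻ (testC hφ hc)) ξ • h ξ = 0) : h =ᵐ[volume] 0 := by
  have key : ∀ (φ : E3 → ℝ) (hφ : ContDiff ℝ ∞ φ) (hc : HasCompactSupport φ),
      (fun ξ => (𝓕⁻ (testC hφ hc)) ξ • h ξ) =ᵐ[volume] 0 := by
    intro φ hφ hc
    refine ae_eq_zero_of_fourier (integrable_schwartz_smul _ hh) fun y => ?_
    rw [Real.fourier_eq, ← horth _ (contDiff_comp_add hφ y) (hasCompactSupport_comp_add hc y)]
    refine integral_congr_ae (Eventually.of_forall fun ξ => ?_)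
    simp only
    rw [fourierInv_testC_translate, smul_assoc]
  -- bump functions with supports of radius `1 / (8 (N + 1))`: one of them detects each frequency
  let φ : ℕ → ContDiffBump (0 : E3) := fun N =>
    ⟨1 / (16 * (N + 1)), 1 / (8 * (N + 1)), by positivity, by
      apply one_div_lt_one_div_of_lt <;> linarith [(Nat.cast_nonneg N : (0 : ℝ) ≤ N)]⟩
  have hall := ae_all_iff.2 fun N => key (φ N) (φ N).contDiff (φ N).hasCompactSupport
  filter_upwards [hall] with ξ hξ
  obtain ⟨N, hN⟩ := exists_nat_gt ‖ξ‖
  have h1 := hξ N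
  simp only [Pi.zero_apply, smul_eq_zero] at h1
  refine h1.resolve_left (fourierInv_bump_ne_zero (φ N) ?_)
  change 1 / (8 * ((N : ℝ) + 1)) * ‖ξ‖ < 1 / 4
  rw [one_div_mul_eq_div, div_lt_div_iff₀ (by positivity) (by norm_num)]
  linarith

end

/-! ### Hermitian symmetry -/

section

variable {ι : Type*} [Fintype ι]

/-- Componentwise real part. -/
def reV : EuclideanSpace ℂ ι →L[ℝ] EuclideanSpace ℝ ι :=
  LinearMap.toContinuousLinearMap
    { toFun := fun v => WithLp.toLp 2 fun i => (v i).re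
      map_add' := fun v w => by ext i; simp
      map_smul' := fun c v => by ext i; simp }

/-- A real vector, seen as a complex vector. -/
def cplx : EuclideanSpace ℝ ι →L[ℝ] EuclideanSpace ℂ ι :=
  LinearMap.toContinuousLinearMap
    { toFun := fun v => WithLp.toLp 2 fun i => (v i : ℂ)
      map_add' := fun v w => by ext i; simp
      map_smul' := fun c v => by ext i; simp }

/-- Componentwise complex conjugation. -/
def conjV : EuclideanSpace ℂ ι →L[ℝ] EuclideanSpace ℂ ι :=
  LinearMap.toContinuousLinearMap
    { toFun := fun v => WithLp.toLp 2 fun i => (starRingEnd ℂ) (v i)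
      map_add' := fun v w => by ext i; simp
      map_smul' := fun c v => by ext i; simp }

@[simp] theorem reV_apply (v : EuclideanSpace ℂ ι) (i : ι) : reV v i = (v i).re := rfl

@[simp] theorem cplx_apply (v : EuclideanSpace ℝ ι) (i : ι) : cplx v i = (v i : ℂ) := rfl

@[simp] theorem conjV_apply (v : EuclideanSpace ℂ ι) (i : ι) :
    conjV v i = (starRingEnd ℂ) (v i) := rfl

@[simp] theorem reV_cplx (v : EuclideanSpace ℝ ι) : reV (cplx v) = v := by ext i; simp

@[simp] theorem conjV_cplx (v : EuclideanSpace ℝ ι) : conjV (cplx v) = cplx v := by ext i; simp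

@[simp] theorem conjV_conjV (v : EuclideanSpace ℂ ι) : conjV (conjV v) = v := by ext i; simp

theorem conjV_smul (c : ℂ) (v : EuclideanSpace ℂ ι) :
    conjV (c • v) = (starRingEnd ℂ) c • conjV v := by ext i; simp

theorem norm_conjV (v : EuclideanSpace ℂ ι) : ‖conjV v‖ = ‖v‖ := by
  simp [EuclideanSpace.norm_eq]

theorem norm_cplx (v : EuclideanSpace ℝ ι) : ‖cplx v‖ = ‖v‖ := by
  simp [EuclideanSpace.norm_eq]

theorem cplx_reV {v : EuclideanSpace ℂ ι} (h : conjV v = v) : cplx (reV v) = v := by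
  ext i
  have hi : (starRingEnd ℂ) (v i) = v i := by rw [← conjV_apply, h]
  simpa using Complex.conj_eq_iff_re.1 hi

theorem norm_reV {v : EuclideanSpace ℂ ι} (h : conjV v = v) : ‖reV v‖ = ‖v‖ := by
  rw [← norm_cplx, cplx_reV h]

/-- The involution `f ↦ conj (f (-ξ))`, whose fixed points are the Fourier transforms of the
real-valued functions. -/
def herm : L2 (EuclideanSpace ℂ ι) →L[ℝ] L2 (EuclideanSpace ℂ ι) :=
  (conjV.compLpL 2 volume).comp
    (Lp.compMeasurePreservingₗᵢ ℝ (fun ξ : E3 => -ξ)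
      (Measure.measurePreserving_neg volume)).toContinuousLinearMap

theorem ae_neg {p : E3 → Prop} (h : ∀ᵐ ξ ∂(volume : Measure E3), p ξ) :
    ∀ᵐ ξ ∂(volume : Measure E3), p (-ξ) :=
  (Measure.measurePreserving_neg (volume : Measure E3)).quasiMeasurePreserving.ae h

theorem herm_coe (f : L2 (EuclideanSpace ℂ ι)) : herm f =ᵐ[volume] fun ξ => conjV (f (-ξ)) := by
  have h1 := conjV.coeFn_compLpL (p := 2) (μ := volume)
    (Lp.compMeasurePreserving (fun ξ : E3 => -ξ) (Measure.measurePreserving_neg volume) f)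
  have h2 := Lp.coeFn_compMeasurePreserving f (Measure.measurePreserving_neg (volume : Measure E3))
  filter_upwards [h1, h2] with ξ h1 h2
  refine h1.trans ?_
  rw [h2]
  rfl

theorem norm_herm (f : L2 (EuclideanSpace ℂ ι)) : ‖herm f‖ = ‖f‖ := by
  refine Eq.trans ?_ (Lp.norm_compMeasurePreserving f
    (Measure.measurePreserving_neg (volume : Measure E3)))
  rw [Lp.norm_def, Lp.norm_def]
  congr 1
  refine eLpNorm_congr_norm_ae ?_
  filter_upwards [herm_coe f,
    Lp.coeFn_compMeasurePreserving f (Measure.measurePreserving_neg (volume : Measure E3))]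
    with ξ h1 h2
  rw [h1, h2, norm_conjV]
  rfl

theorem herm_op {κ : Type*} [Fintype κ] (M : Mult (EuclideanSpace ℂ ι) (EuclideanSpace ℂ κ))
    (h : ∀ ξ v, conjV (M.sym (-ξ) v) = M.sym ξ (conjV v)) (f : L2 (EuclideanSpace ℂ ι)) :
    herm (M.op f) = M.op (herm f) := by
  refine Lp.ext ?_
  filter_upwards [herm_coe (M.op f), ae_neg (M.op_coe f), M.op_coe (herm f), herm_coe f]
    with ξ h1 h2 h3 h4
  rw [h1, h2, h3, h4, h]

theorem rho_neg (ξ : E3) : rho (-ξ) = rho ξ := by simp [rho]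

theorem herm_wt (n : ℕ) (f : L2 (EuclideanSpace ℂ ι)) :
    herm ((wt n).op f) = (wt n).op (herm f) :=
  herm_op _ (fun ξ v => by simp [conjV_smul, rho_neg]) f

theorem fourierInv_testC_neg {φ : E3 → ℝ} (hφ : ContDiff ℝ ∞ φ) (hc : HasCompactSupport φ)
    (ξ : E3) :
    (starRingEnd ℂ) ((𝓕⁻ (testC hφ hc)) ξ) = (𝓕⁻ (testC hφ hc)) (-ξ) := by
  rw [SchwartzMap.fourierInv_coe, Real.fourierInv_eq', Real.fourierInv_eq', ← integral_conj]
  refine integral_congr_ae (Eventually.of_forall fun x => ?_)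
  simp only [testC_apply, smul_eq_mul, map_mul, Complex.conj_ofReal, ← Complex.exp_conj,
    Complex.conj_I, inner_neg_right]
  push_cast
  ring_nf

theorem fourierInv_herm (f : L2 (EuclideanSpace ℂ ι)) :
    (𝓕⁻ (herm f) : L2 (EuclideanSpace ℂ ι)) =ᵐ[volume]
      fun x => conjV ((𝓕⁻ f : L2 (EuclideanSpace ℂ ι)) x) := by
  have hm : MemLp (fun x => conjV ((𝓕⁻ f : L2 (EuclideanSpace ℂ ι)) x)) 2 volume :=
    (Lp.memLp (𝓕⁻ f : L2 (EuclideanSpace ℂ ι))).of_le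
      (conjV.continuous.comp_aestronglyMeasurable (Lp.aestronglyMeasurable _))
      (Eventually.of_forall fun x => (norm_conjV _).le)
  refine ae_eq_of_integral_contDiff_smul_eq (locallyIntegrable_L2 _)
    (hm.locallyIntegrable (by norm_num)) fun φ hφ hc => ?_
  have hcs : ∀ (v : EuclideanSpace ℂ ι) (x : E3), φ x • v = testC hφ hc x • v := fun v x => by
    rw [testC_apply, Complex.coe_smul]
  have h1 : ∫ x, φ x • conjV ((𝓕⁻ f : L2 (EuclideanSpace ℂ ι)) x)
      = conjV (∫ x, testC hφ hc x • (𝓕⁻ f : L2 (EuclideanSpace ℂ ι)) x) := by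
    have hi : Integrable (fun x => φ x • (𝓕⁻ f : L2 (EuclideanSpace ℂ ι)) x) volume :=
      integrable_smul_of_test (Lp.memLp (𝓕⁻ f : L2 (EuclideanSpace ℂ ι))) hφ.continuous hc
    simp only [← hcs]
    rw [← conjV.integral_comp_comm hi]
    simp only [map_smul]
  have h0 : ∀ g : L2 (EuclideanSpace ℂ ι),
      Integrable (fun ξ => (𝓕⁻ (testC hφ hc)) ξ • g ξ) volume := fun g =>
    integrable_schwartz_smul (n := 0) _ (by simpa using Lp.memLp g)
  rw [h1]
  simp only [hcs]
  rw [integral_smul_fourierInv, integral_smul_fourierInv, ← conjV.integral_comp_comm (h0 f),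
    ← integral_neg_eq_self]
  refine integral_congr_ae ?_
  filter_upwards [ae_neg (herm_coe f)] with ξ hξ
  rw [hξ, neg_neg, conjV_smul, fourierInv_testC_neg]

theorem conjV_ev (f : L2 (EuclideanSpace ℂ ι)) (x : E3) : conjV (ev f x) = ev (herm f) x := by
  have h : (fun x => conjV (ev f x)) =ᵐ[volume] fun x => ev (herm f) x := by
    filter_upwards [fourierInv_herm ((wt 2).op f), fourierInv_wt_two_ae f,
      fourierInv_wt_two_ae (herm f)] with x h1 h2 h3
    rw [← h2, ← h1, herm_wt, h3]
  exact congrFun ((Continuous.ae_eq_iff_eq volume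
    (conjV.continuous.comp (ev f).continuous) (ev (herm f)).continuous).1 h) x

theorem norm_reInv_reV {f : L2 (EuclideanSpace ℂ ι)} (hf : herm f = f) :
    ‖reInv reV f‖ = ‖f‖ := by
  have h1 : ‖(𝓕⁻ f : L2 (EuclideanSpace ℂ ι))‖ = ‖f‖ :=
    (Lp.fourierTransformₗᵢ E3 (EuclideanSpace ℂ ι)).symm.norm_map f
  rw [← h1, Lp.norm_def, Lp.norm_def]
  congr 1
  refine eLpNorm_congr_norm_ae ?_
  filter_upwards [reInv_coe reV f, fourierInv_herm f] with x h1 h2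
  rw [h1, norm_reV]
  rw [← h2, hf]

/-- A real vector field, seen as a complex vector field. -/
def cplxL : Lp (EuclideanSpace ℝ ι) 2 (volume : Measure E3) →L[ℝ] L2 (EuclideanSpace ℂ ι) :=
  cplx.compLpL 2 volume

theorem cplxL_coe (f : Lp (EuclideanSpace ℝ ι) 2 (volume : Measure E3)) :
    cplxL f =ᵐ[volume] fun x => cplx (f x) := by
  have h := (cplx (ι := ι)).coeFn_compLpL (p := 2) (μ := (volume : Measure E3)) f
  exact h

/-- The Fourier transform of a real vector field. -/
def fourierR : Lp (EuclideanSpace ℝ ι) 2 (volume : Measure E3) →L[ℝ] L2 (EuclideanSpace ℂ ι) :=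
  ((Lp.fourierTransformₗᵢ E3
    (EuclideanSpace ℂ ι)).toContinuousLinearEquiv.toContinuousLinearMap.restrictScalars ℝ).comp
    cplxL

theorem fourierR_eq (f : Lp (EuclideanSpace ℝ ι) 2 (volume : Measure E3)) :
    fourierR f = 𝓕 (cplxL f) := rfl

theorem fourierInv_fourierR (f : Lp (EuclideanSpace ℝ ι) 2 (volume : Measure E3)) :
    (𝓕⁻ (fourierR f) : L2 (EuclideanSpace ℂ ι)) =ᵐ[volume] fun x => cplx (f x) := by
  rw [fourierR_eq, FourierTransform.fourierInv_fourier_eq]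
  exact cplxL_coe f

theorem herm_fourierR (f : Lp (EuclideanSpace ℝ ι) 2 (volume : Measure E3)) :
    herm (fourierR f) = fourierR f := by
  refine (Lp.fourierTransformₗᵢ E3 (EuclideanSpace ℂ ι)).symm.injective ?_
  refine Lp.ext ?_
  filter_upwards [fourierInv_herm (fourierR f), fourierInv_fourierR f] with x h1 h2
  refine h1.trans (Eq.trans ?_ h2.symm)
  rw [h2, conjV_cplx]

end

/-! ### The Helmholtz kernel and its Fourier transform -/

/-- The primitive of the Gaussian. -/
def gaussPrim (z : ℝ) : ℝ := ∫ t in (0 : ℝ)..z, Real.exp (-t ^ 2)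

theorem hasDerivAt_gaussPrim (z : ℝ) : HasDerivAt gaussPrim (Real.exp (-z ^ 2)) z := by
  have hc : Continuous fun t : ℝ => Real.exp (-t ^ 2) := by fun_prop
  exact intervalIntegral.integral_hasDerivAt_right (hc.intervalIntegrable _ _)
    (hc.stronglyMeasurableAtFilter _ _) hc.continuousAt

theorem tendsto_gaussPrim_atTop : Tendsto gaussPrim atTop (𝓝 (√Real.pi / 2)) := by
  have h := intervalIntegral_tendsto_integral_Ioi (f := fun t : ℝ => Real.exp (-t ^ 2)) (μ := volume)
    0 (by simpa using (integrable_exp_neg_mul_sq one_pos).integrableOn) tendsto_id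
  have h2 := integral_gaussian_Ioi 1
  simp only [neg_mul, one_mul, div_one] at h2
  rw [h2] at h
  exact h

theorem gaussPrim_neg (z : ℝ) : gaussPrim (-z) = -gaussPrim z := by
  unfold gaussPrim
  have h := intervalIntegral.integral_comp_neg (a := 0) (b := z)
    (fun t : ℝ => Real.exp (-t ^ 2))
  simp only [neg_sq, neg_zero] at h
  rw [intervalIntegral.integral_symm, ← h]

theorem tendsto_gaussPrim_atBot : Tendsto gaussPrim atBot (𝓝 (-(√Real.pi / 2))) := by
  have h := (tendsto_gaussPrim_atTop.comp tendsto_neg_atBot_atTop).neg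
  refine h.congr fun z => ?_
  simp [gaussPrim_neg]

/-- A primitive of `s ^ (-3/2) exp (-s - a² / (4 s))`. -/
def subPrim (a s : ℝ) : ℝ :=
  2 / a * (Real.exp (-a) * gaussPrim (√s - a / (2 * √s))
    - Real.exp a * gaussPrim (√s + a / (2 * √s)))

theorem hasDerivAt_subPrim {a s : ℝ} (ha : 0 < a) (hs : 0 < s) :
    HasDerivAt (subPrim a) (Real.exp (-s - a ^ 2 / (4 * s)) / (s * √s)) s := by
  have hr : 0 < √s := Real.sqrt_pos.2 hs
  have h1 : HasDerivAt (fun s : ℝ => √s) (1 / (2 * √s)) s := Real.hasDerivAt_sqrt hs.ne'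
  have h2 : HasDerivAt (fun s : ℝ => a / (2 * √s)) (-(a / (4 * (s * √s)))) s := by
    have := (h1.const_mul 2).inv (by positivity) |>.const_mul a
    refine (this.congr_deriv ?_).congr_of_eventuallyEq ?_
    · have h3 : s = √s ^ 2 := (Real.sq_sqrt hs.le).symm
      rw [show 4 * (s * √s) = 4 * (√s ^ 2 * √s) by rw [← h3]]
      field_simp
      norm_num
    · exact Eventually.of_forall fun t => by simp [div_eq_mul_inv]
  have h3 := (hasDerivAt_gaussPrim _).comp s (h1.sub h2)
  have h4 := (hasDerivAt_gaussPrim _).comp s (h1.add h2)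
  have h5 := ((h3.const_mul (Real.exp (-a))).sub (h4.const_mul (Real.exp a))).const_mul (2 / a)
  refine h5.congr_deriv ?_
  have hsq : √s ^ 2 = s := Real.sq_sqrt hs.le
  have e1 : Real.exp (-(√s - a / (2 * √s)) ^ 2)
      = Real.exp a * Real.exp (-s - a ^ 2 / (4 * s)) := by
    rw [← Real.exp_add]
    congr 1
    rw [sub_sq, div_pow, mul_pow, hsq]
    field_simp
    ring
  have e2 : Real.exp (-(√s + a / (2 * √s)) ^ 2)
      = Real.exp (-a) * Real.exp (-s - a ^ 2 / (4 * s)) := by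
    rw [← Real.exp_add]
    congr 1
    rw [add_sq, div_pow, mul_pow, hsq]
    field_simp
    ring
  simp only [Pi.sub_apply, Pi.add_apply]
  rw [e1, e2]
  have e3 : Real.exp (-a) * Real.exp a = 1 := by rw [← Real.exp_add]; simp
  set X := Real.exp (-s - a ^ 2 / (4 * s))
  calc _ = 2 / a * ((Real.exp (-a) * Real.exp a) * X * (1 / (2 * √s) - -(a / (4 * (s * √s))))
        - (Real.exp (-a) * Real.exp a) * X * (1 / (2 * √s) + -(a / (4 * (s * √s))))) := by ring
    _ = X / (s * √s) := by
      rw [e3]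
      field_simp
      ring

theorem tendsto_sqrt_zero : Tendsto (fun s : ℝ => √s) (𝓝[>] 0) (𝓝[>] 0) := by
  refine tendsto_nhdsWithin_iff.2 ⟨?_, ?_⟩
  · have := Real.continuous_sqrt.tendsto 0
    rw [Real.sqrt_zero] at this
    exact this.mono_left nhdsWithin_le_nhds
  · filter_upwards [self_mem_nhdsWithin] with s hs
    exact Real.sqrt_pos.2 hs

/-- Subordination formula for `exp (-a) / a`. -/
theorem integral_subordination {a : ℝ} (ha : 0 < a) :
    IntegrableOn (fun s : ℝ => Real.exp (-s - a ^ 2 / (4 * s)) / (s * √s)) (Ioi 0) ∧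
    ∫ s in Ioi (0 : ℝ), Real.exp (-s - a ^ 2 / (4 * s)) / (s * √s)
      = 2 * √Real.pi * Real.exp (-a) / a := by
  set L0 : ℝ := 2 / a * (Real.exp (-a) * (-(√Real.pi / 2)) - Real.exp a * (√Real.pi / 2)) with hL0
  have hinv : Tendsto (fun s : ℝ => a / (2 * √s)) (𝓝[>] 0) atTop := by
    have := (tendsto_inv_nhdsGT_zero.comp tendsto_sqrt_zero).const_mul_atTop
      (show 0 < a / 2 by positivity)
    refine this.congr fun s => ?_
    simp only [Function.comp]
    rw [div_mul_eq_div_div, div_eq_mul_inv (a / 2)]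
  have hs0 : Tendsto (fun s : ℝ => √s) (𝓝[>] 0) (𝓝 0) :=
    tendsto_sqrt_zero.mono_right nhdsWithin_le_nhds
  have l1 : Tendsto (subPrim a) (𝓝[>] 0) (𝓝 L0) := by
    have e1 : Tendsto (fun s : ℝ => √s - a / (2 * √s)) (𝓝[>] 0) atBot := by
      have := tendsto_atBot_add_right_of_ge' (𝓝[>] (0 : ℝ)) 1
        (tendsto_neg_atTop_atBot.comp hinv) (g := fun s => √s)
        (by
          filter_upwards [hs0.eventually (gt_mem_nhds zero_lt_one)] with s hs using hs.le)
      refine this.congr fun s => ?_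
      simp only [Function.comp]; ring
    have e2 : Tendsto (fun s : ℝ => √s + a / (2 * √s)) (𝓝[>] 0) atTop :=
      tendsto_atTop_mono (fun s => le_add_of_nonneg_left (Real.sqrt_nonneg s)) hinv
    exact (((tendsto_gaussPrim_atBot.comp e1).const_mul _).sub
      ((tendsto_gaussPrim_atTop.comp e2).const_mul _)).const_mul _
  have l2 : Tendsto (subPrim a) atTop
      (𝓝 (2 / a * (Real.exp (-a) * (√Real.pi / 2) - Real.exp a * (√Real.pi / 2)))) := by
    have e0 : Tendsto (fun s : ℝ => a / (2 * √s)) atTop (𝓝 0) :=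
      tendsto_const_nhds.div_atTop (Real.tendsto_sqrt_atTop.const_mul_atTop two_pos)
    have e1 : Tendsto (fun s : ℝ => √s - a / (2 * √s)) atTop atTop := by
      simpa [sub_eq_add_neg] using Real.tendsto_sqrt_atTop.atTop_add e0.neg
    have e2 : Tendsto (fun s : ℝ => √s + a / (2 * √s)) atTop atTop :=
      Real.tendsto_sqrt_atTop.atTop_add e0
    exact (((tendsto_gaussPrim_atTop.comp e1).const_mul _).sub
      ((tendsto_gaussPrim_atTop.comp e2).const_mul _)).const_mul _
  set g : ℝ → ℝ := Function.update (subPrim a) 0 L0 with hg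
  have hg0 : g 0 = L0 := by simp [hg]
  have hgs : ∀ s, 0 < s → g s = subPrim a s := fun s hs => by simp [hg, hs.ne']
  have hcont : ContinuousWithinAt g (Ici 0) 0 := by
    rw [← continuousWithinAt_Ioi_iff_Ici, ContinuousWithinAt, hg0]
    refine l1.congr' ?_
    filter_upwards [self_mem_nhdsWithin] with s hs
    exact (hgs s hs).symm
  have hder : ∀ s ∈ Ioi (0 : ℝ),
      HasDerivAt g (Real.exp (-s - a ^ 2 / (4 * s)) / (s * √s)) s := fun s hs => by
    refine (hasDerivAt_subPrim ha hs).congr_of_eventuallyEq ?_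
    filter_upwards [lt_mem_nhds hs] with t ht using hgs t ht
  have hpos : ∀ s ∈ Ioi (0 : ℝ), 0 ≤ Real.exp (-s - a ^ 2 / (4 * s)) / (s * √s) := fun s hs => by
    have : (0 : ℝ) < s := hs
    positivity
  have hlim : Tendsto g atTop
      (𝓝 (2 / a * (Real.exp (-a) * (√Real.pi / 2) - Real.exp a * (√Real.pi / 2)))) := by
    refine l2.congr' ?_
    filter_upwards [eventually_gt_atTop 0] with s hs using (hgs s hs).symm
  refine ⟨integrableOn_Ioi_deriv_of_nonneg hcont hder hpos hlim, ?_⟩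
  rw [integral_Ioi_of_hasDerivAt_of_nonneg hcont hder hpos hlim, hg0, hL0]
  field_simp
  ring

/-- The heat kernel at time `α² s`, weighted by `exp (-s)`. -/
def heatW (α s : ℝ) (x : E3) : ℝ :=
  Real.exp (-s) * ((Real.pi / (1 / (4 * α ^ 2 * s))) ^ (-(3 / 2) : ℝ) *
    Real.exp (-(1 / (4 * α ^ 2 * s)) * ‖x‖ ^ 2))

theorem integral_heatW {α : ℝ} (hα : 0 < α) {x : E3} (hx : x ≠ 0) :
    ∫ s in Ioi (0 : ℝ), heatW α s x = helmholtzKernel α x := by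
  have hx0 : 0 < ‖x‖ := norm_pos_iff.2 hx
  have h := (integral_subordination (a := ‖x‖ / α) (by positivity)).2
  have hpi := Real.pi_pos
  have e : ∀ s ∈ Ioi (0 : ℝ), heatW α s x = ((4 * Real.pi * α ^ 2) * √(4 * Real.pi * α ^ 2))⁻¹ *
      (Real.exp (-s - (‖x‖ / α) ^ 2 / (4 * s)) / (s * √s)) := by
    intro s hs
    have hs : (0 : ℝ) < s := hs
    unfold heatW
    have e1 : Real.pi / (1 / (4 * α ^ 2 * s)) = (4 * Real.pi * α ^ 2) * s := by
      field_simp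
    have e2 : ∀ c : ℝ, 0 < c → c ^ (-(3 / 2) : ℝ) = (c * √c)⁻¹ := by
      intro c hc
      rw [Real.rpow_neg hc.le, show (3 / 2 : ℝ) = 1 + 1 / 2 by norm_num, Real.rpow_add hc,
        Real.rpow_one, Real.sqrt_eq_rpow]
    rw [e1, e2 _ (by positivity), Real.sqrt_mul (by positivity), sub_eq_add_neg, Real.exp_add]
    have e3 : -(1 / (4 * α ^ 2 * s)) * ‖x‖ ^ 2 = -((‖x‖ / α) ^ 2 / (4 * s)) := by
      field_simp
    rw [e3]
    have : 0 < √s := Real.sqrt_pos.2 hs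
    field_simp
  rw [setIntegral_congr_fun measurableSet_Ioi e, integral_const_mul, h]
  unfold helmholtzKernel
  have e4 : √(4 * Real.pi * α ^ 2) = 2 * √Real.pi * α := by
    rw [show 4 * Real.pi * α ^ 2 = (2 * α) ^ 2 * Real.pi by ring, Real.sqrt_mul (by positivity),
      Real.sqrt_sq (by positivity)]
    ring
  rw [e4]
  have e5 : 0 < √Real.pi := Real.sqrt_pos.2 hpi
  rw [neg_div]
  field_simp

theorem heatW_nonneg {α s : ℝ} (hs : 0 < s) (x : E3) : 0 ≤ heatW α s x := by
  have := Real.pi_pos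
  unfold heatW
  positivity

theorem measurable_heatW (α : ℝ) : Measurable fun z : ℝ × E3 => heatW α z.1 z.2 := by
  unfold heatW
  fun_prop

theorem fourier_heatW {α s : ℝ} (hα : 0 < α) (hs : 0 < s) (ξ : E3) :
    𝓕 (fun x => (heatW α s x : ℂ)) ξ
      = ((Real.exp (-(1 + 4 * Real.pi ^ 2 * α ^ 2 * ‖ξ‖ ^ 2) * s) : ℝ) : ℂ) := by
  have hpi := Real.pi_pos
  set b : ℝ := 1 / (4 * α ^ 2 * s) with hb
  have hb0 : 0 < b := by positivity
  have h := fourier_gaussian_innerProductSpace (V := E3) (b := (b : ℂ)) (by rwa [Complex.ofReal_re]) ξ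
  have e1 : (fun x : E3 => (heatW α s x : ℂ))
      = ((Real.exp (-s) * (Real.pi / b) ^ (-(3 / 2) : ℝ) : ℝ) : ℂ) •
        fun v : E3 => Complex.exp (-b * ‖v‖ ^ 2) := by
    funext x
    simp only [heatW, Pi.smul_apply, smul_eq_mul, ← hb]
    push_cast
    ring
  rw [e1]
  have e2 := congrFun (VectorFourier.fourierIntegral_const_smul Real.fourierChar
    (volume : Measure E3) (innerₗ E3) (fun v : E3 => Complex.exp (-b * ‖v‖ ^ 2))
    ((Real.exp (-s) * (Real.pi / b) ^ (-(3 / 2) : ℝ) : ℝ) : ℂ)) ξ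
  refine Eq.trans e2 ?_
  rw [Pi.smul_apply]
  refine (congrArg (_ • ·) h).trans ?_
  have e3 : (Real.pi / (b : ℂ)) ^ ((Module.finrank ℝ E3 : ℂ) / 2)
      = (((Real.pi / b) ^ (3 / 2 : ℝ) : ℝ) : ℂ) := by
    rw [Complex.ofReal_cpow (by positivity)]
    simp
  have e4 : Complex.exp (-Real.pi ^ 2 * ‖ξ‖ ^ 2 / b)
      = ((Real.exp (-(4 * Real.pi ^ 2 * α ^ 2 * ‖ξ‖ ^ 2) * s) : ℝ) : ℂ) := by
    rw [Complex.ofReal_exp]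
    congr 1
    rw [hb]
    push_cast
    field_simp
  rw [e3, e4, smul_eq_mul, ← Complex.ofReal_mul, ← Complex.ofReal_mul]
  congr 1
  have e5 : (Real.pi / b) ^ (-(3 / 2) : ℝ) * (Real.pi / b) ^ (3 / 2 : ℝ) = 1 := by
    rw [← Real.rpow_add (by positivity)]
    simp
  calc _ = ((Real.pi / b) ^ (-(3 / 2) : ℝ) * (Real.pi / b) ^ (3 / 2 : ℝ)) *
        (Real.exp (-s) * Real.exp (-(4 * Real.pi ^ 2 * α ^ 2 * ‖ξ‖ ^ 2) * s)) := by ring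
    _ = _ := by
      rw [e5, one_mul, ← Real.exp_add]
      ring_nf

theorem integrable_heatW {α s : ℝ} (hα : 0 < α) (hs : 0 < s) :
    Integrable (fun x : E3 => heatW α s x) volume := by
  have hb : 0 < 1 / (4 * α ^ 2 * s) := by positivity
  have h := GaussianFourier.integrable_cexp_neg_mul_sq_norm_add (V := E3)
    (b := ((1 / (4 * α ^ 2 * s) : ℝ) : ℂ)) (by rwa [Complex.ofReal_re]) 0 0
  have h2 := (h.re.const_mul ((Real.pi / (1 / (4 * α ^ 2 * s))) ^ (-(3 / 2) : ℝ))).const_mul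
    (Real.exp (-s))
  refine h2.congr (Eventually.of_forall fun x => ?_)
  simp only [heatW]
  congr 2
  simp only [zero_mul, add_zero, RCLike.re_eq_complex_re]
  rw [← Complex.ofReal_neg, ← Complex.ofReal_pow, ← Complex.ofReal_mul, Complex.exp_ofReal_re]

theorem integral_heatW_space {α s : ℝ} (hα : 0 < α) (hs : 0 < s) :
    ∫ x : E3, heatW α s x = Real.exp (-s) := by
  have h := fourier_heatW hα hs 0
  rw [Real.fourier_eq] at h
  simp only [inner_zero_right, neg_zero, AddChar.map_zero_eq_one, one_smul] at h
  rw [integral_complex_ofReal] at h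
  have h2 := Complex.ofReal_injective h
  rw [h2]
  simp

theorem integrable_heatW_prod {α : ℝ} (hα : 0 < α) :
    Integrable (fun z : ℝ × E3 => heatW α z.1 z.2)
      ((volume.restrict (Ioi 0)).prod (volume : Measure E3)) := by
  rw [integrable_prod_iff (measurable_heatW α).aestronglyMeasurable]
  constructor
  · filter_upwards [ae_restrict_mem measurableSet_Ioi] with s hs
    exact integrable_heatW hα hs
  · have h : Integrable (fun s : ℝ => Real.exp (-s)) (volume.restrict (Ioi 0)) :=
      integrableOn_exp_neg_Ioi 0
    refine h.congr ?_
    filter_upwards [ae_restrict_mem measurableSet_Ioi] with s hs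
    rw [← integral_heatW_space hα hs]
    refine integral_congr_ae (Eventually.of_forall fun x => ?_)
    exact (Real.norm_of_nonneg (heatW_nonneg hs x)).symm

theorem ae_ne_zero : ∀ᵐ x : E3 ∂volume, x ≠ 0 := by
  simp [ae_iff, measure_singleton]

theorem integrable_helmholtzKernel {α : ℝ} (hα : 0 < α) :
    Integrable (helmholtzKernel α) volume := by
  refine (integrable_heatW_prod hα).integral_prod_right.congr ?_
  filter_upwards [ae_ne_zero] with x hx
  exact integral_heatW hα hx

/-- The symbol of the Helmholtz filter. -/
def helm (α : ℝ) (ξ : E3) : ℝ := 1 / (1 + 4 * Real.pi ^ 2 * α ^ 2 * ‖ξ‖ ^ 2)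

/-- The Fourier transform of the Helmholtz kernel. -/
theorem fourier_helmholtzKernel {α : ℝ} (hα : 0 < α) (ξ : E3) :
    𝓕 (fun x => (helmholtzKernel α x : ℂ)) ξ = (helm α ξ : ℂ) := by
  have hF : Integrable (fun z : ℝ × E3 =>
      Real.fourierChar (-inner ℝ z.2 ξ) • (heatW α z.1 z.2 : ℂ))
      ((volume.restrict (Ioi 0)).prod (volume : Measure E3)) := by
    refine (integrable_heatW_prod hα).mono ?_ (Eventually.of_forall fun z => by simp)
    refine AEStronglyMeasurable.smul ?_ ?_
    · have : Continuous fun z : ℝ × E3 => (Real.fourierChar (-inner ℝ z.2 ξ) : ℂ) :=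
        continuous_subtype_val.comp (Real.continuous_fourierChar.comp (by fun_prop))
      exact this.aestronglyMeasurable
    · exact (Complex.measurable_ofReal.comp (measurable_heatW α)).aestronglyMeasurable
  rw [Real.fourier_eq]
  have h1 : ∀ᵐ x : E3 ∂volume, Real.fourierChar (-inner ℝ x ξ) • (helmholtzKernel α x : ℂ)
      = ∫ s in Ioi (0 : ℝ), Real.fourierChar (-inner ℝ x ξ) • (heatW α s x : ℂ) := by
    filter_upwards [ae_ne_zero] with x hx
    rw [← integral_heatW hα hx, ← integral_complex_ofReal]
    simp only [Circle.smul_def]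
    rw [integral_smul]
  rw [integral_congr_ae h1, ← integral_integral_swap hF]
  have h2 : ∀ s ∈ Ioi (0 : ℝ), ∫ x : E3, Real.fourierChar (-inner ℝ x ξ) • (heatW α s x : ℂ)
      = ((Real.exp (-(1 + 4 * Real.pi ^ 2 * α ^ 2 * ‖ξ‖ ^ 2) * s) : ℝ) : ℂ) := fun s hs => by
    rw [← fourier_heatW hα hs, Real.fourier_eq]
  rw [setIntegral_congr_fun measurableSet_Ioi h2, integral_complex_ofReal]
  congr 1
  have h3 : (0 : ℝ) < 1 + 4 * Real.pi ^ 2 * α ^ 2 * ‖ξ‖ ^ 2 := by positivity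
  rw [integral_exp_mul_Ioi (by linarith) 0, helm]
  field_simp
  simp

theorem memLp_helmholtzKernel {α : ℝ} (hα : 0 < α) : MemLp (helmholtzKernel α) 2 volume := by
  refine (memLp_two_iff_integrable_sq (integrable_helmholtzKernel hα).1).2 ?_
  have hpi := Real.pi_pos
  have h := (integrable_fun_norm_addHaar (volume : Measure E3)
    (f := fun r : ℝ => (Real.exp (-r / α) / (4 * Real.pi * α ^ 2 * r)) ^ 2)).2 ?_
  · exact h
  · have h2 : IntegrableOn (fun r : ℝ => ((4 * Real.pi * α ^ 2)⁻¹) ^ 2 * Real.exp (-(2 / α) * r))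
        (Ioi 0) := (integrableOn_exp_mul_Ioi (by simp [hα]) 0).const_mul _
    refine h2.congr_fun (fun r hr => ?_) measurableSet_Ioi
    have hr : (0 : ℝ) < r := hr
    have e1 : Real.exp (-r / α) ^ 2 = Real.exp (-(2 / α) * r) := by
      rw [← Real.exp_nat_mul]
      congr 1
      push_cast
      ring
    simp only [finrank_euclideanSpace, Fintype.card_fin, smul_eq_mul]
    rw [div_pow, e1]
    field_simp

section

variable {V : Type*} [NormedAddCommGroup V] [InnerProductSpace ℂ V] [CompleteSpace V]

/-! ### The heat semigroup -/

/-- The symbol `4π²|ξ|²` of `-Δ`. -/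
def lap (ξ : E3) : ℝ := 4 * Real.pi ^ 2 * ‖ξ‖ ^ 2

theorem lap_nonneg (ξ : E3) : 0 ≤ lap ξ := by unfold lap; positivity

theorem continuous_lap : Continuous lap := by unfold lap; fun_prop

theorem lap_le (ξ : E3) : lap ξ ≤ 4 * Real.pi ^ 2 * rho ξ ^ 2 := by
  unfold lap
  have := norm_le_rho ξ
  gcongr

theorem rho_sq_le (ξ : E3) : rho ξ ^ 2 ≤ 2 + 2 * lap ξ := by
  have h1 : (1 : ℝ) ≤ 4 * Real.pi ^ 2 := by nlinarith [Real.pi_gt_three]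
  have h2 : ‖ξ‖ ^ 2 ≤ lap ξ := by
    unfold lap
    nlinarith [sq_nonneg ‖ξ‖]
  unfold rho
  nlinarith [sq_nonneg (1 - ‖ξ‖)]

theorem rho_pow_le {k : ℕ} (hk : k ≤ 2) (ξ : E3) : rho ξ ^ k ≤ 2 + 2 * lap ξ :=
  (pow_le_pow_right₀ (one_le_rho ξ) hk).trans (rho_sq_le ξ)

/-- The multiplier `c(ξ) (1 + |ξ|)ᵏ`, `k ≤ 2`, for a real symbol `c` such that `c` and `c |ξ|²` are
bounded. -/
def decayMult (c : E3 → ℝ) (hc : Measurable c) (hb : ∃ C, ∀ ξ, |c ξ| * (1 + lap ξ) ≤ C) (k : ℕ)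
    (hk : k ≤ 2) : Mult V V :=
  Mult.scal (fun ξ => (c ξ : ℂ) * (rho ξ : ℂ) ^ k)
    ((Complex.measurable_ofReal.comp hc).mul
      ((Complex.measurable_ofReal.comp continuous_rho.measurable).pow_const k))
    (by
      obtain ⟨C, hC⟩ := hb
      refine ⟨2 * C, fun ξ => ?_⟩
      rw [norm_mul, norm_pow, norm_rho, Complex.norm_real, Real.norm_eq_abs]
      calc |c ξ| * rho ξ ^ k ≤ |c ξ| * (2 + 2 * lap ξ) :=
            mul_le_mul_of_nonneg_left (rho_pow_le hk ξ) (abs_nonneg _)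
        _ = 2 * (|c ξ| * (1 + lap ξ)) := by ring
        _ ≤ 2 * C := by linarith [hC ξ])

@[simp] theorem decayMult_sym (c : E3 → ℝ) (hc : Measurable c)
    (hb : ∃ C, ∀ ξ, |c ξ| * (1 + lap ξ) ≤ C) (k : ℕ) (hk : k ≤ 2) (ξ : E3) (v : V) :
    (decayMult c hc hb k hk).sym ξ v = ((c ξ : ℂ) * (rho ξ : ℂ) ^ k) • v := rfl

/-- The symbol of the heat semigroup `exp (ν t Δ)` for `t ≥ 0`. -/
def heatSym (ν t : ℝ) (ξ : E3) : ℝ := Real.exp (-(ν * max t 0 * lap ξ))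

theorem measurable_heatSym (ν t : ℝ) : Measurable (heatSym ν t) := by
  have := continuous_lap
  unfold heatSym
  exact Continuous.measurable (by fun_prop)

theorem heatSym_pos (ν t : ℝ) (ξ : E3) : 0 < heatSym ν t ξ := Real.exp_pos _

theorem heatSym_le_one {ν : ℝ} (hν : 0 < ν) (t : ℝ) (ξ : E3) : heatSym ν t ξ ≤ 1 := by
  unfold heatSym
  rw [Real.exp_le_one_iff, neg_nonpos]
  have := lap_nonneg ξ
  positivity

theorem norm_heatSym_le {ν : ℝ} (hν : 0 < ν) (t : ℝ) (ξ : E3) : ‖(heatSym ν t ξ : ℂ)‖ ≤ 1 := by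
  rw [Complex.norm_real, Real.norm_of_nonneg (heatSym_pos ν t ξ).le]
  exact heatSym_le_one hν t ξ

theorem heatSym_decay {ν t : ℝ} (hν : 0 < ν) (ht : 0 < t) (ξ : E3) :
    |heatSym ν t ξ| * (1 + lap ξ) ≤ 1 + 1 / (ν * t) := by
  rw [abs_of_pos (heatSym_pos ν t ξ), mul_add, mul_one]
  refine add_le_add (heatSym_le_one hν t ξ) ?_
  have h0 := lap_nonneg ξ
  unfold heatSym
  rw [max_eq_left ht.le, le_div_iff₀ (by positivity), Real.exp_neg, mul_assoc,
    inv_mul_le_iff₀ (Real.exp_pos _), mul_one]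
  have := Real.add_one_le_exp (ν * t * lap ξ)
  nlinarith

/-- The heat semigroup `exp (ν t Δ)` on the Fourier side; it is the identity for `t ≤ 0`. -/
def heat {ν : ℝ} (hν : 0 < ν) (t : ℝ) : Mult V V :=
  Mult.scal (fun ξ => (heatSym ν t ξ : ℂ)) (Complex.measurable_ofReal.comp (measurable_heatSym ν t))
    ⟨1, norm_heatSym_le hν t⟩

@[simp] theorem heat_sym {ν : ℝ} (hν : 0 < ν) (t : ℝ) (ξ : E3) (v : V) :
    (heat hν t : Mult V V).sym ξ v = (heatSym ν t ξ : ℂ) • v := rfl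

theorem norm_heat_sym_le {ν : ℝ} (hν : 0 < ν) (t : ℝ) (ξ : E3) :
    ‖(heat hν t : Mult V V).sym ξ‖ ≤ 1 :=
  Mult.norm_scal_le _ (norm_heatSym_le hν t) ξ

theorem norm_heat_le {ν : ℝ} (hν : 0 < ν) (t : ℝ) (f : L2 V) : ‖(heat hν t).op f‖ ≤ ‖f‖ := by
  simpa using (heat hν t : Mult V V).norm_op_le (norm_heat_sym_le hν t) f

theorem heat_zero {ν : ℝ} (hν : 0 < ν) (f : L2 V) : (heat hν 0).op f = f := by
  refine Lp.ext ?_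
  filter_upwards [(heat hν 0 : Mult V V).op_coe f] with ξ h
  rw [h]; simp [heatSym]

theorem continuous_heatSym (ν : ℝ) (ξ : E3) : Continuous fun t => heatSym ν t ξ := by
  unfold heatSym; fun_prop

theorem continuous_heat {ν : ℝ} (hν : 0 < ν) (f : L2 V) :
    Continuous fun t => (heat hν t).op f := by
  rw [← continuousOn_univ]
  refine continuousOn_op _ (fun t _ ξ => norm_heat_sym_le hν t ξ) (fun ξ v => ?_) f
  simp only [heat_sym]
  exact ((Complex.continuous_ofReal.comp (continuous_heatSym ν ξ)).smul
    continuous_const).continuousOn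

/-- The smoothing operator `(1 + |ξ|)ᵏ exp (ν t Δ)`, `k ≤ 2`, `t > 0`. -/
def heatSmooth {ν : ℝ} (hν : 0 < ν) {t : ℝ} (ht : 0 < t) (k : ℕ) (hk : k ≤ 2) : Mult V V :=
  decayMult (heatSym ν t) (measurable_heatSym ν t) ⟨_, heatSym_decay hν ht⟩ k hk

theorem wt_heatSmooth {ν : ℝ} (hν : 0 < ν) {t : ℝ} (ht : 0 < t) (k : ℕ) (hk : k ≤ 2) (f : L2 V) :
    (wt k).op ((heatSmooth hν ht k hk).op f) = (heat hν t).op f := by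
  refine Mult.op_op_of_sym _ _ _ (fun ξ v => ?_) f
  simp only [heatSmooth, wt_sym, decayMult_sym, heat_sym, smul_smul]
  congr 1
  field_simp [rho_ne_zero ξ]

/-- The range of `(1 + |ξ|)⁻²` is dense: it contains all `exp (t Δ) f`, `t > 0`. -/
theorem denseRange_wt_two : DenseRange (wt 2 : Mult V V).op := by
  intro f
  have h1 : Tendsto (fun t => (heat one_pos t).op f) (𝓝[>] 0) (𝓝 f) := by
    have := (continuous_heat one_pos f).tendsto 0
    rw [heat_zero] at this
    exact this.mono_left nhdsWithin_le_nhds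
  refine mem_closure_of_tendsto h1 ?_
  filter_upwards [self_mem_nhdsWithin] with t ht
  exact ⟨_, wt_heatSmooth one_pos ht 2 le_rfl f⟩

/-! ### The Helmholtz filter on the Fourier side -/

theorem helm_eq (α : ℝ) (ξ : E3) : helm α ξ = 1 / (1 + α ^ 2 * lap ξ) := by
  unfold helm lap
  ring_nf

theorem helm_pos (α : ℝ) (ξ : E3) : 0 < helm α ξ := by
  unfold helm; positivity

theorem helm_mul (α : ℝ) (ξ : E3) : helm α ξ * (1 + α ^ 2 * lap ξ) = 1 := by
  have := lap_nonneg ξ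
  rw [helm_eq]
  field_simp

theorem measurable_helm (α : ℝ) : Measurable (helm α) := by unfold helm; fun_prop

theorem helm_decay {α : ℝ} (hα : 0 < α) (ξ : E3) :
    |helm α ξ| * (1 + lap ξ) ≤ 1 + 1 / α ^ 2 := by
  have h0 := lap_nonneg ξ
  rw [abs_of_pos (helm_pos α ξ), helm_eq, one_div_mul_eq_div, div_le_iff₀ (by positivity)]
  have : (1 + 1 / α ^ 2) * (1 + α ^ 2 * lap ξ) = 1 + lap ξ + (α ^ 2 * lap ξ + 1 / α ^ 2) := by
    field_simp
    ring
  rw [this]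
  have : 0 ≤ α ^ 2 * lap ξ + 1 / α ^ 2 := by positivity
  linarith

/-- The multiplier `(1 + α²·4π²|ξ|²)⁻¹ (1 + |ξ|)ᵏ`, `k ≤ 2`. -/
def helmMult {α : ℝ} (hα : 0 < α) (k : ℕ) (hk : k ≤ 2) : Mult V V :=
  decayMult (helm α) (measurable_helm α) ⟨_, helm_decay hα⟩ k hk

@[simp] theorem helmMult_sym {α : ℝ} (hα : 0 < α) (k : ℕ) (hk : k ≤ 2) (ξ : E3) (v : V) :
    (helmMult hα k hk).sym ξ v = ((helm α ξ : ℂ) * (rho ξ : ℂ) ^ k) • v := rfl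

theorem wt_helmMult {α : ℝ} (hα : 0 < α) (k : ℕ) (hk : k ≤ 2) (f : L2 V) :
    (wt k).op ((helmMult hα k hk).op f) = (helmMult hα 0 (Nat.zero_le 2)).op f := by
  refine Mult.op_op_of_sym _ _ _ (fun ξ v => ?_) f
  simp only [helmMult_sym, wt_sym, smul_smul]
  congr 1
  field_simp [rho_ne_zero ξ]

theorem integrable_helm_smul_bounded {α : ℝ} (hα : 0 < α) {F : Type*} [NormedAddCommGroup F]
    [NormedSpace ℝ F] (x : E3) {f : E3 → F} (hf : Continuous f) {C : ℝ} (hC : ∀ y, ‖f y‖ ≤ C) :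
    Integrable (fun y => helmholtzKernel α (x - y) • f y) volume :=
  Integrable.smul_bdd ((integrable_helmholtzKernel hα).comp_sub_left x) C
    hf.aestronglyMeasurable (Eventually.of_forall hC)

/-- The Helmholtz filter acts on inverse Fourier transforms of integrable functions by
multiplication with the Fourier transform of the kernel (Fubini). -/
theorem bar_ev {α : ℝ} (hα : 0 < α) (g : L2 V) (x : E3) :
    bar α (fun y => ev g y) x = ev ((helmMult hα 0 (Nat.zero_le 2)).op g) x := by
  have hH := (integrable_helmholtzKernel hα)
  set h : E3 → V := ((wt 2 : Mult V V).op g : E3 → V) with hh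
  have hi : Integrable h volume := integrable_wt_two g
  have e1 : bar α (fun y => ev g y) x = ∫ z, helmholtzKernel α z • ev g (x - z) := by
    unfold bar
    rw [← integral_sub_left_eq_self _ _ x]
    simp
  have hF : Integrable (fun p : E3 × E3 => (Real.fourierChar (inner ℝ p.2 (x - p.1)) : ℂ) •
      ((helmholtzKernel α p.1 : ℂ) • h p.2)) (volume.prod volume) := by
    have h1 : Integrable (fun p : E3 × E3 => (helmholtzKernel α p.1 : ℂ) • h p.2)
        (volume.prod volume) := hH.ofReal.smul_prod hi
    refine h1.mono ?_ (Eventually.of_forall fun p => by rw [norm_smul, Circle.norm_coe, one_mul])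
    have hc : Continuous fun p : E3 × E3 => (Real.fourierChar (inner ℝ p.2 (x - p.1)) : ℂ) :=
      continuous_subtype_val.comp (Real.continuous_fourierChar.comp (by fun_prop))
    exact hc.aestronglyMeasurable.smul h1.1
  have e2 : ∀ z, helmholtzKernel α z • ev g (x - z) = ∫ ξ,
      (Real.fourierChar (inner ℝ ξ (x - z)) : ℂ) • ((helmholtzKernel α z : ℂ) • h ξ) := fun z => by
    rw [ev_apply, Real.fourierInv_eq, ← Complex.coe_smul, ← integral_smul]
    refine integral_congr_ae (Eventually.of_forall fun ξ => ?_)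
    simp only [Circle.smul_def]
    rw [smul_comm]
  rw [e1]
  simp only [e2]
  rw [integral_integral_swap hF]
  have e3 : (wt 2).op ((helmMult hα 0 (Nat.zero_le 2)).op g)
      =ᵐ[volume] fun ξ => (helm α ξ : ℂ) • h ξ := by
    have hcomm : (wt 2).op ((helmMult hα 0 (Nat.zero_le 2)).op g)
        = (helmMult hα 0 (Nat.zero_le 2)).op ((wt 2).op g) :=
      Mult.op_op_eq_of_sym _ _ _ _ (fun ξ v => by
        rw [wt_sym, helmMult_sym, helmMult_sym, wt_sym, smul_comm]) g
    rw [hcomm]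
    filter_upwards [(helmMult hα 0 (Nat.zero_le 2) : Mult V V).op_coe ((wt 2).op g)] with ξ hξ
    rw [hξ]
    simp [hh]
  rw [ev_eq_of_ae _ e3, Real.fourierInv_eq]
  refine integral_congr_ae (Eventually.of_forall fun ξ => ?_)
  simp only
  rw [← fourier_helmholtzKernel hα, Real.fourier_eq, Circle.smul_def, ← integral_smul_const,
    ← integral_smul]
  refine integral_congr_ae (Eventually.of_forall fun z => ?_)
  simp only [Circle.smul_def, smul_smul, smul_eq_mul]
  rw [inner_sub_right, sub_eq_add_neg, AddChar.map_add_eq_mul, Circle.coe_mul,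
    real_inner_comm z ξ]
  congr 1
  ring

theorem bar_comp_ev {α : ℝ} (hα : 0 < α) {F : Type*} [NormedAddCommGroup F] [NormedSpace ℝ F]
    [CompleteSpace F] (T : V →L[ℝ] F) (g : L2 V) (x : E3) :
    bar α (fun y => T (ev g y)) x = T (ev ((helmMult hα 0 (Nat.zero_le 2)).op g) x) := by
  rw [← bar_ev hα g x]
  unfold bar
  rw [← T.integral_comp_comm (integrable_helm_smul_bounded hα x (ev g).continuous (norm_ev_le g))]
  simp only [map_smul]

/-- The integral that defines the filter of an `L²` function converges at every point, as the kernel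
is in `L²`. -/
theorem norm_integral_helm_smul_le {α : ℝ} (hα : 0 < α) (x : E3) (f : L2 V) :
    Integrable (fun y => helmholtzKernel α (x - y) • f y) volume ∧
    ‖∫ y, helmholtzKernel α (x - y) • f y‖
      ≤ (eLpNorm (fun y => helmholtzKernel α (x - y)) 2 volume).toReal * ‖f‖ := by
  have hH : MemLp (fun y => helmholtzKernel α (x - y)) 2 volume :=
    (memLp_helmholtzKernel hα).comp_measurePreserving
      (Measure.measurePreserving_sub_left volume x)
  have h1 : MemLp (fun y => helmholtzKernel α (x - y) • f y) 1 volume :=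
    MemLp.smul (𝕜 := ℝ) (Lp.memLp f) hH
  have h2 := memLp_one_iff_integrable.1 h1
  refine ⟨h2, (norm_integral_le_integral_norm _).trans ?_⟩
  rw [integral_norm_eq_lintegral_enorm h2.1, ← eLpNorm_one_eq_lintegral_enorm, Lp.norm_def,
    ← ENNReal.toReal_mul]
  refine ENNReal.toReal_mono (ENNReal.mul_ne_top hH.2.ne (Lp.memLp f).2.ne) ?_
  exact eLpNorm_smul_le_mul_eLpNorm (𝕜 := ℝ) (p := 2) (q := 2) (r := 1) (Lp.memLp f).1 hH.1

/-- Convolution with the Helmholtz kernel, as a continuous linear functional. -/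
def helmAt {α : ℝ} (hα : 0 < α) (x : E3) : L2 V →L[ℝ] V :=
  LinearMap.mkContinuous
    { toFun := fun f => ∫ y, helmholtzKernel α (x - y) • f y
      map_add' := fun f g => by
        rw [← integral_add (norm_integral_helm_smul_le hα x f).1
          (norm_integral_helm_smul_le hα x g).1]
        refine integral_congr_ae ?_
        filter_upwards [Lp.coeFn_add f g] with y hy
        rw [hy, Pi.add_apply, smul_add]
      map_smul' := fun c f => by
        rw [RingHom.id_apply, ← integral_smul]
        refine integral_congr_ae ?_
        filter_upwards [Lp.coeFn_smul c f] with y hy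
        rw [hy, Pi.smul_apply, smul_comm] }
    _ fun f => (norm_integral_helm_smul_le hα x f).2

/-- The filter of an arbitrary `L²` function, at every point.  Both sides are continuous in `f`, and
they agree on the dense range of `(1 + |ξ|)⁻²`, where the Fourier integrals converge. -/
theorem helmAt_fourierInv {α : ℝ} (hα : 0 < α) (x : E3) (f : L2 V) :
    helmAt hα x (𝓕⁻ f : L2 V) = ev ((helmMult hα 2 le_rfl).op f) x := by
  let A : L2 V → V := fun f => helmAt hα x (𝓕⁻ f : L2 V)
  let B : L2 V → V := fun f => evAt x ((helmMult hα 2 le_rfl).op f)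
  have hA : Continuous A :=
    (helmAt hα x).continuous.comp (Lp.fourierTransformₗᵢ E3 V).symm.continuous
  have hB : Continuous B := (evAt x).continuous.comp (Mult.op _).continuous
  refine congrFun (denseRange_wt_two.equalizer hA hB (funext fun g => ?_)) f
  change (∫ y, helmholtzKernel α (x - y) • (𝓕⁻ ((wt 2).op g) : L2 V) y)
    = ev ((helmMult hα 2 le_rfl).op ((wt 2).op g)) x
  have e1 : (helmMult hα 2 le_rfl).op ((wt 2).op g) = (helmMult hα 0 (Nat.zero_le 2)).op g := by
    refine Mult.op_op_of_sym _ _ _ (fun ξ v => ?_) g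
    simp only [helmMult_sym, wt_sym, smul_smul]
    congr 1
    field_simp [rho_ne_zero ξ]
  rw [e1, ← bar_ev]
  refine integral_congr_ae ?_
  filter_upwards [fourierInv_wt_two_ae g] with y hy
  rw [hy]

end

/-- The filtered datum, at every point, as an inverse Fourier transform. -/
theorem bar_L2 {ι : Type*} [Fintype ι] {α : ℝ} (hα : 0 < α) {u₀ : E3 → EuclideanSpace ℝ ι}
    (hu : MemLp u₀ 2 volume) (x : E3) :
    bar α u₀ x = reV (ev ((helmMult hα 2 le_rfl).op (fourierR hu.toLp)) x) := by
  rw [← helmAt_fourierInv]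
  change _ = reV (∫ y, helmholtzKernel α (x - y) •
    (𝓕⁻ (fourierR hu.toLp) : L2 (EuclideanSpace ℂ ι)) y)
  refine Eq.trans ?_ (reV.integral_comp_comm (norm_integral_helm_smul_le hα x
    (𝓕⁻ (fourierR hu.toLp) : L2 (EuclideanSpace ℂ ι))).1)
  refine integral_congr_ae ?_
  filter_upwards [fourierInv_fourierR hu.toLp, hu.coeFn_toLp] with y h1 h2
  rw [map_smul, h1, h2, reV_cplx]

/-! ### Convolution on the Fourier side -/

/-- Complex vectors. -/
abbrev C3 : Type := EuclideanSpace ℂ (Fin 3)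

/-- Complex tensors of order two. -/
abbrev C9 : Type := EuclideanSpace ℂ (Fin 3 × Fin 3)

/-- The convolution of nonnegative functions. -/
def lconv (F G : E3 → ℝ≥0∞) (x : E3) : ℝ≥0∞ := ∫⁻ t, F t * G (x - t)

theorem lconv_comm (F G : E3 → ℝ≥0∞) : lconv F G = lconv G F := by
  funext x
  unfold lconv
  rw [← lintegral_sub_left_eq_self _ x]
  simp [mul_comm]

theorem aemeasurable_lconv_integrand {F G : E3 → ℝ≥0∞} (hF : AEMeasurable F volume)
    (hG : AEMeasurable G volume) :
    AEMeasurable (fun p : E3 × E3 => F p.2 * G (p.1 - p.2)) (volume.prod volume) :=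
  (hF.comp_quasiMeasurePreserving Measure.quasiMeasurePreserving_snd).mul (hG.comp_quasiMeasurePreserving
    (quasiMeasurePreserving_sub_of_right_invariant volume volume))

theorem aemeasurable_lconv {F G : E3 → ℝ≥0∞} (hF : AEMeasurable F volume)
    (hG : AEMeasurable G volume) : AEMeasurable (lconv F G) volume :=
  (aemeasurable_lconv_integrand hF hG).lintegral_prod_right'

theorem lconv_sq_le {F G : E3 → ℝ≥0∞} (hF : AEMeasurable F volume) (hG : AEMeasurable G volume)
    (x : E3) : lconv F G x ^ (2 : ℝ) ≤ (∫⁻ t, F t) * lconv F (fun t => G t ^ (2 : ℝ)) x := by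
  have hG' : AEMeasurable (fun t => G (x - t)) volume :=
    hG.comp_quasiMeasurePreserving (Measure.measurePreserving_sub_left volume x).quasiMeasurePreserving
  have h := ENNReal.lintegral_mul_le_Lp_mul_Lq volume Real.HolderConjugate.two_two
    (hF.pow_const (1 / 2 : ℝ)) ((hF.pow_const (1 / 2 : ℝ)).mul hG')
  have e1 : lconv F G x = ∫⁻ t, ((fun t => F t ^ (1 / 2 : ℝ)) *
      ((fun t => F t ^ (1 / 2 : ℝ)) * fun t => G (x - t))) t := by
    refine lintegral_congr fun t => ?_
    simp only [Pi.mul_apply]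
    rw [← mul_assoc, ← ENNReal.rpow_add_of_nonneg _ _ (by norm_num) (by norm_num)]
    norm_num
  have e2 : ∀ t, (F t ^ (1 / 2 : ℝ)) ^ (2 : ℝ) = F t := fun t => by
    rw [← ENNReal.rpow_mul]; norm_num
  rw [e1]
  refine (ENNReal.rpow_le_rpow h (by norm_num : (0 : ℝ) ≤ 2)).trans (le_of_eq ?_)
  rw [ENNReal.mul_rpow_of_nonneg _ _ (by norm_num : (0 : ℝ) ≤ 2), ← ENNReal.rpow_mul,
    ← ENNReal.rpow_mul]
  norm_num only [one_div, inv_mul_cancel₀, ENNReal.rpow_one]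
  unfold lconv
  congr 1
  · refine lintegral_congr fun t => ?_
    simpa using e2 t
  · refine lintegral_congr fun t => ?_
    simp only [Pi.mul_apply]
    rw [ENNReal.mul_rpow_of_nonneg _ _ (by norm_num : (0 : ℝ) ≤ 2)]
    congr 1
    simpa using e2 t

/-- Young's inequality `‖F * G‖₂ ≤ ‖F‖₁ ‖G‖₂`. -/
theorem eLpNorm_lconv_le {F G : E3 → ℝ≥0∞} (hF : AEMeasurable F volume)
    (hG : AEMeasurable G volume) :
    eLpNorm (lconv F G) 2 volume ≤ eLpNorm F 1 volume * eLpNorm G 2 volume := by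
  rw [eLpNorm_one_eq_lintegral_enorm, eLpNorm_eq_lintegral_rpow_enorm_toReal (by norm_num)
    (by norm_num), eLpNorm_eq_lintegral_rpow_enorm_toReal (by norm_num) (by norm_num)]
  simp only [enorm_eq_self, ENNReal.toReal_ofNat]
  have h1 : ∫⁻ x, lconv F G x ^ (2 : ℝ) ≤ (∫⁻ t, F t) ^ (2 : ℝ) * ∫⁻ t, G t ^ (2 : ℝ) := by
    have hG2 : AEMeasurable (fun t => G t ^ (2 : ℝ)) volume := hG.pow_const _
    calc ∫⁻ x, lconv F G x ^ (2 : ℝ)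
        ≤ ∫⁻ x, (∫⁻ t, F t) * lconv F (fun t => G t ^ (2 : ℝ)) x :=
          lintegral_mono fun x => lconv_sq_le hF hG x
      _ = (∫⁻ t, F t) * ∫⁻ x, lconv F (fun t => G t ^ (2 : ℝ)) x :=
          lintegral_const_mul'' _ (aemeasurable_lconv hF hG2)
      _ = (∫⁻ t, F t) * ∫⁻ t, ∫⁻ x, F t * G (x - t) ^ (2 : ℝ) := by
          unfold lconv
          rw [lintegral_lintegral_swap (aemeasurable_lconv_integrand hF hG2)]
      _ = (∫⁻ t, F t) * ((∫⁻ t, F t) * ∫⁻ t, G t ^ (2 : ℝ)) := by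
          congr 1
          rw [← lintegral_mul_const'' _ hF]
          refine lintegral_congr fun t => ?_
          have hGt : AEMeasurable (fun x => G (x - t) ^ (2 : ℝ)) volume :=
            hG2.comp_quasiMeasurePreserving
              (measurePreserving_sub_right volume t).quasiMeasurePreserving
          rw [lintegral_const_mul'' _ hGt,
            lintegral_sub_right_eq_self (fun x => G x ^ (2 : ℝ)) t]
      _ = _ := by
          rw [← mul_assoc]
          congr 1
          rw [ENNReal.rpow_two, sq]
  refine (ENNReal.rpow_le_rpow h1 (by norm_num : (0 : ℝ) ≤ 1 / 2)).trans (le_of_eq ?_)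
  rw [ENNReal.mul_rpow_of_nonneg _ _ (by norm_num), ← ENNReal.rpow_mul]
  norm_num

/-- The tensor product of complex vectors. -/
def tens : C3 →L[ℂ] C3 →L[ℂ] C9 :=
  LinearMap.mkContinuous₂
    (LinearMap.mk₂ ℂ (fun a b => WithLp.toLp 2 fun p : Fin 3 × Fin 3 => a p.1 * b p.2)
      (fun a a' b => by ext p; simp [add_mul])
      (fun c a b => by ext p; simp [mul_assoc])
      (fun a b b' => by ext p; simp [mul_add])
      (fun c a b => by ext p; simp [mul_left_comm])) 1
    (fun a b => by
      rw [one_mul, LinearMap.mk₂_apply, EuclideanSpace.norm_eq, EuclideanSpace.norm_eq,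
        EuclideanSpace.norm_eq, ← Real.sqrt_mul (Finset.sum_nonneg fun _ _ => sq_nonneg _)]
      refine Real.sqrt_le_sqrt (le_of_eq ?_)
      rw [Finset.sum_mul_sum, ← Finset.univ_product_univ, Finset.sum_product]
      simp only [norm_mul, mul_pow])

@[simp] theorem tens_apply (a b : C3) (p : Fin 3 × Fin 3) : tens a b p = a p.1 * b p.2 := rfl

theorem norm_tens_le (a b : C3) : ‖tens a b‖ ≤ ‖a‖ * ‖b‖ := by
  have h : ‖tens a‖ ≤ 1 * ‖a‖ := (tens).le_of_opNorm_le (LinearMap.mkContinuous₂_norm_le _ zero_le_one _) a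
  rw [one_mul] at h
  exact (tens a).le_of_opNorm_le h b

/-- The tensor convolution of two vector fields. -/
def tconv (f g : E3 → C3) : E3 → C9 := convolution f g tens volume

theorem tconv_apply (f g : E3 → C3) (x : E3) : tconv f g x = ∫ t, tens (f t) (g (x - t)) := rfl

theorem enorm_tconv_le (f g : E3 → C3) (x : E3) :
    ‖tconv f g x‖ₑ ≤ lconv (fun t => ‖f t‖ₑ) (fun t => ‖g t‖ₑ) x := by
  rw [tconv_apply]
  refine (enorm_integral_le_lintegral_enorm _).trans (lintegral_mono fun t => ?_)
  change _ ≤ ‖f t‖ₑ * ‖g (x - t)‖ₑ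
  rw [← ofReal_norm, ← ofReal_norm, ← ofReal_norm, ← ENNReal.ofReal_mul (norm_nonneg _)]
  exact ENNReal.ofReal_le_ofReal (norm_tens_le _ _)

theorem rho_pow_le_add (k : ℕ) (x t : E3) :
    rho x ^ k ≤ 2 ^ k * (rho t ^ k + rho (x - t) ^ k) := by
  have h : rho x ≤ rho t + rho (x - t) := by
    unfold rho
    have := norm_add_le t (x - t)
    rw [add_sub_cancel] at this
    linarith
  have h1 := rho_pos t
  have h2 := rho_pos (x - t)
  have h3 := rho_pos x
  have h4 : rho x ≤ 2 * max (rho t) (rho (x - t)) := by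
    have := le_max_left (rho t) (rho (x - t))
    have := le_max_right (rho t) (rho (x - t))
    linarith
  refine (pow_le_pow_left₀ h3.le h4 k).trans ?_
  rw [mul_pow]
  refine mul_le_mul_of_nonneg_left ?_ (by positivity)
  rcases max_cases (rho t) (rho (x - t)) with h5 | h5 <;> rw [h5.1]
  · linarith [pow_nonneg h2.le k]
  · linarith [pow_nonneg h1.le k]

/-- `(1 + |ξ|)ᵏ f`. -/
def rhoPow {V : Type*} [NormedAddCommGroup V] [NormedSpace ℂ V] (k : ℕ) (f : E3 → V) : E3 → V :=
  fun ξ => (rho ξ : ℂ) ^ k • f ξ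

theorem enorm_rhoPow {V : Type*} [NormedAddCommGroup V] [NormedSpace ℂ V] (k : ℕ) (f : E3 → V)
    (ξ : E3) : ‖rhoPow k f ξ‖ₑ = ENNReal.ofReal (rho ξ ^ k) * ‖f ξ‖ₑ := by
  unfold rhoPow
  rw [enorm_smul]
  congr 1
  rw [← ofReal_norm, norm_pow, norm_rho]

theorem enorm_rhoPow_tconv_le (k : ℕ) {f g : E3 → C3} (hf : AEStronglyMeasurable f volume)
    (hg : AEStronglyMeasurable g volume) (x : E3) :
    ‖rhoPow k (tconv f g) x‖ₑ ≤ 2 ^ k *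
      (lconv (fun t => ‖rhoPow k f t‖ₑ) (fun t => ‖g t‖ₑ) x
        + lconv (fun t => ‖f t‖ₑ) (fun t => ‖rhoPow k g t‖ₑ) x) := by
  have hr : Measurable fun t : E3 => ENNReal.ofReal (rho t ^ k) :=
    (ENNReal.measurable_ofReal.comp (continuous_rho.pow k).measurable)
  have hsub : AEMeasurable (fun t => ‖g (x - t)‖ₑ) volume :=
    hg.enorm.comp_quasiMeasurePreserving
      (Measure.measurePreserving_sub_left volume x).quasiMeasurePreserving
  have hA : AEMeasurable (fun t => ENNReal.ofReal (rho t ^ k) * ‖f t‖ₑ * ‖g (x - t)‖ₑ) volume :=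
    (hr.aemeasurable.mul hf.enorm).mul hsub
  rw [enorm_rhoPow]
  refine (mul_le_mul_right (enorm_tconv_le f g x) _).trans ?_
  unfold lconv
  simp only [enorm_rhoPow]
  rw [← lintegral_add_left' hA, ← lintegral_const_mul' _ _ ENNReal.ofReal_ne_top,
    ← lintegral_const_mul' _ _ (by simp)]
  refine lintegral_mono fun t => ?_
  have h := ENNReal.ofReal_le_ofReal (rho_pow_le_add k x t)
  rw [ENNReal.ofReal_mul (by positivity), ENNReal.ofReal_add (pow_nonneg (rho_pos _).le _)
    (pow_nonneg (rho_pos _).le _), ENNReal.ofReal_pow (p := 2) (by norm_num),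
    ENNReal.ofReal_ofNat] at h
  calc _ ≤ 2 ^ k * (ENNReal.ofReal (rho t ^ k) + ENNReal.ofReal (rho (x - t) ^ k)) *
        (‖f t‖ₑ * ‖g (x - t)‖ₑ) := mul_le_mul_left h _
    _ = _ := by ring

theorem eLpNorm_enorm' {V : Type*} [NormedAddCommGroup V] (f : E3 → V) (p : ℝ≥0∞) :
    eLpNorm (fun t => ‖f t‖ₑ) p volume = eLpNorm f p volume :=
  eLpNorm_congr_enorm_ae (Eventually.of_forall fun t => by simp)

/-- The weighted Young inequality: the weight is subadditive, up to a constant, along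
`ξ = η + (ξ - η)`. -/
theorem eLpNorm_rhoPow_tconv_le (k : ℕ) {f g : E3 → C3} (hf : AEStronglyMeasurable f volume)
    (hg : AEStronglyMeasurable g volume) :
    eLpNorm (rhoPow k (tconv f g)) 2 volume ≤ 2 ^ k *
      (eLpNorm (rhoPow k f) 2 volume * eLpNorm g 1 volume
        + eLpNorm f 1 volume * eLpNorm (rhoPow k g) 2 volume) := by
  have hr : Continuous fun ξ : E3 => (rho ξ : ℂ) ^ k :=
    (Complex.continuous_ofReal.comp continuous_rho).pow k
  have hfk : AEStronglyMeasurable (rhoPow k f) volume := hr.aestronglyMeasurable.smul hf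
  have hgk : AEStronglyMeasurable (rhoPow k g) volume := hr.aestronglyMeasurable.smul hg
  have h1 : eLpNorm (rhoPow k (tconv f g)) 2 volume ≤ eLpNorm ((2 : ℝ≥0∞) ^ k •
      (lconv (fun t => ‖rhoPow k f t‖ₑ) (fun t => ‖g t‖ₑ)
        + lconv (fun t => ‖f t‖ₑ) (fun t => ‖rhoPow k g t‖ₑ))) 2 volume := by
    refine eLpNorm_mono_enorm fun x => ?_
    simpa using enorm_rhoPow_tconv_le k hf hg x
  have h3 := eLpNorm_lconv_le hf.enorm hgk.enorm
  have h4 := eLpNorm_lconv_le hg.enorm hfk.enorm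
  rw [lconv_comm] at h4
  simp only [eLpNorm_enorm'] at h3 h4
  have h5 := eLpNorm_add_le (p := 2) (μ := volume)
    (aemeasurable_lconv hfk.enorm hg.enorm).aestronglyMeasurable
    (aemeasurable_lconv hf.enorm hgk.enorm).aestronglyMeasurable (by norm_num)
  refine h1.trans ?_
  have h6 : ∀ (c : ℝ≥0∞) (F : E3 → ℝ≥0∞), c ≠ ⊤ → eLpNorm (c • F) 2 volume
      ≤ c * eLpNorm F 2 volume := by
    intro c F hc
    have := eLpNorm_le_nnreal_smul_eLpNorm_of_ae_le_mul' (f := c • F) (g := F) (c := c.toNNReal)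
      (μ := volume) (Eventually.of_forall fun x => by simp [ENNReal.coe_toNNReal hc]) 2
    simpa [ENNReal.smul_def, ENNReal.coe_toNNReal hc] using this
  refine (h6 _ _ (by simp)).trans ?_
  refine mul_le_mul_right (h5.trans (add_le_add ?_ h3)) _
  rw [mul_comm]
  exact h4

theorem eLpNorm_tconv_le {f g : E3 → C3} (hf : AEStronglyMeasurable f volume)
    (hg : AEStronglyMeasurable g volume) :
    eLpNorm (tconv f g) 2 volume ≤ eLpNorm f 1 volume * eLpNorm g 2 volume ∧
    eLpNorm (tconv f g) 2 volume ≤ eLpNorm f 2 volume * eLpNorm g 1 volume := by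
  have h0 : eLpNorm (tconv f g) 2 volume
      ≤ eLpNorm (lconv (fun t => ‖f t‖ₑ) (fun t => ‖g t‖ₑ)) 2 volume :=
    eLpNorm_mono_enorm fun x => by simpa using enorm_tconv_le f g x
  have h3 := eLpNorm_lconv_le hf.enorm hg.enorm
  have h4 := eLpNorm_lconv_le hg.enorm hf.enorm
  rw [lconv_comm] at h4
  simp only [eLpNorm_enorm'] at h3 h4
  exact ⟨h0.trans h3, h0.trans (h4.trans_eq (mul_comm _ _))⟩

theorem integrable_tens {f g : E3 → C3} (hf : MemLp f 2 volume) (hg : MemLp g 2 volume) (x : E3) :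
    Integrable (fun t => tens (f t) (g (x - t))) volume := by
  have hg' : MemLp (fun t => g (x - t)) 2 volume :=
    hg.comp_measurePreserving (Measure.measurePreserving_sub_left volume x)
  have h1 : Integrable (fun t => ‖f t‖ * ‖g (x - t)‖) volume := hf.norm.integrable_mul hg'.norm
  refine h1.mono' ?_ (Eventually.of_forall fun t => norm_tens_le _ _)
  exact tens.aestronglyMeasurable_comp₂ hf.1 hg'.1

theorem tconv_congr {f f' g g' : E3 → C3} (hf : f =ᵐ[volume] f') (hg : g =ᵐ[volume] g') :
    tconv f g = tconv f' g' := by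
  funext x
  rw [tconv_apply, tconv_apply]
  refine integral_congr_ae ?_
  have hg2 := (Measure.measurePreserving_sub_left (volume : Measure E3) x).quasiMeasurePreserving.ae hg
  filter_upwards [hf, hg2] with t h1 h2
  rw [h1, h2]

theorem tconv_add_left {f f' g : E3 → C3} (hf : MemLp f 2 volume) (hf' : MemLp f' 2 volume)
    (hg : MemLp g 2 volume) : tconv (f + f') g = tconv f g + tconv f' g := by
  funext x
  rw [Pi.add_apply, tconv_apply, tconv_apply, tconv_apply,
    ← integral_add (integrable_tens hf hg x) (integrable_tens hf' hg x)]
  simp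

theorem tconv_add_right {f g g' : E3 → C3} (hf : MemLp f 2 volume) (hg : MemLp g 2 volume)
    (hg' : MemLp g' 2 volume) : tconv f (g + g') = tconv f g + tconv f g' := by
  funext x
  rw [Pi.add_apply, tconv_apply, tconv_apply, tconv_apply,
    ← integral_add (integrable_tens hf hg x) (integrable_tens hf hg' x)]
  simp

theorem tconv_smul_left (c : ℝ) (f g : E3 → C3) : tconv (c • f) g = c • tconv f g := by
  funext x
  rw [Pi.smul_apply, tconv_apply, tconv_apply, ← integral_smul]
  refine integral_congr_ae (Eventually.of_forall fun t => ?_)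
  ext p
  simp

theorem tconv_smul_right (c : ℝ) (f g : E3 → C3) : tconv f (c • g) = c • tconv f g := by
  funext x
  rw [Pi.smul_apply, tconv_apply, tconv_apply, ← integral_smul]
  refine integral_congr_ae (Eventually.of_forall fun t => ?_)
  ext p
  simp

theorem rhoPow_wt {V : Type*} [NormedAddCommGroup V] [InnerProductSpace ℂ V] [CompleteSpace V]
    (n : ℕ) (f : L2 V) : rhoPow n ((wt n).op f) =ᵐ[volume] f := by
  filter_upwards [(wt n : Mult V V).op_coe f] with ξ h
  simp only [rhoPow, h, wt_sym, smul_smul]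
  rw [mul_inv_cancel₀ (pow_ne_zero n (rho_ne_zero ξ)), one_smul]

theorem eLpNorm_L2 {V : Type*} [NormedAddCommGroup V] (f : L2 V) :
    eLpNorm f 2 volume = ENNReal.ofReal ‖f‖ := by
  rw [Lp.norm_def, ENNReal.ofReal_toReal (Lp.memLp f).2.ne]

/-- The function whose class is `K n a b`. -/
def convFun (n : ℕ) (a b : L2 C3) : E3 → C9 :=
  rhoPow (n + 2) (tconv ((wt (n + 2)).op a) ((wt (n + 2)).op b))

theorem integrable_wt_add_two (n : ℕ) (a : L2 C3) : Integrable ((wt (n + 2)).op a) volume := by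
  rw [add_comm, ← wt_wt]
  exact integrable_wt_two _

theorem aestronglyMeasurable_convFun (n : ℕ) (a b : L2 C3) :
    AEStronglyMeasurable (convFun n a b) volume := by
  have hr : Continuous fun ξ : E3 => (rho ξ : ℂ) ^ (n + 2) :=
    (Complex.continuous_ofReal.comp continuous_rho).pow _
  exact hr.aestronglyMeasurable.smul ((integrable_wt_add_two n a).integrable_convolution tens
    (integrable_wt_add_two n b)).1

theorem eLpNorm_one_wt_le (n : ℕ) (a : L2 C3) :
    eLpNorm ((wt (n + 2)).op a) 1 volume ≤ ENNReal.ofReal (embC * ‖a‖) := by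
  rw [add_comm, ← wt_wt]
  refine (eLpNorm_wt_two_le _).trans (ENNReal.ofReal_le_ofReal ?_)
  exact mul_le_mul_of_nonneg_left (norm_wt_le n a) embC_nonneg

theorem eLpNorm_convFun_le (n : ℕ) (a b : L2 C3) :
    eLpNorm (convFun n a b) 2 volume
      ≤ ENNReal.ofReal (2 ^ (n + 3) * embC * ‖a‖ * ‖b‖) := by
  refine (eLpNorm_rhoPow_tconv_le (n + 2) (Lp.aestronglyMeasurable _)
    (Lp.aestronglyMeasurable _)).trans ?_
  rw [eLpNorm_congr_ae (rhoPow_wt (n + 2) a), eLpNorm_congr_ae (rhoPow_wt (n + 2) b),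
    eLpNorm_L2, eLpNorm_L2]
  have h0 := embC_nonneg
  have h2 : (2 : ℝ≥0∞) ^ (n + 2) = ENNReal.ofReal (2 ^ (n + 2)) := by
    rw [ENNReal.ofReal_pow (by norm_num), ENNReal.ofReal_ofNat]
  calc _ ≤ 2 ^ (n + 2) * (ENNReal.ofReal ‖a‖ * ENNReal.ofReal (embC * ‖b‖)
        + ENNReal.ofReal (embC * ‖a‖) * ENNReal.ofReal ‖b‖) := by
          gcongr
          · exact eLpNorm_one_wt_le n b
          · exact eLpNorm_one_wt_le n a
    _ = _ := by
          rw [h2, ← ENNReal.ofReal_mul (by positivity), ← ENNReal.ofReal_mul (by positivity),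
            ← ENNReal.ofReal_add (by positivity) (by positivity),
            ← ENNReal.ofReal_mul (by positivity)]
          congr 1
          ring

theorem memLp_convFun (n : ℕ) (a b : L2 C3) : MemLp (convFun n a b) 2 volume :=
  ⟨aestronglyMeasurable_convFun n a b, (eLpNorm_convFun_le n a b).trans_lt ENNReal.ofReal_lt_top⟩

theorem convFun_add_left (n : ℕ) (a a' b : L2 C3) :
    convFun n (a + a') b = convFun n a b + convFun n a' b := by
  unfold convFun
  rw [map_add, tconv_congr (Lp.coeFn_add _ _) (EventuallyEq.refl _ _),
    tconv_add_left (Lp.memLp _) (Lp.memLp _) (Lp.memLp _)]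
  funext ξ
  simp [rhoPow]

theorem convFun_add_right (n : ℕ) (a b b' : L2 C3) :
    convFun n a (b + b') = convFun n a b + convFun n a b' := by
  unfold convFun
  rw [map_add, tconv_congr (EventuallyEq.refl _ _) (Lp.coeFn_add _ _),
    tconv_add_right (Lp.memLp _) (Lp.memLp _) (Lp.memLp _)]
  funext ξ
  simp [rhoPow]

theorem convFun_smul_left (n : ℕ) (c : ℝ) (a b : L2 C3) :
    convFun n (c • a) b = c • convFun n a b := by
  unfold convFun
  rw [map_smul, tconv_congr (Lp.coeFn_smul _ _) (EventuallyEq.refl _ _), tconv_smul_left]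
  funext ξ
  simp only [rhoPow, Pi.smul_apply]
  rw [smul_comm]

theorem convFun_smul_right (n : ℕ) (c : ℝ) (a b : L2 C3) :
    convFun n a (c • b) = c • convFun n a b := by
  unfold convFun
  rw [map_smul, tconv_congr (EventuallyEq.refl _ _) (Lp.coeFn_smul _ _), tconv_smul_right]
  funext ξ
  simp only [rhoPow, Pi.smul_apply]
  rw [smul_comm]

/-- The bilinear map `(a, b) ↦ ρ^(n+2) ((ρ^-(n+2) a) ⋆ (ρ^-(n+2) b))`, with `ρ = 1 + |ξ|`: the
tensor product of two vector fields, for the Fourier coordinates of `H^(n+2)`. -/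
def K (n : ℕ) : L2 C3 →L[ℝ] L2 C3 →L[ℝ] L2 C9 :=
  LinearMap.mkContinuous₂
    (LinearMap.mk₂ ℝ (fun a b => (memLp_convFun n a b).toLp)
      (fun a a' b => by
        rw [← MemLp.toLp_add]
        exact MemLp.toLp_congr _ _ (by rw [convFun_add_left]))
      (fun c a b => by
        rw [← MemLp.toLp_const_smul]
        exact MemLp.toLp_congr _ _ (by rw [convFun_smul_left]))
      (fun a b b' => by
        rw [← MemLp.toLp_add]
        exact MemLp.toLp_congr _ _ (by rw [convFun_add_right]))
      (fun c a b => by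
        rw [← MemLp.toLp_const_smul]
        exact MemLp.toLp_congr _ _ (by rw [convFun_smul_right])))
    (2 ^ (n + 3) * embC)
    (fun a b => by
      have h0 := embC_nonneg
      rw [LinearMap.mk₂_apply, Lp.norm_toLp]
      exact ENNReal.toReal_le_of_le_ofReal (by positivity) (eLpNorm_convFun_le n a b))

theorem K_coe (n : ℕ) (a b : L2 C3) : K n a b =ᵐ[volume] convFun n a b :=
  (memLp_convFun n a b).coeFn_toLp

theorem norm_K_le (n : ℕ) (a b : L2 C3) : ‖K n a b‖ ≤ 2 ^ (n + 3) * embC * ‖a‖ * ‖b‖ := by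
  have h0 := embC_nonneg
  exact ContinuousLinearMap.le_of_opNorm₂_le_of_le (K n)
    (LinearMap.mkContinuous₂_norm_le _ (by positivity) _) le_rfl le_rfl

attribute [irreducible] K

theorem wt_K (n : ℕ) (a b : L2 C3) : (wt n).op (K n a b) = K 0 ((wt n).op a) ((wt n).op b) := by
  refine Lp.ext ?_
  filter_upwards [(wt n : Mult C9 C9).op_congr (K_coe n a b),
    K_coe 0 ((wt n).op a) ((wt n).op b)] with ξ h1 h2
  rw [h1, h2]
  simp only [convFun, rhoPow, wt_sym, smul_smul, zero_add, wt_wt]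
  rw [add_comm n 2, pow_add, mul_comm ((rho ξ : ℂ) ^ 2),
    inv_mul_cancel_left₀ (pow_ne_zero n (rho_ne_zero ξ))]

theorem wt_two_K (a b : L2 C3) :
    (wt 2).op (K 0 a b) =ᵐ[volume] tconv ((wt 2).op a) ((wt 2).op b) := by
  filter_upwards [(wt 2 : Mult C9 C9).op_congr (K_coe 0 a b)] with ξ h1
  rw [h1]
  simp only [convFun, rhoPow, wt_sym, smul_smul, zero_add]
  rw [inv_mul_cancel₀ (pow_ne_zero 2 (rho_ne_zero ξ)), one_smul]

theorem wt_one_K (a b : L2 C3) :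
    (wt 1).op (K 0 a b) =ᵐ[volume] rhoPow 1 (tconv ((wt 2).op a) ((wt 2).op b)) := by
  filter_upwards [(wt 1 : Mult C9 C9).op_congr (K_coe 0 a b)] with ξ h1
  rw [h1]
  simp only [convFun, rhoPow, wt_sym, smul_smul, zero_add]
  congr 1
  field_simp [rho_ne_zero ξ]

theorem norm_le_of_eLpNorm {V : Type*} [NormedAddCommGroup V] {f : L2 V} {g : E3 → V} {C : ℝ}
    (hC : 0 ≤ C) (h : f =ᵐ[volume] g) (hg : eLpNorm g 2 volume ≤ ENNReal.ofReal C) : ‖f‖ ≤ C := by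
  rw [Lp.norm_def, eLpNorm_congr_ae h]
  exact ENNReal.toReal_le_of_le_ofReal hC hg

theorem norm_wt_two_K_le (a b : L2 C3) :
    ‖(wt 2).op (K 0 a b)‖ ≤ embC * ‖a‖ * ‖(wt 2).op b‖ := by
  have h0 := embC_nonneg
  refine norm_le_of_eLpNorm (by positivity) (wt_two_K a b) ?_
  refine (eLpNorm_tconv_le (Lp.aestronglyMeasurable _) (Lp.aestronglyMeasurable _)).1.trans ?_
  rw [eLpNorm_L2, ENNReal.ofReal_mul (by positivity)]
  gcongr
  exact eLpNorm_wt_two_le a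

theorem norm_wt_two_K_le' (a b : L2 C3) :
    ‖(wt 2).op (K 0 a b)‖ ≤ embC * ‖(wt 2).op a‖ * ‖b‖ := by
  have h0 := embC_nonneg
  refine norm_le_of_eLpNorm (by positivity) (wt_two_K a b) ?_
  refine (eLpNorm_tconv_le (Lp.aestronglyMeasurable _) (Lp.aestronglyMeasurable _)).2.trans ?_
  rw [eLpNorm_L2, mul_comm embC, mul_assoc, ENNReal.ofReal_mul (by positivity)]
  gcongr
  exact eLpNorm_wt_two_le b

/-- The tame estimate: the product `u ⊗ u` is controlled in `H¹` by `‖u‖_{H¹}` times the `L¹` norm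
of the Fourier transform of `u`, hence linearly in the `H²` norm once `‖u‖_{H¹}` is bounded. -/
theorem norm_wt_one_K_le (a : L2 C3) :
    ‖(wt 1).op (K 0 a a)‖ ≤ 4 * embC * ‖(wt 1).op a‖ * ‖a‖ := by
  have h0 := embC_nonneg
  refine norm_le_of_eLpNorm (by positivity) (wt_one_K a a) ?_
  refine (eLpNorm_rhoPow_tconv_le 1 (Lp.aestronglyMeasurable _) (Lp.aestronglyMeasurable _)).trans ?_
  have h1 : rhoPow 1 ((wt 2).op a : E3 → C3) =ᵐ[volume] (wt 1).op a := by
    have := rhoPow_wt 1 ((wt 1).op a)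
    rwa [wt_wt] at this
  rw [eLpNorm_congr_ae h1, eLpNorm_L2]
  have h2 := eLpNorm_wt_two_le a
  calc _ ≤ (2 : ℝ≥0∞) ^ 1 * (ENNReal.ofReal ‖(wt 1).op a‖ * ENNReal.ofReal (embC * ‖a‖)
        + ENNReal.ofReal (embC * ‖a‖) * ENNReal.ofReal ‖(wt 1).op a‖) := by gcongr
    _ = _ := by
      have h3 : (2 : ℝ≥0∞) ^ 1 = ENNReal.ofReal 2 := by simp
      rw [h3, ← ENNReal.ofReal_mul (by positivity), ← ENNReal.ofReal_mul (by positivity),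
        ← ENNReal.ofReal_add (by positivity) (by positivity), ← ENNReal.ofReal_mul (by positivity)]
      congr 1
      ring

/-- Convolution on the Fourier side is the pointwise product. -/
theorem ev_K (a b : L2 C3) (x : E3) : ev (K 0 a b) x = tens (ev a x) (ev b x) := by
  rw [ev_eq_of_ae _ (wt_two_K a b), ev_apply, ev_apply, Real.fourierInv_eq_fourier_neg,
    Real.fourierInv_eq_fourier_neg, Real.fourierInv_eq_fourier_neg]
  exact Real.fourier_bilin_convolution_eq tens (integrable_wt_two a) (integrable_wt_two b) (-x)

theorem conjV_tens (a b : C3) : conjV (tens a b) = tens (conjV a) (conjV b) := by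
  ext p; simp

theorem herm_K (a b : L2 C3) : herm (K 0 a b) = K 0 (herm a) (herm b) := by
  refine ev_injective (Eventually.of_forall fun x => ?_)
  rw [← conjV_ev, ev_K, ev_K, conjV_tens, conjV_ev, conjV_ev]

/-! ### The multipliers of the Bardina model -/

/-- Complex scalars, as vectors with one coordinate. -/
abbrev C1 : Type := EuclideanSpace ℂ (Fin 1)

section Mat

variable {ι κ : Type*} [Fintype ι] [Fintype κ] [DecidableEq κ]

/-- The elementary matrix with entry `1` in position `(k, i)`. -/
def elemMat (k : κ) (i : ι) : EuclideanSpace ℂ ι →L[ℂ] EuclideanSpace ℂ κ :=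
  (EuclideanSpace.proj i : EuclideanSpace ℂ ι →L[ℂ] ℂ).smulRight (EuclideanSpace.single k 1)

/-- The multiplier with given matrix entries. -/
def Mult.mat (m : κ → ι → E3 → ℂ) (hm : ∀ k i, Measurable (m k i))
    (hb : ∀ k i, ∃ C, ∀ ξ, ‖m k i ξ‖ ≤ C) :
    Mult (EuclideanSpace ℂ ι) (EuclideanSpace ℂ κ) where
  sym ξ := ∑ k, ∑ i, m k i ξ • elemMat k i
  meas := Finset.stronglyMeasurable_fun_sum _ fun k _ => Finset.stronglyMeasurable_fun_sum _
    fun i _ => (hm k i).stronglyMeasurable.smul_const _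
  bdd := by
    choose C hC using hb
    refine ⟨∑ k, ∑ i, C k i * ‖(elemMat k i : EuclideanSpace ℂ ι →L[ℂ] EuclideanSpace ℂ κ)‖,
      fun ξ => ?_⟩
    refine (norm_sum_le _ _).trans (Finset.sum_le_sum fun k _ => ?_)
    refine (norm_sum_le _ _).trans (Finset.sum_le_sum fun i _ => ?_)
    rw [norm_smul]
    exact mul_le_mul_of_nonneg_right (hC k i ξ) (norm_nonneg _)

theorem Mult.mat_sym (m : κ → ι → E3 → ℂ) (hm : ∀ k i, Measurable (m k i))
    (hb : ∀ k i, ∃ C, ∀ ξ, ‖m k i ξ‖ ≤ C) (ξ : E3) (v : EuclideanSpace ℂ ι) (k : κ) :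
    (Mult.mat m hm hb).sym ξ v k = ∑ i, m k i ξ * v i := by
  simp only [Mult.mat, elemMat, sum_apply, smul_apply,
    ContinuousLinearMap.smulRight_apply, EuclideanSpace.coe_proj, WithLp.ofLp_sum,
    Finset.sum_apply, PiLp.smul_apply, PiLp.single_apply, smul_eq_mul]
  rw [Finset.sum_eq_single k]
  · simp
  · intro k' _ hk
    simp [hk.symm]
  · simp

theorem herm_mat (m : κ → ι → E3 → ℂ) (hm : ∀ k i, Measurable (m k i))
    (hb : ∀ k i, ∃ C, ∀ ξ, ‖m k i ξ‖ ≤ C) (h : ∀ k i ξ, (starRingEnd ℂ) (m k i (-ξ)) = m k i ξ)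
    (f : L2 (EuclideanSpace ℂ ι)) :
    herm ((Mult.mat m hm hb).op f) = (Mult.mat m hm hb).op (herm f) := by
  refine herm_op _ (fun ξ v => ?_) f
  ext k
  rw [conjV_apply, Mult.mat_sym, Mult.mat_sym, map_sum]
  refine Finset.sum_congr rfl fun i _ => ?_
  rw [map_mul, h, conjV_apply]

end Mat

/-- The entries of the Leray projection, with symbol `I - ξ ⊗ ξ / |ξ|²` (the identity at `0`). -/
def lerayEntry (i l : Fin 3) (ξ : E3) : ℝ := (if i = l then 1 else 0) - ξ i * ξ l / ‖ξ‖ ^ 2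

theorem measurable_coord (i : Fin 3) : Measurable fun ξ : E3 => ξ i :=
  Continuous.measurable (by fun_prop)

theorem measurable_lerayEntry (i l : Fin 3) : Measurable (lerayEntry i l) :=
  measurable_const.sub (((measurable_coord i).mul (measurable_coord l)).div
    (measurable_norm.pow_const 2))

theorem abs_riesz_le (i l : Fin 3) (ξ : E3) : |ξ i * ξ l / ‖ξ‖ ^ 2| ≤ 1 := by
  rw [abs_div, abs_mul, abs_of_nonneg (sq_nonneg ‖ξ‖)]
  refine div_le_one_of_le₀ ?_ (sq_nonneg _)
  rw [sq]
  exact mul_le_mul (abs_coord_le ξ i) (abs_coord_le ξ l) (abs_nonneg _) (norm_nonneg _)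

theorem abs_lerayEntry_le (i l : Fin 3) (ξ : E3) : |lerayEntry i l ξ| ≤ 2 := by
  unfold lerayEntry
  refine (abs_sub _ _).trans ?_
  have h1 : |(if i = l then (1 : ℝ) else 0)| ≤ 1 := by split_ifs <;> simp
  linarith [abs_riesz_le i l ξ]

theorem lerayEntry_neg (i l : Fin 3) (ξ : E3) : lerayEntry i l (-ξ) = lerayEntry i l ξ := by
  simp [lerayEntry]

/-- The Leray projection on divergence-free fields. -/
def leray : Mult C3 C3 :=
  Mult.mat (fun i l ξ => (lerayEntry i l ξ : ℂ))
    (fun i l => Complex.measurable_ofReal.comp (measurable_lerayEntry i l))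
    (fun i l => ⟨2, fun ξ => by
      rw [Complex.norm_real, Real.norm_eq_abs]; exact abs_lerayEntry_le i l ξ⟩)

theorem leray_sym (ξ : E3) (v : C3) (i : Fin 3) :
    leray.sym ξ v i = ∑ l, (lerayEntry i l ξ : ℂ) * v l := Mult.mat_sym _ _ _ ξ v i

theorem norm_sq_eq (ξ : E3) : ‖ξ‖ ^ 2 = ξ 0 ^ 2 + ξ 1 ^ 2 + ξ 2 ^ 2 := by
  rw [EuclideanSpace.norm_sq_eq, Fin.sum_univ_three]
  simp

/-- The divergence of the vector `v` at the frequency `ξ`, without the factor `2πi`. -/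
def fdiv (ξ : E3) (v : C3) : ℂ := ∑ l, (ξ l : ℂ) * v l

theorem leray_sym_eq (ξ : E3) (v : C3) (i : Fin 3) :
    leray.sym ξ v i = v i - (ξ i : ℂ) / ((‖ξ‖ ^ 2 : ℝ) : ℂ) * fdiv ξ v := by
  rw [leray_sym, fdiv, Finset.mul_sum]
  have : ∀ l, (lerayEntry i l ξ : ℂ) * v l = (if i = l then v l else 0)
      - (ξ i : ℂ) / ((‖ξ‖ ^ 2 : ℝ) : ℂ) * ((ξ l : ℂ) * v l) := by
    intro l
    unfold lerayEntry
    push_cast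
    split_ifs <;> simp <;> ring
  simp only [this, Finset.sum_sub_distrib, Finset.sum_ite_eq, Finset.mem_univ, if_true]

theorem fdiv_leray (ξ : E3) (v : C3) : fdiv ξ (leray.sym ξ v) = 0 := by
  rcases eq_or_ne ξ 0 with rfl | h
  · simp [fdiv]
  have h1 : ((‖ξ‖ ^ 2 : ℝ) : ℂ) ≠ 0 := by
    exact_mod_cast pow_ne_zero 2 (norm_ne_zero_iff.2 h)
  have h2 : ((‖ξ‖ ^ 2 : ℝ) : ℂ) = ∑ l, (ξ l : ℂ) * (ξ l : ℂ) := by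
    rw [norm_sq_eq, Fin.sum_univ_three]
    push_cast
    ring
  have h3 : fdiv ξ (leray.sym ξ v)
      = fdiv ξ v - (∑ l, (ξ l : ℂ) * (ξ l : ℂ)) / ((‖ξ‖ ^ 2 : ℝ) : ℂ) * fdiv ξ v := by
    conv_lhs => rw [fdiv]
    simp only [leray_sym_eq, mul_sub, Finset.sum_sub_distrib]
    congr 1
    rw [Finset.sum_div, Finset.sum_mul]
    refine Finset.sum_congr rfl fun l _ => ?_
    ring
  rw [h3, ← h2, div_self h1, one_mul, sub_self]

theorem leray_of_fdiv {ξ : E3} {v : C3} (h : fdiv ξ v = 0) : leray.sym ξ v = v := by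
  ext i
  rw [leray_sym_eq, h, mul_zero, sub_zero]

theorem leray_op_eq_self {f : L2 C3} (h : ∀ᵐ ξ ∂volume, fdiv ξ (f ξ) = 0) : leray.op f = f := by
  refine Lp.ext ?_
  filter_upwards [leray.op_coe f, h] with ξ h1 h2
  rw [h1, leray_of_fdiv h2]

theorem fdiv_of_leray {f : L2 C3} (h : leray.op f = f) : ∀ᵐ ξ ∂volume, fdiv ξ (f ξ) = 0 := by
  filter_upwards [leray.op_coe f] with ξ h1
  rw [h] at h1
  rw [h1, fdiv_leray]

section Filtered

variable {α : ℝ} (hα : 0 < α)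
include hα

theorem norm_helm_rho_le {k : ℕ} (hk : k ≤ 2) (ξ : E3) :
    ‖(helm α ξ : ℂ) * (rho ξ : ℂ) ^ k‖ ≤ 2 * (1 + 1 / α ^ 2) := by
  rw [norm_mul, norm_pow, norm_rho, Complex.norm_real, Real.norm_eq_abs]
  calc |helm α ξ| * rho ξ ^ k ≤ |helm α ξ| * (2 + 2 * lap ξ) :=
        mul_le_mul_of_nonneg_left (rho_pow_le hk ξ) (abs_nonneg _)
    _ = 2 * (|helm α ξ| * (1 + lap ξ)) := by ring
    _ ≤ _ := by linarith [helm_decay hα ξ]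

theorem norm_helm_dsym_le {k : ℕ} (hk : k ≤ 1) (j : Fin 3) (ξ : E3) :
    ‖(helm α ξ : ℂ) * (rho ξ : ℂ) ^ k * dsym j ξ‖ ≤ 2 * Real.pi * (2 * (1 + 1 / α ^ 2)) := by
  have h := norm_helm_rho_le hα (Nat.succ_le_succ hk) ξ
  simp only [norm_mul, norm_pow, norm_rho] at h ⊢
  have h2 := norm_dsym_le j ξ
  calc ‖(helm α ξ : ℂ)‖ * rho ξ ^ k * ‖dsym j ξ‖
      ≤ ‖(helm α ξ : ℂ)‖ * rho ξ ^ k * (2 * Real.pi * rho ξ) :=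
        mul_le_mul_of_nonneg_left h2 (mul_nonneg (norm_nonneg _) (pow_nonneg (rho_pos ξ).le _))
    _ = 2 * Real.pi * (‖(helm α ξ : ℂ)‖ * rho ξ ^ (k + 1)) := by ring
    _ ≤ _ := mul_le_mul_of_nonneg_left h (by positivity)

omit hα in
theorem measurable_helm_rho (k : ℕ) :
    Measurable fun ξ => (helm α ξ : ℂ) * (rho ξ : ℂ) ^ k :=
  (Complex.measurable_ofReal.comp (measurable_helm α)).mul
    ((Complex.measurable_ofReal.comp continuous_rho.measurable).pow_const k)

/-- The multiplier `(1 + |ξ|)ᵏ P (div (bar G))`, with the Leray projection `P`. -/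
def nonlin (k : ℕ) (hk : k ≤ 1) : Mult C9 C3 :=
  Mult.mat (fun i p ξ => (lerayEntry i p.2 ξ : ℂ) * ((helm α ξ : ℂ) * (rho ξ : ℂ) ^ k * dsym p.1 ξ))
    (fun i p => (Complex.measurable_ofReal.comp (measurable_lerayEntry i p.2)).mul
      ((measurable_helm_rho k).mul (continuous_dsym p.1).measurable))
    (fun i p => ⟨2 * (2 * Real.pi * (2 * (1 + 1 / α ^ 2))), fun ξ => by
      rw [norm_mul, Complex.norm_real, Real.norm_eq_abs]
      exact mul_le_mul (abs_lerayEntry_le i p.2 ξ) (norm_helm_dsym_le hα hk p.1 ξ) (norm_nonneg _)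
        (by norm_num)⟩)

/-- The multiplier `div (bar G)`. -/
def divHelm : Mult C9 C3 :=
  Mult.mat (fun i p ξ => (if i = p.2 then (helm α ξ : ℂ) * (rho ξ : ℂ) ^ 0 * dsym p.1 ξ else 0))
    (fun i p => by
      split_ifs
      · exact (measurable_helm_rho 0).mul (continuous_dsym p.1).measurable
      · exact measurable_const)
    (fun i p => ⟨2 * Real.pi * (2 * (1 + 1 / α ^ 2)), fun ξ => by
      split_ifs
      · exact norm_helm_dsym_le hα (Nat.zero_le 1) p.1 ξ
      · rw [norm_zero]; positivity⟩)

/-- The multiplier giving the pressure, `-∑ ξⱼ ξₗ / |ξ|² bar Gⱼₗ`, with the weight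
`(1 + |ξ|)ᵏ`. -/
def pressure (k : ℕ) (hk : k ≤ 2) : Mult C9 C1 :=
  Mult.mat (fun _ p ξ => ((-(ξ p.1 * ξ p.2 / ‖ξ‖ ^ 2) : ℝ) : ℂ)
      * ((helm α ξ : ℂ) * (rho ξ : ℂ) ^ k))
    (fun _ p => by
      have h : Measurable fun ξ : E3 => -(ξ p.1 * ξ p.2 / ‖ξ‖ ^ 2) :=
        (((measurable_coord p.1).mul (measurable_coord p.2)).div
          (measurable_norm.pow_const 2)).neg
      exact (Complex.measurable_ofReal.comp h).mul (measurable_helm_rho k))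
    (fun _ p => ⟨1 * (2 * (1 + 1 / α ^ 2)), fun ξ => by
      rw [norm_mul, Complex.norm_real, Real.norm_eq_abs, abs_neg]
      exact mul_le_mul (abs_riesz_le p.1 p.2 ξ) (norm_helm_rho_le hα hk ξ) (norm_nonneg _)
        (by norm_num)⟩)

theorem nonlin_sym (k : ℕ) (hk : k ≤ 1) (ξ : E3) (G : C9) (i : Fin 3) :
    (nonlin hα k hk).sym ξ G i = (helm α ξ : ℂ) * (rho ξ : ℂ) ^ k *
      ∑ j, ∑ l, (lerayEntry i l ξ : ℂ) * (dsym j ξ * G (j, l)) := by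
  rw [nonlin, Mult.mat_sym, Fintype.sum_prod_type, Finset.mul_sum]
  refine Finset.sum_congr rfl fun j _ => ?_
  rw [Finset.mul_sum]
  refine Finset.sum_congr rfl fun l _ => ?_
  ring

theorem divHelm_sym (ξ : E3) (G : C9) (i : Fin 3) :
    (divHelm hα).sym ξ G i = (helm α ξ : ℂ) * ∑ j, dsym j ξ * G (j, i) := by
  rw [divHelm, Mult.mat_sym, Fintype.sum_prod_type, Finset.mul_sum]
  refine Finset.sum_congr rfl fun j _ => ?_
  rw [Finset.sum_eq_single i]
  · simp [mul_assoc]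
  · intro l _ hl
    simp [hl.symm]
  · simp

theorem pressure_sym (k : ℕ) (hk : k ≤ 2) (ξ : E3) (G : C9) (i : Fin 1) :
    (pressure hα k hk).sym ξ G i = -((helm α ξ : ℂ) * (rho ξ : ℂ) ^ k *
      (∑ j, ∑ l, (ξ j : ℂ) * (ξ l : ℂ) * G (j, l)) / ((‖ξ‖ ^ 2 : ℝ) : ℂ)) := by
  rw [pressure, Mult.mat_sym, Fintype.sum_prod_type, Finset.mul_sum, Finset.sum_div,
    ← Finset.sum_neg_distrib]
  refine Finset.sum_congr rfl fun j _ => ?_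
  rw [Finset.mul_sum, Finset.sum_div, ← Finset.sum_neg_distrib]
  refine Finset.sum_congr rfl fun l _ => ?_
  push_cast
  ring

theorem wt_nonlin (k : ℕ) (hk : k ≤ 1) (f : L2 C9) :
    (wt k).op ((nonlin hα k hk).op f) = (nonlin hα 0 (Nat.zero_le 1)).op f := by
  refine Mult.op_op_of_sym _ _ _ (fun ξ v => ?_) f
  ext i
  rw [wt_sym, PiLp.smul_apply, nonlin_sym, nonlin_sym, smul_eq_mul]
  field_simp [rho_ne_zero ξ]

theorem wt_pressure (k : ℕ) (hk : k ≤ 2) (f : L2 C9) :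
    (wt k).op ((pressure hα k hk).op f) = (pressure hα 0 (Nat.zero_le 2)).op f := by
  refine Mult.op_op_of_sym _ _ _ (fun ξ v => ?_) f
  ext i
  rw [wt_sym, PiLp.smul_apply, pressure_sym, pressure_sym, smul_eq_mul]
  field_simp [rho_ne_zero ξ]

omit hα in
/-- Multipliers with scalar weights commute with the other multipliers. -/
theorem Mult.op_wt {V W : Type*} [NormedAddCommGroup V] [InnerProductSpace ℂ V] [CompleteSpace V]
    [NormedAddCommGroup W] [InnerProductSpace ℂ W] [CompleteSpace W] (M : Mult V W) (n : ℕ)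
    (f : L2 V) : M.op ((wt n).op f) = (wt n).op (M.op f) :=
  Mult.op_op_eq_of_sym _ _ _ _ (fun ξ v => by rw [wt_sym, wt_sym, map_smul]) f

omit hα in
theorem Mult.op_heat {V W : Type*} [NormedAddCommGroup V] [InnerProductSpace ℂ V] [CompleteSpace V]
    [NormedAddCommGroup W] [InnerProductSpace ℂ W] [CompleteSpace W] (M : Mult V W) {ν : ℝ}
    (hν : 0 < ν) (t : ℝ)
    (f : L2 V) : M.op ((heat hν t).op f) = (heat hν t).op (M.op f) :=
  Mult.op_op_eq_of_sym _ _ _ _ (fun ξ v => by rw [heat_sym, heat_sym, map_smul]) f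

omit hα in
theorem leray_sym_lerayEntry (ξ : E3) (v : C3) :
    leray.sym ξ v = leray.sym ξ (leray.sym ξ v) := (leray_of_fdiv (fdiv_leray ξ v)).symm

theorem nonlin_eq_leray (k : ℕ) (hk : k ≤ 1) (ξ : E3) (G : C9) :
    (nonlin hα k hk).sym ξ G = leray.sym ξ (((rho ξ : ℂ) ^ k) • (divHelm hα).sym ξ G) := by
  ext i
  rw [nonlin_sym, leray_sym, Finset.mul_sum, Finset.sum_congr rfl fun j _ => Finset.mul_sum _ _ _,
    Finset.sum_comm]
  refine Finset.sum_congr rfl fun l _ => ?_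
  rw [PiLp.smul_apply, divHelm_sym, smul_eq_mul, Finset.mul_sum, Finset.mul_sum, Finset.mul_sum]
  refine Finset.sum_congr rfl fun j _ => ?_
  ring

theorem leray_nonlin (k : ℕ) (hk : k ≤ 1) (f : L2 C9) :
    leray.op ((nonlin hα k hk).op f) = (nonlin hα k hk).op f := by
  refine Mult.op_op_of_sym _ _ _ (fun ξ v => ?_) f
  rw [nonlin_eq_leray, ← leray_sym_lerayEntry]

omit hα in
theorem dsym_neg (j : Fin 3) (ξ : E3) : (starRingEnd ℂ) (dsym j (-ξ)) = dsym j ξ := by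
  simp [dsym, map_ofNat]

omit hα in
theorem helm_neg (ξ : E3) : helm α (-ξ) = helm α ξ := by simp [helm]

theorem herm_nonlin (k : ℕ) (hk : k ≤ 1) (f : L2 C9) :
    herm ((nonlin hα k hk).op f) = (nonlin hα k hk).op (herm f) :=
  herm_mat _ _ _ (fun i p ξ => by
    simp only [map_mul, map_pow, Complex.conj_ofReal, lerayEntry_neg, helm_neg, rho_neg,
      dsym_neg]) f

end Filtered

theorem herm_heat {ι : Type*} [Fintype ι] {ν : ℝ} (hν : 0 < ν) (t : ℝ)
    (f : L2 (EuclideanSpace ℂ ι)) :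
    herm ((heat hν t).op f) = (heat hν t).op (herm f) :=
  herm_op _ (fun ξ v => by
    have h : heatSym ν t (-ξ) = heatSym ν t ξ := by simp [heatSym, lap]
    rw [heat_sym, heat_sym, conjV_smul, Complex.conj_ofReal, h]) f

/-- A multiplier bounded by `(1 + |ξ|)²`, with the weight `(1 + |ξ|)⁻²`. -/
def quadMult {V : Type*} [NormedAddCommGroup V] [InnerProductSpace ℂ V] [CompleteSpace V]
    (c : E3 → ℝ) (hc : Measurable c) (hb : ∃ C, ∀ ξ, |c ξ| ≤ C * rho ξ ^ 2) : Mult V V :=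
  Mult.scal (fun ξ => (c ξ : ℂ) * ((rho ξ : ℂ) ^ 2)⁻¹)
    ((Complex.measurable_ofReal.comp hc).mul (measurable_inv_rho_pow 2)) (by
      obtain ⟨C, hC⟩ := hb
      refine ⟨C, fun ξ => ?_⟩
      rw [norm_mul, norm_inv, norm_pow, norm_rho, Complex.norm_real, Real.norm_eq_abs,
        ← div_eq_mul_inv, div_le_iff₀ (pow_pos (rho_pos ξ) 2)]
      exact hC ξ)

theorem abs_const_add_lap_le (a b : ℝ) (ξ : E3) :
    |a + b * lap ξ| ≤ (|a| + |b| * (4 * Real.pi ^ 2)) * rho ξ ^ 2 := by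
  have h1 := lap_le ξ
  have h2 : 1 ≤ rho ξ ^ 2 := one_le_pow₀ (one_le_rho ξ)
  have h0 := lap_nonneg ξ
  calc |a + b * lap ξ| ≤ |a| + |b * lap ξ| := abs_add_le _ _
    _ = |a| * 1 + |b| * lap ξ := by rw [abs_mul, abs_of_nonneg h0, mul_one]
    _ ≤ |a| * rho ξ ^ 2 + |b| * (4 * Real.pi ^ 2 * rho ξ ^ 2) := by gcongr
    _ = _ := by ring

/-- The operator `a - b Δ`, with the weight `(1 + |ξ|)⁻²`. -/
def lapMult {V : Type*} [NormedAddCommGroup V] [InnerProductSpace ℂ V] [CompleteSpace V]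
    (a b : ℝ) : Mult V V :=
  quadMult (fun ξ => a + b * lap ξ)
    (measurable_const.add (continuous_lap.measurable.const_mul b)) ⟨_, abs_const_add_lap_le a b⟩

@[simp] theorem lapMult_sym {V : Type*} [NormedAddCommGroup V] [InnerProductSpace ℂ V]
    [CompleteSpace V] (a b : ℝ) (ξ : E3) (v : V) :
    (lapMult a b).sym ξ v = (((a + b * lap ξ : ℝ) : ℂ) * ((rho ξ : ℂ) ^ 2)⁻¹) • v := rfl

/-! ### Cancellation of the trilinear term -/

section Trilinear

/-- The integrand of the trilinear form, for a divergence-free field with Fourier transform `f`. -/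
def triInt (f : E3 → C3) (ξ η : E3) : ℂ :=
  fdiv ξ (f η) * ∑ l, f (ξ - η) l * f (-ξ) l

theorem norm_fdiv_le (ξ : E3) (v : C3) : ‖fdiv ξ v‖ ≤ ‖ξ‖ * ‖v‖ := by
  have h : fdiv ξ v = inner ℂ (cplx ξ) v := by
    simp [fdiv, PiLp.inner_apply, mul_comm]
  rw [h]
  refine (norm_inner_le_norm _ _).trans ?_
  rw [norm_cplx]

theorem norm_dot_le (v w : C3) : ‖∑ l, v l * w l‖ ≤ ‖v‖ * ‖w‖ := by
  have h : ∑ l, v l * w l = inner ℂ (conjV v) w := by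
    simp [PiLp.inner_apply, mul_comm]
  rw [h]
  refine (norm_inner_le_norm _ _).trans ?_
  rw [norm_conjV]

/-- The change of variables `ξ ↦ η - ξ` changes the sign of the integral. -/
theorem integral_triInt {f : E3 → C3} {η : E3} (hη : fdiv η (f η) = 0) :
    ∫ ξ, triInt f ξ η = 0 := by
  have h := integral_sub_left_eq_self (fun ξ => triInt f ξ η) volume η
  have h2 : ∀ ξ, triInt f (η - ξ) η = -triInt f ξ η := by
    intro ξ
    have h3 : fdiv (η - ξ) (f η) = fdiv η (f η) - fdiv ξ (f η) := by
      simp [fdiv, sub_mul, Finset.sum_sub_distrib]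
    simp only [triInt, h3, hη, zero_sub, neg_mul]
    congr 2
    refine Finset.sum_congr rfl fun l _ => ?_
    rw [sub_sub_cancel_left, neg_sub, mul_comm]
  simp only [h2, integral_neg] at h
  exact self_eq_neg.1 h.symm

theorem norm_triInt_le (f : E3 → C3) (ξ η : E3) :
    ‖triInt f ξ η‖ₑ ≤ ‖f η‖ₑ * (‖f (ξ - η)‖ₑ * ‖rhoPow 1 f (-ξ)‖ₑ) := by
  rw [← ofReal_norm, ← ofReal_norm, ← ofReal_norm, ← ofReal_norm,
    ← ENNReal.ofReal_mul (norm_nonneg _), ← ENNReal.ofReal_mul (norm_nonneg _)]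
  refine ENNReal.ofReal_le_ofReal ?_
  unfold triInt rhoPow
  rw [norm_mul, norm_smul, norm_pow, norm_rho, pow_one, rho_neg]
  calc ‖fdiv ξ (f η)‖ * ‖∑ l, f (ξ - η) l * f (-ξ) l‖
      ≤ (rho ξ * ‖f η‖) * (‖f (ξ - η)‖ * ‖f (-ξ)‖) := by
        refine mul_le_mul ((norm_fdiv_le _ _).trans ?_) (norm_dot_le _ _) (norm_nonneg _)
          (mul_nonneg (rho_pos ξ).le (norm_nonneg _))
        exact mul_le_mul_of_nonneg_right (norm_le_rho ξ) (norm_nonneg _)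
    _ = _ := by ring

theorem aestronglyMeasurable_triInt {f : E3 → C3} (hf : AEStronglyMeasurable f volume) :
    AEStronglyMeasurable (fun z : E3 × E3 => triInt f z.1 z.2) (volume.prod volume) := by
  have h1 : AEStronglyMeasurable (fun z : E3 × E3 => f z.2) (volume.prod volume) :=
    hf.comp_quasiMeasurePreserving Measure.quasiMeasurePreserving_snd
  have h2 : AEStronglyMeasurable (fun z : E3 × E3 => f (z.1 - z.2)) (volume.prod volume) :=
    hf.comp_quasiMeasurePreserving
      (quasiMeasurePreserving_sub_of_right_invariant volume volume)
  have h3 : AEStronglyMeasurable (fun z : E3 × E3 => f (-z.1)) (volume.prod volume) :=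
    (hf.comp_measurePreserving (Measure.measurePreserving_neg volume)).comp_quasiMeasurePreserving
      Measure.quasiMeasurePreserving_fst
  have hp : ∀ l : Fin 3, Continuous fun v : C3 => v l := fun l => by fun_prop
  unfold triInt fdiv
  refine AEStronglyMeasurable.mul ?_ ?_
  · refine Finset.aestronglyMeasurable_fun_sum _ fun l _ => ?_
    refine AEStronglyMeasurable.mul ?_ ((hp l).comp_aestronglyMeasurable h1)
    have : Continuous fun z : E3 × E3 => ((z.1 l : ℝ) : ℂ) := by fun_prop
    exact this.aestronglyMeasurable
  · refine Finset.aestronglyMeasurable_fun_sum _ fun l _ => ?_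
    exact ((hp l).comp_aestronglyMeasurable h2).mul ((hp l).comp_aestronglyMeasurable h3)

theorem integrable_triInt {f : E3 → C3} (h1 : MemLp f 1 volume) (h2 : MemLp f 2 volume)
    (hr : MemLp (rhoPow 1 f) 2 volume) :
    Integrable (fun z : E3 × E3 => triInt f z.1 z.2) (volume.prod volume) := by
  have hm := aestronglyMeasurable_triInt h1.1
  refine ⟨hm, ?_⟩
  unfold HasFiniteIntegral
  rw [lintegral_prod_symm _ hm.enorm]
  set A : ℝ≥0∞ := eLpNorm f 2 volume * eLpNorm (rhoPow 1 f) 2 volume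
  have hin : ∀ η : E3, ∫⁻ ξ, ‖f (ξ - η)‖ₑ * ‖rhoPow 1 f (-ξ)‖ₑ ≤ A := by
    intro η
    have g1 := (measurePreserving_sub_right (volume : Measure E3) η)
    have g2 := (Measure.measurePreserving_neg (volume : Measure E3))
    have h := ENNReal.lintegral_mul_le_Lp_mul_Lq volume Real.HolderConjugate.two_two
      (h2.1.comp_measurePreserving g1).enorm (hr.1.comp_measurePreserving g2).enorm
    refine h.trans (le_of_eq ?_)
    change _ = eLpNorm f 2 volume * eLpNorm (rhoPow 1 f) 2 volume
    rw [← eLpNorm_comp_measurePreserving h2.1 g1, ← eLpNorm_comp_measurePreserving hr.1 g2,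
      eLpNorm_eq_lintegral_rpow_enorm_toReal (by norm_num) (by norm_num),
      eLpNorm_eq_lintegral_rpow_enorm_toReal (by norm_num) (by norm_num)]
    simp
  calc ∫⁻ η, ∫⁻ ξ, ‖triInt f ξ η‖ₑ ≤ ∫⁻ η, ‖f η‖ₑ * A := by
        refine lintegral_mono fun η => ?_
        refine (lintegral_mono fun ξ => norm_triInt_le f ξ η).trans ?_
        rw [lintegral_const_mul' _ _ enorm_ne_top]
        exact mul_le_mul_right (hin η) _
    _ = (∫⁻ η, ‖f η‖ₑ) * A := by
        rw [lintegral_mul_const'' _ h1.1.enorm]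
    _ < ⊤ := by
        refine ENNReal.mul_lt_top ?_ (ENNReal.mul_lt_top h2.2 hr.2)
        rw [← eLpNorm_one_eq_lintegral_enorm]
        exact h1.2

/-- The convection term does not contribute to the energy: `∫ u · div (u ⊗ u) = 0`. -/
theorem integral_trilinear {f : E3 → C3} (h1 : MemLp f 1 volume) (h2 : MemLp f 2 volume)
    (hr : MemLp (rhoPow 1 f) 2 volume) (hdiv : ∀ᵐ ξ ∂volume, fdiv ξ (f ξ) = 0) :
    ∫ ξ, ∑ j, ∑ l, (ξ j : ℂ) * tconv f f ξ (j, l) * f (-ξ) l = 0 := by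
  have h3 : ∀ ξ, ∑ j, ∑ l, (ξ j : ℂ) * tconv f f ξ (j, l) * f (-ξ) l = ∫ η, triInt f ξ η := by
    intro ξ
    let T : C9 →L[ℂ] ℂ := ∑ j, ∑ l, ((ξ j : ℂ) * f (-ξ) l) •
      (EuclideanSpace.proj (j, l) : C9 →L[ℂ] ℂ)
    have hT : ∀ G : C9, T G = ∑ j, ∑ l, (ξ j : ℂ) * f (-ξ) l * G (j, l) := by
      intro G
      simp [T]
    have h4 := T.integral_comp_comm (integrable_tens h2 h2 ξ)
    rw [← tconv_apply, hT] at h4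
    refine Eq.trans ?_ (h4.symm.trans ?_)
    · exact Finset.sum_congr rfl fun j _ => Finset.sum_congr rfl fun l _ => by ring
    · refine integral_congr_ae (Eventually.of_forall fun η => ?_)
      simp only [hT, tens_apply, triInt, fdiv, Finset.sum_mul, Finset.mul_sum]
      rw [Finset.sum_comm]
      exact Finset.sum_congr rfl fun j _ => Finset.sum_congr rfl fun l _ => by ring
  simp only [h3]
  rw [integral_integral_swap (integrable_triInt h1 h2 hr)]
  rw [integral_eq_zero_of_ae]
  filter_upwards [hdiv] with η hη
  exact integral_triInt hη

theorem leray_sum_conj {ξ : E3} {v : C3} (h : fdiv ξ v = 0) (l : Fin 3) :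
    ∑ i, (lerayEntry i l ξ : ℂ) * (starRingEnd ℂ) (v i) = (starRingEnd ℂ) (v l) := by
  have h1 := congrArg (fun w : C3 => (starRingEnd ℂ) (w l)) (leray_of_fdiv h)
  simp only [leray_sym, map_sum, map_mul, Complex.conj_ofReal] at h1
  rw [← h1]
  refine Finset.sum_congr rfl fun i _ => ?_
  have : lerayEntry i l ξ = lerayEntry l i ξ := by
    simp [lerayEntry, eq_comm, mul_comm]
  rw [this]

/-- The nonlinear term does not contribute to the energy: the symbol `1 + α² · 4π²|ξ|²` of the
energy cancels the symbol of the filter, and what remains is the trilinear integral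
`integral_trilinear`. -/
theorem inner_nonlin {α : ℝ} (hα : 0 < α) {w : L2 C3} (hdiv : leray.op w = w)
    (hw : herm w = w) :
    inner ℂ ((lapMult 1 (α ^ 2)).op w)
      ((wt 2).op ((nonlin hα 0 (Nat.zero_le 1)).op (K 0 w w))) = 0 := by
  set f : E3 → C3 := ((wt 2).op w : E3 → C3) with hf
  have hfd : ∀ᵐ ξ ∂volume, fdiv ξ (f ξ) = 0 := by
    refine fdiv_of_leray ?_
    rw [Mult.op_wt, hdiv]
  have hfh : ∀ᵐ ξ ∂volume, f (-ξ) = conjV (f ξ) := by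
    have h : herm ((wt 2).op w) = (wt 2).op w := by rw [herm_wt, hw]
    have := herm_coe ((wt 2).op w)
    rw [h] at this
    filter_upwards [this] with ξ h1
    rw [hf, h1, conjV_conjV]
  have hf1 : MemLp f 1 volume := memLp_one_iff_integrable.2 (integrable_wt_two w)
  have hr : MemLp (rhoPow 1 f) 2 volume := by
    have h1 : rhoPow 1 f =ᵐ[volume] (wt 1).op w := by
      have := rhoPow_wt 1 ((wt 1).op w)
      rwa [wt_wt] at this
    exact (memLp_congr_ae h1).2 (Lp.memLp _)
  have key := integral_trilinear hf1 (Lp.memLp _) hr hfd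
  rw [L2.inner_def]
  -- the Leray projection is symmetric and fixes `f`, so that it disappears from the integrand
  have h5 : ∫ ξ, inner ℂ ((lapMult 1 (α ^ 2)).op w ξ)
      ((wt 2).op ((nonlin hα 0 (Nat.zero_le 1)).op (K 0 w w)) ξ)
      = ∫ ξ, (2 * Real.pi * Complex.I) * ∑ j, ∑ l, (ξ j : ℂ) * tconv f f ξ (j, l) * f (-ξ) l := by
    rw [← Mult.op_wt]
    refine integral_congr_ae ?_
    filter_upwards [(lapMult 1 (α ^ 2) : Mult C3 C3).op_coe w, (wt 2 : Mult C3 C3).op_coe w,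
      (nonlin hα 0 (Nat.zero_le 1)).op_congr (wt_two_K w w), hfd, hfh] with ξ g1 g2 g3 g4 g5
    have g6 : (lapMult 1 (α ^ 2) : Mult C3 C3).op w ξ
        = ((1 + α ^ 2 * lap ξ : ℝ) : ℂ) • f ξ := by
      rw [g1, hf, g2, lapMult_sym, wt_sym, smul_smul]
    have g7 : (helm α ξ : ℂ) * ((1 + α ^ 2 * lap ξ : ℝ) : ℂ) = 1 := by
      exact_mod_cast helm_mul α ξ
    have g8 : inner ℂ (f ξ) ((nonlin hα 0 (Nat.zero_le 1)).sym ξ (tconv f f ξ))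
        = (helm α ξ : ℂ) * ∑ j, ∑ l, (starRingEnd ℂ) (f ξ l) * (dsym j ξ * tconv f f ξ (j, l)) := by
      simp only [PiLp.inner_apply, RCLike.inner_apply, nonlin_sym, pow_zero, mul_one]
      rw [Finset.sum_congr rfl fun i _ => (mul_assoc (helm α ξ : ℂ) _ _), ← Finset.mul_sum]
      congr 1
      simp only [Finset.sum_mul]
      rw [Finset.sum_comm]
      refine Finset.sum_congr rfl fun j _ => ?_
      rw [Finset.sum_comm]
      refine Finset.sum_congr rfl fun l _ => ?_
      rw [← leray_sum_conj g4 l, Finset.sum_mul]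
      exact Finset.sum_congr rfl fun i _ => by ring
    rw [g3, g6, inner_smul_left, Complex.conj_ofReal, g8, ← mul_assoc, mul_comm _ (helm α ξ : ℂ),
      g7, one_mul, g5, Finset.mul_sum]
    refine Finset.sum_congr rfl fun j _ => ?_
    rw [Finset.mul_sum]
    refine Finset.sum_congr rfl fun l _ => ?_
    rw [conjV_apply, dsym]
    ring
  refine h5.trans ?_
  rw [integral_const_mul, key, mul_zero]

end Trilinear

/-! ### Gronwall's inequality -/

/-- Gronwall's inequality in integral form. -/
theorem gronwall_integral {f : ℝ → ℝ} {a L τ : ℝ} (hL : 0 < L) (hf : ContinuousOn f (Icc 0 τ))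
    (hf0 : ∀ t ∈ Icc 0 τ, 0 ≤ f t) (h : ∀ t ∈ Icc 0 τ, f t ≤ a + L * ∫ s in (0 : ℝ)..t, f s) :
    ∀ t ∈ Icc 0 τ, f t ≤ a * Real.exp (L * t) := by
  intro t ht
  have hτ : 0 ≤ τ := ht.1.trans ht.2
  have hcl : ∀ s, max 0 (min s τ) ∈ Icc 0 τ := fun s =>
    ⟨le_max_left _ _, max_le hτ (min_le_right _ _)⟩
  set g : ℝ → ℝ := fun s => f (max 0 (min s τ)) with hg
  have hgc : Continuous g := hf.comp_continuous (by fun_prop) hcl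
  have hgf : ∀ s ∈ Icc 0 τ, g s = f s := fun s hs => by
    simp only [hg]
    rw [min_eq_left hs.2, max_eq_right hs.1]
  have hint : ∀ s ∈ Icc 0 τ, ∫ r in (0 : ℝ)..s, f r = ∫ r in (0 : ℝ)..s, g r := by
    intro s hs
    refine intervalIntegral.integral_congr fun r hr => (hgf r ?_).symm
    rw [uIcc_of_le hs.1] at hr
    exact ⟨hr.1, hr.2.trans hs.2⟩
  set G : ℝ → ℝ := fun s => ∫ r in (0 : ℝ)..s, g r with hG
  have hGd : ∀ s, HasDerivAt G (g s) s := fun s =>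
    intervalIntegral.integral_hasDerivAt_right (hgc.intervalIntegrable _ _)
      hgc.stronglyMeasurable.stronglyMeasurableAtFilter hgc.continuousAt
  have hG0 : ∀ s, 0 ≤ s → 0 ≤ G s := fun s hs =>
    intervalIntegral.integral_nonneg hs fun r _ => hf0 _ (hcl r)
  have hb : ∀ s ∈ Icc 0 τ, g s ≤ a + L * G s := fun s hs => by
    rw [hgf s hs, hG]
    simp only
    rw [← hint s hs]
    exact h s hs
  have hgr := norm_le_gronwallBound_of_norm_deriv_right_le (f := G) (f' := g) (δ := 0) (K := L)
    (ε := a) (a := 0) (b := τ) (fun s _ => (hGd s).continuousAt.continuousWithinAt)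
    (fun s _ => (hGd s).hasDerivWithinAt) (by simp [hG])
    (fun s hs => by
      have hs' : s ∈ Icc 0 τ := ⟨hs.1, hs.2.le⟩
      rw [Real.norm_of_nonneg (hf0 _ (hcl s)), Real.norm_of_nonneg (hG0 s hs.1)]
      linarith [hb s hs']) t ht
  rw [Real.norm_of_nonneg (hG0 t ht.1), gronwallBound_of_K_ne_0 hL.ne', sub_zero] at hgr
  simp only [zero_mul, zero_add] at hgr
  have h1 := hb t ht
  rw [hgf t ht] at h1
  refine h1.trans ?_
  have h2 : L * G t ≤ a * (Real.exp (L * t) - 1) := by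
    calc L * G t ≤ L * (a / L * (Real.exp (L * t) - 1)) := mul_le_mul_of_nonneg_left hgr hL.le
      _ = _ := by field_simp
  linarith

/-! ### The heat semigroup and Duhamel's formula -/

section

variable {V : Type*} [NormedAddCommGroup V] [InnerProductSpace ℂ V] [CompleteSpace V]
variable {ν : ℝ} (hν : 0 < ν)

theorem heat_add {a b : ℝ} (ha : 0 ≤ a) (hb : 0 ≤ b) (f : L2 V) :
    (heat hν (a + b)).op f = (heat hν a).op ((heat hν b).op f) := by
  refine (Mult.op_op_of_sym _ _ _ (fun ξ v => ?_) f).symm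
  rw [heat_sym, heat_sym, heat_sym, smul_smul, ← Complex.ofReal_mul]
  congr 2
  unfold heatSym
  rw [← Real.exp_add, max_eq_left ha, max_eq_left hb, max_eq_left (add_nonneg ha hb)]
  congr 1
  ring

/-- The semigroup is jointly continuous. -/
theorem continuous_heat_apply {Z : Type*} [TopologicalSpace Z] {h : Z → ℝ} {g : Z → L2 V}
    (hh : Continuous h) (hg : Continuous g) : Continuous fun z => (heat hν (h z)).op (g z) := by
  rw [continuous_iff_continuousAt]
  intro z₀
  have h1 : Tendsto (fun z => (heat hν (h z)).op (g z - g z₀)) (𝓝 z₀) (𝓝 0) := by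
    refine squeeze_zero_norm (fun z => norm_heat_le hν (h z) (g z - g z₀)) ?_
    simpa using ((hg.sub (continuous_const (y := g z₀))).norm).tendsto z₀
  have h2 : Tendsto (fun z => (heat hν (h z)).op (g z₀)) (𝓝 z₀)
      (𝓝 ((heat hν (h z₀)).op (g z₀))) := ((continuous_heat hν (g z₀)).comp hh).tendsto z₀
  have h3 := h1.add h2
  rw [zero_add] at h3
  refine h3.congr fun z => ?_
  rw [← map_add, sub_add_cancel]

/-- The Duhamel integral `∫₀ᵗ exp (ν (t - s) Δ) g(s) ds`. -/
def duh (g : ℝ → L2 V) (t : ℝ) : L2 V := ∫ s in (0 : ℝ)..t, (heat hν (t - s)).op (g s)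

theorem continuous_duh {g : ℝ → L2 V} (hg : Continuous g) : Continuous (duh hν g) := by
  unfold duh
  refine intervalIntegral.continuous_parametric_intervalIntegral_of_continuous ?_ continuous_id
  exact continuous_heat_apply hν (h := fun z : ℝ × ℝ => z.1 - z.2) (g := fun z : ℝ × ℝ => g z.2)
    (by fun_prop) (hg.comp continuous_snd)

theorem continuous_duh_integrand {g : ℝ → L2 V} (hg : Continuous g) (t : ℝ) :
    Continuous fun s => (heat hν (t - s)).op (g s) :=
  continuous_heat_apply hν (by fun_prop) hg

theorem norm_duh_le {g : ℝ → L2 V} {b : ℝ → ℝ} {t : ℝ} (ht : 0 ≤ t)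
    (hb : ∀ s ∈ Icc 0 t, ‖g s‖ ≤ b s) (hbc : ContinuousOn b (Icc 0 t)) :
    ‖duh hν g t‖ ≤ ∫ s in (0 : ℝ)..t, b s := by
  refine intervalIntegral.norm_integral_le_of_norm_le ht ?_
    (ContinuousOn.intervalIntegrable (by rwa [uIcc_of_le ht]))
  filter_upwards with s hs
  exact (norm_heat_le hν _ _).trans (hb s ⟨hs.1.le, hs.2⟩)

theorem duh_congr {g g' : ℝ → L2 V} {t : ℝ} (ht : 0 ≤ t) (h : ∀ s ∈ Icc 0 t, g s = g' s) :
    duh hν g t = duh hν g' t := by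
  refine intervalIntegral.integral_congr fun s hs => ?_
  rw [uIcc_of_le ht] at hs
  simp only [h s hs]

theorem duh_sub {g g' : ℝ → L2 V} (hg : Continuous g) (hg' : Continuous g') (t : ℝ) :
    duh hν (fun s => g s - g' s) t = duh hν g t - duh hν g' t := by
  unfold duh
  rw [← intervalIntegral.integral_sub
    ((continuous_duh_integrand hν hg t).intervalIntegrable _ _)
    ((continuous_duh_integrand hν hg' t).intervalIntegrable _ _)]
  simp only [map_sub]

/-- A bounded operator that commutes with the semigroup commutes with the Duhamel integral. -/
theorem map_duh {W : Type*} [NormedAddCommGroup W] [InnerProductSpace ℂ W] [CompleteSpace W]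
    (T : L2 V →L[ℝ] L2 W) (hT : ∀ t f, T ((heat hν t).op f) = (heat hν t).op (T f))
    {g : ℝ → L2 V} (hg : Continuous g) (t : ℝ) :
    T (duh hν g t) = duh hν (fun s => T (g s)) t := by
  unfold duh
  rw [← T.intervalIntegral_comp_comm ((continuous_duh_integrand hν hg t).intervalIntegrable _ _)]
  simp only [hT]

theorem duh_add {g : ℝ → L2 V} (hg : Continuous g) {a t : ℝ} (ha : 0 ≤ a) (ht : 0 ≤ t) :
    duh hν g (a + t) = (heat hν t).op (duh hν g a) + duh hν (fun s => g (a + s)) t := by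
  have hi : ∀ b c, IntervalIntegrable (fun s => (heat hν (a + t - s)).op (g s)) volume b c :=
    fun b c => (continuous_duh_integrand hν hg (a + t)).intervalIntegrable b c
  unfold duh
  rw [← intervalIntegral.integral_add_adjacent_intervals (hi 0 a) (hi a (a + t)),
    ← ((heat hν t).op).intervalIntegral_comp_comm
      ((continuous_duh_integrand hν hg a).intervalIntegrable _ _)]
  congr 1
  · refine intervalIntegral.integral_congr fun s hs => ?_
    rw [uIcc_of_le ha] at hs
    rw [← heat_add hν ht (sub_nonneg.2 hs.2)]
    congr 2
    ring_nf
  · have h := intervalIntegral.integral_comp_add_right (a := 0) (b := t)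
      (fun s => (heat hν (a + t - s)).op (g s)) a
    rw [zero_add, add_comm t a] at h
    rw [← h]
    refine intervalIntegral.integral_congr fun s _ => ?_
    simp only
    rw [add_comm s a, add_sub_add_left_eq_sub]

/-- Duhamel's formula restarted at the time `a`. -/
theorem duhamel_restart {y g : ℝ → L2 V} {y₀ : L2 V} (hg : Continuous g)
    (h : ∀ t, 0 ≤ t → y t = (heat hν t).op y₀ + duh hν g t) {a t : ℝ} (ha : 0 ≤ a) (ht : 0 ≤ t) :
    y (a + t) = (heat hν t).op (y a) + duh hν (fun s => g (a + s)) t := by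
  rw [h _ (add_nonneg ha ht), h a ha, duh_add hν hg ha ht, add_comm a t, heat_add hν ht ha, map_add,
    add_assoc]

/-- The symbol `(exp (-ν h b) - 1) / h` of the difference quotients of the heat semigroup. -/
def quotSym (ν h : ℝ) (ξ : E3) : ℝ :=
  dslope (fun r => Real.exp (-(ν * lap ξ) * r)) 0 h

theorem hasDerivAt_exp_mul (c : ℝ) : HasDerivAt (fun r => Real.exp (c * r)) c 0 := by
  have h := ((hasDerivAt_id (0 : ℝ)).const_mul c).exp
  simpa using h

theorem quotSym_zero (ν : ℝ) (ξ : E3) : quotSym ν 0 ξ = -(ν * lap ξ) := by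
  rw [quotSym, dslope_same]
  exact (hasDerivAt_exp_mul _).deriv

theorem quotSym_of_ne {h : ℝ} (hh : h ≠ 0) (ξ : E3) :
    quotSym ν h ξ = (Real.exp (-(ν * lap ξ) * h) - 1) / h := by
  rw [quotSym, dslope_of_ne _ hh, slope_def_field]
  simp

theorem measurable_quotSym (ν h : ℝ) : Measurable (quotSym ν h) := by
  have hl := continuous_lap.measurable
  rcases eq_or_ne h 0 with rfl | hh
  · have : quotSym ν 0 = fun ξ => -(ν * lap ξ) := funext fun ξ => quotSym_zero ν ξ
    rw [this]
    exact (hl.const_mul ν).neg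
  · have : quotSym ν h = fun ξ => (Real.exp (-(ν * lap ξ) * h) - 1) / h :=
      funext fun ξ => quotSym_of_ne hh ξ
    rw [this]
    exact ((((hl.const_mul ν).neg.mul_const h).exp).sub_const 1).div_const h

include hν in
theorem abs_quotSym_le {h : ℝ} (hh : 0 ≤ h) (ξ : E3) :
    |quotSym ν h ξ| ≤ ν * (4 * Real.pi ^ 2) * rho ξ ^ 2 := by
  have h0 : 0 ≤ ν * lap ξ := mul_nonneg hν.le (lap_nonneg ξ)
  have h1 : |quotSym ν h ξ| ≤ ν * lap ξ := by
    rcases eq_or_lt_of_le hh with rfl | hh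
    · rw [quotSym_zero, abs_neg, abs_of_nonneg h0]
    · rw [quotSym_of_ne hh.ne', abs_div, abs_of_pos hh, div_le_iff₀ hh, abs_of_nonpos]
      · linarith [Real.add_one_le_exp (-(ν * lap ξ) * h)]
      · have : Real.exp (-(ν * lap ξ) * h) ≤ 1 := by
          rw [Real.exp_le_one_iff]
          nlinarith
        linarith
  refine h1.trans ?_
  rw [mul_assoc]
  exact mul_le_mul_of_nonneg_left (lap_le ξ) hν.le

theorem continuous_quotSym (ξ : E3) : Continuous fun h => quotSym ν h ξ := by
  rw [continuous_iff_continuousAt]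
  intro h
  rcases eq_or_ne h 0 with rfl | hh
  · exact continuousAt_dslope_same.2 (hasDerivAt_exp_mul _).differentiableAt
  · refine (continuousAt_dslope_of_ne hh).2 ?_
    exact Continuous.continuousAt (by fun_prop)

/-- The difference quotients of the heat semigroup, with the weight `(1 + |ξ|)⁻²`. -/
def quotMult (h : ℝ) (hh : 0 ≤ h) : Mult V V :=
  quadMult (quotSym ν h) (measurable_quotSym ν h) ⟨_, abs_quotSym_le hν hh⟩

/-- The generator of the heat semigroup. -/
theorem hasDerivWithinAt_heat (f : L2 V) :
    HasDerivWithinAt (fun h => (wt 2).op ((heat hν h).op f)) (-(lapMult 0 ν).op f) (Ici 0) 0 := by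
  rw [hasDerivWithinAt_iff_tendsto_slope]
  have hc : ContinuousOn (fun h => (quotMult hν (max h 0) (le_max_right h 0) : Mult V V).op f)
      (Ici (0 : ℝ)) := by
    refine continuousOn_op (C := ν * (4 * Real.pi ^ 2)) _ (fun h _ ξ => ?_) (fun ξ v => ?_) f
    · refine Mult.norm_scal_le ((Complex.measurable_ofReal.comp
        (measurable_quotSym ν (max h 0))).mul (measurable_inv_rho_pow 2)) (fun ξ => ?_) ξ
      change ‖((quotSym ν (max h 0) ξ : ℝ) : ℂ) * ((rho ξ : ℂ) ^ 2)⁻¹‖ ≤ _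
      rw [norm_mul, norm_inv, norm_pow, norm_rho, Complex.norm_real, Real.norm_eq_abs,
        ← div_eq_mul_inv, div_le_iff₀ (pow_pos (rho_pos ξ) 2)]
      exact abs_quotSym_le hν (le_max_right h 0) ξ
    · simp only [quotMult, quadMult, Mult.scal_sym]
      refine Continuous.continuousOn ?_
      refine ((Complex.continuous_ofReal.comp ((continuous_quotSym ξ).comp
        (by fun_prop : Continuous fun h : ℝ => max h 0))).mul continuous_const).smul
        continuous_const
  have h0 : (quotMult hν (max (0 : ℝ) 0) (le_max_right 0 0) : Mult V V).op f
      = -(lapMult 0 ν).op f := by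
    refine Lp.ext ?_
    filter_upwards [(quotMult hν (max (0 : ℝ) 0) (le_max_right 0 0) : Mult V V).op_coe f,
      (lapMult 0 ν : Mult V V).op_coe f, Lp.coeFn_neg ((lapMult 0 ν : Mult V V).op f)]
      with ξ h1 h2 h3
    rw [h1, h3, Pi.neg_apply, h2]
    simp only [quotMult, quadMult, Mult.scal_sym, lapMult_sym, max_self, quotSym_zero]
    rw [← neg_smul]
    push_cast
    congr 1
    ring
  have h1 := (hc 0 self_mem_Ici).tendsto
  rw [h0] at h1
  refine (h1.mono_left (nhdsWithin_mono _ sdiff_subset)).congr' ?_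
  filter_upwards [self_mem_nhdsWithin] with h hh
  have hpos : 0 < h := lt_of_le_of_ne hh.1 (Ne.symm hh.2)
  rw [slope_def_module, sub_zero, heat_zero]
  refine Lp.ext ?_
  rw [← map_sub]
  filter_upwards [(quotMult hν (max h 0) (le_max_right h 0) : Mult V V).op_coe f,
    Lp.coeFn_smul (h⁻¹) ((wt 2).op ((heat hν h).op f - f)),
    (wt 2 : Mult V V).op_coe ((heat hν h).op f - f), Lp.coeFn_sub ((heat hν h).op f) f,
    (heat hν h : Mult V V).op_coe f] with ξ g1 g2 g3 g4 g5
  rw [g1, g2, Pi.smul_apply, g3, g4, Pi.sub_apply, g5]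
  simp only [quotMult, quadMult, Mult.scal_sym, wt_sym, heat_sym, heatSym, max_eq_left hpos.le]
  rw [quotSym_of_ne hpos.ne', ← Complex.coe_smul, smul_smul]
  have : ∀ (c : ℂ) (v : V), c • v - v = (c - 1) • v := fun c v => by rw [sub_smul, one_smul]
  rw [this, smul_smul]
  congr 1
  push_cast
  rw [show (-(ν * lap ξ : ℂ) * (h : ℂ)) = -((ν : ℂ) * h * lap ξ) by ring]
  ring

/-- The derivative of a Duhamel integral at time zero. -/
theorem hasDerivWithinAt_duh {g : ℝ → L2 V} (hg : Continuous g) :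
    HasDerivWithinAt (duh hν g) (g 0) (Ici 0) 0 := by
  have hF : Continuous fun z : ℝ × ℝ => (heat hν (z.1 - z.1 * z.2)).op (g (z.1 * z.2)) :=
    continuous_heat_apply hν (by fun_prop) (hg.comp (by fun_prop))
  have hI : Continuous fun h : ℝ => ∫ θ in (0 : ℝ)..1, (heat hν (h - h * θ)).op (g (h * θ)) :=
    intervalIntegral.continuous_parametric_intervalIntegral_of_continuous hF continuous_const
  rw [hasDerivWithinAt_iff_tendsto_slope]
  have h0 : (∫ θ in (0 : ℝ)..1, (heat hν (0 - 0 * θ)).op (g (0 * θ))) = g 0 := by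
    simp [heat_zero]
  have h1 := hI.tendsto 0
  rw [h0] at h1
  refine (h1.mono_left nhdsWithin_le_nhds).congr' ?_
  filter_upwards [self_mem_nhdsWithin] with h hh
  rw [slope_def_module, sub_zero]
  have h2 : duh hν g 0 = 0 := by simp [duh]
  rw [h2, sub_zero, duh]
  have h3 := intervalIntegral.integral_comp_mul_left (a := 0) (b := 1)
    (fun s => (heat hν (h - s)).op (g s)) hh.2
  rw [mul_zero, mul_one] at h3
  exact h3

/-- A solution of Duhamel's formula satisfies the heat equation in `L²`. -/
theorem duhamel_hasDerivWithinAt {y g : ℝ → L2 V} {y₀ : L2 V} (hg : Continuous g)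
    (h : ∀ t, 0 ≤ t → y t = (heat hν t).op y₀ + duh hν g t) {t : ℝ} (ht : 0 ≤ t) :
    HasDerivWithinAt (fun s => (wt 2).op (y s)) (-(lapMult 0 ν).op (y t) + (wt 2).op (g t))
      (Ici 0) t := by
  -- The restarted formula only gives right derivatives; as they are continuous in time, the
  -- fundamental theorem of calculus for right derivatives turns them into derivatives.
  have hright : ∀ a, 0 ≤ a → HasDerivWithinAt (fun s => (wt 2).op (y s))
      (-(lapMult 0 ν).op (y a) + (wt 2).op (g a)) (Ici a) a := by
    intro a ha
    have h1 := hasDerivWithinAt_heat hν (y a)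
    have h2 := ((wt 2 : Mult V V).op).hasFDerivAt.comp_hasDerivWithinAt (0 : ℝ)
      (hasDerivWithinAt_duh hν (hg.comp (continuous_const_add a)))
    have h3 := h1.add h2
    simp only [Function.comp_def, add_zero] at h3
    have h4 : HasDerivWithinAt (fun r : ℝ => r - a) 1 (Ici a) a :=
      ((hasDerivAt_id a).sub_const a).hasDerivWithinAt
    have h5 := HasDerivWithinAt.scomp_of_eq (h := fun r : ℝ => r - a) a h3 h4
      (fun r hr => mem_Ici.2 (sub_nonneg.2 (mem_Ici.1 hr))) (sub_self a).symm
    rw [one_smul] at h5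
    refine h5.congr (fun r hr => ?_) ?_
    · have := duhamel_restart hν hg h ha (sub_nonneg.2 (mem_Ici.1 hr))
      rw [add_sub_cancel] at this
      simp only [Function.comp_def, Pi.add_apply]
      rw [this, map_add]
    · simp [duh, heat_zero]
  have hyc : Continuous fun t => (heat hν t).op y₀ + duh hν g t :=
    (continuous_heat hν y₀).add (continuous_duh hν hg)
  let z : ℝ → L2 V := fun t => (heat hν t).op y₀ + duh hν g t
  have hz : ∀ t, 0 ≤ t → y t = z t := h
  let d : ℝ → L2 V := fun t => -(lapMult 0 ν).op (z t) + (wt 2).op (g t)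
  have hd : Continuous d := (((lapMult 0 ν).op.continuous.comp hyc).neg).add
    ((wt 2).op.continuous.comp hg)
  have hftc : ∀ r, 0 ≤ r → (wt 2).op (y r) = (wt 2).op (y 0) + ∫ s in (0 : ℝ)..r, d s := by
    intro r hr
    rw [intervalIntegral.integral_eq_sub_of_hasDeriv_right (f := fun s => (wt 2).op (z s))
      (((wt 2).op.continuous.comp hyc).continuousOn) ?_ (hd.intervalIntegrable _ _),
      hz 0 le_rfl, hz r hr, add_sub_cancel]
    intro x hx
    rw [min_eq_left hr, max_eq_right hr] at hx
    have h6 := (hright x hx.1.le)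
    rw [hz x hx.1.le] at h6
    refine (h6.congr (fun s hs => ?_) ?_).mono Ioi_subset_Ici_self
    · rw [hz s (hx.1.le.trans hs)]
    · rw [hz x hx.1.le]
  have h7 : HasDerivAt (fun r => (wt 2).op (y 0) + ∫ s in (0 : ℝ)..r, d s) (d t) t :=
    (intervalIntegral.integral_hasDerivAt_right (hd.intervalIntegrable _ _)
      hd.stronglyMeasurable.stronglyMeasurableAtFilter hd.continuousAt).const_add _
  have h8 := h7.hasDerivWithinAt (s := Ici 0)
  have h9 : d t = -(lapMult 0 ν).op (y t) + (wt 2).op (g t) := by rw [hz t ht]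
  rw [← h9]
  exact h8.congr (fun r hr => hftc r hr) (hftc t ht)

/-- Uniqueness for Duhamel's formula with a Lipschitz nonlinearity. -/
theorem duhamel_unique {N : ℝ → L2 V → L2 V} (hN : Continuous fun z : ℝ × L2 V => N z.1 z.2)
    {τ L : ℝ} (hL : 0 < L) (hNL : ∀ t ∈ Icc 0 τ, ∀ a b, ‖N t a - N t b‖ ≤ L * ‖a - b‖)
    {y z : ℝ → L2 V} (hy : Continuous y) (hz : Continuous z) {y₀ : L2 V}
    (ey : ∀ t ∈ Icc 0 τ, y t = (heat hν t).op y₀ + duh hν (fun s => N s (y s)) t)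
    (ez : ∀ t ∈ Icc 0 τ, z t = (heat hν t).op y₀ + duh hν (fun s => N s (z s)) t) :
    ∀ t ∈ Icc 0 τ, y t = z t := by
  intro t ht
  have hgy : Continuous fun s => N s (y s) := hN.comp (continuous_id.prodMk hy)
  have hgz : Continuous fun s => N s (z s) := hN.comp (continuous_id.prodMk hz)
  have h := gronwall_integral (f := fun s => ‖y s - z s‖) (a := 0) (τ := τ) hL
    ((hy.sub hz).norm.continuousOn) (fun _ _ => norm_nonneg _) (fun s hs => ?_) t ht
  · rw [zero_mul] at h
    exact sub_eq_zero.1 (norm_le_zero_iff.1 h)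
  · rw [ey s hs, ez s hs, add_sub_add_left_eq_sub, ← duh_sub hν hgy hgz, zero_add,
      ← intervalIntegral.integral_const_mul]
    exact norm_duh_le hν hs.1 (fun r hr => hNL r ⟨hr.1, hr.2.trans hs.2⟩ _ _)
      ((hy.sub hz).norm.const_mul L).continuousOn

/-- Existence for Duhamel's formula, by Picard iteration in a weighted space: the weight `φ` makes
the Duhamel integral a contraction. -/
theorem exists_duhamel {N : ℝ → L2 V → L2 V} (hN : Continuous fun z : ℝ × L2 V => N z.1 z.2)
    {L φ : ℝ → ℝ} (hL : Continuous L) (hL0 : ∀ t, 0 ≤ L t) (hφ : Continuous φ)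
    (hφ1 : ∀ t, 1 ≤ φ t) (hNL : ∀ t a b, ‖N t a - N t b‖ ≤ L t * ‖a - b‖) (hN0 : ∀ t, N t 0 = 0)
    (hLφ : ∀ t, 0 ≤ t → ∫ s in (0 : ℝ)..t, L s * φ s ≤ φ t / 2) (y₀ : L2 V) :
    ∃ y : ℝ → L2 V, Continuous y ∧
      ∀ t, 0 ≤ t → y t = (heat hν t).op y₀ + duh hν (fun s => N s (y s)) t := by
  have hφ0 : ∀ t, 0 < φ t := fun t => zero_lt_one.trans_le (hφ1 t)
  have hgc : ∀ {z : ℝ → L2 V}, Continuous z → Continuous fun s => N s (φ s • z s) :=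
    fun hz => hN.comp (continuous_id.prodMk (hφ.smul hz))
  -- the unknown is `z = y / φ`, extended by its value at `0` to negative times
  let Φ : (ℝ → L2 V) → ℝ → L2 V := fun z t =>
    (φ (max t 0))⁻¹ • ((heat hν (max t 0)).op y₀ + duh hν (fun s => N s (φ s • z s)) (max t 0))
  have hm : Continuous fun t : ℝ => max t 0 := by fun_prop
  have hΦc : ∀ {z : ℝ → L2 V}, Continuous z → Continuous (Φ z) := fun {z} hz =>
    ((hφ.comp hm).inv₀ fun t => (hφ0 _).ne').smul
      (((continuous_heat hν y₀).comp hm).add ((continuous_duh hν (hgc hz)).comp hm))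
  have hdiff : ∀ {z w : ℝ → L2 V} {B : ℝ}, Continuous z → Continuous w → 0 ≤ B →
      (∀ t, ‖z t - w t‖ ≤ B) → ∀ t, ‖Φ z t - Φ w t‖ ≤ 1 / 2 * B := by
    intro z w B hz hw hB hzw t
    have ht : 0 ≤ max t 0 := le_max_right _ _
    have h0 : Φ z t - Φ w t = (φ (max t 0))⁻¹ •
        duh hν (fun s => N s (φ s • z s) - N s (φ s • w s)) (max t 0) := by
      rw [duh_sub hν (hgc hz) (hgc hw), ← smul_sub, add_sub_add_left_eq_sub]
    rw [h0, norm_smul, norm_inv, Real.norm_of_nonneg (hφ0 _).le, inv_mul_le_iff₀ (hφ0 _)]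
    have h1 := norm_duh_le hν (g := fun s => N s (φ s • z s) - N s (φ s • w s))
      (b := fun s => L s * φ s * B) ht (fun s _ => ?_)
      ((hL.mul hφ).mul continuous_const).continuousOn
    · refine h1.trans ?_
      rw [intervalIntegral.integral_mul_const]
      have := mul_le_mul_of_nonneg_right (hLφ _ ht) hB
      linarith
    · have h3 : ‖φ s • z s - φ s • w s‖ = φ s * ‖z s - w s‖ := by
        rw [← smul_sub, norm_smul, Real.norm_of_nonneg (hφ0 s).le]
      calc _ ≤ L s * ‖φ s • z s - φ s • w s‖ := hNL s _ _
        _ = L s * φ s * ‖z s - w s‖ := by rw [h3, mul_assoc]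
        _ ≤ _ := mul_le_mul_of_nonneg_left (hzw s) (mul_nonneg (hL0 s) (hφ0 s).le)
  have hΦ0 : ∀ t, ‖Φ (fun _ => 0) t‖ ≤ ‖y₀‖ := by
    intro t
    have h1 : Φ (fun _ => 0) t = (φ (max t 0))⁻¹ • (heat hν (max t 0)).op y₀ := by
      simp [Φ, duh, hN0]
    rw [h1, norm_smul, norm_inv, Real.norm_of_nonneg (hφ0 _).le]
    calc _ ≤ 1 * ‖y₀‖ := mul_le_mul (inv_le_one_of_one_le₀ (hφ1 _)) (norm_heat_le hν _ _)
          (norm_nonneg _) zero_le_one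
      _ = _ := one_mul _
  let ΦB : BoundedContinuousFunction ℝ (L2 V) → BoundedContinuousFunction ℝ (L2 V) := fun z =>
    BoundedContinuousFunction.ofNormedAddCommGroup (Φ z) (hΦc z.continuous)
      (1 / 2 * ‖z‖ + ‖y₀‖) (fun t => by
        have h1 := hdiff z.continuous (continuous_const (y := (0 : L2 V))) (norm_nonneg z)
          (fun s => by rw [sub_zero]; exact z.norm_coe_le_norm s) t
        have h2 := norm_add_le (Φ z t - Φ (fun _ => 0) t) (Φ (fun _ => 0) t)
        rw [sub_add_cancel] at h2
        linarith [hΦ0 t])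
  have hcontr : ContractingWith (1 / 2) ΦB := by
    refine ⟨by norm_num, LipschitzWith.of_dist_le_mul fun z w => ?_⟩
    rw [BoundedContinuousFunction.dist_le (by positivity)]
    intro t
    rw [dist_eq_norm]
    have h := hdiff z.continuous w.continuous dist_nonneg
      (fun s => by rw [← dist_eq_norm]; exact z.dist_coe_le_dist s) t
    change ‖Φ z t - Φ w t‖ ≤ _
    simpa using h
  obtain ⟨z, hz⟩ : ∃ z, ΦB z = z := ⟨_, hcontr.fixedPoint_isFixedPt⟩
  refine ⟨fun t => φ t • z t, hφ.smul z.continuous, fun t ht => ?_⟩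
  have h1 : z t = Φ z t := congrArg (fun f : BoundedContinuousFunction ℝ (L2 V) => f t) hz.symm
  simp only [Φ, max_eq_left ht] at h1
  change φ t • z t = _
  rw [h1, smul_inv_smul₀ (hφ0 t).ne']

end

/-! ### Quadratic forms of multipliers -/

section

variable {V : Type*} [NormedAddCommGroup V] [InnerProductSpace ℂ V] [CompleteSpace V]
  {W : Type*} [NormedAddCommGroup W] [InnerProductSpace ℂ W] [CompleteSpace W]

theorem re_inner_op (M N : Mult V W) {m : E3 → ℝ}
    (h : ∀ ξ v, (inner ℂ (M.sym ξ v) (N.sym ξ v)).re = m ξ * ‖v‖ ^ 2) (w : L2 V) :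
    Integrable (fun ξ => m ξ * ‖w ξ‖ ^ 2) volume ∧
      (inner ℂ (M.op w) (N.op w)).re = ∫ ξ, m ξ * ‖w ξ‖ ^ 2 := by
  have hi := L2.integrable_inner (𝕜 := ℂ) (M.op w) (N.op w)
  have hae : (fun ξ => RCLike.re (inner ℂ (M.op w ξ) (N.op w ξ)))
      =ᵐ[volume] fun ξ => m ξ * ‖w ξ‖ ^ 2 := by
    filter_upwards [M.op_coe w, N.op_coe w] with ξ h1 h2
    rw [h1, h2]
    exact h ξ _
  refine ⟨hi.re.congr hae, ?_⟩
  rw [L2.inner_def]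
  have h3 := integral_re hi
  rw [← integral_congr_ae hae]
  exact h3.symm

theorem norm_sq_op (M : Mult V W) {m : E3 → ℝ} (h : ∀ ξ v, ‖M.sym ξ v‖ ^ 2 = m ξ * ‖v‖ ^ 2)
    (w : L2 V) : Integrable (fun ξ => m ξ * ‖w ξ‖ ^ 2) volume ∧
      ‖M.op w‖ ^ 2 = ∫ ξ, m ξ * ‖w ξ‖ ^ 2 := by
  have h1 := re_inner_op M M (m := m) (fun ξ v => by
    rw [← h, ← inner_self_eq_norm_sq (𝕜 := ℂ)]
    rfl) w
  refine ⟨h1.1, ?_⟩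
  rw [← h1.2, ← inner_self_eq_norm_sq (𝕜 := ℂ)]
  rfl

/-- Real scalar symbols give symmetric operators. -/
theorem inner_scal_symm (M N : Mult V V) {c d : E3 → ℝ} (hM : ∀ ξ v, M.sym ξ v = (c ξ : ℂ) • v)
    (hN : ∀ ξ v, N.sym ξ v = (d ξ : ℂ) • v) (a b : L2 V) :
    (inner ℂ (M.op a) (N.op b)).re = (inner ℂ (M.op b) (N.op a)).re := by
  have h1 : inner ℂ (M.op a) (N.op b) = inner ℂ (N.op a) (M.op b) := by
    rw [L2.inner_def, L2.inner_def]
    refine integral_congr_ae ?_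
    filter_upwards [M.op_coe a, N.op_coe a, M.op_coe b, N.op_coe b] with ξ h1 h2 h3 h4
    rw [h1, h2, h3, h4, hM, hN, hM, hN]
    simp only [inner_smul_left, inner_smul_right, Complex.conj_ofReal]
    ring
  rw [h1, ← inner_conj_symm, Complex.conj_re]

end

theorem Mult.op_smul {V W : Type*} [NormedAddCommGroup V] [NormedSpace ℂ V]
    [NormedAddCommGroup W] [NormedSpace ℂ W] (M : Mult V W) (c : ℝ) (f : L2 V) :
    M.op (c • f) = c • M.op f := map_smul _ _ _

/-! ### The energy -/

/-- Twice the energy, `∫ |u|² + α² ∫ |∇u|²`, of the field `u = 𝓕⁻ ((1 + |ξ|)⁻² w)`. -/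
def en (α : ℝ) (w : L2 C3) : ℝ :=
  (inner ℂ ((lapMult 1 (α ^ 2)).op w) ((wt 2).op w)).re

/-- The dissipation `∫ |∇u|² + α² ∫ |Δu|²` of the field `u = 𝓕⁻ ((1 + |ξ|)⁻² w)`. -/
def dis (α : ℝ) (w : L2 C3) : ℝ :=
  (inner ℂ ((lapMult 1 (α ^ 2)).op w) ((lapMult 0 1).op w)).re

theorem continuous_en (α : ℝ) : Continuous (en α) :=
  Complex.continuous_re.comp (((Mult.op _).continuous).inner ((Mult.op _).continuous))

theorem continuous_dis (α : ℝ) : Continuous (dis α) :=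
  Complex.continuous_re.comp (((Mult.op _).continuous).inner ((Mult.op _).continuous))

theorem re_inner_real_smul {V : Type*} [NormedAddCommGroup V] [InnerProductSpace ℂ V] (c d : ℝ)
    (v : V) : (inner ℂ ((c : ℂ) • v) ((d : ℂ) • v)).re = c * d * ‖v‖ ^ 2 := by
  rw [inner_smul_left, inner_smul_right, Complex.conj_ofReal, ← inner_self_eq_norm_sq (𝕜 := ℂ),
    ← mul_assoc, ← Complex.ofReal_mul, Complex.re_ofReal_mul]
  rfl

theorem en_eq (α : ℝ) (w : L2 C3) :
    Integrable (fun ξ => (1 + α ^ 2 * lap ξ) * (rho ξ ^ 4)⁻¹ * ‖w ξ‖ ^ 2) volume ∧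
      en α w = ∫ ξ, (1 + α ^ 2 * lap ξ) * (rho ξ ^ 4)⁻¹ * ‖w ξ‖ ^ 2 := by
  refine re_inner_op _ _ (fun ξ v => ?_) w
  rw [lapMult_sym, wt_sym]
  have h1 : ((rho ξ : ℂ) ^ 2)⁻¹ = (((rho ξ ^ 2)⁻¹ : ℝ) : ℂ) := by push_cast; rfl
  rw [h1, ← Complex.ofReal_mul, re_inner_real_smul]
  have := (rho_pos ξ).ne'
  congr 1
  field_simp

theorem dis_eq (α : ℝ) (w : L2 C3) :
    Integrable (fun ξ => (1 + α ^ 2 * lap ξ) * lap ξ * (rho ξ ^ 4)⁻¹ * ‖w ξ‖ ^ 2) volume ∧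
      dis α w = ∫ ξ, (1 + α ^ 2 * lap ξ) * lap ξ * (rho ξ ^ 4)⁻¹ * ‖w ξ‖ ^ 2 := by
  refine re_inner_op _ _ (fun ξ v => ?_) w
  rw [lapMult_sym, lapMult_sym]
  have h1 : ((rho ξ : ℂ) ^ 2)⁻¹ = (((rho ξ ^ 2)⁻¹ : ℝ) : ℂ) := by push_cast; rfl
  rw [h1, ← Complex.ofReal_mul, ← Complex.ofReal_mul, re_inner_real_smul]
  have := (rho_pos ξ).ne'
  congr 1
  field_simp
  ring

theorem dis_nonneg (α : ℝ) (w : L2 C3) : 0 ≤ dis α w := by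
  rw [(dis_eq α w).2]
  refine integral_nonneg fun ξ => ?_
  have := lap_nonneg ξ
  have := rho_pos ξ
  positivity

/-- The energy controls the `H¹` norm. -/
theorem norm_sq_wt_one_le {α : ℝ} (hα : 0 < α) (w : L2 C3) :
    ‖(wt 1).op w‖ ^ 2 ≤ 2 * (1 + 1 / α ^ 2) * en α w := by
  have h1 := norm_sq_op (wt 1 : Mult C3 C3) (m := fun ξ => (rho ξ ^ 2)⁻¹) (fun ξ v => by
    rw [wt_sym, norm_smul, norm_inv, norm_pow, norm_rho, pow_one, mul_pow, inv_pow]) w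
  have h2 := en_eq α w
  rw [h1.2, h2.2, ← integral_const_mul]
  refine integral_mono h1.1 (h2.1.const_mul _) fun ξ => ?_
  have h3 := rho_sq_le ξ
  have h4 := rho_pos ξ
  have h5 := lap_nonneg ξ
  simp only
  rw [← mul_assoc, ← mul_assoc]
  refine mul_le_mul_of_nonneg_right ?_ (sq_nonneg _)
  rw [inv_eq_one_div, ← div_eq_mul_inv, div_le_div_iff₀ (by positivity) (by positivity)]
  have h6 : rho ξ ^ 2 ≤ 2 * (1 + 1 / α ^ 2) * (1 + α ^ 2 * lap ξ) := by
    have : 2 * (1 + 1 / α ^ 2) * (1 + α ^ 2 * lap ξ)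
        = 2 + 2 * lap ξ + 2 * (α ^ 2 * lap ξ + 1 / α ^ 2) := by
      field_simp
      ring
    rw [this]
    have : 0 ≤ α ^ 2 * lap ξ + 1 / α ^ 2 := by positivity
    linarith
  nlinarith [sq_nonneg (rho ξ)]

/-- The energy is differentiable along curves that are continuous in `H²` and differentiable in
`L²`: it is a symmetric form that pairs `H²` with `L²`. -/
theorem hasDerivWithinAt_en {α : ℝ} {y : ℝ → L2 C3} {y' : L2 C3} {S : Set ℝ} {t : ℝ}
    (ht : t ∈ S) (hy : ContinuousOn y S)
    (h : HasDerivWithinAt (fun s => (wt 2).op (y s)) y' S t) :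
    HasDerivWithinAt (fun s => en α (y s))
      (2 * (inner ℂ ((lapMult 1 (α ^ 2)).op (y t)) y').re) S t := by
  rw [hasDerivWithinAt_iff_tendsto_slope] at h ⊢
  have h1 : Tendsto (fun s => (lapMult 1 (α ^ 2)).op (y s + y t)) (𝓝[S \ {t}] t)
      (𝓝 ((lapMult 1 (α ^ 2)).op (y t + y t))) :=
    ((Mult.op _).continuous.tendsto _).comp
      (((hy t ht).mono_left (nhdsWithin_mono _ sdiff_subset)).add tendsto_const_nhds)
  have h2 := (Complex.continuous_re.tendsto _).comp (h1.inner (𝕜 := ℂ) h)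
  have h3 : (inner ℂ ((lapMult 1 (α ^ 2)).op (y t + y t)) y').re
      = 2 * (inner ℂ ((lapMult 1 (α ^ 2)).op (y t)) y').re := by
    rw [map_add, inner_add_left, Complex.add_re, two_mul]
  rw [h3] at h2
  refine h2.congr fun s => ?_
  simp only [Function.comp]
  rw [slope_def_module, slope_def_field, inner_smul_right_eq_smul, ← map_sub]
  have h4 := inner_scal_symm (lapMult 1 (α ^ 2) : Mult C3 C3) (wt 2)
    (c := fun ξ => (1 + α ^ 2 * lap ξ) * (rho ξ ^ 2)⁻¹) (d := fun ξ => (rho ξ ^ 2)⁻¹)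
    (fun ξ v => by rw [lapMult_sym]; push_cast; rfl) (fun ξ v => by rw [wt_sym]; push_cast; rfl)
    (y s) (y t)
  rw [Complex.smul_re, map_add, map_sub, inner_sub_right, inner_add_left, inner_add_left,
    Complex.sub_re, Complex.add_re, Complex.add_re, h4, smul_eq_mul, div_eq_inv_mul]
  unfold en
  ring

/-! ### The nonlinear term -/

section

variable {α : ℝ} (hα : 0 < α)

/-- The nonlinear term `-P div (bar (u ⊗ u))` in the Fourier coordinates of `H²`. -/
def NL (w : L2 C3) : L2 C3 := -(nonlin hα 0 (Nat.zero_le 1)).op (K 0 w w)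

theorem continuous_K_self (n : ℕ) : Continuous fun w : L2 C3 => K n w w :=
  (K n).continuous.clm_apply continuous_id

theorem continuous_NL : Continuous (NL hα) :=
  ((Mult.op _).continuous.comp (continuous_K_self 0)).neg

theorem NL_sub (a b : L2 C3) : NL hα a - NL hα b
    = -(nonlin hα 0 (Nat.zero_le 1)).op (K 0 (a - b) a + K 0 b (a - b)) := by
  unfold NL
  simp only [map_sub, map_add, sub_apply]
  abel

theorem exists_norm_NL_sub_le : ∃ C, 0 ≤ C ∧ ∀ a b : L2 C3,
    ‖NL hα a - NL hα b‖ ≤ C * (‖a‖ + ‖b‖) * ‖a - b‖ := by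
  obtain ⟨C, hC0, hC⟩ := (nonlin hα 0 (Nat.zero_le 1)).exists_norm_op_le
  refine ⟨C * (2 ^ 3 * embC), mul_nonneg hC0 (mul_nonneg (by norm_num) embC_nonneg), fun a b => ?_⟩
  rw [NL_sub, norm_neg]
  refine (hC _).trans ?_
  rw [mul_assoc, mul_assoc]
  refine mul_le_mul_of_nonneg_left ?_ hC0
  refine (norm_add_le _ _).trans ?_
  have h1 := norm_K_le 0 (a - b) a
  have h2 := norm_K_le 0 b (a - b)
  rw [zero_add] at h1 h2
  calc _ ≤ _ := add_le_add h1 h2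
    _ = _ := by ring

/-- The nonlinear term is Lipschitz in `L²` on bounded sets of `H²`. -/
theorem exists_norm_wt_NL_sub_le : ∃ C, 0 ≤ C ∧ ∀ a b : L2 C3,
    ‖(wt 2).op (NL hα a - NL hα b)‖ ≤ C * (‖a‖ + ‖b‖) * ‖(wt 2).op (a - b)‖ := by
  obtain ⟨C, hC0, hC⟩ := (nonlin hα 0 (Nat.zero_le 1)).exists_norm_op_le
  refine ⟨C * embC, mul_nonneg hC0 embC_nonneg, fun a b => ?_⟩
  rw [NL_sub, map_neg, norm_neg, ← Mult.op_wt]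
  refine (hC _).trans ?_
  rw [mul_assoc, mul_assoc]
  refine mul_le_mul_of_nonneg_left ?_ hC0
  rw [map_add]
  refine (norm_add_le _ _).trans ?_
  have h1 := norm_wt_two_K_le' (a - b) a
  have h2 := norm_wt_two_K_le b (a - b)
  calc _ ≤ _ := add_le_add h1 h2
    _ = _ := by ring

theorem exists_norm_NL_le : ∃ C, 0 ≤ C ∧ ∀ a : L2 C3,
    ‖NL hα a‖ ≤ C * ‖(wt 1).op a‖ * ‖a‖ := by
  obtain ⟨C, hC0, hC⟩ := (nonlin hα 1 le_rfl).exists_norm_op_le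
  refine ⟨C * (4 * embC), mul_nonneg hC0 (mul_nonneg (by norm_num) embC_nonneg), fun a => ?_⟩
  rw [NL, norm_neg, ← wt_nonlin hα 1 le_rfl, ← Mult.op_wt]
  refine (hC _).trans ?_
  rw [mul_assoc, mul_assoc]
  refine mul_le_mul_of_nonneg_left ?_ hC0
  rw [← mul_assoc]
  exact norm_wt_one_K_le a

theorem NL_smul (c : ℝ) (a : L2 C3) : NL hα (c • a) = c ^ 2 • NL hα a := by
  have h : K 0 (c • a) (c • a) = c ^ 2 • K 0 a a := by
    have h1 : K 0 (c • a) = c • K 0 a := (K 0).map_smul c a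
    have h2 : K 0 a (c • a) = c • K 0 a a := (K 0 a).map_smul c a
    rw [h1, sq, mul_smul, ← h2]
    rfl
  have h3 : (nonlin hα 0 (Nat.zero_le 1)).op (c ^ 2 • K 0 a a)
      = c ^ 2 • (nonlin hα 0 (Nat.zero_le 1)).op (K 0 a a) := Mult.op_smul _ _ _
  unfold NL
  rw [h, h3]
  exact (smul_neg _ _).symm

theorem herm_NL (a : L2 C3) : herm (NL hα a) = NL hα (herm a) := by
  rw [NL, map_neg, herm_nonlin, herm_K, NL]

theorem leray_NL (a : L2 C3) : leray.op (NL hα a) = NL hα a := by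
  rw [NL, map_neg, leray_nonlin]

/-- The energy decreases along the solutions of the equation, at the rate `2ν` times the
dissipation; the nonlinear term may be multiplied by a scalar. -/
theorem energy_hasDerivWithinAt {ν : ℝ} (hν : 0 < ν) {y g : ℝ → L2 C3} {y₀ : L2 C3}
    (hyc : ContinuousOn y (Ici 0)) (hg : Continuous g)
    (h : ∀ t, 0 ≤ t → y t = (heat hν t).op y₀ + duh hν g t) {t c : ℝ} (ht : 0 ≤ t)
    (hgt : g t = c • NL hα (y t)) (hP : leray.op (y t) = y t) (hH : herm (y t) = y t) :
    HasDerivWithinAt (fun s => en α (y s)) (-(2 * ν * dis α (y t))) (Ici 0) t := by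
  have h1 := hasDerivWithinAt_en (α := α) ht hyc (duhamel_hasDerivWithinAt hν hg h ht)
  have h2 : (inner ℂ ((lapMult 1 (α ^ 2)).op (y t)) ((wt 2).op (g t))).re = 0 := by
    rw [hgt, map_smul, NL, map_neg, smul_neg, inner_neg_right, inner_smul_right_eq_smul,
      inner_nonlin hα hP hH, smul_zero, neg_zero, Complex.zero_re]
  have h3 : (lapMult 0 ν).op (y t) = ν • (lapMult 0 1).op (y t) := by
    refine Lp.ext ?_
    filter_upwards [(lapMult 0 ν : Mult C3 C3).op_coe (y t),
      (lapMult 0 1 : Mult C3 C3).op_coe (y t), Lp.coeFn_smul ν ((lapMult 0 1).op (y t))]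
      with ξ g1 g2 g3
    rw [g1, g3, Pi.smul_apply, g2, lapMult_sym, lapMult_sym, ← Complex.coe_smul, smul_smul]
    congr 1
    push_cast
    ring
  rw [inner_add_right, Complex.add_re, h2, add_zero, inner_neg_right, h3,
    inner_smul_right_eq_smul, Complex.neg_re, Complex.smul_re, smul_eq_mul] at h1
  refine h1.congr_deriv ?_
  unfold dis
  ring

end

/-! ### The radial retraction on a ball -/

section

variable {X : Type*} [NormedAddCommGroup X] [NormedSpace ℝ X]

/-- The radial retraction on the ball of radius `R`. -/
def rad (R : ℝ) (a : X) : X := (R / max R ‖a‖) • a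

theorem rad_of_le {R : ℝ} (hR : 0 < R) {a : X} (h : ‖a‖ ≤ R) : rad R a = a := by
  rw [rad, max_eq_left h, div_self hR.ne', one_smul]

theorem norm_rad_le {R : ℝ} (hR : 0 < R) (a : X) : ‖rad R a‖ ≤ R := by
  have hm : 0 < max R ‖a‖ := hR.trans_le (le_max_left _ _)
  rw [rad, norm_smul, Real.norm_of_nonneg (div_nonneg hR.le hm.le), div_mul_eq_mul_div,
    div_le_iff₀ hm]
  exact mul_le_mul_of_nonneg_left (le_max_right _ _) hR.le

theorem norm_rad_sub_le {R : ℝ} (hR : 0 < R) (a b : X) : ‖rad R a - rad R b‖ ≤ 2 * ‖a - b‖ := by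
  set p := max R ‖a‖ with hp
  set q := max R ‖b‖ with hq
  have hp0 : 0 < p := hR.trans_le (le_max_left _ _)
  have hq0 : 0 < q := hR.trans_le (le_max_left _ _)
  have h1 : rad R a - rad R b = (R / p) • (a - b) + (R / p - R / q) • b := by
    simp only [rad, ← hp, ← hq]
    rw [smul_sub, sub_smul]
    abel
  have h2 : |p - q| ≤ ‖a - b‖ := by
    have h3 : |p - q| ≤ max |R - R| |‖a‖ - ‖b‖| := abs_max_sub_max_le_max _ _ _ _
    rw [sub_self, abs_zero, max_eq_right (abs_nonneg _)] at h3
    exact h3.trans (abs_norm_sub_norm_le a b)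
  have h4 : |R / p - R / q| * ‖b‖ ≤ |p - q| := by
    have h5 : R / p - R / q = -(R * (p - q)) / (p * q) := by
      field_simp
      ring
    rw [h5, abs_div, abs_neg, abs_mul, abs_of_pos hR, abs_of_pos (mul_pos hp0 hq0),
      div_mul_eq_mul_div, div_le_iff₀ (mul_pos hp0 hq0)]
    have h6 : R * ‖b‖ ≤ p * q := mul_le_mul (le_max_left _ _) (le_max_right _ _) (norm_nonneg _)
      hp0.le
    calc R * |p - q| * ‖b‖ = |p - q| * (R * ‖b‖) := by ring
      _ ≤ _ := mul_le_mul_of_nonneg_left h6 (abs_nonneg _)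
  rw [h1]
  refine (norm_add_le _ _).trans ?_
  rw [norm_smul, norm_smul, Real.norm_eq_abs, Real.norm_eq_abs]
  have h7 : |R / p| ≤ 1 := by
    rw [abs_of_pos (div_pos hR hp0)]
    exact div_le_one_of_le₀ (le_max_left _ _) hp0.le
  have h8 := mul_le_mul_of_nonneg_right h7 (norm_nonneg (a - b))
  linarith

theorem continuous_rad {Z : Type*} [TopologicalSpace Z] {R : Z → ℝ} {a : Z → X} (hR : Continuous R)
    (hR0 : ∀ z, 0 < R z) (ha : Continuous a) : Continuous fun z => rad (R z) (a z) :=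
  (hR.div (hR.max ha.norm) fun z => ((hR0 z).trans_le (le_max_left _ _)).ne').smul ha

end

/-! ### Global existence -/

section

variable {α ν : ℝ} (hα : 0 < α) (hν : 0 < ν)

theorem NL_rad (R : ℝ) (a : L2 C3) :
    NL hα (rad R a) = (R / max R ‖a‖) ^ 2 • NL hα a := NL_smul hα _ a

theorem herm_rad (R : ℝ) (a : L2 C3) : herm (rad R a) = rad R (herm a) := by
  rw [rad, rad, norm_herm]
  exact herm.map_smul _ a

theorem continuous_truncated {Z : Type*} [TopologicalSpace Z] {r b : ℝ} (hr : 0 < r) {f : Z → ℝ}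
    {y : Z → L2 C3} (hf : Continuous f) (hy : Continuous y) :
    Continuous fun z => NL hα (rad (r * Real.exp (b * f z)) (y z)) := by
  have h1 : Continuous fun z => r * Real.exp (b * f z) := by fun_prop
  exact (continuous_NL hα).comp (continuous_rad h1 (fun z => by positivity) hy)

/-- Solutions of the equation with a nonlinear term truncated outside the ball of radius
`r exp (b t)`.  The truncated term is Lipschitz with a constant that grows exponentially in time,
so that the weight in the Picard iteration is a double exponential. -/
theorem exists_truncated {r b : ℝ} (hr : 0 < r) (hb : 0 < b) {w₀ : L2 C3}
    (hP₀ : leray.op w₀ = w₀) (hH₀ : herm w₀ = w₀) :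
    ∃ y : ℝ → L2 C3, Continuous y ∧
      (∀ t, 0 ≤ t → y t = (heat hν t).op w₀
        + duh hν (fun s => NL hα (rad (r * Real.exp (b * s)) (y s))) t) ∧
      ∀ t, 0 ≤ t → leray.op (y t) = y t ∧ herm (y t) = y t := by
  obtain ⟨C, hC0, hC⟩ := exists_norm_NL_sub_le hα
  have hNc : Continuous fun z : ℝ × L2 C3 => NL hα (rad (r * Real.exp (b * z.1)) z.2) :=
    continuous_truncated hα hr continuous_fst continuous_snd
  have hR0 : ∀ t, 0 < r * Real.exp (b * t) := fun t => by positivity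
  have hNL : ∀ t (a c : L2 C3), ‖NL hα (rad (r * Real.exp (b * t)) a)
      - NL hα (rad (r * Real.exp (b * t)) c)‖ ≤ 4 * C * (r * Real.exp (b * t)) * ‖a - c‖ := by
    intro t a c
    refine (hC _ _).trans ?_
    have h1 := norm_rad_le (hR0 t) a
    have h2 := norm_rad_le (hR0 t) c
    have h3 := norm_rad_sub_le (hR0 t) a c
    calc _ ≤ C * (r * Real.exp (b * t) + r * Real.exp (b * t)) * (2 * ‖a - c‖) := by gcongr
      _ = _ := by ring
  -- with `φ t = exp (8 C r / b * exp (b t))`, the function `φ / 2` is a primitive of `L φ`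
  have hφd : ∀ t, HasDerivAt (fun t => Real.exp (8 * C * r / b * Real.exp (b * t)) / 2)
      (4 * C * (r * Real.exp (b * t)) * Real.exp (8 * C * r / b * Real.exp (b * t))) t := by
    intro t
    have h1 : HasDerivAt (fun t => Real.exp (b * t)) (Real.exp (b * t) * b) t := by
      simpa using ((hasDerivAt_id t).const_mul b).exp
    refine (((h1.const_mul (8 * C * r / b)).exp).div_const 2).congr_deriv ?_
    field_simp
    ring
  have hφ1 : ∀ t, 1 ≤ Real.exp (8 * C * r / b * Real.exp (b * t)) :=
    fun t => Real.one_le_exp (by positivity)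
  obtain ⟨y, hyc, hy⟩ := exists_duhamel hν (N := fun t a => NL hα (rad (r * Real.exp (b * t)) a))
    (L := fun t => 4 * C * (r * Real.exp (b * t)))
    (φ := fun t => Real.exp (8 * C * r / b * Real.exp (b * t)))
    hNc (by fun_prop) (fun t => by positivity) (by fun_prop) hφ1 hNL
    (fun t => by simp [rad, NL]) (fun t _ => by
      rw [intervalIntegral.integral_eq_sub_of_hasDerivAt (fun s _ => hφd s)
        (Continuous.intervalIntegrable (by fun_prop) _ _)]
      linarith [hφ1 0]) w₀
  have hgc : Continuous fun s => NL hα (rad (r * Real.exp (b * s)) (y s)) :=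
    continuous_truncated hα hr continuous_id hyc
  refine ⟨y, hyc, hy, fun τ hτ => ⟨?_, ?_⟩⟩
  · rw [hy τ hτ, map_add, Mult.op_heat, hP₀, map_duh hν _ (fun t f => Mult.op_heat _ hν t f) hgc]
    simp only [leray_NL]
  -- `herm y` solves the same equation as `y`
  · refine duhamel_unique hν (N := fun t a => NL hα (rad (r * Real.exp (b * t)) a))
      (y := fun s => herm (y s)) (z := y) hNc (τ := τ)
      -- the summand `1` keeps the Lipschitz constant positive when `C = 0`
      (L := 4 * C * (r * Real.exp (b * τ)) + 1) (by positivity)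
      (fun t ht a c => (hNL t a c).trans ?_) (herm.continuous.comp hyc) hyc (y₀ := w₀)
      (fun t ht => ?_) (fun t ht => hy t ht.1) τ ⟨hτ, le_rfl⟩
    · refine mul_le_mul_of_nonneg_right ?_ (norm_nonneg _)
      have h1 : Real.exp (b * t) ≤ Real.exp (b * τ) :=
        Real.exp_le_exp.2 (mul_le_mul_of_nonneg_left ht.2 hb.le)
      have h2 : 4 * C * (r * Real.exp (b * t)) ≤ 4 * C * (r * Real.exp (b * τ)) := by gcongr
      linarith
    · have h1 : herm (y t) = (heat hν t).op w₀
          + herm (duh hν (fun s => NL hα (rad (r * Real.exp (b * s)) (y s))) t) := by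
        conv_lhs => rw [hy t ht.1]
        rw [map_add, herm_heat, hH₀]
      rw [h1, map_duh hν herm (fun t f => herm_heat hν t f) hgc]
      simp only [herm_NL, herm_rad]

/-- The energy does not increase, even when the nonlinear term is multiplied by a scalar that
depends on time, as it is by the truncation. -/
theorem en_le {y g : ℝ → L2 C3} {w₀ : L2 C3} (hyc : Continuous y) (hg : Continuous g)
    (h : ∀ t, 0 ≤ t → y t = (heat hν t).op w₀ + duh hν g t) {c : ℝ → ℝ}
    (hgt : ∀ t, 0 ≤ t → g t = c t • NL hα (y t))
    (hPH : ∀ t, 0 ≤ t → leray.op (y t) = y t ∧ herm (y t) = y t) {t : ℝ} (ht : 0 ≤ t) :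
    en α (y t) ≤ en α w₀ := by
  have hda : ∀ t, 0 < t → HasDerivAt (fun s => en α (y s)) (-(2 * ν * dis α (y t))) t :=
    fun t ht => (energy_hasDerivWithinAt hα hν hyc.continuousOn hg h ht.le (hgt t ht.le)
      (hPH t ht.le).1 (hPH t ht.le).2).hasDerivAt (Ici_mem_nhds ht)
  have hanti : AntitoneOn (fun s => en α (y s)) (Ici 0) := by
    refine antitoneOn_of_deriv_nonpos (convex_Ici 0)
      ((continuous_en α).comp hyc).continuousOn (fun t ht => ?_) (fun t ht => ?_)
    · rw [interior_Ici] at ht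
      exact (hda t ht).differentiableAt.differentiableWithinAt
    · rw [interior_Ici] at ht
      rw [(hda t ht).deriv, neg_nonpos]
      exact mul_nonneg (by positivity) (dis_nonneg _ _)
  have h1 := hanti (mem_Ici.2 le_rfl) (mem_Ici.2 ht) ht
  have h2 : y 0 = w₀ := by
    rw [h 0 le_rfl, heat_zero, duh, intervalIntegral.integral_same, add_zero]
  simpa only [h2] using h1

/-- Global existence for the equation in Duhamel's form.  The energy bound and the tame estimate of
the nonlinear term show that the solution of a truncated equation stays inside the ball where
nothing is truncated. -/
theorem exists_global {w₀ : L2 C3} (hP₀ : leray.op w₀ = w₀) (hH₀ : herm w₀ = w₀) :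
    ∃ w : ℝ → L2 C3, Continuous w ∧
      (∀ t, 0 ≤ t → w t = (heat hν t).op w₀ + duh hν (fun s => NL hα (w s)) t) ∧
      ∀ t, 0 ≤ t → leray.op (w t) = w t ∧ herm (w t) = w t := by
  obtain ⟨D, hD0, hD⟩ := exists_norm_NL_le hα
  obtain ⟨M, hM0, hM⟩ : ∃ M : ℝ, 0 ≤ M ∧ ∀ a : L2 C3, en α a ≤ en α w₀ → ‖(wt 1).op a‖ ≤ M := by
    refine ⟨Real.sqrt (2 * (1 + 1 / α ^ 2) * en α w₀), Real.sqrt_nonneg _, fun a ha => ?_⟩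
    refine Real.le_sqrt_of_sq_le ((norm_sq_wt_one_le hα a).trans ?_)
    exact mul_le_mul_of_nonneg_left ha (by positivity)
  -- The truncated term is at most `(D M + 1) ‖y‖`, and Gronwall's inequality bounds `‖y t‖` by the
  -- radius `(‖w₀‖ + 1) exp ((D M + 1) t)` at which the term is truncated.
  have hb : 0 < D * M + 1 := by positivity
  have hr : 0 < ‖w₀‖ + 1 := by positivity
  obtain ⟨y, hyc, hy, hPH⟩ := exists_truncated hα hν hr hb hP₀ hH₀
  have hgc : Continuous fun s => NL hα (rad ((‖w₀‖ + 1) * Real.exp ((D * M + 1) * s)) (y s)) :=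
    continuous_truncated hα hr continuous_id hyc
  have hR0 : ∀ t, 0 < (‖w₀‖ + 1) * Real.exp ((D * M + 1) * t) := fun t => by positivity
  have hH1 : ∀ t, 0 ≤ t → ‖(wt 1).op (y t)‖ ≤ M := fun t ht =>
    hM _ (en_le hα hν hyc hgc hy (fun t _ => NL_rad hα _ (y t)) hPH ht)
  have hNy : ∀ t, 0 ≤ t → ‖NL hα (rad ((‖w₀‖ + 1) * Real.exp ((D * M + 1) * t)) (y t))‖
      ≤ (D * M + 1) * ‖y t‖ := by
    intro t ht
    have hR := hR0 t
    generalize (‖w₀‖ + 1) * Real.exp ((D * M + 1) * t) = R at hR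
    rw [NL_rad, norm_smul, Real.norm_of_nonneg (sq_nonneg _)]
    have hm : 0 < max R ‖y t‖ := hR.trans_le (le_max_left _ _)
    have hθ1 : (R / max R ‖y t‖) ^ 2 ≤ 1 :=
      pow_le_one₀ (div_nonneg hR.le hm.le) (div_le_one_of_le₀ (le_max_left _ _) hm.le)
    calc _ ≤ 1 * ‖NL hα (y t)‖ := mul_le_mul_of_nonneg_right hθ1 (norm_nonneg _)
      _ ≤ D * ‖(wt 1).op (y t)‖ * ‖y t‖ := by rw [one_mul]; exact hD _
      _ ≤ D * M * ‖y t‖ := by gcongr; exact hH1 t ht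
      _ ≤ _ := mul_le_mul_of_nonneg_right (by linarith) (norm_nonneg _)
  have hbound : ∀ t, 0 ≤ t → ‖y t‖ ≤ (‖w₀‖ + 1) * Real.exp ((D * M + 1) * t) := by
    intro t ht
    have h := gronwall_integral (f := fun s => ‖y s‖) (a := ‖w₀‖) (τ := t) hb
      hyc.norm.continuousOn (fun _ _ => norm_nonneg _) (fun s hs => ?_) t ⟨ht, le_rfl⟩
    · refine h.trans (mul_le_mul_of_nonneg_right (by linarith) (Real.exp_pos _).le)
    · conv_lhs => rw [hy s hs.1]
      refine (norm_add_le _ _).trans (add_le_add (norm_heat_le hν _ _) ?_)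
      rw [← intervalIntegral.integral_const_mul]
      exact norm_duh_le hν hs.1 (fun r hr => hNy r hr.1) (hyc.norm.const_mul _).continuousOn
  refine ⟨y, hyc, fun t ht => ?_, hPH⟩
  conv_lhs => rw [hy t ht]
  congr 1
  refine duh_congr hν ht fun s hs => ?_
  rw [rad_of_le (hR0 s) (hbound s hs.1)]

end

/-! ### Pointwise derivatives -/

section

variable {V : Type*} [NormedAddCommGroup V] [InnerProductSpace ℂ V] [CompleteSpace V]
  {F : Type*} [NormedAddCommGroup F] [NormedSpace ℝ F]

/-- The partial derivative `∂ₖ`, with the weight `(1 + |ξ|)⁻¹`. -/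
def dmul (k : Fin 3) : Mult V V :=
  Mult.scal (fun ξ => dsym k ξ * ((rho ξ : ℂ) ^ 1)⁻¹)
    ((continuous_dsym k).measurable.mul (measurable_inv_rho_pow 1)) ⟨2 * Real.pi, fun ξ => by
      rw [norm_mul, norm_inv, norm_pow, norm_rho, pow_one, ← div_eq_mul_inv,
        div_le_iff₀ (rho_pos ξ)]
      exact norm_dsym_le k ξ⟩

@[simp] theorem dmul_sym (k : Fin 3) (ξ : E3) (v : V) :
    (dmul k).sym ξ v = (dsym k ξ * ((rho ξ : ℂ) ^ 1)⁻¹) • v := rfl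

theorem integrable_norm_mul_wt (f : L2 V) :
    Integrable (fun ξ => ‖ξ‖ * ‖(wt 2).op ((wt 1).op f) ξ‖) volume := by
  have h1 := (integrable_wt_two f).norm
  refine h1.mono' ?_ ?_
  · exact (continuous_norm.aestronglyMeasurable).mul (Lp.aestronglyMeasurable _).norm
  · rw [wt_wt, add_comm, ← wt_wt]
    filter_upwards [(wt 1 : Mult V V).op_coe ((wt 2).op f)] with ξ h
    rw [h, wt_sym, norm_mul, norm_norm, norm_norm, norm_smul, norm_inv, norm_pow, norm_rho, pow_one,
      ← mul_assoc]
    refine mul_le_of_le_one_left (norm_nonneg _) ?_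
    rw [← div_eq_mul_inv]
    exact div_le_one_of_le₀ (norm_le_rho ξ) (rho_pos ξ).le

theorem sum_coord_smul_e (v : E3) : v = ∑ k, v k • e k := by
  ext i
  simp [e, Finset.sum_apply, Pi.single_apply]

theorem hasFDerivAt_ev (f : L2 V) (x : E3) :
    HasFDerivAt (fun y => ev ((wt 1).op f) y)
      (∑ k, (EuclideanSpace.proj k : E3 →L[ℝ] ℝ).smulRight (ev ((dmul k).op f) x)) x := by
  set h : E3 → V := ((wt 2).op ((wt 1).op f) : E3 → V) with hh
  have h1 : Integrable h volume := integrable_wt_two _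
  have h2 : Integrable (fun ξ => ‖ξ‖ * ‖h ξ‖) volume := integrable_norm_mul_wt f
  have h3 := (Real.hasFDerivAt_fourier h1 h2 (-x)).comp x (hasFDerivAt_id x).neg
  have h4 : (𝓕 h ∘ Neg.neg) = fun y => ev ((wt 1).op f) y := by
    funext y
    rw [ev_apply, Real.fourierInv_eq_fourier_neg]
    rfl
  rw [h4] at h3
  refine h3.congr_fderiv ?_
  have hi : Integrable (VectorFourier.fourierSMulRight (innerSL ℝ) h) volume := by
    refine (h2.const_mul (2 * Real.pi * ‖(innerSL ℝ : E3 →L[ℝ] E3 →L[ℝ] ℝ)‖)).mono'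
      h1.1.fourierSMulRight (Eventually.of_forall fun ξ => ?_)
    exact (VectorFourier.norm_fourierSMulRight_le _ _ _).trans_eq (by ring)
  have hk : ∀ k, (𝓕 (VectorFourier.fourierSMulRight (innerSL ℝ) h) (-x)) (e k)
      = -ev ((dmul k).op f) x := by
    intro k
    rw [Real.fourier_continuousLinearMap_apply hi, ev_apply, Real.fourierInv_eq_fourier_neg,
      ← Pi.neg_apply (f := 𝓕 _)]
    have h5 : (fun ξ => VectorFourier.fourierSMulRight (innerSL ℝ) h ξ (e k))
        =ᵐ[volume] fun ξ => -((wt 2).op ((dmul k).op f)) ξ := by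
      filter_upwards [(wt 2 : Mult V V).op_coe ((wt 1).op f), (wt 1 : Mult V V).op_coe f,
        (wt 2 : Mult V V).op_coe ((dmul k).op f), (dmul k : Mult V V).op_coe f] with ξ g1 g2 g3 g4
      have g5 : innerSL ℝ ξ (e k) = ξ k := by rw [innerSL_apply_apply, inner_e]
      rw [VectorFourier.fourierSMulRight_apply, g5, g3, g4, hh, g1, g2]
      simp only [wt_sym, dmul_sym, smul_smul]
      rw [← Complex.coe_smul, smul_smul, smul_smul, ← neg_smul]
      congr 1
      rw [dsym]
      ring
    rw [Pi.neg_apply, Real.fourier_eq, Real.fourier_eq, ← integral_neg]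
    refine integral_congr_ae ?_
    filter_upwards [h5] with ξ h6
    rw [h6, smul_neg]
  ext v
  conv_lhs => rw [sum_coord_smul_e v]
  rw [map_sum, sum_apply]
  refine Finset.sum_congr rfl fun k _ => ?_
  rw [map_smul, ContinuousLinearMap.comp_apply, ContinuousLinearMap.smulRight_apply]
  change v k • (𝓕 (VectorFourier.fourierSMulRight (innerSL ℝ) h) (-x)) (-(e k)) = v k • _
  rw [map_neg, hk, neg_neg]

variable (T : V →L[ℝ] F)

theorem differentiable_ev (f : L2 V) : Differentiable ℝ fun y => T (ev ((wt 1).op f) y) :=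
  fun x => (T.hasFDerivAt.comp x (hasFDerivAt_ev f x)).differentiableAt

theorem fderiv_ev_apply (f : L2 V) (x v : E3) :
    fderiv ℝ (fun y => T (ev ((wt 1).op f) y)) x v = ∑ k, v k • T (ev ((dmul k).op f) x) := by
  have h := (T.hasFDerivAt.comp x (hasFDerivAt_ev f x)).fderiv
  simp only [Function.comp_def] at h
  rw [h, ContinuousLinearMap.comp_apply, sum_apply, map_sum]
  refine Finset.sum_congr rfl fun k _ => ?_
  rw [ContinuousLinearMap.smulRight_apply, map_smul]
  rfl

theorem pd_ev (k : Fin 3) (f : L2 V) (x : E3) :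
    pd k (fun y => T (ev ((wt 1).op f) y)) x = T (ev ((dmul k).op f) x) := by
  rw [pd, fderiv_ev_apply, Finset.sum_eq_single k]
  · simp [e]
  · intro l _ hl
    simp [e, hl]
  · simp

theorem contDiff_ev (n : ℕ) (f : L2 V) : ContDiff ℝ n fun y => T (ev ((wt n).op f) y) := by
  induction n generalizing f with
  | zero =>
    rw [Nat.cast_zero, contDiff_zero]
    exact T.continuous.comp (ev _).continuous
  | succ n ih =>
    have h1 : (wt (n + 1)).op f = (wt 1).op ((wt n).op f) := by rw [wt_wt, add_comm]
    rw [Nat.cast_succ, h1]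
    refine contDiff_succ_iff_fderiv_apply.2 ⟨differentiable_ev T _, fun h => ?_, fun v => ?_⟩
    · exact absurd h (by simp)
    · simp only [fderiv_ev_apply]
      refine ContDiff.sum fun k _ => contDiff_const.smul ?_
      rw [Mult.op_wt]
      exact ih _

/-- The second derivatives. -/
theorem fderiv_fderiv_ev_apply (f : L2 V) (x v w : E3) :
    fderiv ℝ (fderiv ℝ (fun y => T (ev ((wt 2).op f) y))) x v w
      = ∑ k, w k • ∑ l, v l • T (ev ((dmul l).op ((dmul k).op f)) x) := by
  have hc := contDiff_ev T 2 f
  have hd : DifferentiableAt ℝ (fderiv ℝ (fun y => T (ev ((wt 2).op f) y))) x :=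
    ((hc.fderiv_right (m := 1) (by norm_num)).differentiable (by norm_num)).differentiableAt
  have h1 := fderiv_clm_apply hd (differentiableAt_const w)
  have h2 := congrArg (fun L : E3 →L[ℝ] F => L v) h1
  simp only [fderiv_fun_const, Pi.zero_apply, ContinuousLinearMap.comp_zero, zero_add,
    ContinuousLinearMap.flip_apply] at h2
  rw [← h2]
  have h3 : (fun y => fderiv ℝ (fun y => T (ev ((wt 2).op f) y)) y w)
      = fun y => ∑ k, w k • T (ev ((wt 1).op ((dmul k).op f)) y) := by
    funext y
    have : (wt 2).op f = (wt 1).op ((wt 1).op f) := by rw [wt_wt]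
    rw [this, fderiv_ev_apply]
    refine Finset.sum_congr rfl fun k _ => ?_
    rw [Mult.op_wt]
  have h4 := HasFDerivAt.fun_sum (u := Finset.univ) fun (k : Fin 3) _ =>
    ((differentiable_ev T ((dmul k).op f)).differentiableAt (x := x)).hasFDerivAt.fun_const_smul
      (w k)
  rw [h3, h4.fderiv, sum_apply]
  refine Finset.sum_congr rfl fun k _ => ?_
  rw [smul_apply, fderiv_ev_apply]

theorem pd_pd_ev (k l : Fin 3) (f : L2 V) (x : E3) :
    pd l (pd k (fun y => T (ev ((wt 2).op f) y))) x
      = T (ev ((dmul l).op ((dmul k).op f)) x) := by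
  have h : pd k (fun y => T (ev ((wt 2).op f) y))
      = fun y => T (ev ((wt 1).op ((dmul k).op f)) y) := by
    funext y
    have : (wt 2).op f = (wt 1).op ((wt 1).op f) := by rw [wt_wt]
    rw [this, pd_ev, Mult.op_wt]
  rw [h, pd_ev]

theorem continuousOn_T_ev {G : ℝ → L2 V} {I : Set ℝ} (hG : ContinuousOn G I) :
    ContinuousOn (fun z : ℝ × E3 => T (ev (G z.1) z.2)) (I ×ˢ univ) :=
  T.continuous.comp_continuousOn (continuousOn_ev hG)

theorem continuousOn_fderiv_ev {G : ℝ → L2 V} {I : Set ℝ} (hG : ContinuousOn G I) :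
    ContinuousOn (fun z : ℝ × E3 => fderiv ℝ (fun y => T (ev ((wt 1).op (G z.1)) y)) z.2)
      (I ×ˢ univ) := by
  refine continuousOn_clm_apply.2 fun v => ?_
  simp only [fderiv_ev_apply]
  refine continuousOn_finsetSum _ fun k _ => ContinuousOn.const_smul ?_ _
  exact continuousOn_T_ev T ((Mult.op _).continuous.comp_continuousOn hG)

theorem continuousOn_fderiv_fderiv_ev {G : ℝ → L2 V} {I : Set ℝ} (hG : ContinuousOn G I) :
    ContinuousOn (fun z : ℝ × E3 =>
      fderiv ℝ (fderiv ℝ (fun y => T (ev ((wt 2).op (G z.1)) y))) z.2) (I ×ˢ univ) := by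
  refine continuousOn_clm_apply.2 fun v => continuousOn_clm_apply.2 fun w => ?_
  simp only [fderiv_fderiv_ev_apply]
  refine continuousOn_finsetSum _ fun k _ => ContinuousOn.const_smul ?_ _
  refine continuousOn_finsetSum _ fun l _ => ContinuousOn.const_smul ?_ _
  exact continuousOn_T_ev T ((Mult.op _).continuous.comp_continuousOn
    ((Mult.op _).continuous.comp_continuousOn hG))

end

/-! ### Smoothing -/

section

variable {α ν : ℝ} (hα : 0 < α) (hν : 0 < ν)

theorem wt_succ_nonlin (n : ℕ) (z : L2 C3) :
    (wt (n + 1)).op (-(nonlin hα 1 le_rfl).op (K n z z)) = NL hα ((wt n).op z) := by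
  unfold NL
  rw [← wt_wt, map_neg, wt_nonlin hα 1 le_rfl, ← wt_K, Mult.op_wt]
  exact map_neg _ _

theorem wt_NL (n : ℕ) (z : L2 C3) :
    (wt n).op (-(nonlin hα 0 (Nat.zero_le 1)).op (K n z z)) = NL hα ((wt n).op z) := by
  unfold NL
  rw [← wt_K, Mult.op_wt]
  exact map_neg _ _

theorem continuous_nonlin_K (k : ℕ) (hk : k ≤ 1) (n : ℕ) {z : ℝ → L2 C3} (hz : Continuous z) :
    Continuous fun s => -(nonlin hα k hk).op (K n (z s) (z s)) :=
  ((Mult.op _).continuous.comp ((continuous_K_self n).comp hz)).neg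

/-- Smoothing for positive times: the solution is continuous in every space `Hⁿ⁺²`. -/
theorem exists_lift {w : ℝ → L2 C3} {w₀ : L2 C3} (hwc : Continuous w)
    (hw : ∀ t, 0 ≤ t → w t = (heat hν t).op w₀ + duh hν (fun s => NL hα (w s)) t) (n : ℕ) :
    ∀ ε, 0 < ε → ∃ z : ℝ → L2 C3, Continuous z ∧ ∀ t, ε ≤ t → (wt n).op (z t) = w t := by
  have hgc : Continuous fun s => NL hα (w s) := (continuous_NL hα).comp hwc
  induction n with
  | zero => exact fun ε _ => ⟨w, hwc, fun t _ => wt_zero_op _⟩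
  | succ n ih =>
    intro ε hε
    -- Duhamel's formula is restarted at the time `a = ε / 2`: the nonlinear term gains one
    -- derivative, and so does the semigroup after another time `a`.
    obtain ⟨a, ha, hε2⟩ : ∃ a, 0 < a ∧ ε = a + a := ⟨ε / 2, by positivity, by ring⟩
    obtain ⟨z, hzc, hz⟩ := ih a ha
    have hG : Continuous fun s => -(nonlin hα 1 le_rfl).op (K n (z (a + s)) (z (a + s))) :=
      continuous_nonlin_K hα 1 le_rfl n (hzc.comp (continuous_const_add a))
    refine ⟨fun t => (heat hν (t - ε)).op ((heatSmooth hν ha 1 one_le_two).op (z a))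
      + duh hν (fun s => -(nonlin hα 1 le_rfl).op (K n (z (a + s)) (z (a + s)))) (t - a),
      ?_, fun t ht => ?_⟩
    · exact ((continuous_heat hν _).comp (continuous_id.sub continuous_const)).add
        ((continuous_duh hν hG).comp (continuous_id.sub continuous_const))
    · have hta : 0 ≤ t - a := by linarith
      have h1 := duhamel_restart hν hgc hw ha.le hta
      rw [add_sub_cancel] at h1
      rw [h1, map_add]
      congr 1
      · rw [Mult.op_heat, ← wt_wt, wt_heatSmooth, Mult.op_heat,
          ← heat_add hν (by linarith) ha.le, hz a le_rfl]
        rw [show t - ε + a = t - a by linarith]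
      · rw [map_duh hν _ (fun t f => Mult.op_heat _ hν t f) hG]
        refine duh_congr hν hta fun s hs => ?_
        rw [wt_succ_nonlin, hz _ (by linarith [hs.1])]

/-- For positive times the solution is differentiable in `H²`. -/
theorem hasDerivAt_of_lift {w : ℝ → L2 C3} {w₀ : L2 C3} (hwc : Continuous w)
    (hw : ∀ t, 0 ≤ t → w t = (heat hν t).op w₀ + duh hν (fun s => NL hα (w s)) t)
    {ε : ℝ} (hε : 0 < ε) {z : ℝ → L2 C3} (hzc : Continuous z)
    (hz : ∀ t, ε ≤ t → (wt 2).op (z t) = w t) {t : ℝ} (ht : ε < t) :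
    HasDerivAt w (-(lapMult 0 ν).op (z t) + NL hα (w t)) t := by
  have hgc : Continuous fun s => NL hα (w s) := (continuous_NL hα).comp hwc
  have hG : Continuous fun s =>
      -(nonlin hα 0 (Nat.zero_le 1)).op (K 2 (z (ε + s)) (z (ε + s))) :=
    continuous_nonlin_K hα 0 (Nat.zero_le 1) 2 (hzc.comp (continuous_const_add ε))
  have h1 : ∀ r, 0 ≤ r → z (ε + r) = (heat hν r).op (z ε)
      + duh hν (fun s => -(nonlin hα 0 (Nat.zero_le 1)).op (K 2 (z (ε + s)) (z (ε + s)))) r := by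
    intro r hr
    refine wt_injective 2 ?_
    rw [hz _ (by linarith), duhamel_restart hν hgc hw hε.le hr, map_add, Mult.op_heat,
      hz ε le_rfl, map_duh hν _ (fun t f => Mult.op_heat _ hν t f) hG]
    congr 1
    refine duh_congr hν hr fun s hs => ?_
    rw [wt_NL, hz _ (by linarith [hs.1])]
  have hr : 0 < t - ε := by linarith
  have h2 := (duhamel_hasDerivWithinAt hν (y := fun r => z (ε + r)) hG h1 hr.le).hasDerivAt
    (Ici_mem_nhds hr)
  have h3 := h2.comp_sub_const (x := t) (a := ε)
  rw [wt_NL, add_sub_cancel, hz t ht.le] at h3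
  refine h3.congr_of_eventuallyEq ?_
  filter_upwards [Ioi_mem_nhds ht] with s hs
  rw [add_sub_cancel, hz s (mem_Ioi.1 hs).le]

end

/-! ### The terms of the equation on the Fourier side -/

theorem ev_coord {ι : Type*} [Fintype ι] (f : L2 (EuclideanSpace ℂ ι)) (i : ι) (x : E3) :
    Integrable (fun ξ => Real.fourierChar (inner ℝ ξ x) • ((wt 2).op f) ξ i) volume ∧
      ev f x i = ∫ ξ, Real.fourierChar (inner ℝ ξ x) • ((wt 2).op f) ξ i := by
  have h1 : Integrable (fun ξ => Real.fourierChar (inner ℝ ξ x) • ((wt 2).op f) ξ) volume := by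
    have := (Real.fourierIntegral_convergent_iff (-x)).2 (integrable_wt_two f)
    simpa only [inner_neg_right, neg_neg] using this
  have h2 := (EuclideanSpace.proj i : EuclideanSpace ℂ ι →L[ℂ] ℂ).integrable_comp h1
  have h3 := (EuclideanSpace.proj i : EuclideanSpace ℂ ι →L[ℂ] ℂ).integral_comp_comm h1
  refine ⟨h2, ?_⟩
  rw [ev_apply, Real.fourierInv_eq]
  exact h3.symm

/-- Linear relations between the coordinates of Fourier transforms are inherited by the
functions. -/
theorem ev_coord_eq_sum {ι κ σ : Type*} [Fintype ι] [Fintype κ] [Fintype σ]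
    {f : L2 (EuclideanSpace ℂ ι)} {g : σ → L2 (EuclideanSpace ℂ κ)} {i : ι} {c : σ → κ}
    (h : ∀ᵐ ξ ∂volume, f ξ i = ∑ s, g s ξ (c s)) (x : E3) :
    ev f x i = ∑ s, ev (g s) x (c s) := by
  rw [(ev_coord f i x).2, Finset.sum_congr rfl fun s _ => (ev_coord (g s) (c s) x).2,
    ← integral_finsetSum _ fun s _ => (ev_coord (g s) (c s) x).1]
  refine integral_congr_ae ?_
  have h1 : ∀ᵐ ξ ∂volume, ∀ s, (wt 2).op (g s) ξ = (wt 2).sym ξ (g s ξ) :=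
    ae_all_iff.2 fun s => (wt 2).op_coe (g s)
  filter_upwards [h, h1, (wt 2).op_coe f] with ξ h2 h3 h4
  simp only [h4, h3, wt_sym, PiLp.smul_apply, h2, Finset.smul_sum]

theorem ev_coord_eq {ι κ : Type*} [Fintype ι] [Fintype κ]
    {f : L2 (EuclideanSpace ℂ ι)} {g : L2 (EuclideanSpace ℂ κ)} {i : ι} {k : κ}
    (h : ∀ᵐ ξ ∂volume, f ξ i = g ξ k) (x : E3) : ev f x i = ev g x k := by
  have := ev_coord_eq_sum (f := f) (g := fun _ : Unit => g) (i := i) (c := fun _ => k)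
    (by simpa using h) x
  simpa using this

/-- The real part of a coordinate. -/
def reP {ι : Type*} [Fintype ι] (i : ι) : EuclideanSpace ℂ ι →L[ℝ] ℝ :=
  (EuclideanSpace.proj i : EuclideanSpace ℝ ι →L[ℝ] ℝ).comp reV

@[simp] theorem reP_apply {ι : Type*} [Fintype ι] (i : ι) (v : EuclideanSpace ℂ ι) :
    reP i v = (v i).re := rfl

theorem gradient_apply {f : E3 → ℝ} (x : E3) (i : Fin 3) : gradient f x i = pd i f x := by
  rw [← inner_e, gradient, InnerProductSpace.toDual_symm_apply]
  rfl

section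

variable {α : ℝ} (hα : 0 < α)

theorem re_ev_of_herm {ι : Type*} [Fintype ι] {w : L2 (EuclideanSpace ℂ ι)} (hw : herm w = w)
    (y : E3) (j : ι) : ((ev w y j).re : ℂ) = ev w y j := by
  have h := conjV_ev w y
  rw [hw] at h
  exact Complex.conj_eq_iff_re.1 (congrArg (fun v : EuclideanSpace ℂ ι => v j) h)

theorem mul_ev_of_herm {w : L2 C3} (hw : herm w = w) (j i : Fin 3) :
    (fun y => reV (ev w y) j * reV (ev w y) i) = fun y => reP (j, i) (ev (K 0 w w) y) := by
  funext y
  rw [ev_K, reP_apply, tens_apply, reV_apply, reV_apply]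
  conv_rhs => rw [← re_ev_of_herm hw y j, ← re_ev_of_herm hw y i, ← Complex.ofReal_mul]
  exact (Complex.ofReal_re _).symm

theorem pd_bar_ev {w : L2 C3} (hw : herm w = w) (x : E3) (i j : Fin 3) :
    pd j (bar α fun y => reV (ev w y) j * reV (ev w y) i) x
      = (ev ((dmul j).op ((helmMult hα 1 one_le_two).op (K 0 w w))) x (j, i)).re := by
  have h3 : bar α (fun y => reP (j, i) (ev (K 0 w w) y))
      = fun y => reP (j, i) (ev ((wt 1).op ((helmMult hα 1 one_le_two).op (K 0 w w))) y) := by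
    funext y
    rw [bar_comp_ev hα, wt_helmMult hα 1 one_le_two]
  have h2 := congrArg (fun F => pd j (bar α F) x) (mul_ev_of_herm hw j i)
  refine h2.trans ?_
  have h4 := congrArg (fun F => pd j F x) h3
  exact h4.trans (pd_ev (reP (j, i)) j _ x)

theorem divHelm_coord (G : L2 C9) (i : Fin 3) : ∀ᵐ ξ ∂volume, (divHelm hα).op G ξ i
    = ∑ j, (dmul j).op ((helmMult hα 1 one_le_two).op G) ξ (j, i) := by
  have h4 : ∀ᵐ ξ ∂volume, ∀ j : Fin 3, (dmul j).op ((helmMult hα 1 one_le_two).op G) ξ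
        = (dmul j).sym ξ ((helmMult hα 1 one_le_two).sym ξ (G ξ)) :=
    ae_all_iff.2 fun j => (dmul j).op_congr ((helmMult hα 1 one_le_two).op_coe _)
  filter_upwards [h4, (divHelm hα).op_coe G] with ξ h5 h6
  rw [h6, divHelm_sym, Finset.mul_sum]
  refine Finset.sum_congr rfl fun j _ => ?_
  rw [h5, dmul_sym, helmMult_sym, smul_smul, PiLp.smul_apply, smul_eq_mul]
  have := rho_ne_zero ξ
  field_simp

/-- `div (bar (v ⊗ v))` for `v = 𝓕⁻ ((1 + |ξ|)⁻² w)`. -/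
theorem divBar_ev {w : L2 C3} (hw : herm w = w) (x : E3) :
    divBar α (fun y => reV (ev w y)) x = reV (ev ((divHelm hα).op (K 0 w w)) x) := by
  ext i
  have h1 : divBar α (fun y => reV (ev w y)) x i
      = ∑ j, (ev ((dmul j).op ((helmMult hα 1 one_le_two).op (K 0 w w))) x (j, i)).re := by
    rw [divBar, PiLp.toLp_apply]
    exact Finset.sum_congr rfl fun j _ => pd_bar_ev hα hw x i j
  rw [h1, reV_apply, ← Complex.re_sum]
  exact congrArg Complex.re (ev_coord_eq_sum (c := fun j : Fin 3 => (j, i))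
    (divHelm_coord hα (K 0 w w) i) x).symm

/-- The gradient of the pressure. -/
theorem gradient_pressure (G : L2 C9) (x : E3) :
    gradient (fun y => reP 0 (ev ((pressure hα 0 (Nat.zero_le 2)).op G) y)) x
      = reV (ev ((nonlin hα 0 (Nat.zero_le 1)).op G - (divHelm hα).op G) x) := by
  ext i
  rw [gradient_apply, ← wt_pressure hα 1 one_le_two, pd_ev, reP_apply, reV_apply]
  congr 1
  refine ev_coord_eq ?_ x
  filter_upwards [(dmul i).op_congr ((pressure hα 1 one_le_two).op_coe G),
    (divHelm hα).op_coe G, (nonlin hα 0 (Nat.zero_le 1)).op_coe G,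
    Lp.coeFn_sub ((nonlin hα 0 (Nat.zero_le 1)).op G) ((divHelm hα).op G)] with ξ h1 h2 h3 h4
  rw [h1, h4, Pi.sub_apply, h2, h3, nonlin_eq_leray, pow_zero, one_smul, PiLp.sub_apply,
    leray_sym_eq, dmul_sym, PiLp.smul_apply, pressure_sym, smul_eq_mul, fdiv]
  simp only [divHelm_sym]
  have hr := rho_ne_zero ξ
  have h5 : ∑ l, (ξ l : ℂ) * ((helm α ξ : ℂ) * ∑ j, dsym j ξ * (G ξ) (j, l))
      = (helm α ξ : ℂ) * (2 * Real.pi * Complex.I)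
        * ∑ j, ∑ l, (ξ j : ℂ) * (ξ l : ℂ) * (G ξ) (j, l) := by
    rw [Finset.sum_comm, Finset.mul_sum]
    refine Finset.sum_congr rfl fun l _ => ?_
    rw [Finset.mul_sum, Finset.mul_sum, Finset.mul_sum]
    refine Finset.sum_congr rfl fun j _ => ?_
    rw [dsym]
    ring
  rw [h5, dsym]
  field_simp
  ring

theorem sum_dmul_dmul (ν : ℝ) (z : L2 C3) :
    ν • ∑ k, (dmul k).op ((dmul k).op z) = -(lapMult 0 ν).op z := by
  refine Lp.ext ?_
  have h1 : ∀ᵐ ξ ∂volume, ∀ k : Fin 3, (dmul k).op ((dmul k).op z) ξ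
      = (dmul k).sym ξ ((dmul k).sym ξ (z ξ)) :=
    ae_all_iff.2 fun k => (dmul k).op_congr ((dmul k).op_coe z)
  filter_upwards [h1, (lapMult 0 ν).op_coe z, Lp.coeFn_neg ((lapMult 0 ν).op z),
    Lp.coeFn_smul ν (∑ k, (dmul k).op ((dmul k).op z)),
    Lp.coeFn_finsetSum Finset.univ fun k => (dmul k).op ((dmul k).op z)] with ξ h2 h3 h4 h5 h6
  rw [h4, h5, Pi.neg_apply, Pi.smul_apply, h3, h6, Finset.sum_apply]
  simp only [h2, dmul_sym, lapMult_sym, smul_smul]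
  rw [← Finset.sum_smul, ← Complex.coe_smul, smul_smul, ← neg_smul]
  congr 1
  have h7 : ((lap ξ : ℝ) : ℂ) = -(dsym 0 ξ ^ 2 + dsym 1 ξ ^ 2 + dsym 2 ξ ^ 2) := by
    rw [lap, norm_sq_eq]
    simp only [dsym, mul_pow, Complex.I_sq]
    push_cast
    ring
  rw [Fin.sum_univ_three, zero_add, Complex.ofReal_mul, h7]
  ring

end

section

variable {V : Type*} [NormedAddCommGroup V] [InnerProductSpace ℂ V] [CompleteSpace V]

theorem integral_fderiv_smul_fourierInv (g : L2 V) (k : Fin 3) {φ : E3 → ℝ}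
    (hφ : ContDiff ℝ ∞ φ) (hc : HasCompactSupport φ) :
    ∫ x, ((pd k φ x : ℝ) : ℂ) • (𝓕⁻ g : L2 V) x
      = -∫ ξ, (𝓕⁻ (testC hφ hc)) ξ • dsym k ξ • g ξ := by
  have h1 := integral_smul_fourierInv (∂^{fun j => e ((![k] : Fin 1 → Fin 3) j)} (testC hφ hc)) g
  simp only [iteratedLineDeriv_testC, fourierInv_iteratedLineDeriv] at h1
  have h2 : ∀ x, iteratedFDeriv ℝ 1 φ x (fun j => e ((![k] : Fin 1 → Fin 3) j)) = pd k φ x := by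
    intro x
    rw [iteratedFDeriv_one_apply]
    rfl
  simp only [h2] at h1
  rw [h1, ← integral_neg]
  congr 1
  funext ξ
  simp only [dsyms, Finset.univ_unique, Finset.prod_singleton, smul_smul, ← neg_smul]
  congr 1
  simp
  ring

end

theorem memLp_inv_rho_dsym_sum {ι : Type*} [Fintype ι] (f : L2 (EuclideanSpace ℂ ι)) (i : ι)
    (k : Fin 3) : MemLp (fun ξ => ((rho ξ : ℂ) ^ 1)⁻¹ • (dsym k ξ * f ξ i)) 2 volume := by
  have h : MemLp (fun ξ => (EuclideanSpace.proj i : EuclideanSpace ℂ ι →L[ℂ] ℂ)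
      ((dmul k).op f ξ)) 2 volume := (EuclideanSpace.proj i :
        EuclideanSpace ℂ ι →L[ℂ] ℂ).comp_memLp' (Lp.memLp _)
  refine h.ae_eq ?_
  filter_upwards [(dmul k).op_coe f] with ξ h1
  rw [h1, dmul_sym]
  change (dsym k ξ * ((rho ξ : ℂ) ^ 1)⁻¹) * f ξ i = ((rho ξ : ℂ) ^ 1)⁻¹ * (dsym k ξ * f ξ i)
  ring

/-- A family of first order relations, tested against smooth functions, passes to the Fourier
side. -/
theorem sum_dsym_eq_zero {ι : Type*} [Fintype ι] {f : L2 (EuclideanSpace ℂ ι)} {σ : Type*}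
    [Fintype σ] (c : σ → ℂ) (k : σ → Fin 3) (i : σ → ι)
    (h : ∀ φ : E3 → ℝ, ContDiff ℝ ∞ φ → HasCompactSupport φ →
      ∑ s, c s * ∫ x, ((pd (k s) φ x : ℝ) : ℂ) * (𝓕⁻ f : L2 (EuclideanSpace ℂ ι)) x (i s) = 0) :
    ∀ᵐ ξ ∂volume, ∑ s, c s * (dsym (k s) ξ * f ξ (i s)) = 0 := by
  refine ae_eq_zero_of_forall_test (n := 1) ?_ fun φ hφ hc => ?_
  · have h1 : (fun ξ : E3 => ((rho ξ : ℂ) ^ 1)⁻¹ • ∑ s, c s * (dsym (k s) ξ * f ξ (i s)))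
        = fun ξ => ∑ s, c s * (((rho ξ : ℂ) ^ 1)⁻¹ • (dsym (k s) ξ * f ξ (i s))) := by
      funext ξ
      rw [Finset.smul_sum]
      refine Finset.sum_congr rfl fun s _ => ?_
      rw [smul_eq_mul, smul_eq_mul]
      ring
    rw [h1]
    exact memLp_finsetSum _ fun s _ => (memLp_inv_rho_dsym_sum f (i s) (k s)).const_mul (c s)
  · have hi : ∀ s, Integrable (fun ξ => (𝓕⁻ (testC hφ hc)) ξ • (dsym (k s) ξ • f ξ)) volume := by
      intro s
      refine integrable_schwartz_smul (n := 1) _ (((Lp.memLp ((dmul (k s)).op f))).ae_eq ?_)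
      filter_upwards [(dmul (k s)).op_coe f] with ξ h1
      rw [h1, dmul_sym, smul_smul, mul_comm]
    have h2 : ∀ s, ∫ x, ((pd (k s) φ x : ℝ) : ℂ) * (𝓕⁻ f : L2 (EuclideanSpace ℂ ι)) x (i s)
        = -∫ ξ, (𝓕⁻ (testC hφ hc)) ξ • (dsym (k s) ξ * f ξ (i s)) := by
      intro s
      have hpd : Integrable (fun x => ((pd (k s) φ x : ℝ) : ℂ) •
          (𝓕⁻ f : L2 (EuclideanSpace ℂ ι)) x) volume := by
        have := integrable_smul_of_test (Lp.memLp (𝓕⁻ f : L2 (EuclideanSpace ℂ ι)))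
          ((hφ.continuous_fderiv (by simp)).clm_apply continuous_const) (hc.fderiv_apply ℝ (e (k s)))
        refine this.congr (Eventually.of_forall fun x => ?_)
        exact (Complex.coe_smul _ _).symm
      have h3 := congrArg (fun v : EuclideanSpace ℂ ι => v (i s))
        (integral_fderiv_smul_fourierInv f (k s) hφ hc)
      have h4 := (EuclideanSpace.proj (i s) : EuclideanSpace ℂ ι →L[ℂ] ℂ).integral_comp_comm hpd
      have h5 := (EuclideanSpace.proj (i s) : EuclideanSpace ℂ ι →L[ℂ] ℂ).integral_comp_comm (hi s)
      exact h4.trans (h3.trans (congrArg Neg.neg h5.symm))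
    have h6 := h φ hφ hc
    simp only [h2] at h6
    have h7 : ∀ s, Integrable (fun ξ => (𝓕⁻ (testC hφ hc)) ξ • (dsym (k s) ξ * f ξ (i s)))
        volume := fun s =>
      (EuclideanSpace.proj (i s) : EuclideanSpace ℂ ι →L[ℂ] ℂ).integrable_comp (hi s)
    have h8 : (fun ξ => (𝓕⁻ (testC hφ hc)) ξ • ∑ s, c s * (dsym (k s) ξ * f ξ (i s)))
        = fun ξ => ∑ s, c s * ((𝓕⁻ (testC hφ hc)) ξ • (dsym (k s) ξ * f ξ (i s))) := by
      funext ξ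
      rw [Finset.smul_sum]
      exact Finset.sum_congr rfl fun s _ => (mul_smul_comm _ _ _).symm
    rw [h8, integral_finsetSum _ fun s _ => (h7 s).const_mul (c s), ← neg_eq_zero,
      ← Finset.sum_neg_distrib, ← h6]
    refine Finset.sum_congr rfl fun s _ => ?_
    rw [integral_const_mul, mul_neg]

/-- The Leray projection fixes the Fourier transform of a divergence-free field. -/
theorem leray_fourierR {f : Lp E3 2 (volume : Measure E3)} (hf : WeaklyDivFree f) :
    leray.op (fourierR f) = fourierR f := by
  refine leray_op_eq_self ?_
  have h := sum_dsym_eq_zero (f := fourierR f) (σ := Fin 3) (fun _ => 1) id id fun φ hφ hc => ?_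
  · filter_upwards [h] with ξ h1
    rw [fdiv]
    have h2 : (2 * Real.pi * Complex.I : ℂ) * ∑ l, (ξ l : ℂ) * fourierR f ξ l = 0 := by
      rw [← h1, Finset.mul_sum]
      refine Finset.sum_congr rfl fun l _ => ?_
      rw [dsym, id]
      ring
    exact (mul_eq_zero.1 h2).resolve_left Complex.two_pi_I_ne_zero
  · have h1 := hf φ hφ hc
    have hi' : ∀ k : Fin 3, Integrable (fun x => pd k φ x * f x k) volume := by
      intro k
      have := integrable_smul_of_test (Lp.memLp f)
          ((hφ.continuous_fderiv (by simp)).clm_apply continuous_const) (hc.fderiv_apply ℝ (e k))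
      exact (EuclideanSpace.proj k : E3 →L[ℝ] ℝ).integrable_comp this
    have h2 : ∀ k : Fin 3, ∫ x, ((pd k φ x : ℝ) : ℂ) * (𝓕⁻ (fourierR f) : L2 C3) x k
        = ∫ x, ((pd k φ x * f x k : ℝ) : ℂ) := by
      intro k
      refine integral_congr_ae ?_
      filter_upwards [fourierInv_fourierR f] with x hx
      rw [hx, cplx_apply, Complex.ofReal_mul]
    simp only [one_mul, id, h2]
    have h3 : ∫ x, inner ℝ (f x) (gradient φ x) = ∑ k, ∫ x, pd k φ x * f x k := by
      rw [← integral_finsetSum _ fun k _ => hi' k]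
      congr 1
      funext x
      rw [PiLp.inner_apply]
      refine Finset.sum_congr rfl fun k _ => ?_
      rw [gradient_apply]
      simp
    have h4 : ∀ k : Fin 3, ∫ x, ((pd k φ x * f x k : ℝ) : ℂ)
        = ((∫ x, pd k φ x * f x k : ℝ) : ℂ) := fun k => integral_ofReal
    simp only [h4]
    rw [← Complex.ofReal_sum, ← h3, h1, Complex.ofReal_zero]

/-! ### The regular solution -/

theorem timeIoo_top : timeIoo ⊤ = Ioi 0 := by
  ext t; simp [timeIoo, EReal.coe_lt_top]

theorem continuousOn_Ioi_of_forall {X : Type*} [TopologicalSpace X] {Φ : ℝ × E3 → X}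
    (h : ∀ ε, 0 < ε → ContinuousOn Φ (Ioi ε ×ˢ univ)) : ContinuousOn Φ (Ioi 0 ×ˢ univ) := by
  rintro ⟨t, x⟩ ⟨ht, -⟩
  have ht' : 0 < t := ht
  have h1 := h (t / 2) (by positivity) (t, x) ⟨half_lt_self ht', mem_univ _⟩
  have h2 : (Ioi (t / 2) ×ˢ univ : Set (ℝ × E3)) ∈ 𝓝 (t, x) :=
    (isOpen_Ioi.prod isOpen_univ).mem_nhds ⟨half_lt_self ht', mem_univ _⟩
  exact (h1.continuousAt h2).continuousWithinAt

/-- The real part, on `ℂ³`. -/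
abbrev reC3 : C3 →L[ℝ] E3 := reV

/-- The real part, on `ℂ¹`. -/
abbrev reC1 : C1 →L[ℝ] ℝ := reP 0

/-- The velocity field `𝓕⁻ ((1 + |ξ|)⁻² w(t))`. -/
def vel (w : ℝ → L2 C3) (t : ℝ) (x : E3) : E3 := reC3 (ev (w t) x)

section

variable {α ν : ℝ} (hα : 0 < α) (hν : 0 < ν) {w₀ : L2 C3} {w : ℝ → L2 C3}

/-- The pressure of the velocity field `vel w`. -/
def pres (w : ℝ → L2 C3) (t : ℝ) (x : E3) : ℝ :=
  reC1 (ev ((pressure hα 0 (Nat.zero_le 2)).op (K 0 (w t) (w t))) x)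

theorem continuous_pressure_K (k : ℕ) (hk : k ≤ 2) (hwc : Continuous w) :
    Continuous fun t => (pressure hα k hk).op (K 0 (w t) (w t)) :=
  (Mult.op _).continuous.comp ((continuous_K_self 0).comp hwc)

theorem pres_eq (w : ℝ → L2 C3) (t : ℝ) : pres hα w t
    = fun x => reC1 (ev ((wt 2).op ((pressure hα 2 le_rfl).op (K 0 (w t) (w t)))) x) := by
  funext x
  rw [pres, wt_pressure]

theorem continuousOn_vel (hwc : Continuous w) (I : Set ℝ) :
    ContinuousOn (fun z : ℝ × E3 => vel w z.1 z.2) (I ×ˢ univ) := by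
  unfold vel
  exact continuousOn_T_ev reC3 (G := w) hwc.continuousOn

theorem continuousOn_pres (hwc : Continuous w) (I : Set ℝ) :
    ContinuousOn (fun z : ℝ × E3 => pres hα w z.1 z.2) (I ×ˢ univ) := by
  unfold pres
  exact continuousOn_T_ev reC1
    (G := fun t => (pressure hα 0 (Nat.zero_le 2)).op (K 0 (w t) (w t)))
    (continuous_pressure_K hα 0 (Nat.zero_le 2) hwc).continuousOn

theorem differentiable_pres (w : ℝ → L2 C3) (t : ℝ) : Differentiable ℝ (pres hα w t) := by
  rw [pres_eq]
  exact (contDiff_ev (reC1) 2 _).differentiable (by norm_num)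

theorem gradient_pres (w : ℝ → L2 C3) (t : ℝ) (x : E3) : gradient (pres hα w t) x
    = reC3 (ev ((nonlin hα 0 (Nat.zero_le 1)).op (K 0 (w t) (w t))
        - (divHelm hα).op (K 0 (w t) (w t))) x) :=
  gradient_pressure hα (K 0 (w t) (w t)) x

theorem continuousOn_gradient_pres (hwc : Continuous w) (I : Set ℝ) :
    ContinuousOn (fun z : ℝ × E3 => gradient (pres hα w z.1) z.2) (I ×ˢ univ) := by
  simp only [gradient_pres]
  refine continuousOn_T_ev reC3 (G := fun t => (nonlin hα 0 (Nat.zero_le 1)).op (K 0 (w t) (w t))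
    - (divHelm hα).op (K 0 (w t) (w t))) (Continuous.continuousOn ?_)
  exact ((Mult.op _).continuous.comp ((continuous_K_self 0).comp hwc)).sub
    ((Mult.op _).continuous.comp ((continuous_K_self 0).comp hwc))

theorem hasDerivAt_vel {t : ℝ} {w' : L2 C3} (h : HasDerivAt w w' t) (x : E3) :
    HasDerivAt (fun s => vel w s x) (reC3 (ev w' x)) t :=
  (ContinuousLinearMap.hasFDerivAt (reC3.comp (evAt x : L2 C3 →L[ℝ] C3))).comp_hasDerivAt t h

theorem vel_eq_of_lift {z : L2 C3} {n : ℕ} {t : ℝ} (h : (wt n).op z = w t) :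
    vel w t = fun x => reC3 (ev ((wt n).op z) x) := by
  funext x
  rw [vel, h]

theorem sum_pd_vel {t : ℝ} {z : L2 C3} (h : (wt 1).op z = w t) (hP : leray.op (w t) = w t)
    (x : E3) : ∑ k, pd k (vel w t) x k = 0 := by
  have h1 : ∀ k, pd k (vel w t) x k = (ev ((dmul k).op z) x k).re := by
    intro k
    rw [vel_eq_of_lift h, pd_ev]
    rfl
  simp only [h1]
  rw [← Complex.re_sum]
  have h2 := ev_coord_eq_sum (f := (0 : L2 C3)) (g := fun k => (dmul k).op z) (i := 0)
    (c := fun k : Fin 3 => k) ?_ x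
  · rw [← h2]
    simp
  · have h3 : ∀ᵐ ξ ∂volume, ∀ k : Fin 3, (dmul k).op z ξ = (dmul k).sym ξ (z ξ) :=
      ae_all_iff.2 fun k => (dmul k).op_coe z
    have h4 := (wt 1).op_coe z
    rw [h] at h4
    filter_upwards [h3, h4, fdiv_of_leray hP, Lp.coeFn_zero C3 2 (volume : Measure E3)]
      with ξ h5 h6 h7 h8
    rw [h8, Pi.zero_apply, PiLp.zero_apply]
    rw [fdiv] at h7
    have h9 : ∑ k, (dmul k).op z ξ k
        = 2 * Real.pi * Complex.I * ∑ l, (ξ l : ℂ) * w t ξ l := by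
      rw [Finset.mul_sum]
      refine Finset.sum_congr rfl fun k _ => ?_
      rw [h5, h6, dmul_sym, wt_sym, PiLp.smul_apply, PiLp.smul_apply, smul_eq_mul, smul_eq_mul,
        dsym]
      ring
    rw [h9, h7, mul_zero]

theorem momentum_vel {t : ℝ} {z : L2 C3} (hz : (wt 2).op z = w t) (hH : herm (w t) = w t)
    (h : HasDerivAt w (-(lapMult 0 ν).op z + NL hα (w t)) t) (x : E3) :
    deriv (fun s => vel w s x) t + divBar α (vel w t) x - ν • ∑ k, pd k (pd k (vel w t)) x
      + gradient (pres hα w t) x = 0 := by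
  have h1 : ν • ∑ k, pd k (pd k (vel w t)) x = reC3 (ev (-(lapMult 0 ν).op z) x) := by
    rw [vel_eq_of_lift hz, ← sum_dmul_dmul]
    simp only [pd_pd_ev]
    have h2 := map_smul (reC3.comp (evAt x)) ν (∑ k, (dmul k).op ((dmul k).op z))
    have h3 := map_sum (reC3.comp (evAt x)) (fun k => (dmul k).op ((dmul k).op z)) Finset.univ
    rw [h3] at h2
    exact h2.symm
  have h4 : divBar α (vel w t) x = reC3 (ev ((divHelm hα).op (K 0 (w t) (w t))) x) :=
    divBar_ev hα hH x
  rw [(hasDerivAt_vel h x).deriv, h1, h4, gradient_pres]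
  have h5 : ∀ a b c d : L2 C3, reC3 (ev (a + b) x) + reC3 (ev c x) - reC3 (ev d x)
      + reC3 (ev (-b - c) x) = reC3 (ev (a - d) x) := by
    intro a b c d
    change (reC3.comp (evAt x)) (a + b) + (reC3.comp (evAt x)) c - (reC3.comp (evAt x)) d
      + (reC3.comp (evAt x)) (-b - c) = (reC3.comp (evAt x)) (a - d)
    rw [map_add, map_sub, map_sub, map_neg]
    abel
  have h6 : (nonlin hα 0 (Nat.zero_le 1)).op (K 0 (w t) (w t)) = -NL hα (w t) := by
    unfold NL
    exact (neg_neg _).symm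
  rw [h6, h5, sub_self]
  exact map_zero (reC3.comp (evAt x : L2 C3 →L[ℝ] C3))

theorem mild_zero (hw : ∀ t, 0 ≤ t → w t = (heat hν t).op w₀ + duh hν (fun s => NL hα (w s)) t) :
    w 0 = w₀ := by
  have h : duh hν (fun s => NL hα (w s)) 0 = 0 := intervalIntegral.integral_same
  rw [hw 0 le_rfl, heat_zero, h, add_zero]

theorem contInSobolev_vel {m : ℕ} {I : Set ℝ} {z : ℝ → L2 C3} (hzc : Continuous z)
    (hz : ∀ t ∈ I, (wt m).op (z t) = w t) : ContInSobolev m I (vel w) := by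
  refine contInSobolev_of_fourier reC3 m (f := fun t => (wt 2).op (z t))
    ((Mult.op _).continuous.comp hzc).continuousOn fun t ht => ?_
  rw [wt_wt, add_comm, ← wt_wt, hz t ht]
  exact reInv_wt_two reC3 (w t)

theorem contInSobolev_pres {m : ℕ} {I : Set ℝ} {z : ℝ → L2 C3} (hzc : Continuous z)
    (hz : ∀ t ∈ I, (wt m).op (z t) = w t) : ContInSobolev m I (pres hα w) := by
  refine contInSobolev_of_fourier (reC1) m
    (f := fun t => (wt 2).op ((pressure hα 0 (Nat.zero_le 2)).op (K m (z t) (z t))))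
    ((Mult.op _).continuous.comp ((Mult.op _).continuous.comp
      ((continuous_K_self m).comp hzc))).continuousOn fun t ht => ?_
  have h1 : (wt m).op (K m (z t) (z t)) = K 0 (w t) (w t) :=
    (wt_K m (z t) (z t)).trans (by rw [hz t ht])
  have h2 := (Mult.op_wt (pressure hα 0 (Nat.zero_le 2)) m (K m (z t) (z t))).symm
  have h3 := Mult.op_wt (wt m) 2 ((pressure hα 0 (Nat.zero_le 2)).op (K m (z t) (z t)))
  rw [h2, h1] at h3
  exact h3 ▸ reInv_wt_two reC1 _

/-- The filter gains two derivatives on the product `u ⊗ u`, which is in `H²`. -/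
theorem contInSobolev_pres_four (hwc : Continuous w) (I : Set ℝ) :
    ContInSobolev 4 I (pres hα w) := by
  refine contInSobolev_of_fourier (reC1) 4
    (continuous_pressure_K hα 2 le_rfl hwc).continuousOn fun t _ => ?_
  rw [pres_eq, ← wt_wt 2 2]
  exact reInv_wt_two (reC1) _

theorem exists_hasDerivAt (hwc : Continuous w)
    (hw : ∀ t, 0 ≤ t → w t = (heat hν t).op w₀ + duh hν (fun s => NL hα (w s)) t) {t : ℝ}
    (ht : 0 < t) : ∃ z : L2 C3, (wt 2).op z = w t ∧
      HasDerivAt w (-(lapMult 0 ν).op z + NL hα (w t)) t := by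
  obtain ⟨z, hzc, hz⟩ := exists_lift hα hν hwc hw 2 (t / 2) (by positivity)
  exact ⟨z t, hz t (half_le_self ht.le),
    hasDerivAt_of_lift hα hν hwc hw (by positivity) hzc hz (half_lt_self ht)⟩

theorem continuousOn_deriv_vel (hwc : Continuous w)
    (hw : ∀ t, 0 ≤ t → w t = (heat hν t).op w₀ + duh hν (fun s => NL hα (w s)) t) :
    ContinuousOn (fun z : ℝ × E3 => deriv (fun s => vel w s z.2) z.1) (Ioi 0 ×ˢ univ) := by
  refine continuousOn_Ioi_of_forall fun ε hε => ?_
  obtain ⟨z, hzc, hz⟩ := exists_lift hα hν hwc hw 2 ε hε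
  have hc : Continuous fun s => -(lapMult 0 ν).op (z s) + NL hα (w s) :=
    ((Mult.op _).continuous.comp hzc).neg.add ((continuous_NL hα).comp hwc)
  refine (continuousOn_T_ev reC3 hc.continuousOn).congr fun s hs => ?_
  exact (hasDerivAt_vel (hasDerivAt_of_lift hα hν hwc hw hε hzc hz hs.1) s.2).deriv

theorem continuousOn_fderiv_vel (hwc : Continuous w)
    (hw : ∀ t, 0 ≤ t → w t = (heat hν t).op w₀ + duh hν (fun s => NL hα (w s)) t) :
    ContinuousOn (fun z : ℝ × E3 => fderiv ℝ (vel w z.1) z.2) (Ioi 0 ×ˢ univ) := by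
  refine continuousOn_Ioi_of_forall fun ε hε => ?_
  obtain ⟨z, hzc, hz⟩ := exists_lift hα hν hwc hw 1 ε hε
  refine (continuousOn_fderiv_ev reC3 hzc.continuousOn).congr fun s hs => ?_
  have h := vel_eq_of_lift (hz s.1 (le_of_lt hs.1))
  exact congrArg (fun F => fderiv ℝ F s.2) h

theorem continuousOn_hessian_vel (hwc : Continuous w)
    (hw : ∀ t, 0 ≤ t → w t = (heat hν t).op w₀ + duh hν (fun s => NL hα (w s)) t) :
    ContinuousOn (fun z : ℝ × E3 => fderiv ℝ (fderiv ℝ (vel w z.1)) z.2) (Ioi 0 ×ˢ univ) := by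
  refine continuousOn_Ioi_of_forall fun ε hε => ?_
  obtain ⟨z, hzc, hz⟩ := exists_lift hα hν hwc hw 2 ε hε
  refine (continuousOn_fderiv_fderiv_ev reC3 hzc.continuousOn).congr fun s hs => ?_
  have h := vel_eq_of_lift (hz s.1 (le_of_lt hs.1))
  exact congrArg (fun F => fderiv ℝ (fderiv ℝ F) s.2) h

/-- A global solution of Duhamel's equation gives a regular solution of the Bardina model. -/
theorem isRegularSolution_vel {u₀ : E3 → E3} (hu₀ : ∀ x, reC3 (ev w₀ x) = bar α u₀ x)
    (hwc : Continuous w)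
    (hw : ∀ t, 0 ≤ t → w t = (heat hν t).op w₀ + duh hν (fun s => NL hα (w s)) t)
    (hPH : ∀ t, 0 ≤ t → leray.op (w t) = w t ∧ herm (w t) = w t) :
    IsRegularSolution α ν u₀ ⊤ (vel w) (pres hα w) := by
  refine ⟨?_, ?_, fun t _ => differentiable_pres hα w t, continuousOn_gradient_pres hα hwc _,
    ?_, ?_, ?_, ?_, ?_, ?_, ?_, fun x => ?_, fun τ _ _ => ?_⟩
  · exact continuousOn_vel hwc _
  · exact continuousOn_pres hα hwc _
  all_goals try rw [timeIoo_top]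
  · intro t ht x
    obtain ⟨z, -, hz⟩ := exists_hasDerivAt hα hν hwc hw ht
    exact (hasDerivAt_vel hz x).differentiableAt
  · exact continuousOn_deriv_vel hα hν hwc hw
  · intro t ht
    obtain ⟨z, -, hz⟩ := exists_lift hα hν hwc hw 2 t ht
    rw [vel_eq_of_lift (hz t le_rfl)]
    exact contDiff_ev reC3 2 _
  · exact continuousOn_fderiv_vel hα hν hwc hw
  · exact continuousOn_hessian_vel hα hν hwc hw
  · intro t ht x
    obtain ⟨z, hz, h⟩ := exists_hasDerivAt hα hν hwc hw ht
    exact momentum_vel hα hz (hPH t (le_of_lt ht)).2 h x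
  · intro t ht x
    obtain ⟨z, -, hz⟩ := exists_lift hα hν hwc hw 1 t ht
    exact sum_pd_vel (hz t le_rfl) (hPH t (le_of_lt ht)).1 x
  · rw [vel, mild_zero hα hν hw, hu₀]
  · exact contInSobolev_of_fourier reC3 2 hwc.continuousOn fun t _ => reInv_wt_two reC3 (w t)

theorem timeDerivContInL2_vel (hwc : Continuous w)
    (hw : ∀ t, 0 ≤ t → w t = (heat hν t).op w₀ + duh hν (fun s => NL hα (w s)) t) :
    TimeDerivContInL2 (vel w) := by
  have hgc : Continuous fun s => NL hα (w s) := (continuous_NL hα).comp hwc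
  refine ⟨fun t => reInv reC3 ((wt 2).op (w t)),
    fun t => reInv reC3 (-(lapMult 0 ν).op (w t) + (wt 2).op (NL hα (w t))),
    fun t _ => reInv_wt_two reC3 (w t), fun t ht => ?_, ?_, fun t ht => ?_⟩
  · exact (reInv reC3).hasFDerivAt.comp_hasDerivWithinAt t (duhamel_hasDerivWithinAt hν hgc hw ht)
  · exact ((reInv reC3).continuous.comp (((Mult.op _).continuous.comp hwc).neg.add
      ((Mult.op _).continuous.comp hgc))).continuousOn
  · obtain ⟨z, hzc, hz⟩ := exists_lift hα hν hwc hw 2 (t / 2) (by positivity)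
    have h1 := hasDerivAt_of_lift hα hν hwc hw (by positivity) hzc hz (half_lt_self ht)
    have h2 : -(lapMult 0 ν).op (w t) + (wt 2).op (NL hα (w t))
        = (wt 2).op (-(lapMult 0 ν).op (z t) + NL hα (w t)) := by
      rw [map_add, map_neg, ← Mult.op_wt, hz t (half_le_self ht.le)]
    beta_reduce
    rw [h2]
    refine (reInv_wt_two reC3 _).trans (Eventually.of_forall fun x => ?_)
    exact ((hasDerivAt_vel h1 x).deriv).symm

end

/-! ### The energy balance -/

theorem dsyms_neg {j : ℕ} (a : Fin j → Fin 3) (ξ : E3) :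
    (starRingEnd ℂ) (dsyms a (-ξ)) = dsyms a ξ := by
  rw [dsyms, dsyms, map_prod]
  exact Finset.prod_congr rfl fun k _ => dsym_neg (a k) ξ

theorem herm_dwt (m : ℕ) {j : ℕ} (hj : j ≤ m) (a : Fin j → Fin 3) {f : L2 C3} (hf : herm f = f) :
    herm ((dwt m hj a).op f) = (dwt m hj a).op f := by
  have h := herm_op (dwt m hj a : Mult C3 C3) (fun ξ v => by
    rw [dwt_sym, dwt_sym, conjV_smul, map_mul, dsyms_neg, rho_neg]
    simp) f
  rw [h, hf]

theorem norm_dsym_sq (k : Fin 3) (ξ : E3) : ‖dsym k ξ‖ ^ 2 = 4 * Real.pi ^ 2 * ξ k ^ 2 := by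
  rw [dsym]
  simp only [norm_mul, Complex.norm_I, Complex.norm_real, mul_pow, Real.norm_eq_abs, sq_abs,
    Complex.norm_ofNat]
  ring

theorem normSq_toSobolev {f : L2 C3} (hf : herm f = f) :
    Integrable (fun ξ => (rho ξ ^ 4)⁻¹ * ‖f ξ‖ ^ 2) volume ∧
      normSq (toSobolev reC3 2 f) = ∫ ξ, (rho ξ ^ 4)⁻¹ * ‖f ξ‖ ^ 2 := by
  rw [normSq, wd_toSobolev_zero, norm_reInv_reV (by rw [herm_wt, hf])]
  refine norm_sq_op _ (fun ξ v => ?_) f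
  rw [wt_sym, norm_smul, norm_inv, norm_pow, norm_rho, mul_pow]
  ring

theorem gradNormSq_toSobolev {f : L2 C3} (hf : herm f = f) :
    Integrable (fun ξ => lap ξ * (rho ξ ^ 4)⁻¹ * ‖f ξ‖ ^ 2) volume ∧
      gradNormSq (toSobolev reC3 2 f) = ∫ ξ, lap ξ * (rho ξ ^ 4)⁻¹ * ‖f ξ‖ ^ 2 := by
  have h : ∀ k : Fin 3,
      Integrable (fun ξ => 4 * Real.pi ^ 2 * ξ k ^ 2 * (rho ξ ^ 4)⁻¹ * ‖f ξ‖ ^ 2) volume ∧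
      ‖wd (toSobolev reC3 2 f) ⟨⟨1, by decide⟩, ![k]⟩‖ ^ 2
        = ∫ ξ, 4 * Real.pi ^ 2 * ξ k ^ 2 * (rho ξ ^ 4)⁻¹ * ‖f ξ‖ ^ 2 := by
    intro k
    rw [wd_toSobolev, norm_reInv_reV (herm_dwt 2 _ _ hf)]
    refine norm_sq_op _ (fun ξ v => ?_) f
    rw [dwt_sym, norm_smul, norm_mul, norm_inv, norm_pow, norm_rho, mul_pow, mul_pow]
    have : dsyms ![k] ξ = dsym k ξ := by simp [dsyms]
    rw [this, norm_dsym_sq]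
    ring
  have h2 : (fun ξ => lap ξ * (rho ξ ^ 4)⁻¹ * ‖f ξ‖ ^ 2)
      = fun ξ => ∑ k : Fin 3, 4 * Real.pi ^ 2 * ξ k ^ 2 * (rho ξ ^ 4)⁻¹ * ‖f ξ‖ ^ 2 := by
    funext ξ
    rw [Fin.sum_univ_three, lap, norm_sq_eq]
    ring
  rw [gradNormSq, Finset.sum_congr rfl fun k _ => (h k).2, h2]
  exact ⟨integrable_finsetSum _ fun k _ => (h k).1,
    (integral_finsetSum _ fun k _ => (h k).1).symm⟩

theorem laplNormSq_toSobolev {f : L2 C3} (hf : herm f = f) :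
    Integrable (fun ξ => lap ξ ^ 2 * (rho ξ ^ 4)⁻¹ * ‖f ξ‖ ^ 2) volume ∧
      laplNormSq (toSobolev reC3 2 f) = ∫ ξ, lap ξ ^ 2 * (rho ξ ^ 4)⁻¹ * ‖f ξ‖ ^ 2 := by
  have h : ∑ k : Fin 3, wd (toSobolev reC3 2 f) ⟨⟨2, by decide⟩, ![k, k]⟩
      = reInv reC3 (∑ k : Fin 3, (dwt 2 le_rfl ![k, k]).op f) := by
    rw [map_sum]
    rfl
  have h2 : herm (∑ k : Fin 3, (dwt 2 le_rfl ![k, k]).op f)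
      = ∑ k : Fin 3, (dwt 2 le_rfl ![k, k]).op f := by
    rw [map_sum]
    exact Finset.sum_congr rfl fun k _ => herm_dwt 2 _ _ hf
  have h3 : ∑ k : Fin 3, (dwt 2 le_rfl ![k, k]).op f = (1 : ℝ) • ∑ k, (dmul k).op ((dmul k).op f) := by
    rw [one_smul]
    refine Finset.sum_congr rfl fun k _ => ?_
    refine (Mult.op_op_of_sym _ _ _ (fun ξ v => ?_) f).symm
    rw [dmul_sym, dmul_sym, dwt_sym, smul_smul]
    congr 1
    simp [dsyms, Fin.prod_univ_two]
    ring
  rw [laplNormSq, h, norm_reInv_reV h2, h3, sum_dmul_dmul, norm_neg]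
  refine norm_sq_op _ (fun ξ v => ?_) f
  rw [lapMult_sym, norm_smul, norm_mul, norm_inv, norm_pow, norm_rho, Complex.norm_real, mul_pow,
    mul_pow, Real.norm_eq_abs, sq_abs]
  ring

theorem en_toSobolev (α : ℝ) {f : L2 C3} (hf : herm f = f) :
    en α f = α ^ 2 * gradNormSq (toSobolev reC3 2 f) + normSq (toSobolev reC3 2 f) := by
  have h1 := normSq_toSobolev hf
  have h2 := gradNormSq_toSobolev hf
  rw [(en_eq α f).2, h1.2, h2.2, ← integral_const_mul, ← integral_add (h2.1.const_mul _) h1.1]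
  congr 1
  funext ξ
  ring

theorem dis_toSobolev (α : ℝ) {f : L2 C3} (hf : herm f = f) :
    dis α f = α ^ 2 * laplNormSq (toSobolev reC3 2 f) + gradNormSq (toSobolev reC3 2 f) := by
  have h1 := gradNormSq_toSobolev hf
  have h2 := laplNormSq_toSobolev hf
  rw [(dis_eq α f).2, h1.2, h2.2, ← integral_const_mul, ← integral_add (h2.1.const_mul _) h1.1]
  congr 1
  funext ξ
  ring

theorem continuous_gradNormSq {m : ℝ → SobolevH E3 2} (h : Continuous m) :
    Continuous fun t => gradNormSq (m t) := by
  unfold gradNormSq wd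
  refine continuous_finsetSum _ fun k _ => ?_
  exact (((PiLp.continuous_apply 2 _ _).comp (continuous_subtype_val.comp h)).norm).pow 2

theorem continuous_laplNormSq {m : ℝ → SobolevH E3 2} (h : Continuous m) :
    Continuous fun t => laplNormSq (m t) := by
  unfold laplNormSq wd
  refine (Continuous.norm ?_).pow 2
  refine continuous_finsetSum _ fun k _ => ?_
  exact (PiLp.continuous_apply 2 _ _).comp (continuous_subtype_val.comp h)

theorem energyBalance_vel {α ν : ℝ} (hα : 0 < α) (hν : 0 < ν) {w₀ : L2 C3} {w : ℝ → L2 C3}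
    {u₀ : E3 → E3} (hu₀ : ∀ x, reC3 (ev w₀ x) = bar α u₀ x) (hH₀ : herm w₀ = w₀)
    (hwc : Continuous w)
    (hw : ∀ t, 0 ≤ t → w t = (heat hν t).op w₀ + duh hν (fun s => NL hα (w s)) t)
    (hPH : ∀ t, 0 ≤ t → leray.op (w t) = w t ∧ herm (w t) = w t) :
    EnergyBalance α ν u₀ (vel w) := by
  have hUc : Continuous fun t => toSobolev reC3 2 (w t) := (continuous_toSobolev reC3 2).comp hwc
  have hgc : Continuous fun s => NL hα (w s) := (continuous_NL hα).comp hwc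
  have hrep : ∀ f : L2 C3, Represents (toSobolev reC3 2 f) fun x => reC3 (ev f x) := by
    intro f
    rw [Represents, wd_toSobolev_zero]
    exact reInv_wt_two reC3 f
  refine ⟨fun t => toSobolev reC3 2 (w t), toSobolev reC3 2 w₀, hUc.continuousOn,
    fun t _ => hrep (w t), ?_, fun t ht => ?_⟩
  · have h := hrep w₀
    simp only [hu₀] at h
    exact h
  · have hd : ∀ s, 0 ≤ s → HasDerivWithinAt (fun s => en α (w s)) (-(2 * ν * dis α (w s)))
        (Ici 0) s := fun s hs => energy_hasDerivWithinAt hα hν hwc.continuousOn hgc hw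
          (c := 1) hs (one_smul ℝ _).symm (hPH s hs).1 (hPH s hs).2
    have hc : Continuous fun s => -(2 * ν * dis α (w s)) :=
      (continuous_const.mul ((continuous_dis α).comp hwc)).neg
    have h1 := intervalIntegral.integral_eq_sub_of_hasDeriv_right_of_le ht.le
      ((continuous_en α).comp hwc).continuousOn
      (fun s hs => (hd s hs.1.le).mono (fun r hr => hs.1.le.trans (le_of_lt hr)))
      (hc.intervalIntegrable 0 t)
    have hG := (continuous_gradNormSq hUc).intervalIntegrable (μ := volume) 0 t
    have hL := (continuous_laplNormSq hUc).intervalIntegrable (μ := volume) 0 t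
    have h2 : ∫ s in (0 : ℝ)..t, -(2 * ν * dis α (w s))
        = -(2 * ν * (α ^ 2 * (∫ s in (0 : ℝ)..t, laplNormSq (toSobolev reC3 2 (w s)))
          + ∫ s in (0 : ℝ)..t, gradNormSq (toSobolev reC3 2 (w s)))) := by
      rw [← intervalIntegral.integral_const_mul, ← intervalIntegral.integral_add (hL.const_mul _) hG,
        ← intervalIntegral.integral_const_mul, ← intervalIntegral.integral_neg]
      refine intervalIntegral.integral_congr fun s hs => ?_
      rw [uIcc_of_le ht.le] at hs
      simp only [dis_toSobolev α (hPH s hs.1).2]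
    rw [h2] at h1
    simp only [Function.comp_apply] at h1
    rw [mild_zero hα hν hw, en_toSobolev α (hPH t ht.le).2, en_toSobolev α hH₀] at h1
    linarith

theorem herm_helmMult {α : ℝ} (hα : 0 < α) (k : ℕ) (hk : k ≤ 2) (f : L2 C3) :
    herm ((helmMult hα k hk).op f) = (helmMult hα k hk).op (herm f) :=
  herm_op _ (fun ξ v => by
    rw [helmMult_sym, helmMult_sym, conjV_smul, helm_neg, rho_neg]
    simp) f

theorem leray_helmMult {α : ℝ} (hα : 0 < α) (k : ℕ) (hk : k ≤ 2) (f : L2 C3) :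
    leray.op ((helmMult hα k hk).op f) = (helmMult hα k hk).op (leray.op f) :=
  Mult.op_op_eq_of_sym _ _ _ _ (fun ξ v => by rw [helmMult_sym, helmMult_sym, map_smul]) f

theorem WeaklyDivFree.congr {f g : E3 → E3} (hf : WeaklyDivFree f) (h : f =ᵐ[volume] g) :
    WeaklyDivFree g := by
  intro φ hφ hc
  rw [← hf φ hφ hc]
  refine integral_congr_ae ?_
  filter_upwards [h] with x hx
  rw [hx]

/-- The Fourier datum of the filtered initial velocity. -/
theorem exists_datum {α : ℝ} (hα : 0 < α) {u₀ : E3 → E3} (hu₀ : MemLp u₀ 2 volume)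
    (hdiv : WeaklyDivFree u₀) : ∃ w₀ : L2 C3, (∀ x, reC3 (ev w₀ x) = bar α u₀ x) ∧
      leray.op w₀ = w₀ ∧ herm w₀ = w₀ := by
  refine ⟨(helmMult hα 2 le_rfl).op (fourierR hu₀.toLp), fun x => (bar_L2 hα hu₀ x).symm, ?_, ?_⟩
  · rw [leray_helmMult, leray_fourierR (hdiv.congr hu₀.coeFn_toLp.symm)]
  · rw [herm_helmMult, herm_fourierR]

/-! ### Weak derivatives on the Fourier side -/

theorem fourierR_injective {f g : Lp E3 2 (volume : Measure E3)} (h : fourierR f = fourierR g) :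
    f = g := by
  refine Lp.ext ?_
  have h1 := fourierInv_fourierR f
  rw [h] at h1
  filter_upwards [h1, fourierInv_fourierR g] with x h2 h3
  rw [← reV_cplx (f x), ← h2, h3, reV_cplx]

theorem integral_smul_fourierR (f : Lp E3 2 (volume : Measure E3)) {ψ : E3 → ℝ}
    (hψ : Continuous ψ) (hc : HasCompactSupport ψ) :
    ∫ x, (ψ x : ℂ) • (𝓕⁻ (fourierR f) : L2 C3) x = cplx (∫ x, ψ x • f x) := by
  rw [← ContinuousLinearMap.integral_comp_comm _ (integrable_smul_of_test (Lp.memLp f) hψ hc)]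
  refine integral_congr_ae ?_
  filter_upwards [fourierInv_fourierR f] with x hx
  rw [hx, map_smul]
  exact Complex.coe_smul _ _

/-- The Fourier transform of a weak derivative. -/
theorem IsWeakDeriv.fourierR {j : ℕ} {a : Fin j → Fin 3} {f g : Lp E3 2 (volume : Measure E3)}
    (h : IsWeakDeriv a f g) :
    Bardina.fourierR g =ᵐ[volume] fun ξ => dsyms a ξ • Bardina.fourierR f ξ := by
  have h1 : (fun ξ => Bardina.fourierR g ξ - dsyms a ξ • Bardina.fourierR f ξ)
      =ᵐ[volume] (0 : E3 → C3) := by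
    have hg0 := (wt j : Mult C3 C3).op_coe (Bardina.fourierR g)
    have hf0 := (dwt j le_rfl a : Mult C3 C3).op_coe (Bardina.fourierR f)
    refine ae_eq_zero_of_forall_test (n := j) ?_ fun φ hφ hc => ?_
    · refine ((Lp.memLp ((wt j).op (Bardina.fourierR g))).sub
        (Lp.memLp ((dwt j le_rfl a).op (Bardina.fourierR f)))).ae_eq ?_
      filter_upwards [hg0, hf0] with ξ h2 h3
      rw [Pi.sub_apply, h2, h3, wt_sym, dwt_sym, smul_sub, smul_smul, mul_comm]
    · have i1 : Integrable (fun ξ => (𝓕⁻ (testC hφ hc)) ξ • Bardina.fourierR g ξ) volume := by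
        refine integrable_schwartz_smul (n := 0) _ ?_
        simpa using Lp.memLp (Bardina.fourierR g)
      have i2 : Integrable (fun ξ => (𝓕⁻ (testC hφ hc)) ξ • (dsyms a ξ • Bardina.fourierR f ξ))
          volume := by
        refine integrable_schwartz_smul (n := j) _ ((Lp.memLp ((dwt j le_rfl a).op
          (Bardina.fourierR f))).ae_eq ?_)
        filter_upwards [hf0] with ξ h3
        rw [h3, dwt_sym, smul_smul, mul_comm]
      simp only [smul_sub]
      rw [integral_sub i1 i2, sub_eq_zero]
      have h4 := congrArg cplx (h φ hφ hc)
      rw [map_smul, ← integral_smul_fourierR g hφ.continuous hc,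
        ← integral_smul_fourierR f (continuous_iteratedFDeriv_apply hφ _)
          (hasCompactSupport_iteratedFDeriv_apply hc _)] at h4
      have h5 := integral_smul_fourierInv (testC hφ hc) (Bardina.fourierR g)
      have h6 := integral_smul_fourierInv (∂^{fun k => e (a k)} (testC hφ hc))
        (Bardina.fourierR f)
      simp only [testC_apply] at h5
      simp only [iteratedLineDeriv_testC, fourierInv_iteratedLineDeriv] at h6
      rw [h5, h6] at h4
      have h7 : ∫ ξ, ((-1) ^ j * dsyms a ξ * (𝓕⁻ (testC hφ hc)) ξ) • Bardina.fourierR f ξ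
          = (-1 : ℝ) ^ j • ∫ ξ, (𝓕⁻ (testC hφ hc)) ξ • (dsyms a ξ • Bardina.fourierR f ξ) := by
        rw [← integral_smul]
        congr 1
        funext ξ
        rw [← Complex.coe_smul, smul_smul, smul_smul]
        congr 1
        push_cast
        ring
      rw [h7] at h4
      exact (smul_right_injective C3 (pow_ne_zero j (by norm_num : (-1 : ℝ) ≠ 0)) h4).symm
  filter_upwards [h1] with ξ h2
  exact sub_eq_zero.1 h2

theorem isWeakDeriv_wd {m : ℕ} (U : SobolevH E3 m) (i : DerivIndex m) :
    IsWeakDeriv i.2 (wd U (DerivIndex.zero m)) (wd U i) := U.2 i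

/-- An element of `H^m` is determined by the function that it represents. -/
theorem Represents.unique {m : ℕ} {U U' : SobolevH E3 m} {f : E3 → E3} (h : Represents U f)
    (h' : Represents U' f) : U = U' := by
  have h0 : wd U (DerivIndex.zero m) = wd U' (DerivIndex.zero m) := Lp.ext (h.trans h'.symm)
  refine Subtype.ext (PiLp.ext fun i => ?_)
  change wd U i = wd U' i
  refine fourierR_injective (Lp.ext ?_)
  have h1 := (isWeakDeriv_wd U i).fourierR
  rw [h0] at h1
  exact h1.trans ((isWeakDeriv_wd U' i).fourierR).symm

theorem represents_toSobolev (m : ℕ) (f : L2 C3) {u : E3 → E3}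
    (h : reInv reC3 ((wt m).op f) =ᵐ[volume] u) : Represents (toSobolev reC3 m f) u := by
  rw [Represents, wd_toSobolev_zero]
  exact h

/-- The function `w` with `𝓕 u = (1 + |ξ|)⁻² w`, for `u` in `H²`. -/
def sobolevLift (U : SobolevH E3 2) : L2 C3 :=
  (helmMult one_pos 2 le_rfl).op (fourierR (wd U (DerivIndex.zero 2))
    - ∑ k : Fin 3, fourierR (wd U ⟨⟨2, by decide⟩, ![k, k]⟩))

theorem continuous_wd {m : ℕ} (i : DerivIndex m) :
    Continuous fun U : SobolevH E3 m => wd U i :=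
  (PiLp.continuous_apply 2 _ _).comp continuous_subtype_val

theorem continuous_sobolevLift : Continuous sobolevLift := by
  refine (Mult.op _).continuous.comp ((fourierR.continuous.comp (continuous_wd _)).sub ?_)
  exact continuous_finsetSum _ fun k _ => fourierR.continuous.comp (continuous_wd _)

theorem lap_eq_dsyms (ξ : E3) : ∑ k : Fin 3, dsyms ![k, k] ξ = -((lap ξ : ℝ) : ℂ) := by
  have h : ∀ k : Fin 3, dsyms ![k, k] ξ = dsym k ξ ^ 2 := by
    intro k
    simp [dsyms, Fin.prod_univ_two, sq]
  simp only [h]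
  rw [Fin.sum_univ_three, lap, norm_sq_eq]
  simp only [dsym, mul_pow, Complex.I_sq]
  push_cast
  ring

theorem fourierR_laplacian (U : SobolevH E3 2) :
    (∑ k : Fin 3, fourierR (wd U ⟨⟨2, by decide⟩, ![k, k]⟩) : L2 C3)
      =ᵐ[volume] fun ξ => -((lap ξ : ℝ) : ℂ) • fourierR (wd U (DerivIndex.zero 2)) ξ := by
  have h1 : ∀ᵐ ξ ∂volume, ∀ k : Fin 3, fourierR (wd U ⟨⟨2, by decide⟩, ![k, k]⟩) ξ
      = dsyms ![k, k] ξ • fourierR (wd U (DerivIndex.zero 2)) ξ :=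
    ae_all_iff.2 fun k => (isWeakDeriv_wd U ⟨⟨2, by decide⟩, ![k, k]⟩).fourierR
  filter_upwards [h1, Lp.coeFn_finsetSum Finset.univ
    fun k : Fin 3 => fourierR (wd U ⟨⟨2, by decide⟩, ![k, k]⟩)] with ξ h2 h3
  rw [h3, Finset.sum_apply]
  simp only [h2]
  rw [← Finset.sum_smul, lap_eq_dsyms]

theorem wt_sobolevLift (U : SobolevH E3 2) :
    (wt 2).op (sobolevLift U) = fourierR (wd U (DerivIndex.zero 2)) := by
  rw [sobolevLift, wt_helmMult]
  refine Lp.ext ?_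
  filter_upwards [(helmMult one_pos 0 (Nat.zero_le 2) : Mult C3 C3).op_coe
      (fourierR (wd U (DerivIndex.zero 2)) - ∑ k : Fin 3, fourierR (wd U ⟨⟨2, by decide⟩, ![k, k]⟩)),
    Lp.coeFn_sub (fourierR (wd U (DerivIndex.zero 2)))
      (∑ k : Fin 3, fourierR (wd U ⟨⟨2, by decide⟩, ![k, k]⟩)), fourierR_laplacian U] with ξ h1 h2 h3
  rw [h1, h2, Pi.sub_apply, h3, helmMult_sym, neg_smul, sub_neg_eq_add, pow_zero, mul_one]
  have h4 := helm_mul 1 ξ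
  rw [one_pow, one_mul] at h4
  have h5 : ((helm 1 ξ : ℝ) : ℂ) * (1 + (lap ξ : ℝ)) = 1 := by exact_mod_cast h4
  calc ((helm 1 ξ : ℝ) : ℂ) • (fourierR (wd U (DerivIndex.zero 2)) ξ
        + ((lap ξ : ℝ) : ℂ) • fourierR (wd U (DerivIndex.zero 2)) ξ)
      = (((helm 1 ξ : ℝ) : ℂ) * (1 + (lap ξ : ℝ))) • fourierR (wd U (DerivIndex.zero 2)) ξ := by
        rw [mul_smul, add_smul, one_smul]
    _ = _ := by rw [h5, one_smul]

theorem lapMult_sobolevLift (ν : ℝ) (U : SobolevH E3 2) :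
    -(lapMult 0 ν).op (sobolevLift U)
      = ν • ∑ k : Fin 3, fourierR (wd U ⟨⟨2, by decide⟩, ![k, k]⟩) := by
  refine Lp.ext ?_
  have h0 := (wt 2 : Mult C3 C3).op_coe (sobolevLift U)
  rw [wt_sobolevLift] at h0
  filter_upwards [h0, (lapMult 0 ν).op_coe (sobolevLift U), fourierR_laplacian U,
    Lp.coeFn_neg ((lapMult 0 ν).op (sobolevLift U)),
    Lp.coeFn_smul ν (∑ k : Fin 3, fourierR (wd U ⟨⟨2, by decide⟩, ![k, k]⟩))] with ξ h1 h2 h3 h4 h5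
  rw [h4, h5, Pi.neg_apply, Pi.smul_apply, h2, h3, h1, lapMult_sym, wt_sym, ← Complex.coe_smul,
    smul_smul, smul_smul, ← neg_smul]
  congr 1
  push_cast
  ring

theorem herm_sobolevLift (U : SobolevH E3 2) : herm (sobolevLift U) = sobolevLift U := by
  refine wt_injective 2 ?_
  rw [← herm_wt, wt_sobolevLift, herm_fourierR]

theorem reC3_ev_sobolevLift {U : SobolevH E3 2} {f : E3 → E3} (hU : Represents U f)
    (hf : Continuous f) (x : E3) : f x = reC3 (ev (sobolevLift U) x) := by
  have h : f =ᵐ[volume] fun x => reC3 (ev (sobolevLift U) x) := by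
    have h1 := fourierInv_wt_two_ae (sobolevLift U)
    rw [wt_sobolevLift] at h1
    filter_upwards [h1, fourierInv_fourierR (wd U (DerivIndex.zero 2)), hU] with y h2 h3 h4
    rw [← h2, h3, h4]
    exact (reV_cplx _).symm
  exact congrFun ((Continuous.ae_eq_iff_eq volume hf
    (reC3.continuous.comp (ev (sobolevLift U)).continuous)).1 h) x

/-- A real field of `H²` determines its Fourier transform. -/
theorem eq_of_reC3_ev {a b : L2 C3} (ha : herm a = a) (hb : herm b = b)
    (h : ∀ x, reC3 (ev a x) = reC3 (ev b x)) : a = b := by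
  refine ev_injective (Eventually.of_forall fun x => ?_)
  have h1 : conjV (ev a x) = ev a x := by rw [conjV_ev, ha]
  have h2 : conjV (ev b x) = ev b x := by rw [conjV_ev, hb]
  rw [← cplx_reV h1, ← cplx_reV h2]
  exact congrArg cplx (h x)

theorem leray_sobolevLift {U : SobolevH E3 2} {f : E3 → E3} (hU : Represents U f)
    (hf : WeaklyDivFree f) : leray.op (sobolevLift U) = sobolevLift U := by
  refine wt_injective 2 ?_
  rw [← Mult.op_wt, wt_sobolevLift, leray_fourierR (hf.congr hU.symm)]

/-! ### Uniqueness for the equation in `L²` -/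

/-- The Laplacian is dissipative in `L²`. -/
theorem re_inner_wt_lapMult_nonneg {ν : ℝ} (hν : 0 < ν) (d : L2 C3) :
    0 ≤ (inner ℂ ((wt 2).op d) ((lapMult 0 ν).op d)).re := by
  have h := re_inner_op (wt 2 : Mult C3 C3) (lapMult 0 ν)
    (m := fun ξ => (rho ξ ^ 2)⁻¹ * ((0 + ν * lap ξ) * (rho ξ ^ 2)⁻¹)) (fun ξ v => by
      have h1 : ((rho ξ : ℂ) ^ 2)⁻¹ = (((rho ξ ^ 2)⁻¹ : ℝ) : ℂ) := by push_cast; rfl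
      rw [lapMult_sym, wt_sym, h1, ← Complex.ofReal_mul, re_inner_real_smul]) d
  rw [h.2]
  refine integral_nonneg fun ξ => ?_
  have := lap_nonneg ξ
  have := rho_pos ξ
  positivity

theorem hasDerivAt_norm_sq {y : ℝ → L2 C3} {y' : L2 C3} {t : ℝ} (h : HasDerivAt y y' t) :
    HasDerivAt (fun s => ‖y s‖ ^ 2) (2 * (inner ℂ (y t) y').re) t := by
  have h1 := (h.inner ℂ h)
  have h2 := (Complex.reCLM.hasFDerivAt.comp_hasDerivAt t h1)
  have h3 : (fun s => ‖y s‖ ^ 2) = Complex.reCLM ∘ fun s => inner ℂ (y s) (y s) := by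
    funext s
    exact (inner_self_eq_norm_sq (𝕜 := ℂ) (y s)).symm
  rw [h3]
  refine h2.congr_deriv ?_
  rw [map_add, two_mul]
  congr 1
  exact inner_re_symm (𝕜 := ℂ) y' (y t)

/-- A nonnegative function with `f' ≤ L f` that vanishes at the origin is zero. -/
theorem eq_zero_of_deriv_le {f f' : ℝ → ℝ} {τ L : ℝ} (hf : ContinuousOn f (Icc 0 τ))
    (h0 : f 0 = 0) (hpos : ∀ t, 0 ≤ f t) (hd : ∀ t ∈ Ioo 0 τ, HasDerivAt f (f' t) t)
    (hle : ∀ t ∈ Ioo 0 τ, f' t ≤ L * f t) {t : ℝ} (ht : t ∈ Icc 0 τ) : f t = 0 := by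
  have hE : ∀ s, HasDerivAt (fun s => Real.exp (-L * s)) (Real.exp (-L * s) * (-L)) s := by
    intro s
    have := ((hasDerivAt_id s).const_mul (-L)).exp
    simpa using this
  have hg : AntitoneOn (fun s => Real.exp (-L * s) * f s) (Icc 0 τ) := by
    refine antitoneOn_of_hasDerivWithinAt_nonpos (convex_Icc 0 τ)
      (f' := fun s => Real.exp (-L * s) * (-L) * f s + Real.exp (-L * s) * f' s)
      ((by fun_prop : Continuous fun s => Real.exp (-L * s)).continuousOn.mul hf)
      (fun s hs => ?_) fun s hs => ?_
    · rw [interior_Icc] at hs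
      exact ((hE s).mul (hd s hs)).hasDerivWithinAt
    · rw [interior_Icc] at hs
      have h1 := hle s hs
      have h2 := Real.exp_pos (-L * s)
      nlinarith
  have h1 := hg ⟨le_rfl, ht.1.trans ht.2⟩ ht ht.1
  simp only [h0, mul_zero] at h1
  have h2 := Real.exp_pos (-L * t)
  exact le_antisymm (nonpos_of_mul_nonpos_right h1 h2) (hpos t)

/-- Two solutions of the equation, as differentiable functions with values in `L²`, agree if they
agree at time zero. -/
theorem eqOn_of_hasDerivAt {α ν : ℝ} (hα : 0 < α) (hν : 0 < ν) {a b : ℝ → L2 C3} {τ : ℝ}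
    (ha : ContinuousOn a (Icc 0 τ)) (hb : ContinuousOn b (Icc 0 τ)) (h0 : a 0 = b 0)
    (hda : ∀ t ∈ Ioo 0 τ, HasDerivAt (fun s => (wt 2).op (a s))
      (-(lapMult 0 ν).op (a t) + (wt 2).op (NL hα (a t))) t)
    (hdb : ∀ t ∈ Ioo 0 τ, HasDerivAt (fun s => (wt 2).op (b s))
      (-(lapMult 0 ν).op (b t) + (wt 2).op (NL hα (b t))) t) {t : ℝ} (ht : t ∈ Icc 0 τ) :
    a t = b t := by
  obtain ⟨C, hC0, hC⟩ := exists_norm_wt_NL_sub_le hα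
  obtain ⟨Ma, hMa⟩ := isCompact_Icc.exists_bound_of_continuousOn ha
  obtain ⟨Mb, hMb⟩ := isCompact_Icc.exists_bound_of_continuousOn hb
  have hy : ContinuousOn (fun s => (wt 2).op (a s - b s)) (Icc 0 τ) :=
    (Mult.op _).continuous.comp_continuousOn (ha.sub hb)
  have hdy : ∀ s ∈ Ioo 0 τ, HasDerivAt (fun s => (wt 2).op (a s - b s))
      (-(lapMult 0 ν).op (a s - b s) + (wt 2).op (NL hα (a s) - NL hα (b s))) s := by
    intro s hs
    have h1 := (hda s hs).sub (hdb s hs)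
    have h2 : (fun s => (wt 2).op (a s - b s))
        = (fun s => (wt 2).op (a s)) - fun s => (wt 2).op (b s) := by
      funext r
      exact map_sub _ _ _
    rw [h2]
    refine h1.congr_deriv ?_
    rw [map_sub, map_sub]
    abel
  have h1 := eq_zero_of_deriv_le (L := 2 * (C * (Ma + Mb)))
    (f := fun s => ‖(wt 2).op (a s - b s)‖ ^ 2) (hy.norm.pow 2) ?_ (fun s => sq_nonneg _)
    (fun s hs => hasDerivAt_norm_sq (hdy s hs)) (fun s hs => ?_) ht
  · have h2 : (wt 2).op (a t - b t) = 0 := norm_eq_zero.1 (pow_eq_zero_iff two_ne_zero |>.1 h1)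
    have h3 : a t - b t = 0 := wt_injective 2 (h2.trans (map_zero _).symm)
    exact sub_eq_zero.1 h3
  · simp only [h0, sub_self]
    rw [map_zero, norm_zero, zero_pow two_ne_zero]
  · have hs' : s ∈ Icc 0 τ := ⟨hs.1.le, hs.2.le⟩
    have h2 := re_inner_wt_lapMult_nonneg hν (a s - b s)
    have h3 : (inner ℂ ((wt 2).op (a s - b s)) ((wt 2).op (NL hα (a s) - NL hα (b s)))).re
        ≤ ‖(wt 2).op (a s - b s)‖ * ‖(wt 2).op (NL hα (a s) - NL hα (b s))‖ :=
      re_inner_le_norm (𝕜 := ℂ) _ _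
    have h4 := hC (a s) (b s)
    have h5 : C * (‖a s‖ + ‖b s‖) * ‖(wt 2).op (a s - b s)‖
        ≤ C * (Ma + Mb) * ‖(wt 2).op (a s - b s)‖ := by
      have := hMa s hs'
      have := hMb s hs'
      gcongr
    rw [inner_add_right, inner_neg_right, Complex.add_re, Complex.neg_re]
    have h6 := mul_le_mul_of_nonneg_left (h4.trans h5) (norm_nonneg ((wt 2).op (a s - b s)))
    nlinarith

/-! ### Integration by parts against test functions -/

section

variable {F : Type*} [NormedAddCommGroup F] [NormedSpace ℝ F] [CompleteSpace F]

theorem integrable_smul_of_continuous {φ : E3 → ℝ} (hφ : Continuous φ) (hc : HasCompactSupport φ)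
    {f : E3 → F} (hf : Continuous f) : Integrable (fun x => φ x • f x) volume :=
  (hφ.smul hf).integrable_of_hasCompactSupport hc.smul_right

theorem continuous_pd {f : E3 → F} (hf : ContDiff ℝ 1 f) (k : Fin 3) : Continuous (pd k f) :=
  (hf.continuous_fderiv one_ne_zero).clm_apply continuous_const

theorem contDiff_pd {n m : ℕ∞} {f : E3 → F} (hf : ContDiff ℝ n f) (h : m + 1 ≤ n) (k : Fin 3) :
    ContDiff ℝ m (pd k f) :=
  (hf.fderiv_right (by exact_mod_cast h)).clm_apply contDiff_const

theorem contDiff_pd_infty {f : E3 → F} (hf : ContDiff ℝ ∞ f) (k : Fin 3) :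
    ContDiff ℝ ∞ (pd k f) := contDiff_pd hf (by simp) k

theorem hasCompactSupport_pd {φ : E3 → ℝ} (hc : HasCompactSupport φ) (k : Fin 3) :
    HasCompactSupport (pd k φ) := hc.fderiv_apply ℝ (e k)

theorem integral_smul_pd {φ : E3 → ℝ} (hφ : ContDiff ℝ 1 φ) (hc : HasCompactSupport φ)
    {f : E3 → F} (hf : Differentiable ℝ f) {k : Fin 3} (hf' : Continuous (pd k f)) :
    ∫ x, φ x • pd k f x = -∫ x, pd k φ x • f x :=
  integral_smul_fderiv_eq_neg_fderiv_smul_of_integrable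
    (integrable_smul_of_continuous (continuous_pd hφ k) (hasCompactSupport_pd hc k) hf.continuous)
    (integrable_smul_of_continuous hφ.continuous hc hf')
    (integrable_smul_of_continuous hφ.continuous hc hf.continuous)
    (fun x _ => hφ.differentiable one_ne_zero x) fun x _ => hf x

theorem pd_pd_eq {φ : E3 → ℝ} (hφ : ContDiff ℝ ∞ φ) (i k : Fin 3) (x : E3) :
    pd i (pd k φ) x = fderiv ℝ (fderiv ℝ φ) x (e i) (e k) := by
  have hd : DifferentiableAt ℝ (fderiv ℝ φ) x :=
    ((hφ.fderiv_right (m := 1) (WithTop.coe_le_coe.2 le_top)).differentiable one_ne_zero) x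
  have h1 := fderiv_clm_apply hd (differentiableAt_const (e k))
  have h2 := congrArg (fun L : E3 →L[ℝ] ℝ => L (e i)) h1
  simp only [fderiv_fun_const, Pi.zero_apply, ContinuousLinearMap.comp_zero, zero_add,
    ContinuousLinearMap.flip_apply] at h2
  exact h2

theorem pd_pd_comm {φ : E3 → ℝ} (hφ : ContDiff ℝ ∞ φ) (i k : Fin 3) :
    pd i (pd k φ) = pd k (pd i φ) := by
  funext x
  rw [pd_pd_eq hφ, pd_pd_eq hφ]
  refine (hφ.contDiffAt.isSymmSndFDerivAt ?_).eq (e i) (e k)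
  rw [minSmoothness_of_isRCLikeNormedField]
  exact WithTop.coe_le_coe.2 le_top

theorem integral_smul_pd_pd {φ : E3 → ℝ} (hφ : ContDiff ℝ ∞ φ) (hc : HasCompactSupport φ)
    {v : E3 → F} (hv : ContDiff ℝ 2 v) (k : Fin 3) :
    ∫ x, φ x • pd k (pd k v) x = ∫ x, pd k (pd k φ) x • v x := by
  have h1 : ContDiff ℝ 1 (pd k v) := contDiff_pd (n := 2) (m := 1) hv (by norm_num) k
  rw [integral_smul_pd (hφ.of_le (by simp)) hc (h1.differentiable one_ne_zero)
      (continuous_pd h1 k),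
    integral_smul_pd ((contDiff_pd_infty hφ k).of_le (by simp)) (hasCompactSupport_pd hc k)
      (hv.differentiable two_ne_zero) h1.continuous, neg_neg]

theorem iteratedFDeriv_two_eq_pd_pd {φ : E3 → ℝ} (hφ : ContDiff ℝ ∞ φ) (k : Fin 3) (x : E3) :
    iteratedFDeriv ℝ 2 φ x (fun j => e ((![k, k] : Fin 2 → Fin 3) j)) = pd k (pd k φ) x := by
  rw [iteratedFDeriv_two_apply, pd_pd_eq hφ]
  rfl

/-- Classical and weak second derivatives agree. -/
theorem integral_smul_wd {φ : E3 → ℝ} (hφ : ContDiff ℝ ∞ φ) (hc : HasCompactSupport φ)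
    {v : E3 → E3} (hv : ContDiff ℝ 2 v) {U : SobolevH E3 2} (hU : Represents U v) (k : Fin 3) :
    ∫ x, φ x • pd k (pd k v) x = ∫ x, φ x • wd U ⟨⟨2, by decide⟩, ![k, k]⟩ x := by
  have h1 := isWeakDeriv_wd U ⟨⟨2, by decide⟩, ![k, k]⟩ φ hφ hc
  simp only [iteratedFDeriv_two_eq_pd_pd hφ] at h1
  rw [integral_smul_pd_pd hφ hc hv]
  have h2 : ∫ x, pd k (pd k φ) x • v x
      = ∫ x, pd k (pd k φ) x • wd U (DerivIndex.zero 2) x := by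
    refine integral_congr_ae ?_
    filter_upwards [hU] with x hx
    rw [hx]
  rw [h2, h1]
  simp

theorem integral_coord {φ : E3 → ℝ} {f : E3 → E3} (h : Integrable (fun x => φ x • f x) volume)
    (i : Fin 3) : (∫ x, φ x • f x) i = ∫ x, φ x * f x i :=
  ((EuclideanSpace.proj i : E3 →L[ℝ] ℝ).integral_comp_comm h).symm

/-- The curl of a gradient vanishes in the sense of distributions. -/
theorem integral_curl_gradient {φ : E3 → ℝ} (hφ : ContDiff ℝ ∞ φ) (hc : HasCompactSupport φ)
    {q : E3 → ℝ} (hq : Differentiable ℝ q) (hq' : Continuous (gradient q)) (i k : Fin 3) :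
    (∫ x, pd k φ x • gradient q x) i = (∫ x, pd i φ x • gradient q x) k := by
  have hp : ∀ l, Continuous (pd l q) := by
    intro l
    have : pd l q = fun x => gradient q x l := by
      funext x
      rw [gradient_apply]
    rw [this]
    exact (EuclideanSpace.proj l : E3 →L[ℝ] ℝ).continuous.comp hq'
  have h : ∀ i k, (∫ x, pd k φ x • gradient q x) i = -∫ x, pd i (pd k φ) x * q x := by
    intro i k
    rw [integral_coord (integrable_smul_of_continuous (contDiff_pd_infty hφ k).continuous
      (hasCompactSupport_pd hc k) hq')]
    simp only [gradient_apply]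
    exact integral_smul_pd ((contDiff_pd_infty hφ k).of_le (by simp)) (hasCompactSupport_pd hc k)
      hq (hp i)
  rw [h, h, pd_pd_comm hφ]

/-- A field with vanishing classical divergence is divergence free in the sense of distributions. -/
theorem weaklyDivFree_of_pd {v : E3 → E3} (hv : ContDiff ℝ 1 v)
    (hdiv : ∀ x, ∑ k, pd k v x k = 0) : WeaklyDivFree v := by
  intro φ hφ hc
  have h1 : ∀ x, inner ℝ (v x) (gradient φ x) = ∑ k, pd k φ x * v x k := by
    intro x
    rw [PiLp.inner_apply]
    refine Finset.sum_congr rfl fun k _ => ?_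
    rw [gradient_apply]
    simp
  have hi : ∀ k, Integrable (fun x => pd k φ x • v x) volume := fun k =>
    integrable_smul_of_continuous (contDiff_pd_infty hφ k).continuous (hasCompactSupport_pd hc k)
      hv.continuous
  have hi' : ∀ k, Integrable (fun x => φ x • pd k v x) volume := fun k =>
    integrable_smul_of_continuous hφ.continuous hc (continuous_pd hv k)
  have h2 : ∀ k, ∫ x, pd k φ x * v x k = -∫ x, φ x * pd k v x k := by
    intro k
    rw [← integral_coord (hi k), ← integral_coord (hi' k),
      integral_smul_pd (hφ.of_le (by simp)) hc (hv.differentiable one_ne_zero) (continuous_pd hv k)]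
    simp
  simp only [h1]
  have h3 : ∀ k, Integrable (fun x => pd k φ x * v x k) volume := fun k =>
    (EuclideanSpace.proj k : E3 →L[ℝ] ℝ).integrable_comp (hi k)
  have h4 : ∀ k, Integrable (fun x => φ x * pd k v x k) volume := fun k =>
    (EuclideanSpace.proj k : E3 →L[ℝ] ℝ).integrable_comp (hi' k)
  rw [integral_finsetSum _ fun k _ => h3 k]
  simp only [h2]
  rw [Finset.sum_neg_distrib, ← integral_finsetSum _ fun k _ => h4 k]
  simp only [← Finset.mul_sum, hdiv, mul_zero, integral_zero, neg_zero]

/-- Differentiation in time under the integral against a test function. -/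
theorem hasDerivAt_integral_smul {φ : E3 → ℝ} (hφ : Continuous φ) (hc : HasCompactSupport φ)
    {v v' : ℝ → E3 → F} {S : Set ℝ} (hS : IsOpen S)
    (hv : ∀ s ∈ S, ∀ x, HasDerivAt (fun r => v r x) (v' s x) s)
    (hvc : ∀ s ∈ S, Continuous (v s))
    (hvc' : ContinuousOn (fun z : ℝ × E3 => v' z.1 z.2) (S ×ˢ univ)) {t : ℝ} (ht : t ∈ S) :
    HasDerivAt (fun s => ∫ x, φ x • v s x) (∫ x, φ x • v' t x) t := by
  obtain ⟨ε, hε, hεS⟩ := Metric.isOpen_iff.1 hS t ht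
  have hball : Metric.closedBall t (ε / 2) ⊆ S :=
    (Metric.closedBall_subset_ball (by linarith)).trans hεS
  obtain ⟨C, hC⟩ := ((isCompact_closedBall t (ε / 2)).prod hc).exists_bound_of_continuousOn
    (hvc'.mono (prod_mono hball (subset_univ _)))
  have hslice : ∀ s ∈ S, Continuous (v' s) := fun s hs =>
    hvc'.comp_continuous (f := fun x : E3 => (s, x)) (by fun_prop) fun x => ⟨hs, mem_univ x⟩
  refine (hasDerivAt_integral_of_dominated_loc_of_deriv_le (F := fun s x => φ x • v s x)
    (F' := fun s x => φ x • v' s x) (bound := fun x => ‖φ x‖ * C)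
    (Metric.closedBall_mem_nhds t (half_pos hε)) ?_ ?_ ?_ ?_ ?_ ?_).2
  · filter_upwards [hS.mem_nhds ht] with s hs
    exact (hφ.smul (hvc s hs)).aestronglyMeasurable
  · exact integrable_smul_of_continuous hφ hc (hvc t ht)
  · exact (hφ.smul (hslice t ht)).aestronglyMeasurable
  · filter_upwards with x s hs
    rw [norm_smul]
    by_cases hx : x ∈ tsupport φ
    · exact mul_le_mul_of_nonneg_left (hC (s, x) ⟨hs, hx⟩) (norm_nonneg _)
    · rw [image_eq_zero_of_notMem_tsupport hx, norm_zero, zero_mul, zero_mul]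
  · exact ((hφ.integrable_of_hasCompactSupport hc).norm).mul_const C
  · filter_upwards with x s hs
    exact (hv s (hball hs) x).const_smul (φ x)

end

/-! ### Testing against curls -/

/-- The pairing of the function with Fourier transform `f` with the test field `φ c`. -/
def pairL {φ : E3 → ℝ} (hφ : ContDiff ℝ ∞ φ) (hc : HasCompactSupport φ) (c : E3) :
    L2 C3 →L[ℝ] ℝ :=
  (innerSL ℝ ((hφ.continuous.smul continuous_const).memLp_of_hasCompactSupport
    (μ := (volume : Measure E3)) (p := 2) (f := fun x => φ x • c) hc.smul_right).toLp).comp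
    (reInv reC3)

theorem pairL_apply {φ : E3 → ℝ} (hφ : ContDiff ℝ ∞ φ) (hc : HasCompactSupport φ) (i : Fin 3)
    {f : L2 C3} {g : E3 → E3} (hg : reInv reC3 f =ᵐ[volume] g) :
    pairL hφ hc (e i) f = (∫ x, φ x • g x) i := by
  have h1 : Integrable (fun x => φ x • reInv reC3 f x) volume :=
    integrable_smul_of_test (Lp.memLp _) hφ.continuous hc
  have h2 : ∫ x, φ x • g x = ∫ x, φ x • reInv reC3 f x := by
    refine integral_congr_ae ?_
    filter_upwards [hg] with x hx
    rw [hx]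
  rw [h2, integral_coord h1, pairL, ContinuousLinearMap.comp_apply, innerSL_apply_apply,
    L2.inner_def]
  refine integral_congr_ae ?_
  filter_upwards [((hφ.continuous.smul continuous_const).memLp_of_hasCompactSupport
    (μ := (volume : Measure E3)) (p := 2) (f := fun x => φ x • e i)
    hc.smul_right).coeFn_toLp] with x hx
  rw [hx, inner_smul_left, inner_e']
  rfl

/-- The pairing of the curl of the function with Fourier transform `f` with a test function. -/
def curlL {φ : E3 → ℝ} (hφ : ContDiff ℝ ∞ φ) (hc : HasCompactSupport φ) (i k : Fin 3) :
    L2 C3 →L[ℝ] ℝ :=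
  pairL (contDiff_pd_infty hφ k) (hasCompactSupport_pd hc k) (e i)
    - pairL (contDiff_pd_infty hφ i) (hasCompactSupport_pd hc i) (e k)

theorem curlL_apply {φ : E3 → ℝ} (hφ : ContDiff ℝ ∞ φ) (hc : HasCompactSupport φ) (i k : Fin 3)
    {f : L2 C3} {g : E3 → E3} (hg : reInv reC3 f =ᵐ[volume] g) :
    curlL hφ hc i k f = (∫ x, pd k φ x • g x) i - (∫ x, pd i φ x • g x) k := by
  rw [curlL, sub_apply, pairL_apply _ _ i hg, pairL_apply _ _ k hg]

/-- The Leray projection of a field with vanishing curl is zero. -/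
theorem leray_eq_zero_of_curlL {z : L2 C3} (hz : herm z = z)
    (h : ∀ (φ : E3 → ℝ) (hφ : ContDiff ℝ ∞ φ) (hc : HasCompactSupport φ) (i k : Fin 3),
      curlL hφ hc i k z = 0) : leray.op z = 0 := by
  have h1 : (𝓕⁻ z : L2 C3) =ᵐ[volume] fun x => cplx (reInv reC3 z x) := by
    have h2 := fourierInv_herm z
    rw [hz] at h2
    filter_upwards [h2, reInv_coe reC3 z] with x h3 h4
    rw [h4]
    exact (cplx_reV h3.symm).symm
  have h2 : ∀ i k : Fin 3, ∀ᵐ ξ ∂volume, (ξ k : ℂ) * z ξ i = (ξ i : ℂ) * z ξ k := by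
    intro i k
    have h3 := sum_dsym_eq_zero (f := z) (σ := Fin 2) ![1, -1] ![k, i] ![i, k] fun φ hφ hc => ?_
    · filter_upwards [h3] with ξ h4
      rw [Fin.sum_univ_two] at h4
      simp only [Matrix.cons_val_zero, Matrix.cons_val_one, dsym] at h4
      have h5 : (2 * Real.pi * Complex.I : ℂ) * ((ξ k : ℂ) * z ξ i - (ξ i : ℂ) * z ξ k) = 0 := by
        rw [← h4]
        ring
      exact sub_eq_zero.1 ((mul_eq_zero.1 h5).resolve_left Complex.two_pi_I_ne_zero)
    · have h4 : ∀ i k : Fin 3, ∫ x, ((pd k φ x : ℝ) : ℂ) * (𝓕⁻ z : L2 C3) x i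
          = (((∫ x, pd k φ x • reInv reC3 z x) i : ℝ) : ℂ) := by
        intro i k
        have hint : Integrable (fun x => pd k φ x • reInv reC3 z x) volume :=
          integrable_smul_of_test (Lp.memLp _) (contDiff_pd_infty hφ k).continuous
            (hasCompactSupport_pd hc k)
        rw [integral_coord hint]
        refine Eq.trans ?_ integral_ofReal
        refine integral_congr_ae ?_
        filter_upwards [h1] with x hx
        rw [hx, cplx_apply]
        exact (Complex.ofReal_mul _ _).symm
      rw [Fin.sum_univ_two]
      simp only [Matrix.cons_val_zero, Matrix.cons_val_one, h4]
      have h5 := h φ hφ hc i k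
      rw [curlL_apply hφ hc i k (EventuallyEq.refl _ _)] at h5
      rw [one_mul, neg_one_mul, ← sub_eq_add_neg, ← Complex.ofReal_sub, h5, Complex.ofReal_zero]
  refine Lp.ext ?_
  have h3 : ∀ᵐ ξ ∂volume, ∀ i k : Fin 3, (ξ k : ℂ) * z ξ i = (ξ i : ℂ) * z ξ k :=
    ae_all_iff.2 fun i => ae_all_iff.2 fun k => h2 i k
  have hne : ∀ᵐ ξ : E3 ∂volume, ξ ≠ 0 := by
    simp [ae_iff, measure_singleton]
  filter_upwards [leray.op_coe z, h3, hne, Lp.coeFn_zero C3 2 (volume : Measure E3)]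
    with ξ h4 h5 h6 h7
  rw [h4, h7, Pi.zero_apply]
  ext i
  rw [leray_sym_eq, PiLp.zero_apply]
  have hn : ((‖ξ‖ ^ 2 : ℝ) : ℂ) ≠ 0 := by
    exact_mod_cast pow_ne_zero 2 (norm_ne_zero_iff.2 h6)
  have h8 : (ξ i : ℂ) * fdiv ξ (z ξ) = ((‖ξ‖ ^ 2 : ℝ) : ℂ) * z ξ i := by
    rw [fdiv, Finset.mul_sum, norm_sq_eq]
    have : ∀ l : Fin 3, (ξ i : ℂ) * ((ξ l : ℂ) * z ξ l) = (ξ l : ℂ) ^ 2 * z ξ i := by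
      intro l
      linear_combination (-(ξ l : ℂ)) * h5 i l
    simp only [this]
    rw [Fin.sum_univ_three]
    push_cast
    ring
  rw [div_mul_eq_mul_div, h8, mul_div_cancel_left₀ _ hn, sub_self]

/-- A divergence-free curve in `L²`, whose curl is differentiable in the sense of distributions,
is differentiable. -/
theorem hasDerivAt_of_curlL {J R : ℝ → L2 C3} {S : Set ℝ} (hS : IsOpen S) (hconv : Convex ℝ S)
    (hR : ContinuousOn R S) (hJP : ∀ t ∈ S, leray.op (J t) = J t) (hJH : ∀ t ∈ S, herm (J t) = J t)
    (hRH : ∀ t ∈ S, herm (R t) = R t)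
    (h : ∀ (φ : E3 → ℝ) (hφ : ContDiff ℝ ∞ φ) (hc : HasCompactSupport φ) (i k : Fin 3), ∀ t ∈ S,
      HasDerivAt (fun s => curlL hφ hc i k (J s)) (curlL hφ hc i k (R t)) t) {t₀ : ℝ}
    (ht₀ : t₀ ∈ S) : HasDerivAt J (leray.op (R t₀)) t₀ := by
  have hsub : ∀ t ∈ S, uIcc t₀ t ⊆ S := fun t ht => by
    rw [← segment_eq_uIcc]
    exact hconv.segment_subset ht₀ ht
  have hint : ∀ t ∈ S, IntervalIntegrable R volume t₀ t := fun t ht =>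
    (hR.mono (hsub t ht)).intervalIntegrable
  have hder : ∀ t ∈ S, HasDerivAt (fun s => ∫ r in t₀..s, R r) (R t) t := fun t ht =>
    intervalIntegral.integral_hasDerivAt_right (hint t ht)
      (hR.stronglyMeasurableAtFilter hS t ht) (hR.continuousAt (hS.mem_nhds ht))
  -- the curl of `J t - J t₀ - ∫ R` is constant in time, and vanishes at `t₀`
  have hz : ∀ t ∈ S, leray.op (J t - J t₀ - ∫ r in t₀..t, R r) = 0 := by
    intro t ht
    refine leray_eq_zero_of_curlL ?_ fun φ hφ hc i k => ?_
    · rw [map_sub, map_sub, hJH t ht, hJH t₀ ht₀,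
        ← ContinuousLinearMap.intervalIntegral_comp_comm _ (hint t ht)]
      congr 1
      exact intervalIntegral.integral_congr fun r hr => hRH r (hsub t ht hr)
    · set L := curlL hφ hc i k
      have h1 : ∀ s ∈ S, HasDerivWithinAt (fun s => L (J s - J t₀ - ∫ r in t₀..s, R r)) 0 S s := by
        intro s hs
        have h2 := ((h φ hφ hc i k s hs).sub_const (L (J t₀))).sub
          (L.hasFDerivAt.comp_hasDerivAt s (hder s hs))
        rw [sub_self] at h2
        refine (h2.congr_of_eventuallyEq (Eventually.of_forall fun r => ?_)).hasDerivWithinAt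
        rw [map_sub, map_sub]
        rfl
      have h3 := hconv.is_const_of_fderivWithin_eq_zero (𝕜 := ℝ)
        (f := fun s => L (J s - J t₀ - ∫ r in t₀..s, R r))
        (fun s hs => (h1 s hs).differentiableWithinAt) (fun s hs => ?_) ht ht₀
      · rw [h3, intervalIntegral.integral_same, sub_self, sub_zero, map_zero]
      · ext
        exact (h1 s hs).derivWithin (hS.uniqueDiffWithinAt hs)
  have h4 : (fun t => J t) =ᶠ[𝓝 t₀] fun t => J t₀ + leray.op (∫ r in t₀..t, R r) := by
    filter_upwards [hS.mem_nhds ht₀] with t ht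
    have h5 := hz t ht
    rw [map_sub, map_sub, hJP t ht, hJP t₀ ht₀, sub_eq_zero] at h5
    rw [← h5]
    abel
  refine HasDerivAt.congr_of_eventuallyEq ?_ h4
  exact (leray.op.hasFDerivAt.comp_hasDerivAt t₀ (hder t₀ ht₀)).const_add (J t₀)

/-! ### Uniqueness of regular solutions -/

theorem herm_divHelm {α : ℝ} (hα : 0 < α) (f : L2 C9) :
    herm ((divHelm hα).op f) = (divHelm hα).op (herm f) :=
  herm_mat _ _ _ (fun i p ξ => by
    split_ifs
    · simp only [map_mul, map_pow, Complex.conj_ofReal, helm_neg, rho_neg, dsym_neg]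
    · exact map_zero _) f

theorem reInv_fourierR (f : Lp E3 2 (volume : Measure E3)) : reInv reC3 (fourierR f) = f := by
  refine Lp.ext ?_
  filter_upwards [reInv_coe reC3 (fourierR f), fourierInv_fourierR f] with x h1 h2
  rw [h1, h2]
  exact reV_cplx _

/-- The Leray projection of the filtered convection term is the nonlinear term of the equation. -/
theorem leray_divHelm {α : ℝ} (hα : 0 < α) (f : L2 C9) :
    leray.op ((divHelm hα).op f) = (nonlin hα 0 (Nat.zero_le 1)).op f :=
  Mult.op_op_of_sym _ _ _ (fun ξ v => by rw [nonlin_eq_leray, pow_zero, one_smul]) f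

section

variable {α ν : ℝ} (hα : 0 < α) (hν : 0 < ν)

/-- The right-hand side of the momentum equation without the pressure, on the Fourier side. -/
def rhs (ν : ℝ) (w : L2 C3) : L2 C3 :=
  -(lapMult 0 ν).op w - (wt 2).op ((divHelm hα).op (K 0 w w))

theorem continuous_rhs (ν : ℝ) : Continuous (rhs hα ν) :=
  ((Mult.op _).continuous.neg).sub ((Mult.op _).continuous.comp
    ((Mult.op _).continuous.comp (continuous_K_self 0)))

theorem herm_lapMult (a b : ℝ) (f : L2 C3) :
    herm ((lapMult a b).op f) = (lapMult a b).op (herm f) :=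
  herm_op _ (fun ξ v => by
    have h : lap (-ξ) = lap ξ := by simp [lap]
    rw [lapMult_sym, lapMult_sym, conjV_smul, rho_neg, h]
    simp) f

theorem herm_rhs {w : L2 C3} (hw : herm w = w) : herm (rhs hα ν w) = rhs hα ν w := by
  unfold rhs
  rw [map_sub, map_neg, herm_lapMult, herm_wt, herm_divHelm, herm_K, hw]

theorem leray_rhs {w : L2 C3} (hw : leray.op w = w) :
    leray.op (rhs hα ν w) = -(lapMult 0 ν).op w + (wt 2).op (NL hα w) := by
  have h1 : leray.op ((lapMult 0 ν).op w) = (lapMult 0 ν).op (leray.op w) :=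
    Mult.op_op_eq_of_sym _ _ _ _ (fun ξ v => by rw [lapMult_sym, lapMult_sym, map_smul]) w
  unfold rhs NL
  rw [map_sub, map_neg, h1, hw, Mult.op_wt, leray_divHelm, sub_eq_add_neg]
  congr 1
  exact (map_neg _ _).symm

theorem coeFn_smul_sum_sub (g : Fin 3 → Lp E3 2 (volume : Measure E3))
    (b : Lp E3 2 (volume : Measure E3)) :
    (ν • ∑ l, g l - b : Lp E3 2 (volume : Measure E3))
      =ᵐ[volume] fun x => ν • ∑ l, g l x - b x := by
  filter_upwards [Lp.coeFn_sub (ν • ∑ l, g l) b, Lp.coeFn_smul ν (∑ l, g l),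
    Lp.coeFn_finsetSum Finset.univ g] with x h2 h3 h4
  rw [h2, Pi.sub_apply, h3, Pi.smul_apply, h4, Finset.sum_apply]

theorem reInv_smul_sum (g : Fin 3 → Lp E3 2 (volume : Measure E3)) :
    reInv reC3 (ν • ∑ l, fourierR (g l)) = ν • ∑ l, g l := by
  have h2 := map_smul (reInv reC3) ν (∑ l, fourierR (g l))
  rw [h2, map_sum]
  simp only [reInv_fourierR]

theorem reInv_rhs (ν : ℝ) (U : SobolevH E3 2) :
    reInv reC3 (rhs hα ν (sobolevLift U)) =ᵐ[volume] fun x =>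
      ν • ∑ l : Fin 3, wd U ⟨⟨2, by decide⟩, ![l, l]⟩ x
        - reC3 (ev ((divHelm hα).op (K 0 (sobolevLift U) (sobolevLift U))) x) := by
  have h1 : reInv reC3 (rhs hα ν (sobolevLift U))
      = ν • ∑ l : Fin 3, wd U ⟨⟨2, by decide⟩, ![l, l]⟩
        - reInv reC3 ((wt 2).op ((divHelm hα).op (K 0 (sobolevLift U) (sobolevLift U)))) := by
    rw [rhs, lapMult_sobolevLift, ← reInv_smul_sum]
    exact map_sub _ _ _
  rw [h1]
  refine (coeFn_smul_sum_sub _ _).trans ?_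
  filter_upwards [reInv_wt_two reC3
    ((divHelm hα).op (K 0 (sobolevLift U) (sobolevLift U)))] with x h2
  rw [h2]

theorem integral_smul_smul_sum_sub (ν : ℝ) {ψ : E3 → ℝ} {g : Fin 3 → E3 → E3} {b : E3 → E3}
    (hg : ∀ m, Integrable (fun x => ψ x • g m x) volume)
    (hb : Integrable (fun x => ψ x • b x) volume) :
    Integrable (fun x => ψ x • (ν • ∑ m, g m x - b x)) volume ∧
    ∫ x, ψ x • (ν • ∑ m, g m x - b x) = ν • (∑ m, ∫ x, ψ x • g m x) - ∫ x, ψ x • b x := by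
  have h1 : (fun x => ψ x • (ν • ∑ m, g m x - b x))
      = fun x => ν • (∑ m, ψ x • g m x) - ψ x • b x := by
    funext x
    rw [smul_sub, smul_comm, Finset.smul_sum]
  have h2 : Integrable (fun x => ν • ∑ m, ψ x • g m x) volume :=
    (integrable_finsetSum _ fun m _ => hg m).smul ν
  rw [h1]
  refine ⟨h2.sub hb, ?_⟩
  rw [integral_sub h2 hb, integral_smul, integral_finsetSum _ fun m _ => hg m]

/-- The momentum equation tested against a smooth function. -/
theorem curlL_deriv {v : E3 → E3} (hv : ContDiff ℝ 2 v) {U : SobolevH E3 2} (hU : Represents U v)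
    {q : E3 → ℝ} (hq : Differentiable ℝ q) (hq' : Continuous (gradient q)) {v' : E3 → E3}
    (hmom : ∀ x, v' x + divBar α v x - ν • ∑ k, pd k (pd k v) x + gradient q x = 0)
    {φ : E3 → ℝ} (hφ : ContDiff ℝ ∞ φ) (hc : HasCompactSupport φ) (i k : Fin 3) :
    (∫ x, pd k φ x • v' x) i - (∫ x, pd i φ x • v' x) k
      = curlL hφ hc i k (rhs hα ν (sobolevLift U)) := by
  set w := sobolevLift U with hw
  have hvw : v = fun x => reC3 (ev w x) := funext fun x => reC3_ev_sobolevLift hU hv.continuous x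
  have hdB : ∀ x, divBar α v x = reC3 (ev ((divHelm hα).op (K 0 w w)) x) := by
    intro x
    rw [hvw]
    exact divBar_ev hα (herm_sobolevLift U) x
  have hdBc : Continuous (divBar α v) := by
    have h : divBar α v = fun x => reC3 (ev ((divHelm hα).op (K 0 w w)) x) := funext hdB
    rw [h]
    exact reC3.continuous.comp (ev ((divHelm hα).op (K 0 w w))).continuous
  have hvkk : ∀ l, Continuous (pd l (pd l v)) := fun l =>
    continuous_pd (contDiff_pd (n := 2) (m := 1) hv (by norm_num) l) l
  have hR : reInv reC3 (rhs hα ν w) =ᵐ[volume] fun x =>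
      ν • ∑ l : Fin 3, wd U ⟨⟨2, by decide⟩, ![l, l]⟩ x - divBar α v x := by
    simp only [hdB]
    exact reInv_rhs hα ν U
  have hv' : ∀ x, v' x = (ν • ∑ l, pd l (pd l v) x - divBar α v x) - gradient q x := by
    intro x
    have h := hmom x
    rw [← sub_eq_zero, ← h]
    abel
  have key : ∀ l j : Fin 3, (∫ x, pd l φ x • v' x) j
      = (∫ x, pd l φ x • (ν • ∑ m : Fin 3, wd U ⟨⟨2, by decide⟩, ![m, m]⟩ x - divBar α v x)) j
        - (∫ x, pd l φ x • gradient q x) j := by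
    intro l j
    have hφl := contDiff_pd_infty hφ l
    have hcl := hasCompactSupport_pd hc l
    have i1 : ∀ m, Integrable (fun x => pd l φ x • pd m (pd m v) x) volume := fun m =>
      integrable_smul_of_continuous hφl.continuous hcl (hvkk m)
    have i2 := integrable_smul_of_continuous hφl.continuous hcl hdBc
    have i3 := integrable_smul_of_continuous hφl.continuous hcl hq'
    have i4 : ∀ m : Fin 3,
        Integrable (fun x => pd l φ x • wd U ⟨⟨2, by decide⟩, ![m, m]⟩ x) volume := fun m =>
      integrable_smul_of_test (Lp.memLp _) hφl.continuous hcl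
    have h1 := integral_smul_smul_sum_sub ν (g := fun m => pd m (pd m v)) i1 i2
    have h2 := integral_smul_smul_sum_sub ν
      (g := fun m x => wd U ⟨⟨2, by decide⟩, ![m, m]⟩ x) i4 i2
    have h3 : ∫ x, pd l φ x • v' x
        = (∫ x, pd l φ x • (ν • ∑ m, pd m (pd m v) x - divBar α v x))
          - ∫ x, pd l φ x • gradient q x := by
      rw [← integral_sub h1.1 i3]
      congr 1
      funext x
      rw [hv', smul_sub (pd l φ x) (ν • ∑ m, pd m (pd m v) x - divBar α v x)]
    have h4 : ∀ m, ∫ x, pd l φ x • pd m (pd m v) x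
        = ∫ x, pd l φ x • wd U ⟨⟨2, by decide⟩, ![m, m]⟩ x := fun m =>
      integral_smul_wd hφl hcl hv hU m
    rw [h3, PiLp.sub_apply, h1.2, h2.2, Finset.sum_congr rfl fun m _ => h4 m]
  rw [key, key, curlL_apply hφ hc i k hR, integral_curl_gradient hφ hc hq hq' i k]
  ring

/-- A regular solution satisfies the equation in `L²`, for positive times. -/
theorem IsRegularSolution.hasDerivAt {u₀ : E3 → E3} {T : EReal} {v : ℝ → E3 → E3}
    {q : ℝ → E3 → ℝ} (h : IsRegularSolution α ν u₀ T v q) {τ : ℝ} (hτ : (τ : EReal) < T)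
    {U : ℝ → SobolevH E3 2} (hUc : ContinuousOn U (Icc 0 τ))
    (hU : ∀ t ∈ Icc 0 τ, Represents (U t) (v t)) {t : ℝ} (ht : t ∈ Ioo 0 τ) :
    HasDerivAt (fun s => (wt 2).op (sobolevLift (U s)))
      (-(lapMult 0 ν).op (sobolevLift (U t)) + (wt 2).op (NL hα (sobolevLift (U t)))) t := by
  have hIoo : ∀ s ∈ Ioo 0 τ, s ∈ timeIoo T := fun s hs =>
    ⟨hs.1, (EReal.coe_lt_coe_iff.2 hs.2).trans hτ⟩
  have hIco : ∀ s ∈ Ioo 0 τ, s ∈ timeIco T := fun s hs => ⟨hs.1.le, (hIoo s hs).2⟩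
  have hU' : ∀ s ∈ Ioo 0 τ, Represents (U s) (v s) := fun s hs => hU s ⟨hs.1.le, hs.2.le⟩
  have hv2 : ∀ s ∈ Ioo 0 τ, ContDiff ℝ 2 (v s) := fun s hs => h.diff_u s (hIoo s hs)
  have hP : ∀ s ∈ Ioo 0 τ, leray.op (sobolevLift (U s)) = sobolevLift (U s) := fun s hs =>
    leray_sobolevLift (hU' s hs) (weaklyDivFree_of_pd ((hv2 s hs).of_le one_le_two)
      (h.incompressible s (hIoo s hs)))
  have hwc : ContinuousOn (fun s => sobolevLift (U s)) (Ioo 0 τ) :=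
    continuous_sobolevLift.comp_continuousOn (hUc.mono Ioo_subset_Icc_self)
  have hrep : ∀ s ∈ Ioo 0 τ, reInv reC3 ((wt 2).op (sobolevLift (U s))) =ᵐ[volume] v s := by
    intro s hs
    rw [wt_sobolevLift, reInv_fourierR]
    exact hU' s hs
  rw [← leray_rhs hα (hP t ht)]
  refine hasDerivAt_of_curlL (R := fun s => rhs hα ν (sobolevLift (U s))) isOpen_Ioo (convex_Ioo 0 τ)
    ((continuous_rhs hα ν).comp_continuousOn hwc) (fun s hs => ?_) (fun s hs => ?_)
    (fun s hs => herm_rhs hα (herm_sobolevLift _)) (fun φ hφ hc i k s hs => ?_) ht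
  · rw [Mult.op_wt, hP s hs]
  · rw [herm_wt, herm_sobolevLift]
  · have hd : ∀ l j : Fin 3, HasDerivAt (fun r => (∫ x, pd l φ x • v r x) j)
        ((∫ x, pd l φ x • deriv (fun r => v r x) s) j) s := by
      intro l j
      have h1 := hasDerivAt_integral_smul (contDiff_pd_infty hφ l).continuous
        (hasCompactSupport_pd hc l) (v := v) (v' := fun s x => deriv (fun r => v r x) s)
        isOpen_Ioo (fun r hr x => (h.diff_t_u r (hIoo r hr) x).hasDerivAt)
        (fun r hr => (hv2 r hr).continuous)
        (h.cont_dt_u.mono (prod_mono hIoo Subset.rfl)) hs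
      exact (EuclideanSpace.proj j : E3 →L[ℝ] ℝ).hasFDerivAt.comp_hasDerivAt s h1
    have hgq : Continuous (gradient (q s)) := h.cont_grad_p.comp_continuous
      (f := fun x : E3 => (s, x)) (by fun_prop) fun x => ⟨hIco s hs, mem_univ x⟩
    have h2 := curlL_deriv hα (hv2 s hs) (hU' s hs) (h.diff_p s (hIco s hs)) hgq
      (h.momentum s (hIoo s hs)) hφ hc i k
    rw [← h2]
    refine ((hd k i).sub (hd i k)).congr_of_eventuallyEq ?_
    filter_upwards [isOpen_Ioo.mem_nhds hs] with r hr
    exact curlL_apply hφ hc i k (hrep r hr)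

end

section

variable {α ν : ℝ} (hα : 0 < α) (hν : 0 < ν) {w₀ : L2 C3} {w : ℝ → L2 C3} {u₀ : E3 → E3}
  (hu₀ : ∀ x, reC3 (ev w₀ x) = bar α u₀ x) (hwc : Continuous w)
  (hw : ∀ t, 0 ≤ t → w t = (heat hν t).op w₀ + duh hν (fun s => NL hα (w s)) t)
  (hPH : ∀ t, 0 ≤ t → leray.op (w t) = w t ∧ herm (w t) = w t)
  {T : EReal} {v : ℝ → E3 → E3} {q : ℝ → E3 → ℝ} (h : IsRegularSolution α ν u₀ T v q)

theorem exists_real_between {t : ℝ} (ht : t ∈ timeIco T) : ∃ τ : ℝ, t < τ ∧ (τ : EReal) < T := by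
  obtain ⟨τ, h1, h2⟩ := EReal.lt_iff_exists_real_btwn.1 ht.2
  exact ⟨τ, EReal.coe_lt_coe_iff.1 h1, h2⟩

include hu₀ hwc hw hPH h in
/-- Uniqueness of the velocity. -/
theorem IsRegularSolution.eq_vel {t : ℝ} (ht : t ∈ timeIco T) : v t = vel w t := by
  obtain ⟨τ, htτ, hτ⟩ := exists_real_between ht
  have hτ0 : 0 ≤ τ := ht.1.trans htτ.le
  obtain ⟨U, hUc, hU⟩ := h.cont_H2 τ hτ0 hτ
  have hvc : ∀ s ∈ Icc 0 τ, Continuous (v s) := fun s hs =>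
    h.cont_u.comp_continuous (f := fun x : E3 => (s, x)) (by fun_prop)
      fun x => ⟨⟨hs.1, (EReal.coe_le_coe_iff.2 hs.2).trans_lt hτ⟩, mem_univ x⟩
  have h00 : (0 : ℝ) ∈ Icc 0 τ := ⟨le_rfl, hτ0⟩
  have h0 : sobolevLift (U 0) = w 0 := by
    refine eq_of_reC3_ev (herm_sobolevLift _) (hPH 0 le_rfl).2 fun x => ?_
    rw [← reC3_ev_sobolevLift (hU 0 h00) (hvc 0 h00), h.initial, mild_zero hα hν hw, hu₀]
  have hgc : Continuous fun s => NL hα (w s) := (continuous_NL hα).comp hwc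
  have h1 := eqOn_of_hasDerivAt hα hν (a := fun s => sobolevLift (U s)) (b := w)
    (continuous_sobolevLift.comp_continuousOn hUc) hwc.continuousOn h0
    (fun s hs => h.hasDerivAt hα hτ hUc hU hs)
    (fun s hs => (duhamel_hasDerivWithinAt hν hgc hw hs.1.le).hasDerivAt (Ici_mem_nhds hs.1))
    (t := t) ⟨ht.1, htτ.le⟩
  funext x
  rw [reC3_ev_sobolevLift (hU t ⟨ht.1, htτ.le⟩) (hvc t ⟨ht.1, htτ.le⟩) x, vel]
  exact congrArg (fun a => reC3 (ev a x)) h1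

include hu₀ hwc hw hPH h in
theorem IsRegularSolution.gradient_eq_of_pos {t : ℝ} (ht : t ∈ timeIoo T) (x : E3) :
    gradient (q t) x = gradient (pres hα w t) x := by
  have hIco : t ∈ timeIco T := ⟨ht.1.le, ht.2⟩
  obtain ⟨τ, htτ, hτ⟩ := exists_real_between hIco
  have hv : ∀ s ∈ Ioo 0 τ, v s = vel w s := fun s hs =>
    h.eq_vel hα hν hu₀ hwc hw hPH ⟨hs.1.le, (EReal.coe_lt_coe_iff.2 hs.2).trans hτ⟩
  have h1 : deriv (fun s => v s x) t = deriv (fun s => vel w s x) t := by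
    refine Filter.EventuallyEq.deriv_eq ?_
    filter_upwards [isOpen_Ioo.mem_nhds (⟨ht.1, htτ⟩ : t ∈ Ioo 0 τ)] with s hs
    rw [hv s hs]
  have h2 := h.momentum t ht x
  have h3 := (isRegularSolution_vel hα hν hu₀ hwc hw hPH).momentum t ⟨ht.1, EReal.coe_lt_top t⟩ x
  rw [h1, hv t ⟨ht.1, htτ⟩] at h2
  exact add_left_cancel (h2.trans h3.symm)

include hu₀ hwc hw hPH h in
/-- Uniqueness of the pressure gradient.  The momentum equation only holds for positive times; the
time `0` is reached by continuity of `∇q`. -/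
theorem IsRegularSolution.gradient_eq {t : ℝ} (ht : t ∈ timeIco T) (x : E3) :
    gradient (q t) x = gradient (pres hα w t) x := by
  rcases ht.1.eq_or_lt with h0 | h0
  · subst h0
    obtain ⟨τ, hτ0, hτ⟩ := exists_real_between ht
    have hsub : Ioo 0 τ ⊆ timeIco T := fun s hs =>
      ⟨hs.1.le, (EReal.coe_lt_coe_iff.2 hs.2).trans hτ⟩
    have hc : ContinuousOn (fun z : ℝ × E3 => gradient (q z.1) z.2 - gradient (pres hα w z.1) z.2)
        (timeIco T ×ˢ univ) := h.cont_grad_p.sub (continuousOn_gradient_pres hα hwc _)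
    have hc2 : ContinuousOn (fun s : ℝ => gradient (q s) x - gradient (pres hα w s) x)
        (timeIco T) := hc.comp (f := fun s : ℝ => (s, x)) (by fun_prop) fun s hs => ⟨hs, mem_univ x⟩
    have h1 : Tendsto (fun s : ℝ => gradient (q s) x - gradient (pres hα w s) x) (𝓝[>] 0)
        (𝓝 (gradient (q 0) x - gradient (pres hα w 0) x)) :=
      (hc2 0 ht).mono_left (nhdsWithin_le_of_mem
        (Filter.mem_of_superset (Ioo_mem_nhdsGT hτ0) hsub))
    have h2 : Tendsto (fun s : ℝ => gradient (q s) x - gradient (pres hα w s) x) (𝓝[>] 0)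
        (𝓝 0) := by
      refine tendsto_const_nhds.congr' ?_
      filter_upwards [Ioo_mem_nhdsGT hτ0] with s hs
      rw [h.gradient_eq_of_pos hα hν hu₀ hwc hw hPH ⟨hs.1, (hsub hs).2⟩ x, sub_self]
    exact sub_eq_zero.1 (tendsto_nhds_unique h1 h2)
  · exact h.gradient_eq_of_pos hα hν hu₀ hwc hw hPH ⟨h0, ht.2⟩ x

include hu₀ hwc hw hPH h in
theorem IsRegularSolution.exists_pressure_eq {t : ℝ} (ht : t ∈ timeIco T) :
    ∃ c : ℝ, ∀ x, q t x = pres hα w t x + c := by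
  have hq := h.diff_p t ht
  have hp := differentiable_pres hα w t
  refine ⟨q t 0 - pres hα w t 0, fun x => ?_⟩
  have h1 := is_const_of_fderiv_eq_zero (𝕜 := ℝ) (hq.sub hp) (fun y => ?_) x 0
  · simp only [Pi.sub_apply] at h1
    linarith
  · rw [fderiv_sub (hq y) (hp y), sub_eq_zero]
    exact (InnerProductSpace.toDual ℝ E3).symm.injective
      (h.gradient_eq hα hν hu₀ hwc hw hPH ht y)

theorem memLp_pres (t : ℝ) : MemLp (pres hα w t) 2 volume :=
  (Lp.memLp (reInv reC1 ((wt 2).op ((pressure hα 0 (Nat.zero_le 2)).op (K 0 (w t) (w t)))))).ae_eq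
    (reInv_wt_two reC1 _)

theorem eq_zero_of_memLp_const {c : ℝ} (hc : MemLp (fun _ : E3 => c) 2 volume) : c = 0 := by
  rcases (memLp_const_iff (by norm_num) (by norm_num)).1 hc with h1 | h1
  · exact h1
  · simp at h1

include hu₀ hwc hw hPH h in
theorem IsRegularSolution.pressure_eq {t : ℝ} (ht : t ∈ timeIco T) (hq : MemLp (q t) 2 volume)
    (x : E3) : q t x = pres hα w t x := by
  obtain ⟨c, hc⟩ := h.exists_pressure_eq hα hν hu₀ hwc hw hPH ht
  have h1 : MemLp (fun _ : E3 => c) 2 volume := by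
    refine (hq.sub (memLp_pres hα (w := w) t)).ae_eq (Eventually.of_forall fun y => ?_)
    rw [Pi.sub_apply, hc y, add_sub_cancel_left]
  rw [hc x, eq_zero_of_memLp_const h1, add_zero]

include hu₀ hwc hw hPH in
/-- A regular solution over `[0, T[` is the restriction of the global one, whose `H²` norm is
continuous up to the time `T`. -/
theorem IsRegularSolution.not_becomesSingular {T : ℝ} (hT : 0 < T) {v : ℝ → E3 → E3}
    {q : ℝ → E3 → ℝ} (h : IsRegularSolution α ν u₀ T v q) : ¬ BecomesSingular T v := by
  rintro ⟨U, hU, hlim⟩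
  have hc : Continuous fun t => ‖toSobolev reC3 2 (w t)‖ :=
    ((continuous_toSobolev reC3 2).comp hwc).norm
  have hUw : (fun t => ‖toSobolev reC3 2 (w t)‖) =ᶠ[𝓝[<] T] fun t => ‖U t‖ := by
    filter_upwards [Ico_mem_nhdsLT hT] with t ht
    have h1 := hU t ht
    rw [h.eq_vel hα hν hu₀ hwc hw hPH ⟨ht.1, EReal.coe_lt_coe_iff.2 ht.2⟩] at h1
    have h2 := represents_toSobolev 2 (w t) (reInv_wt_two reC3 (w t))
    rw [Represents.unique h1 h2]
  exact not_tendsto_nhds_of_tendsto_atTop hlim _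
    (((hc.tendsto T).mono_left nhdsWithin_le_nhds).congr' hUw)

end

end Bardina

end

theorem theorem1p1 (α ν : ℝ) (hα : 0 < α) (hν : 0 < ν) (u₀ : Bardina.E3 → Bardina.E3)
    (hu₀ : MemLp u₀ 2 volume) (hdiv : Bardina.WeaklyDivFree u₀) :
    (∃ (u : ℝ → Bardina.E3 → Bardina.E3) (p : ℝ → Bardina.E3 → ℝ),
      Bardina.IsRegularSolution α ν u₀ ⊤ u p ∧
      Bardina.EnergyBalance α ν u₀ u ∧
      Bardina.TimeDerivContInL2 u ∧
      Bardina.ContInSobolev 4 (Ici 0) p ∧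
      (∀ τ : ℝ, 0 < τ → ∀ m : ℕ,
        Bardina.ContInSobolev m (Ici τ) u ∧ Bardina.ContInSobolev m (Ici τ) p) ∧
      (∀ (T : EReal) (v : ℝ → Bardina.E3 → Bardina.E3) (q : ℝ → Bardina.E3 → ℝ),
        Bardina.IsRegularSolution α ν u₀ T v q →
          (∀ t ∈ Bardina.timeIco T, ∀ x, v t x = u t x) ∧
          (∀ t ∈ Bardina.timeIco T, ∃ c : ℝ, ∀ x, q t x = p t x + c) ∧
          ((∀ t ∈ Bardina.timeIco T, MemLp (q t) 2 volume) →
            ∀ t ∈ Bardina.timeIco T, ∀ x, q t x = p t x))) ∧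
    (∀ T : ℝ, 0 < T → ∀ (v : ℝ → Bardina.E3 → Bardina.E3) (q : ℝ → Bardina.E3 → ℝ),
      Bardina.IsRegularSolution α ν u₀ T v q → ¬ Bardina.BecomesSingular T v) := by
  obtain ⟨w₀, hbar, hP₀, hH₀⟩ := Bardina.exists_datum hα hu₀ hdiv
  obtain ⟨w, hwc, hw, hPH⟩ := Bardina.exists_global hα hν hP₀ hH₀
  refine ⟨⟨Bardina.vel w, Bardina.pres hα w,
    Bardina.isRegularSolution_vel hα hν hbar hwc hw hPH,
    Bardina.energyBalance_vel hα hν hbar hH₀ hwc hw hPH,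
    Bardina.timeDerivContInL2_vel hα hν hwc hw,
    Bardina.contInSobolev_pres_four hα hwc (Ici 0), fun τ hτ m => ?_, fun T v q h => ?_⟩,
    fun T hT v q h => h.not_becomesSingular hα hν hbar hwc hw hPH hT⟩
  · obtain ⟨z, hzc, hz⟩ := Bardina.exists_lift hα hν hwc hw m τ hτ
    exact ⟨Bardina.contInSobolev_vel hzc hz, Bardina.contInSobolev_pres hα hzc hz⟩
  · exact ⟨fun t ht => congrFun (h.eq_vel hα hν hbar hwc hw hPH ht),
      fun t ht => h.exists_pressure_eq hα hν hbar hwc hw hPH ht,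
      fun hq t ht => h.pressure_eq hα hν hbar hwc hw hPH ht (hq t ht)⟩
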